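/- Let $n\ge 2$, $M\ge 0$ and $\lambda>0$. Setting. $\Omega\subset\mathbf R^n$ is a bounded connected open set, $D$ is a relatively open subset of $\partial\Omega$, and $N=\partial\Omega\setminus D$. In some system of rectangular coordinates $(x',x_n)=(x_1,x'',x_n)\in\mathbf R\times\mathbf R^{n-2}\times\mathbf R$ put $Z_r(x)=\{y:|y'-x'|<r,\ |y_n-x_n|<(1+M)r\}$. We call $Z=Z_r(x)$, $x\in\partial\Omega$, a coordinate cylinder if there are functions $\phi:\mathbf R^{n-1}\to\mathbf R$ and $\psi:\mathbf R^{n-2}\to\mathbf R$ with Lipschitz constant $M$ such that $\Omega\cap Z=\{y_n>\phi(y')\}\cap Z$, $\partial\Omega\cap Z=\{y_n=\phi(y')\}\cap Z$, $D\cap Z=\{y_1>\psi(y''),\ y_n=\phi(y')\}\cap Z$ and $N\cap Z=\{y_1\le\psi(y''),\ y_n=\phi(y')\}\cap Z$ (a cylinder that meets only one of $D$, $N$ is covered by a constant $\psi$). Assume that $\partial\Omega$ is covered by finitely many cylinders $Z_{r_i}(x_i)$, $x_i\in\partial\Omega$, such that each $Z_{100r_i}(x_i)$ is a coordinate cylinder,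 and let $r_0=\min_i r_i$. Write $\Delta_r(x)=B_r(x)\cap\partial\Omega$, $\Psi_r(x)=B_r(x)\cap\Omega$, and let $\sigma$ be surface measure. Let $A(y)$ be a symmetric matrix function on $\Omega$ with measurable entries and $\lambda^{-1}|\xi|^2\le A(y)\xi\cdot\xi\le\lambda|\xi|^2$ for all $\xi\in\mathbf R^n$ and a.e. $y\in\Omega$. Let $W^{1,2}_D(\Omega)$ be the closure in $W^{1,2}(\Omega)$ of the functions smooth up to the boundary that vanish on $D$. Let $f\in L^p(N)$ for some $p>1$ with $p\ge 2(n-1)/n$. A weak solution of $$\operatorname{div}A\nabla u=0\ \text{in }\Omega,\qquad u=0\ \text{on }D,\qquad A\nabla u\cdot\nu=f\ \text{on }N$$ is a function $u\in W^{1,2}_D(\Omega)$ with $\int_\Omega A\nabla u\cdot\nabla v\,dy=\int_N f\,v\,d\sigma$ for all $v\in W^{1,2}_D(\Omega)$, where $v$ on $N$ is understood as a trace. Statement. There is a number $p_0>2$, depending only on $n$, $M$ and $\lambda$, such that for every $t\in[2,p_0)$, with $t\neq 2$ if $n=2$, there is a constant $C>0$ with the following property. For all $\Omega,D,A,f,u$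 as above, all $x\in\overline\Omega$ and $0<r<r_0$ such that $f$ is supported in $N\cap\Delta_r(x)$, $$\left(\frac1{|\Psi_r(x)|}\int_{\Psi_r(x)}|\nabla u|^t\,dy\right)^{1/t}\le C\left[\frac1{|\Psi_{Cr}(x)|}\int_{\Psi_{Cr}(x)}|\nabla u|\,dy+\left(\frac1{r^{n-1}}\int_{N\cap\Delta_{Cr}(x)}|f|^{t(n-1)/n}\,d\sigma\right)^{n/(t(n-1))}\right],$$ where the right-hand side may be $+\infty$; in particular $\nabla u\in L^t(\Psi_r(x))$ whenever $f\in L^{t(n-1)/n}(N)$. If $n\ge3$, the constant $C$ depends only on $n$, $M$ and $\lambda$ (not on $t$); if $n=2$, it depends only on $M$, $\lambda$ and $t$. -/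

import Mathlib

open MeasureTheory Set Filter Topology
open scoped NNReal ENNReal Matrix

noncomputable section

namespace MixedProblem

/-- Euclidean space of dimension `n = d + 2 ≥ 2`. -/
abbrev E (d : ℕ) : Type := EuclideanSpace ℝ (Fin (d + 2))

/-! ### Coordinates `y = (y', yₙ) = (y₁, y'', yₙ) ∈ ℝ × ℝⁿ⁻² × ℝ` -/

/-- `y' = (y₁, …, yₙ₋₁)`. -/
def horiz {d : ℕ} (y : E d) : EuclideanSpace ℝ (Fin (d + 1)) :=
  WithLp.toLp 2 fun i => y i.castSucc

/-- `yₙ`. -/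
def vert {d : ℕ} (y : E d) : ℝ := y (Fin.last (d + 1))

/-- `y₁`. -/
def fst {d : ℕ} (y : E d) : ℝ := y 0

/-- `y'' = (y₂, …, yₙ₋₁)`. -/
def mid {d : ℕ} (y : E d) : EuclideanSpace ℝ (Fin d) :=
  WithLp.toLp 2 fun i => y i.succ.castSucc

/-! ### Lipschitz domains for the mixed problem -/

/-- The cylinder `{y : |y' - x'| < r, |yₙ - xₙ| < (1 + M) r}` in the rectangular coordinates given
by the rigid motion `e`. -/
def cyl {d : ℕ} (M : ℝ≥0) (e : E d ≃ᵃⁱ[ℝ] E d) (x : E d) (r : ℝ) : Set (E d) :=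
  {y | ‖horiz (e y) - horiz (e x)‖ < r ∧ |vert (e y) - vert (e x)| < (1 + M) * r}

/-- The Neumann part `N = ∂Ω \ D` of the boundary. -/
def neumannPart {d : ℕ} (Ω D : Set (E d)) : Set (E d) := frontier Ω \ D

/-- `cyl M e x r` is a coordinate cylinder for the mixed problem: inside it, `Ω` lies above the
graph of an `M`-Lipschitz function `φ`, `∂Ω` is this graph, and the part of the graph where
`y₁ > ψ(y'')` is `D`, the rest `N`, for an `M`-Lipschitz function `ψ`. (If the cylinder meets only
one of `D` and `N`, then a constant `ψ` of large modulus will do.) -/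
def IsCoordCylinder {d : ℕ} (M : ℝ≥0) (Ω D : Set (E d)) (e : E d ≃ᵃⁱ[ℝ] E d) (x : E d) (r : ℝ) :
    Prop :=
  ∃ (φ : EuclideanSpace ℝ (Fin (d + 1)) → ℝ) (ψ : EuclideanSpace ℝ (Fin d) → ℝ),
    LipschitzWith M φ ∧ LipschitzWith M ψ ∧
    Ω ∩ cyl M e x r = {y | φ (horiz (e y)) < vert (e y)} ∩ cyl M e x r ∧
    frontier Ω ∩ cyl M e x r = {y | vert (e y) = φ (horiz (e y))} ∩ cyl M e x r ∧
    D ∩ cyl M e x r =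
      {y | ψ (mid (e y)) < fst (e y) ∧ vert (e y) = φ (horiz (e y))} ∩ cyl M e x r ∧
    neumannPart Ω D ∩ cyl M e x r =
      {y | fst (e y) ≤ ψ (mid (e y)) ∧ vert (e y) = φ (horiz (e y))} ∩ cyl M e x r

/-- `Ω` is a bounded connected Lipschitz domain with constant `M`, `D` is a relatively open subset
of `∂Ω` whose relative boundary is locally a Lipschitz graph, and `r₀` is the smallest radius of a
finite covering of `∂Ω` by coordinate cylinders whose concentric dilates by the factor `100` (hence
also they themselves) are coordinate cylinders. -/
structure IsMixedLipschitzDomain {d : ℕ} (M : ℝ≥0) (Ω D : Set (E d)) (r₀ : ℝ) : Prop where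
  isOpen : IsOpen Ω
  isConnected : IsConnected Ω
  isBounded : Bornology.IsBounded Ω
  relOpen : ∃ U : Set (E d), IsOpen U ∧ D = U ∩ frontier Ω
  cover : ∃ (k : ℕ) (e : Fin k → (E d ≃ᵃⁱ[ℝ] E d)) (c : Fin k → E d) (ρ : Fin k → ℝ),
    (∀ i, c i ∈ frontier Ω) ∧ (∀ i, 0 < ρ i) ∧
    (∀ i, IsCoordCylinder M Ω D (e i) (c i) (100 * ρ i)) ∧
    frontier Ω ⊆ (⋃ i, cyl M (e i) (c i) (ρ i)) ∧
    IsLeast (Set.range ρ) r₀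

/-- Surface measure: the `(n - 1)`-dimensional Hausdorff measure, normalized to agree with Lebesgue
measure on hyperplanes. -/
def σ (d : ℕ) : Measure (E d) := μHE[d + 1]

/-! ### Sobolev spaces -/

/-- `G` is the weak gradient of `u` in `Ω`. -/
def HasWeakGradient {d : ℕ} (Ω : Set (E d)) (u : E d → ℝ) (G : E d → E d) : Prop :=
  ∀ η : E d → ℝ, ContDiff ℝ ((⊤ : ℕ∞) : WithTop ℕ∞) η → HasCompactSupport η → tsupport η ⊆ Ω →
    ∀ i, ∫ y in Ω, u y * gradient η y i = - ∫ y in Ω, G y i * η y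

/-- `u ∈ W^{1,2}(Ω)` with weak gradient `G`. -/
structure MemW12 {d : ℕ} (Ω : Set (E d)) (u : E d → ℝ) (G : E d → E d) : Prop where
  memLp : MemLp u 2 (volume.restrict Ω)
  memLp_grad : MemLp G 2 (volume.restrict Ω)
  weakGradient : HasWeakGradient Ω u G

/-- The functions `η k`, smooth up to the boundary, converge in `W^{1,2}(Ω)` to `u` (with weak
gradient `G`). -/
def SmoothApprox {d : ℕ} (Ω : Set (E d)) (η : ℕ → E d → ℝ) (u : E d → ℝ) (G : E d → E d) : Prop :=
  (∀ k, ContDiff ℝ ((⊤ : ℕ∞) : WithTop ℕ∞) (η k)) ∧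
  Tendsto (fun k => eLpNorm (fun y => η k y - u y) 2 (volume.restrict Ω)) atTop (𝓝 0) ∧
  Tendsto (fun k => eLpNorm (fun y => gradient (η k) y - G y) 2 (volume.restrict Ω)) atTop (𝓝 0)

/-- `u ∈ W^{1,2}_D(Ω)` with weak gradient `G`: the closure in `W^{1,2}(Ω)` of the smooth functions
that vanish on `D`. -/
def MemW12D {d : ℕ} (Ω D : Set (E d)) (u : E d → ℝ) (G : E d → E d) : Prop :=
  MemW12 Ω u G ∧ ∃ η : ℕ → E d → ℝ, SmoothApprox Ω η u G ∧ ∀ k, ∀ y ∈ D, η k y = 0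

/-- `g` is the restriction (trace) to `∂Ω` of the Sobolev function `v` with weak gradient `H`: the
`L²(∂Ω)`-limit of the restrictions of smooth functions that converge to `v` in `W^{1,2}(Ω)`. -/
def IsTrace {d : ℕ} (Ω : Set (E d)) (v : E d → ℝ) (H : E d → E d) (g : E d → ℝ) : Prop :=
  MemLp g 2 ((σ d).restrict (frontier Ω)) ∧
  ∃ η : ℕ → E d → ℝ, SmoothApprox Ω η v H ∧
    Tendsto (fun k => eLpNorm (fun y => η k y - g y) 2 ((σ d).restrict (frontier Ω))) atTop (𝓝 0)

/-! ### The mixed problem -/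

/-- `A` is a symmetric matrix function with measurable entries and
`lam⁻¹ |ξ|² ≤ A(y) ξ · ξ ≤ lam |ξ|²` in `Ω`. -/
def IsEllipticCoeff {d : ℕ} (lam : ℝ) (Ω : Set (E d))
    (A : E d → Matrix (Fin (d + 2)) (Fin (d + 2)) ℝ) : Prop :=
  (∀ i j, AEMeasurable (fun y => A y i j) (volume.restrict Ω)) ∧
  ∀ᵐ y ∂(volume.restrict Ω), (A y).IsSymm ∧
    ∀ ξ : E d, lam⁻¹ * ‖ξ‖ ^ 2 ≤ (A y *ᵥ ξ.ofLp) ⬝ᵥ ξ.ofLp ∧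
      (A y *ᵥ ξ.ofLp) ⬝ᵥ ξ.ofLp ≤ lam * ‖ξ‖ ^ 2

/-- `u`, with weak gradient `G`, is a weak solution of `div A∇u = 0` in `Ω`, `u = 0` on `D`,
`A∇u · ν = f` on `N`: `u ∈ W^{1,2}_D(Ω)` and `∫_Ω A∇u · ∇v dy = ∫_N f v dσ` for all
`v ∈ W^{1,2}_D(Ω)`. -/
def IsWeakSolution {d : ℕ} (Ω D : Set (E d)) (A : E d → Matrix (Fin (d + 2)) (Fin (d + 2)) ℝ)
    (f : E d → ℝ) (u : E d → ℝ) (G : E d → E d) : Prop :=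
  MemW12D Ω D u G ∧
  ∀ (v : E d → ℝ) (H : E d → E d) (g : E d → ℝ), MemW12D Ω D v H → IsTrace Ω v H g →
    ∫ y in Ω, (A y *ᵥ (G y).ofLp) ⬝ᵥ (H y).ofLp = ∫ y in neumannPart Ω D, f y * g y ∂(σ d)

end MixedProblem

end

open MixedProblem

/-! Write n = d + 2. The gain of integrability is Gehring's lemma for |∇u|, carried out with an
extra boundary term for f. Its input is a reverse Hölder inequality on all small balls, with
constants that see the domain only through n and M.

Geometry. At small scales ρ every point y of Ω has a `LocalGeometry`: one cone of directions in
which points near y can be moved without leaving Ω, and a set S of volume comparable with ρⁿ that is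
joined to all nearby points by segments in Ω. If D comes close to y, then S lies above a piece of D,
so that functions vanishing on D are controlled on S by their gradient. Averaging over translations
yields a Poincaré inequality for u - c, where c = 0 if D is close (`exists_poincare_const`).
Translations by vectors of length comparable with ερ give it the form: a factor of order ε² times
the squared L² norm of ∇u, plus a large multiple of the squared L¹ norm.

Reverse Hölder. Testing the equation with η²(u - c) gives Caccioppoli's inequality. The boundary
integral is estimated by Hölder and by a trace inequality up to the critical exponent 2(n-1)/(n-2),
see `exists_trace_const`; that inequality follows from a Gagliardo–Nirenberg argument along n
directions that all point into Ω. Since u is not smooth, all tests use smooth approximants that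
vanish on D, and their errors tend to zero. The small L² term is removed by a covering argument,
`exists_reverse_holder_of_absorb`. The result is `exists_reverse_holder`, with the L¹ norm of the
gradient and an L^s norm of f on the right.

Gehring. A stopping-time argument and Vitali's covering lemma give an inequality between integrals
over level sets of the weighted functions (`exists_level_set_const`). Integrated against α^(m-1) dα
it bounds the integral of |∇u|^(2+m), provided m is small compared with the constant in front of the
gradient term. In the boundary term balls are counted by rⁿ⁻¹ rather than rⁿ; this produces the
power n/(n-1), and f is measured in L^q with q = t(n-1)/n.

The mean of |∇u| on the right. In the assertion C is both a factor and a dilation, and enlarging the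
dilation may dilute the mean of |∇u|. The gradient is therefore estimated by the data alone, which
is possible because f is supported in the ball: testing with the bounded function κ arctan((u -
c)/κ) needs only the L¹ norm of f, a weighted Cauchy–Schwarz inequality turns this into an L¹ bound
for ∇u with an absorbable remainder, and `exists_gradient_const` follows. The first term on the
right is then simply dropped.

Constants. The constant of the gradient term in the reverse Hölder inequality does not depend on the
exponent s used for f, so p₀ = 2 + m₀ depends only on n, M and λ. If n ≥ 3, the critical s =
2(n-1)/n serves all t at once. If n = 2, this value would be 1, which is excluded, so s has to lie
strictly between 1 and t/2 and the constant depends on t. -/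

namespace MixedProblem

/-! ### Jensen and Cauchy–Schwarz for squares of integrals. -/

section Jensen
variable {X : Type*} [MeasurableSpace X]

theorem sq_lintegral_le {π : Measure X} [IsProbabilityMeasure π] {f : X → ℝ≥0∞}
    (hf : AEMeasurable f π) : (∫⁻ x, f x ∂π) ^ 2 ≤ ∫⁻ x, f x ^ 2 ∂π := by
  have h := ENNReal.lintegral_mul_le_Lp_mul_Lq π Real.HolderConjugate.two_two hf
    (aemeasurable_const (b := (1 : ℝ≥0∞)))
  simp only [Pi.mul_apply, mul_one, ENNReal.one_rpow, lintegral_const, measure_univ] at h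
  calc (∫⁻ x, f x ∂π) ^ 2 ≤ ((∫⁻ x, f x ^ (2 : ℝ) ∂π) ^ (1 / 2 : ℝ)) ^ 2 := by gcongr
    _ = ∫⁻ x, f x ^ 2 ∂π := by
      rw [← ENNReal.rpow_natCast, ← ENNReal.rpow_mul]; norm_num

theorem sq_setLIntegral_le {μ : Measure X} {f g : X → ℝ≥0∞}
    (hf : AEMeasurable f μ) (hg : AEMeasurable g μ) :
    (∫⁻ x, f x * g x ∂μ) ^ 2 ≤ (∫⁻ x, f x ^ 2 ∂μ) * ∫⁻ x, g x ^ 2 ∂μ := by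
  have h := ENNReal.lintegral_mul_le_Lp_mul_Lq μ Real.HolderConjugate.two_two hf hg
  simp only [Pi.mul_apply] at h
  calc (∫⁻ x, f x * g x ∂μ) ^ 2
      ≤ ((∫⁻ x, f x ^ (2 : ℝ) ∂μ) ^ (1 / 2 : ℝ) * (∫⁻ x, g x ^ (2 : ℝ) ∂μ) ^ (1 / 2 : ℝ)) ^ 2 := by
        gcongr
    _ = _ := by
      rw [mul_pow, ← ENNReal.rpow_natCast, ← ENNReal.rpow_mul, ← ENNReal.rpow_natCast,
        ← ENNReal.rpow_mul]; norm_num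

theorem add_sq_le_two_mul (a b : ℝ≥0∞) : (a + b) ^ 2 ≤ 2 * a ^ 2 + 2 * b ^ 2 := by
  have := ENNReal.rpow_add_le_mul_rpow_add_rpow a b (p := 2) (by norm_num)
  norm_num at this
  rw [← mul_add]
  exact_mod_cast this

end Jensen

/-! ### Poincaré inequalities by integration along segments. -/

section Segments
variable {V : Type*} [NormedAddCommGroup V] [NormedSpace ℝ V]

theorem enorm_sub_le_lintegral_segment {u : V → ℝ} (hu : ContDiff ℝ 1 u) (a q : V) :
    ‖u (a + q) - u a‖ₑ ≤ ∫⁻ s in Icc (0 : ℝ) 1, ‖q‖ₑ * ‖fderiv ℝ u (a + s • q)‖ₑ := by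
  have h1 : ContDiff ℝ 1 fun s : ℝ => u (a + s • q) := hu.comp (by fun_prop)
  have h2 := enorm_sub_le_lintegral_deriv_of_contDiffOn_Icc (f := fun s : ℝ => u (a + s • q))
    h1.contDiffOn zero_le_one
  simp only [one_smul, zero_smul, add_zero] at h2
  refine h2.trans (lintegral_mono fun s => ?_)
  have h3 : HasDerivAt (fun s : ℝ => u (a + s • q)) (fderiv ℝ u (a + s • q) q) s := by
    have h4 : HasDerivAt (fun s : ℝ => a + s • q) q s := by
      simpa using ((hasDerivAt_id s).smul_const q).const_add a
    exact ((hu.differentiable one_ne_zero _).hasFDerivAt).comp_hasDerivAt s h4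
  rw [h3.deriv, mul_comm]
  exact ContinuousLinearMap.le_opENorm _ _

end Segments

set_option linter.unusedSectionVars false

section Poincare
variable {V : Type*} [NormedAddCommGroup V] [NormedSpace ℝ V] [MeasurableSpace V]
  [BorelSpace V] [FiniteDimensional ℝ V] {μ : Measure V} [μ.IsAddHaarMeasure]

theorem setLIntegral_translate_le {T H : Set V} (hT : MeasurableSet T) (hH : MeasurableSet H)
    {q : V} (hTH : ∀ a ∈ T, a + q ∈ H) (F : V → ℝ≥0∞) :
    ∫⁻ a in T, F (a + q) ∂μ ≤ ∫⁻ a in H, F a ∂μ := by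
  calc ∫⁻ a in T, F (a + q) ∂μ ≤ ∫⁻ a, H.indicator F (a + q) ∂μ := by
        rw [← lintegral_indicator hT]
        refine lintegral_mono fun a => ?_
        by_cases ha : a ∈ T
        · simp [ha, hTH a ha]
        · simp [ha]
    _ = ∫⁻ a in H, F a ∂μ := by
        rw [lintegral_add_right_eq_self (fun a => H.indicator F a) q, lintegral_indicator hH]

/-- The difference is an integral of the gradient along a segment. After the integrals are
exchanged, each intermediate translate of `T` lies in `H`, so every value of the segment parameter
costs at most one integral over `H`. -/
theorem lintegral_enorm_sub_translate_le {u : V → ℝ} (hu : ContDiff ℝ 1 u) {T H : Set V}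
    (hT : MeasurableSet T) (hH : MeasurableSet H) {q : V}
    (hTH : ∀ a ∈ T, ∀ s ∈ Icc (0 : ℝ) 1, a + s • q ∈ H) :
    ∫⁻ a in T, ‖u (a + q) - u a‖ₑ ∂μ ≤ ‖q‖ₑ * ∫⁻ a in H, ‖fderiv ℝ u a‖ₑ ∂μ := by
  have hc : Continuous (fderiv ℝ u) := hu.continuous_fderiv one_ne_zero
  calc ∫⁻ a in T, ‖u (a + q) - u a‖ₑ ∂μ
      ≤ ∫⁻ a in T, (∫⁻ s in Icc (0 : ℝ) 1, ‖q‖ₑ * ‖fderiv ℝ u (a + s • q)‖ₑ) ∂μ :=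
        lintegral_mono fun a => enorm_sub_le_lintegral_segment hu a q
    _ = ∫⁻ s in Icc (0 : ℝ) 1, (∫⁻ a in T, ‖q‖ₑ * ‖fderiv ℝ u (a + s • q)‖ₑ ∂μ) := by
        refine lintegral_lintegral_swap (Measurable.aemeasurable ?_)
        refine Continuous.measurable ?_ |>.const_mul _
        fun_prop
    _ ≤ ∫⁻ s in Icc (0 : ℝ) 1, ‖q‖ₑ * ∫⁻ a in H, ‖fderiv ℝ u a‖ₑ ∂μ := by
        refine setLIntegral_mono' measurableSet_Icc fun s hs => ?_
        rw [lintegral_const_mul _ (by fun_prop)]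
        gcongr _ * ?_
        exact setLIntegral_translate_le (μ := μ) hT hH (fun a ha => hTH a ha s hs)
          (fun a => ‖fderiv ℝ u a‖ₑ)
    _ = _ := by simp

theorem lintegral_enorm_sub_translate_sq_le {u : V → ℝ} (hu : ContDiff ℝ 1 u) {T H : Set V}
    (hT : MeasurableSet T) (hH : MeasurableSet H) {q : V}
    (hTH : ∀ a ∈ T, ∀ s ∈ Icc (0 : ℝ) 1, a + s • q ∈ H) :
    ∫⁻ a in T, ‖u (a + q) - u a‖ₑ ^ 2 ∂μ ≤ ‖q‖ₑ ^ 2 * ∫⁻ a in H, ‖fderiv ℝ u a‖ₑ ^ 2 ∂μ := by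
  have hc : Continuous (fderiv ℝ u) := hu.continuous_fderiv one_ne_zero
  have : IsProbabilityMeasure (volume.restrict (Icc (0 : ℝ) 1)) := ⟨by simp⟩
  calc ∫⁻ a in T, ‖u (a + q) - u a‖ₑ ^ 2 ∂μ
      ≤ ∫⁻ a in T, (∫⁻ s in Icc (0 : ℝ) 1, (‖q‖ₑ * ‖fderiv ℝ u (a + s • q)‖ₑ) ^ 2) ∂μ := by
        refine lintegral_mono fun a => le_trans ?_ (sq_lintegral_le (by fun_prop))
        gcongr
        exact enorm_sub_le_lintegral_segment hu a q
    _ = ∫⁻ s in Icc (0 : ℝ) 1, (∫⁻ a in T, (‖q‖ₑ * ‖fderiv ℝ u (a + s • q)‖ₑ) ^ 2 ∂μ) := by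
        refine lintegral_lintegral_swap (Measurable.aemeasurable ?_)
        refine (Continuous.measurable ?_ |>.const_mul _).pow_const _
        fun_prop
    _ ≤ ∫⁻ s in Icc (0 : ℝ) 1, ‖q‖ₑ ^ 2 * ∫⁻ a in H, ‖fderiv ℝ u a‖ₑ ^ 2 ∂μ := by
        refine setLIntegral_mono' measurableSet_Icc fun s hs => ?_
        simp_rw [mul_pow]
        rw [lintegral_const_mul _ (by fun_prop)]
        gcongr _ * ?_
        exact setLIntegral_translate_le (μ := μ) hT hH (fun a ha => hTH a ha s hs)
          (fun a => ‖fderiv ℝ u a‖ₑ ^ 2)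
    _ = _ := by simp

/-- A Poincaré inequality in `L¹` between two sets whose points can be joined by segments. -/
theorem lintegral_lintegral_enorm_sub_le {u : V → ℝ} (hu : ContDiff ℝ 1 u) {T S H : Set V}
    (hT : MeasurableSet T) (hS : MeasurableSet S) (hH : MeasurableSet H) {ℓ : ℝ}
    (hℓ : ∀ a ∈ T, ∀ z ∈ S, dist z a ≤ ℓ)
    (hTSH : ∀ a ∈ T, ∀ z ∈ S, segment ℝ a z ⊆ H) :
    ∫⁻ z in S, (∫⁻ a in T, ‖u a - u z‖ₑ ∂μ) ∂μ ≤
      μ (Metric.closedBall 0 ℓ) * (ENNReal.ofReal ℓ * ∫⁻ a in H, ‖fderiv ℝ u a‖ₑ ∂μ) := by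
  have hm : Measurable fun p : V × V => ‖u p.2 - u p.1‖ₑ := by
    have := hu.continuous; fun_prop
  have hmS : MeasurableSet {p : V × V | p.1 + p.2 ∈ S} := by
    exact (measurable_fst.add measurable_snd) hS
  calc ∫⁻ z in S, (∫⁻ a in T, ‖u a - u z‖ₑ ∂μ) ∂μ
      = ∫⁻ a in T, (∫⁻ z in S, ‖u a - u z‖ₑ ∂μ) ∂μ :=
        lintegral_lintegral_swap hm.aemeasurable
    -- With z = a + q, and a integrated first, the claim reduces to translations by a fixed q. Only
    -- vectors of length at most ℓ occur, whence the volume of a ball of radius ℓ.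
    _ = ∫⁻ a in T, (∫⁻ q, {p : V × V | p.1 + p.2 ∈ S}.indicator
          (fun p => ‖u p.1 - u (p.1 + p.2)‖ₑ) (a, q) ∂μ) ∂μ := by
        refine lintegral_congr fun a => ?_
        rw [← lintegral_indicator hS, ← lintegral_add_left_eq_self _ a]
        rfl
    _ = ∫⁻ q, (∫⁻ a in T, {p : V × V | p.1 + p.2 ∈ S}.indicator
          (fun p => ‖u p.1 - u (p.1 + p.2)‖ₑ) (a, q) ∂μ) ∂μ := by
        refine lintegral_lintegral_swap (Measurable.aemeasurable ?_)
        refine Measurable.indicator ?_ hmS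
        have := hu.continuous; fun_prop
    _ ≤ ∫⁻ q in Metric.closedBall 0 ℓ,
          (ENNReal.ofReal ℓ * ∫⁻ a in H, ‖fderiv ℝ u a‖ₑ ∂μ) ∂μ := by
        rw [← lintegral_indicator Metric.isClosed_closedBall.measurableSet]
        refine lintegral_mono fun q => ?_
        have hTq : MeasurableSet (T ∩ {a | a + q ∈ S}) :=
          hT.inter ((measurable_id.add_const q) hS)
        have h1 : ∫⁻ a in T, {p : V × V | p.1 + p.2 ∈ S}.indicator
            (fun p => ‖u p.1 - u (p.1 + p.2)‖ₑ) (a, q) ∂μ =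
            ∫⁻ a in T ∩ {a | a + q ∈ S}, ‖u (a + q) - u a‖ₑ ∂μ := by
          have hS' : MeasurableSet {a | a + q ∈ S} := (measurable_id.add_const q) hS
          rw [inter_comm, ← Measure.restrict_restrict hS', ← lintegral_indicator hS']
          refine lintegral_congr fun a => ?_
          by_cases h : a + q ∈ S <;> simp [indicator, h, enorm_sub_rev]
        simp only [h1]
        by_cases hq : q ∈ Metric.closedBall (0 : V) ℓ
        · rw [indicator_of_mem hq]
          refine (lintegral_enorm_sub_translate_le hu hTq hH ?_).trans ?_
          · rintro a ⟨ha, haS⟩ s hs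
            refine hTSH a ha _ haS ?_
            rw [segment_eq_image']
            exact ⟨s, hs, by simp⟩
          · gcongr
            rw [← ofReal_norm]
            exact ENNReal.ofReal_le_ofReal (by simpa using hq)
        · have : T ∩ {a | a + q ∈ S} = ∅ := by
            ext a
            simp only [mem_inter_iff, mem_ofPred_eq, mem_empty_iff_false, iff_false, not_and]
            intro ha haS
            apply hq
            simpa using hℓ a ha _ haS
          simp [this]
    _ = _ := by rw [setLIntegral_const, mul_comm]

/-- An `L²` norm is controlled by a small multiple of the gradient and an `L¹` norm. -/
theorem lintegral_enorm_sub_sq_le {u : V → ℝ} (hu : ContDiff ℝ 1 u) {T H₁ H Q : Set V}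
    (hT : MeasurableSet T) (hH₁ : MeasurableSet H₁) (hH : MeasurableSet H) (hQ : MeasurableSet Q)
    (hQ0 : μ Q ≠ 0) (hQt : μ Q ≠ ∞) {ℓ : ℝ} (hℓ : ∀ q ∈ Q, ‖q‖ ≤ ℓ)
    (hTQ : ∀ a ∈ T, ∀ q ∈ Q, a + q ∈ H₁)
    (hTH : ∀ a ∈ T, ∀ q ∈ Q, ∀ s ∈ Icc (0 : ℝ) 1, a + s • q ∈ H) (c : ℝ) :
    ∫⁻ a in T, ‖u a - c‖ₑ ^ 2 ∂μ ≤ 2 * (ENNReal.ofReal ℓ ^ 2 * ∫⁻ a in H, ‖fderiv ℝ u a‖ₑ ^ 2 ∂μ)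
      + 2 * (μ T * ((μ Q)⁻¹ * ∫⁻ a in H₁, ‖u a - c‖ₑ ∂μ) ^ 2) := by
  have huc := hu.continuous
  -- Average u(a) - c = -(u(a+q) - u(a)) + (u(a+q) - c) over q in `Q`. The first part costs the
  -- squared length of q times the energy; the second is a mean of |u - c| over a translate of `Q`
  -- inside `H₁`.
  set π : Measure V := (μ Q)⁻¹ • μ.restrict Q with hπ
  have : IsProbabilityMeasure π := ⟨by simp [hπ, ENNReal.inv_mul_cancel hQ0 hQt]⟩
  have hQae : ∀ᵐ q ∂π, q ∈ Q := Measure.ae_smul_measure (ae_restrict_mem hQ) _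
  have hm2 : Measurable fun p : V × V => ‖u (p.1 + p.2) - u p.1‖ₑ ^ 2 := by fun_prop
  have hm1 : ∀ a, Measurable fun q => ‖u (a + q) - u a‖ₑ := fun a =>
    ((huc.comp (continuous_const.add continuous_id)).sub continuous_const).measurable.enorm
  have key : ∀ a ∈ T, ‖u a - c‖ₑ ^ 2 ≤
      2 * (∫⁻ q, ‖u (a + q) - u a‖ₑ ^ 2 ∂π) + 2 * ((μ Q)⁻¹ * ∫⁻ a in H₁, ‖u a - c‖ₑ ∂μ) ^ 2 := by
    intro a ha
    have h1 : ‖u a - c‖ₑ ≤ (∫⁻ q, ‖u (a + q) - u a‖ₑ ∂π) + ∫⁻ q, ‖u (a + q) - c‖ₑ ∂π := by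
      rw [← lintegral_add_left (hm1 a)]
      calc ‖u a - c‖ₑ = ∫⁻ q, ‖u a - c‖ₑ ∂π := by simp
        _ ≤ _ := lintegral_mono fun q => by
          have : u a - c = -(u (a + q) - u a) + (u (a + q) - c) := by ring
          rw [this]
          refine (enorm_add_le _ _).trans ?_
          rw [enorm_neg]
    have h2 : ∫⁻ q, ‖u (a + q) - c‖ₑ ∂π ≤ (μ Q)⁻¹ * ∫⁻ a in H₁, ‖u a - c‖ₑ ∂μ := by
      rw [hπ, lintegral_smul_measure, smul_eq_mul]
      gcongr _ * ?_
      have := setLIntegral_translate_le (μ := μ) hQ hH₁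
        (fun q hq => by rw [add_comm]; exact hTQ a ha q hq) (fun a => ‖u a - c‖ₑ)
      simpa only [add_comm _ a] using this
    calc ‖u a - c‖ₑ ^ 2 ≤ ((∫⁻ q, ‖u (a + q) - u a‖ₑ ∂π) + ∫⁻ q, ‖u (a + q) - c‖ₑ ∂π) ^ 2 := by
          gcongr
      _ ≤ _ := add_sq_le_two_mul _ _
      _ ≤ _ := by
        gcongr
        exact sq_lintegral_le (hm1 a).aemeasurable
  calc ∫⁻ a in T, ‖u a - c‖ₑ ^ 2 ∂μ
      ≤ ∫⁻ a in T, (2 * (∫⁻ q, ‖u (a + q) - u a‖ₑ ^ 2 ∂π) +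
          2 * ((μ Q)⁻¹ * ∫⁻ a in H₁, ‖u a - c‖ₑ ∂μ) ^ 2) ∂μ := setLIntegral_mono' hT key
    _ = 2 * (∫⁻ a in T, (∫⁻ q, ‖u (a + q) - u a‖ₑ ^ 2 ∂π) ∂μ) +
          2 * (μ T * ((μ Q)⁻¹ * ∫⁻ a in H₁, ‖u a - c‖ₑ ∂μ) ^ 2) := by
        rw [lintegral_add_right _ measurable_const, setLIntegral_const,
          lintegral_const_mul _ hm2.lintegral_prod_right']
        ring
    _ ≤ _ := by
        gcongr
        rw [lintegral_lintegral_swap hm2.aemeasurable]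
        calc ∫⁻ q, (∫⁻ a in T, ‖u (a + q) - u a‖ₑ ^ 2 ∂μ) ∂π
            ≤ ∫⁻ q, (ENNReal.ofReal ℓ ^ 2 * ∫⁻ a in H, ‖fderiv ℝ u a‖ₑ ^ 2 ∂μ) ∂π := by
              refine lintegral_mono_ae (hQae.mono fun q hq => ?_)
              refine (lintegral_enorm_sub_translate_sq_le hu hT hH
                fun a ha s hs => hTH a ha q hq s hs).trans ?_
              gcongr
              rw [← ofReal_norm]
              exact ENNReal.ofReal_le_ofReal (hℓ q hq)
          _ = _ := by simp

end Poincare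
variable {d : ℕ}

/-! ### Graph coordinates -/

/-- The point with coordinates `(x', t)`. -/
noncomputable def join (p : EuclideanSpace ℝ (Fin (d + 1)) × ℝ) : E d :=
  WithLp.toLp 2 (Fin.snoc (α := fun _ => ℝ) p.1.ofLp p.2)

@[simp] theorem horiz_join (p : EuclideanSpace ℝ (Fin (d + 1)) × ℝ) : horiz (join p) = p.1 := by
  ext i; simp [horiz, join]

@[simp] theorem vert_join (p : EuclideanSpace ℝ (Fin (d + 1)) × ℝ) : vert (join p) = p.2 := by
  simp [vert, join]

theorem join_horiz_vert (y : E d) : join (horiz y, vert y) = y := by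
  ext i
  refine Fin.lastCases ?_ (fun j => ?_) i <;> simp [horiz, vert, join]

theorem horiz_add (x y : E d) : horiz (x + y) = horiz x + horiz y := by ext i; simp [horiz]
theorem horiz_sub (x y : E d) : horiz (x - y) = horiz x - horiz y := by ext i; simp [horiz]
theorem horiz_smul (c : ℝ) (x : E d) : horiz (c • x) = c • horiz x := by ext i; simp [horiz]
theorem vert_add (x y : E d) : vert (x + y) = vert x + vert y := by simp [vert]
theorem vert_sub (x y : E d) : vert (x - y) = vert x - vert y := by simp [vert]
theorem vert_smul (c : ℝ) (x : E d) : vert (c • x) = c * vert x := by simp [vert]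

theorem norm_sq_eq_horiz_vert (x : E d) : ‖x‖ ^ 2 = ‖horiz x‖ ^ 2 + vert x ^ 2 := by
  rw [EuclideanSpace.norm_sq_eq, EuclideanSpace.norm_sq_eq, Fin.sum_univ_castSucc]
  simp [horiz, vert]

theorem norm_horiz_le (x : E d) : ‖horiz x‖ ≤ ‖x‖ := by
  have := norm_sq_eq_horiz_vert x
  exact le_of_sq_le_sq (by nlinarith [sq_nonneg (vert x)]) (norm_nonneg _)

theorem abs_vert_le (x : E d) : |vert x| ≤ ‖x‖ := by
  have := norm_sq_eq_horiz_vert x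
  exact le_of_sq_le_sq (by rw [sq_abs]; nlinarith [sq_nonneg ‖horiz x‖]) (norm_nonneg _)

theorem norm_le_horiz_add_vert (x : E d) : ‖x‖ ≤ ‖horiz x‖ + |vert x| := by
  have := norm_sq_eq_horiz_vert x
  have h1 := norm_nonneg (horiz x)
  have h2 := abs_nonneg (vert x)
  exact le_of_sq_le_sq (by nlinarith [sq_abs (vert x)]) (by positivity)

theorem dist_horiz_le (x y : E d) : dist (horiz x) (horiz y) ≤ dist x y := by
  rw [dist_eq_norm, dist_eq_norm, ← horiz_sub]; exact norm_horiz_le _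

theorem abs_vert_sub_le (x y : E d) : |vert x - vert y| ≤ dist x y := by
  rw [dist_eq_norm, ← vert_sub]; exact abs_vert_le _

theorem dist_le_horiz_add_vert (x y : E d) :
    dist x y ≤ dist (horiz x) (horiz y) + |vert x - vert y| := by
  rw [dist_eq_norm, dist_eq_norm, ← horiz_sub, ← vert_sub]; exact norm_le_horiz_add_vert _

theorem measurePreserving_join :
    MeasurePreserving (join : EuclideanSpace ℝ (Fin (d + 1)) × ℝ → E d)
      (volume.prod volume) volume := by
  have h1 : MeasurePreserving (Prod.map (@WithLp.ofLp 2 (Fin (d + 1) → ℝ)) (id : ℝ → ℝ))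
      (volume.prod volume) (volume.prod volume) :=
    (PiLp.volume_preserving_ofLp _).prod (MeasurePreserving.id _)
  have h2 : MeasurePreserving (Prod.swap : (Fin (d + 1) → ℝ) × ℝ → _)
      (volume.prod volume) (volume.prod volume) := Measure.measurePreserving_swap
  have h3 := (volume_preserving_piFinSuccAbove (fun _ : Fin (d + 1 + 1) => ℝ)
    (Fin.last (d + 1))).symm
  have h4 := PiLp.volume_preserving_toLp (Fin (d + 1 + 1))
  suffices heq : (join : EuclideanSpace ℝ (Fin (d + 1)) × ℝ → E d) =
      WithLp.toLp 2 ∘ (MeasurableEquiv.piFinSuccAbove (fun _ => ℝ) (Fin.last (d + 1))).symm ∘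
        Prod.swap ∘ Prod.map WithLp.ofLp id by
    rw [heq]
    exact h4.comp (h3.comp (h2.comp h1))
  funext p
  simp only [join, Function.comp, MeasurableEquiv.piFinSuccAbove]
  congr 1
  ext i
  refine Fin.lastCases ?_ (fun j => ?_) i
  · simp [Prod.swap]
  · simp [Prod.swap]

theorem measurePreserving_affineIsometryEquiv (e : E d ≃ᵃⁱ[ℝ] E d) :
    MeasurePreserving e volume volume := by
  have h := e.toIsometryEquiv.measurePreserving_euclideanHausdorffMeasure (d + 2)
  rwa [EuclideanSpace.euclideanHausdorffMeasure_eq_volume] at h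

/-- The point at height `t` above the graph of `φ` over `x'`, in the coordinates given by `e`. -/
noncomputable def graphMap (e : E d ≃ᵃⁱ[ℝ] E d) (φ : EuclideanSpace ℝ (Fin (d + 1)) → ℝ)
    (p : EuclideanSpace ℝ (Fin (d + 1)) × ℝ) : E d :=
  e.symm (join (p.1, φ p.1 + p.2))

@[simp] theorem horiz_graphMap (e : E d ≃ᵃⁱ[ℝ] E d) (φ : EuclideanSpace ℝ (Fin (d + 1)) → ℝ)
    (p : EuclideanSpace ℝ (Fin (d + 1)) × ℝ) : horiz (e (graphMap e φ p)) = p.1 := by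
  simp [graphMap]

@[simp] theorem vert_graphMap (e : E d ≃ᵃⁱ[ℝ] E d) (φ : EuclideanSpace ℝ (Fin (d + 1)) → ℝ)
    (p : EuclideanSpace ℝ (Fin (d + 1)) × ℝ) : vert (e (graphMap e φ p)) = φ p.1 + p.2 := by
  simp [graphMap]

theorem graphMap_eq (e : E d ≃ᵃⁱ[ℝ] E d) (φ : EuclideanSpace ℝ (Fin (d + 1)) → ℝ) (y : E d) :
    graphMap e φ (horiz (e y), vert (e y) - φ (horiz (e y))) = y := by
  simp [graphMap, join_horiz_vert]

/-- On each vertical line the map is a translation, so it is a shear followed by an isometry and has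
no Jacobian, however rough φ is. -/
theorem measurePreserving_graphMap (e : E d ≃ᵃⁱ[ℝ] E d)
    {φ : EuclideanSpace ℝ (Fin (d + 1)) → ℝ} (hφ : Measurable φ) :
    MeasurePreserving (graphMap e φ) (volume.prod volume) volume := by
  have h1 : MeasurePreserving (fun p : EuclideanSpace ℝ (Fin (d + 1)) × ℝ => (p.1, φ p.1 + p.2))
      (volume.prod volume) (volume.prod volume) := by
    refine (MeasurePreserving.id volume).skew_product (g := fun x t => φ x + t)
      (by unfold Function.uncurry; fun_prop) (ae_of_all _ fun x => ?_)
    exact (measurePreserving_add_left volume (φ x)).map_eq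
  exact (measurePreserving_affineIsometryEquiv e.symm).comp (measurePreserving_join.comp h1)

/-- The vector with coordinates `v` in the coordinate system given by `e`. -/
noncomputable def dir (e : E d ≃ᵃⁱ[ℝ] E d) (v : E d) : E d := e.linearIsometryEquiv.symm v

theorem apply_add (e : E d ≃ᵃⁱ[ℝ] E d) (a q : E d) :
    e (a + q) = e a + e.linearIsometryEquiv q := by
  have := e.map_vadd a q
  simp only [vadd_eq_add] at this
  rw [show a + q = q + a from add_comm _ _, this]
  exact add_comm _ _

theorem apply_add_dir (e : E d ≃ᵃⁱ[ℝ] E d) (a v : E d) : e (a + dir e v) = e a + v := by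
  rw [apply_add]; simp [dir]

theorem norm_dir (e : E d ≃ᵃⁱ[ℝ] E d) (v : E d) : ‖dir e v‖ = ‖v‖ := by simp [dir]

/-- The upward unit vector. -/
noncomputable def up (d : ℕ) : E d := join (0, 1)

theorem norm_up : ‖up d‖ = 1 := by
  have := norm_sq_eq_horiz_vert (up d)
  simp only [up, horiz_join, vert_join, norm_zero] at this
  have h := norm_nonneg (up d)
  unfold up at *
  nlinarith

theorem graphMap_add (e : E d ≃ᵃⁱ[ℝ] E d) (φ : EuclideanSpace ℝ (Fin (d + 1)) → ℝ)
    (x : EuclideanSpace ℝ (Fin (d + 1))) (s t : ℝ) :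
    graphMap e φ (x, s + t) = graphMap e φ (x, s) + t • dir e (up d) := by
  apply e.injective
  have : t • dir e (up d) = dir e (t • up d) := by simp [dir]
  rw [this, apply_add_dir, ← join_horiz_vert (e (graphMap e φ (x, s + t))),
    ← join_horiz_vert (e (graphMap e φ (x, s)) + _)]
  congr 2
  · rw [horiz_add, horiz_smul]; simp [up]
  · rw [vert_add, vert_smul]; simp [up]; ring

/-- In the set `U`, the coordinate system `e` flattens `Ω` and `D` as in a coordinate cylinder. -/
structure GraphChart (M : ℝ≥0) (Ω D : Set (E d)) (e : E d ≃ᵃⁱ[ℝ] E d)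
    (φ : EuclideanSpace ℝ (Fin (d + 1)) → ℝ) (ψ : EuclideanSpace ℝ (Fin d) → ℝ)
    (U : Set (E d)) : Prop where
  lipφ : LipschitzWith M φ
  lipψ : LipschitzWith M ψ
  mem_iff : ∀ p ∈ U, (p ∈ Ω ↔ φ (horiz (e p)) < vert (e p))
  frontier_iff : ∀ p ∈ U, (p ∈ frontier Ω ↔ vert (e p) = φ (horiz (e p)))
  mem_D_iff : ∀ p ∈ U, (p ∈ D ↔ ψ (mid (e p)) < fst (e p) ∧ vert (e p) = φ (horiz (e p)))

theorem GraphChart.mono {M : ℝ≥0} {Ω D : Set (E d)} {e : E d ≃ᵃⁱ[ℝ] E d}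
    {φ : EuclideanSpace ℝ (Fin (d + 1)) → ℝ} {ψ : EuclideanSpace ℝ (Fin d) → ℝ}
    {U V : Set (E d)} (h : GraphChart M Ω D e φ ψ U) (hV : V ⊆ U) :
    GraphChart M Ω D e φ ψ V :=
  ⟨h.lipφ, h.lipψ, fun p hp => h.mem_iff p (hV hp), fun p hp => h.frontier_iff p (hV hp),
    fun p hp => h.mem_D_iff p (hV hp)⟩

theorem lipschitz_sub_le {X : Type*} [PseudoMetricSpace X] {M : ℝ≥0} {φ : X → ℝ}
    (h : LipschitzWith M φ) (x y : X) : |φ x - φ y| ≤ M * dist x y := by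
  rw [← Real.dist_eq]; exact h.dist_le_mul x y

theorem lipschitz_graph (e : E d ≃ᵃⁱ[ℝ] E d) {M : ℝ≥0}
    {φ : EuclideanSpace ℝ (Fin (d + 1)) → ℝ} (h : LipschitzWith M φ) :
    LipschitzWith (1 + M) fun x => graphMap e φ (x, 0) := by
  refine LipschitzWith.of_dist_le_mul fun x y => ?_
  rw [← e.dist_map]
  refine (dist_le_horiz_add_vert _ _).trans ?_
  have := lipschitz_sub_le h x y
  simp only [horiz_graphMap, vert_graphMap, add_zero]
  push_cast
  linarith

/-- Surface measure on a Lipschitz graph is controlled by Lebesgue measure on the base. -/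
theorem GraphChart.lintegral_frontier_le {M : ℝ≥0} {Ω D : Set (E d)} {e : E d ≃ᵃⁱ[ℝ] E d}
    {φ : EuclideanSpace ℝ (Fin (d + 1)) → ℝ} {ψ : EuclideanSpace ℝ (Fin d) → ℝ}
    {U : Set (E d)} (h : GraphChart M Ω D e φ ψ U) (hU : MeasurableSet U) {F : E d → ℝ≥0∞}
    (hF : Measurable F) :
    ∫⁻ y in frontier Ω ∩ U, F y ∂(σ d) ≤
      ((1 + M : ℝ≥0) : ℝ≥0∞) ^ (d + 1) * ∫⁻ x, U.indicator F (graphMap e φ (x, 0)) := by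
  set g : EuclideanSpace ℝ (Fin (d + 1)) → E d := fun x => graphMap e φ (x, 0) with hg
  have hgl : LipschitzWith (1 + M) g := lipschitz_graph e h.lipφ
  have hgm : Measurable g := hgl.continuous.measurable
  -- The piece of boundary lies in the image of the base under a (1 + M)-Lipschitz map, and such a
  -- map multiplies (d+1)-dimensional Hausdorff measure by at most (1 + M)^(d+1).
  have key : (σ d).restrict (frontier Ω ∩ U) ≤
      ((1 + M : ℝ≥0) : ℝ≥0∞) ^ (d + 1) • (volume.map g) := by
    refine Measure.le_iff.2 fun A hA => ?_
    rw [Measure.restrict_apply hA, Measure.smul_apply, Measure.map_apply hgm hA, smul_eq_mul]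
    have hsub : A ∩ (frontier Ω ∩ U) ⊆ g '' (g ⁻¹' A) := by
      rintro y ⟨hyA, hyf, hyU⟩
      have : g (horiz (e y)) = y := by
        have h1 := graphMap_eq e φ y
        rwa [(h.frontier_iff y hyU).1 hyf, sub_self] at h1
      exact ⟨horiz (e y), by rwa [mem_preimage, this], this⟩
    refine (measure_mono hsub).trans ?_
    have h2 := hgl.hausdorffMeasure_image_le (d := ((d + 1 : ℕ) : ℝ)) (by positivity) (g ⁻¹' A)
    rw [← EuclideanSpace.euclideanHausdorffMeasure_eq_volume (d + 1)]
    simp only [σ, Measure.euclideanHausdorffMeasure_def, Measure.smul_apply, ENNReal.smul_def,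
      smul_eq_mul]
    rw [ENNReal.rpow_natCast] at h2
    calc _ ≤ _ := mul_le_mul_right h2 _
      _ = _ := by ring
  have hfU : MeasurableSet (frontier Ω ∩ U) := isClosed_frontier.measurableSet.inter hU
  calc ∫⁻ y in frontier Ω ∩ U, F y ∂(σ d)
      = ∫⁻ y in frontier Ω ∩ U, U.indicator F y ∂(σ d) := by
        refine setLIntegral_congr_fun hfU fun y hy => ?_
        simp [hy.2]
    _ ≤ ∫⁻ y, U.indicator F y ∂(((1 + M : ℝ≥0) : ℝ≥0∞) ^ (d + 1) • (volume.map g)) :=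
        lintegral_mono' key le_rfl
    _ = _ := by
        rw [lintegral_smul_measure, lintegral_map (hF.indicator hU) hgm, smul_eq_mul]

/-! ### Trace and Sobolev inequalities for functions supported in a chart. -/

theorem enorm_le_lintegral_ray {V : Type*} [NormedAddCommGroup V] [NormedSpace ℝ V] {W : V → ℝ}
    (hW : ContDiff ℝ 1 W) {y : V} {r : ℝ} (hs : ∀ p ∉ Metric.ball y r, W p = 0) (p : V) {v : V}
    (hv : v ≠ 0) :
    ‖W p‖ₑ ≤ ∫⁻ t in Ioi (0 : ℝ), ‖v‖ₑ * ‖fderiv ℝ W (p + t • v)‖ₑ := by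
  have hv0 : 0 < ‖v‖ := norm_pos_iff.2 hv
  -- At this time the ray has left the ball, so that W vanishes there and W(p) is recovered by
  -- integrating the derivative.
  set T : ℝ := (|r| + dist p y) / ‖v‖ with hT
  have hT0 : 0 ≤ T := by positivity
  have hWT : W (p + T • v) = 0 := by
    apply hs
    rw [Metric.mem_ball, not_lt]
    have h1 : ‖T • v‖ = |r| + dist p y := by
      rw [norm_smul, Real.norm_of_nonneg hT0, hT]; field_simp
    have h2 : dist (p + T • v) y ≥ ‖T • v‖ - dist p y := by
      rw [dist_eq_norm, dist_eq_norm]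
      have := norm_sub_le (p + T • v - y) (p - y)
      rw [show p + T • v - y - (p - y) = T • v by abel] at this
      linarith
    linarith [le_abs_self r]
  have h1 : ContDiff ℝ 1 fun s : ℝ => W (p + s • v) := hW.comp (by fun_prop)
  have h2 := enorm_sub_le_lintegral_deriv_of_contDiffOn_Icc (f := fun s : ℝ => W (p + s • v))
    h1.contDiffOn hT0
  simp only [hWT, zero_smul, add_zero, zero_sub, enorm_neg] at h2
  refine h2.trans ?_
  rw [setLIntegral_congr Ioc_ae_eq_Icc.symm]
  refine (lintegral_mono' (Measure.restrict_mono Ioc_subset_Ioi_self le_rfl) fun s => ?_)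
  have h3 : HasDerivAt (fun s : ℝ => W (p + s • v)) (fderiv ℝ W (p + s • v) v) s := by
    have h4 : HasDerivAt (fun s : ℝ => p + s • v) v s := by
      simpa using ((hasDerivAt_id s).smul_const v).const_add p
    exact ((hW.differentiable one_ne_zero _).hasFDerivAt).comp_hasDerivAt s h4
  rw [h3.deriv, mul_comm]
  exact ContinuousLinearMap.le_opENorm _ _

theorem enorm_fderiv_eq_zero_of_notMem {V : Type*} [NormedAddCommGroup V] [NormedSpace ℝ V]
    {W : V → ℝ} {p : V} (h : p ∉ tsupport W) : ‖fderiv ℝ W p‖ₑ = 0 := by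
  have h0 : fderiv ℝ W p = 0 := by
    by_contra h0
    exact h (support_fderiv_subset ℝ h0)
  rw [← ofReal_norm, h0, norm_zero, ENNReal.ofReal_zero]

section Chart
variable {M : ℝ≥0} {Ω D : Set (E d)} {e : E d ≃ᵃⁱ[ℝ] E d}
    {φ : EuclideanSpace ℝ (Fin (d + 1)) → ℝ} {ψ : EuclideanSpace ℝ (Fin d) → ℝ}
    {U : Set (E d)}

theorem lintegral_graphMap (hφ : LipschitzWith M φ) {F : E d → ℝ≥0∞} (hF : Measurable F) :
    ∫⁻ x, (∫⁻ t, F (graphMap e φ (x, t))) = ∫⁻ y, F y := by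
  have h := measurePreserving_graphMap e hφ.continuous.measurable
  rw [← h.lintegral_comp hF]
  exact (lintegral_prod (fun p => F (graphMap e φ p)) (hF.comp h.measurable).aemeasurable).symm

/-- A boundary value of W is at most the integral of |∇W| over the upward vertical ray, whose points
in the support of W belong to Ω. Integration over the base and Fubini in graph coordinates fill out
Ω. W need not vanish on any part of ∂Ω. -/
theorem GraphChart.trace_le (h : GraphChart M Ω D e φ ψ U) (hΩ : MeasurableSet Ω) {W : E d → ℝ}
    (hW : ContDiff ℝ 1 W) {y : E d} {r : ℝ} (hs : tsupport W ⊆ Metric.ball y r)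
    (hU : Metric.ball y r ⊆ U) :
    ∫⁻ z in frontier Ω, ‖W z‖ₑ ∂(σ d) ≤
      ((1 + M : ℝ≥0) : ℝ≥0∞) ^ (d + 1) * ∫⁻ z in Ω, ‖fderiv ℝ W z‖ₑ := by
  have hc : Continuous (fderiv ℝ W) := hW.continuous_fderiv one_ne_zero
  have hW0 : ∀ p ∉ Metric.ball y r, W p = 0 := fun p hp =>
    image_eq_zero_of_notMem_tsupport fun h => hp (hs h)
  have hind : ∀ z, ‖W z‖ₑ = (Metric.ball y r).indicator (fun z => ‖W z‖ₑ) z := by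
    intro z
    by_cases hz : z ∈ Metric.ball y r
    · simp [hz]
    · simp [hz, hW0 z hz]
  have hdir : dir e (up d) ≠ 0 := by
    rw [← norm_ne_zero_iff, norm_dir, norm_up]; exact one_ne_zero
  have hdir1 : ‖dir e (up d)‖ₑ = 1 := by rw [← ofReal_norm, norm_dir, norm_up]; simp
  calc ∫⁻ z in frontier Ω, ‖W z‖ₑ ∂(σ d)
      = ∫⁻ z in frontier Ω ∩ Metric.ball y r, ‖W z‖ₑ ∂(σ d) := by
        conv_lhs => enter [2, z]; rw [hind z]
        rw [lintegral_indicator Metric.isOpen_ball.measurableSet,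
          Measure.restrict_restrict Metric.isOpen_ball.measurableSet, inter_comm]
    _ ≤ _ := (h.mono hU).lintegral_frontier_le Metric.isOpen_ball.measurableSet
        (by have := hW.continuous; fun_prop)
    _ ≤ _ := by
        gcongr _ * ?_
        rw [← lintegral_indicator hΩ, ← lintegral_graphMap (e := e) h.lipφ
          ((by fun_prop : Measurable fun z => ‖fderiv ℝ W z‖ₑ).indicator hΩ)]
        refine lintegral_mono fun x => ?_
        simp only [← hind]
        refine (enorm_le_lintegral_ray hW hW0 _ hdir).trans ?_
        rw [← lintegral_indicator measurableSet_Ioi]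
        refine lintegral_mono fun t => ?_
        by_cases ht : t ∈ Ioi (0 : ℝ)
        · rw [indicator_of_mem ht, hdir1, one_mul, ← graphMap_add, zero_add]
          by_cases hz : graphMap e φ (x, t) ∈ tsupport W
          · have : graphMap e φ (x, t) ∈ Ω := by
              rw [h.mem_iff _ (hU (hs hz))]
              simpa using ht
            rw [indicator_of_mem this]
          · exact (enorm_fderiv_eq_zero_of_notMem hz).le.trans zero_le
        · simp [indicator_of_notMem ht]

/-- The linear map `x ↦ x + K (∑ xᵢ) eₙ`. -/
noncomputable def coneMap (d : ℕ) (K : ℝ) : (Fin (d + 2) → ℝ) →ₗ[ℝ] E d :=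
  (WithLp.linearEquiv 2 ℝ (Fin (d + 2) → ℝ)).symm.toLinearMap +
    (LinearMap.lsum ℝ (fun _ => ℝ) ℝ fun _ => LinearMap.id).smulRight (K • up d)

theorem coneMap_apply (K : ℝ) (x : Fin (d + 2) → ℝ) :
    coneMap d K x = WithLp.toLp 2 x + (∑ i, x i) • (K • up d) := by
  simp [coneMap, LinearMap.lsum_apply]

theorem horiz_up : horiz (up d) = 0 := by simp [up]
theorem vert_up : vert (up d) = 1 := by simp [up]

/-- The map multiplies the sum of the coordinates by 1 + K. On the kernel this sum therefore
vanishes, and then so does x. -/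
theorem coneMap_injective {K : ℝ} (hK : 0 ≤ K) : Function.Injective (coneMap d K) := by
  rw [injective_iff_map_eq_zero]
  intro x hx
  rw [coneMap_apply] at hx
  have h1 : ∀ i, x i + (∑ i, x i) * (K * up d i) = 0 := fun i => by
    have := congrArg (fun z : E d => z i) hx
    simpa using this
  have h2 : ∑ i, up d i = 1 := by
    simp [up, join, Fin.sum_univ_castSucc]
  have h3 : ∑ i, x i = 0 := by
    have h4 : ∑ i, (x i + (∑ i, x i) * (K * up d i)) = (∑ i, x i) * (1 + K) := by
      rw [Finset.sum_add_distrib, ← Finset.mul_sum, ← Finset.mul_sum, h2]; ring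
    rw [Finset.sum_congr rfl fun i _ => h1 i, Finset.sum_const_zero] at h4
    rcases mul_eq_zero.1 h4.symm with h | h
    · exact h
    · linarith
  funext i
  simpa [h3] using h1 i

/-- The image of Lebesgue measure under a linear isomorphism is again a Haar measure. The value of
the Jacobian is immaterial; what matters is that it is the same for all charts with the same d and
K. -/
theorem exists_lintegral_coneMap {K : ℝ} (hK : 0 ≤ K) : ∃ c : ℝ≥0∞, c ≠ 0 ∧ c ≠ ∞ ∧
    ∀ F : E d → ℝ≥0∞, Measurable F → ∫⁻ x, F (coneMap d K x) = c * ∫⁻ z, F z := by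
  have hfr : Module.finrank ℝ (Fin (d + 2) → ℝ) = Module.finrank ℝ (E d) := by simp
  set L := (LinearEquiv.ofInjectiveOfFinrankEq (coneMap d K) (coneMap_injective hK)
    hfr).toContinuousLinearEquiv with hL
  have hLc : ∀ x, L x = coneMap d K x := fun x => rfl
  have hm : Measurable L := L.continuous.measurable
  have : (volume.map L : Measure (E d)).IsAddHaarMeasure := L.isAddHaarMeasure_map _
  have h := Measure.isAddLeftInvariant_eq_smul (volume.map L : Measure (E d)) volume
  refine ⟨Measure.addHaarScalarFactor (volume.map L : Measure (E d)) volume,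
    ?_, ENNReal.coe_ne_top, fun F hF => ?_⟩
  · have := Measure.addHaarScalarFactor_pos_of_isAddHaarMeasure
      (volume.map L : Measure (E d)) volume
    exact_mod_cast this.ne'
  · calc ∫⁻ x, F (coneMap d K x) = ∫⁻ x, F (L x) := rfl
      _ = ∫⁻ z, F z ∂(volume.map L) := (lintegral_map hF hm).symm
      _ = _ := by
        conv_lhs => rw [h]
        rw [lintegral_smul_measure]
        rfl

theorem coneMap_update (K : ℝ) (x : Fin (d + 2) → ℝ) (i : Fin (d + 2)) (t : ℝ) :
    coneMap d K (Function.update x i (x i + t)) =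
      coneMap d K x + t • coneMap d K (Pi.single i 1) := by
  rw [← map_smul, ← map_add]
  congr 1
  ext j
  by_cases hj : j = i
  · subst hj; simp
  · simp [hj]

theorem norm_horiz_coneMap_single_le (K : ℝ) (i : Fin (d + 2)) :
    ‖horiz (coneMap d K (Pi.single i 1))‖ ≤ 1 := by
  rw [coneMap_apply, horiz_add, horiz_smul, horiz_smul, horiz_up]
  simp only [smul_zero, add_zero]
  refine (norm_horiz_le _).trans ?_
  have : (WithLp.toLp 2 (Pi.single i (1 : ℝ)) : E d) = EuclideanSpace.single i 1 := rfl
  rw [this]; simp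

theorem le_vert_coneMap_single (K : ℝ) (i : Fin (d + 2)) :
    K ≤ vert (coneMap d K (Pi.single i 1)) := by
  rw [coneMap_apply, vert_add, vert_smul, vert_smul, vert_up]
  have : 0 ≤ vert (WithLp.toLp 2 (Pi.single i (1 : ℝ)) : E d) := by
    simp only [vert, Pi.single_apply]; positivity
  rw [Finset.sum_pi_single' , if_pos (Finset.mem_univ i)]
  linarith

/-- Points in the upward cone over a point of the epigraph belong to the epigraph. -/
theorem epigraph_add {a v : E d} (hφ : LipschitzWith M φ) (ha : φ (horiz (e a)) < vert (e a))
    (hv : M * ‖horiz v‖ ≤ vert v) :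
    φ (horiz (e (a + dir e v))) < vert (e (a + dir e v)) := by
  rw [apply_add_dir, horiz_add, vert_add]
  have := lipschitz_sub_le hφ (horiz (e a) + horiz v) (horiz (e a))
  rw [dist_eq_norm, add_sub_cancel_left, abs_le] at this
  linarith

theorem dir_smul (t : ℝ) (v : E d) : dir e (t • v) = t • dir e v := by simp [dir]

/-- This is the Gagliardo–Nirenberg argument in skew coordinates. The images of the coordinate
vectors under `coneMap` are n independent directions that point into the epigraph from each of its
points, so W(a) is bounded by line integrals of |∇W| that stay in Ω, although W is not assumed to
vanish on ∂Ω. The grid-lines inequality for products of line integrals does the rest. -/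
theorem exists_sobolev_const (d : ℕ) (M : ℝ≥0) : ∃ C : ℝ≥0∞, C ≠ ∞ ∧
    ∀ {Ω D : Set (E d)} {e : E d ≃ᵃⁱ[ℝ] E d} {φ : EuclideanSpace ℝ (Fin (d + 1)) → ℝ}
    {ψ : EuclideanSpace ℝ (Fin d) → ℝ} {U : Set (E d)}, GraphChart M Ω D e φ ψ U →
    MeasurableSet Ω → ∀ {W : E d → ℝ}, ContDiff ℝ 1 W → ∀ {y : E d} {r : ℝ},
    tsupport W ⊆ Metric.ball y r → Metric.ball y r ⊆ U →
    ∫⁻ z in Ω, ‖W z‖ₑ ^ (((d : ℝ) + 2) / (d + 1)) ≤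
      C * (∫⁻ z in Ω, ‖fderiv ℝ W z‖ₑ) ^ (((d : ℝ) + 2) / (d + 1)) := by
  -- The directions have horizontal part at most 1 and vertical part at least K, so any K ≥ M keeps
  -- them in the cone of the epigraph; the additional 1 makes them nonzero.
  set K : ℝ := M + 1 with hK
  set p : ℝ := ((d : ℝ) + 2) / (d + 1) with hp
  have hd1 : (0 : ℝ) < d + 1 := by positivity
  have hp1 : 1 < p := by rw [hp, lt_div_iff₀ hd1]; linarith
  have hconj : Real.HolderConjugate (Fintype.card (Fin (d + 2))) p := by
    rw [Real.holderConjugate_iff]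
    simp only [Fintype.card_fin, hp]
    push_cast
    refine ⟨by linarith, by field_simp; ring⟩
  obtain ⟨c, hc0, hct, hcF⟩ := exists_lintegral_coneMap (d := d) (K := K) (by positivity)
  set B : ℝ≥0∞ := ∑ i, ‖coneMap d K (Pi.single i 1)‖ₑ with hB
  have hBt : B ≠ ∞ := by simp [hB]
  refine ⟨c⁻¹ * (B * c) ^ p, ENNReal.mul_ne_top (ENNReal.inv_ne_top.2 hc0)
    (ENNReal.rpow_ne_top_of_nonneg (by linarith) (ENNReal.mul_ne_top hBt hct)), ?_⟩
  intro Ω D e φ ψ U h hΩ W hW y r hs hU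
  have hcW : Continuous (fderiv ℝ W) := hW.continuous_fderiv one_ne_zero
  have hW0 : ∀ p ∉ Metric.ball y r, W p = 0 := fun p hp =>
    image_eq_zero_of_notMem_tsupport fun h => hp (hs h)
  have hmp := (e.linearIsometryEquiv.symm).measurePreserving
  have hrot : ∀ F : E d → ℝ≥0∞, Measurable F →
      ∫⁻ x, F (dir e (coneMap d K x)) = c * ∫⁻ z, F z := by
    intro F hF
    rw [hcF (fun z => F (dir e z)) (hF.comp hmp.measurable)]
    congr 1
    exact hmp.lintegral_comp hF
  set F : E d → ℝ≥0∞ := Ω.indicator fun z => ‖fderiv ℝ W z‖ₑ with hF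
  have hFm : Measurable F := (by fun_prop : Measurable fun z => ‖fderiv ℝ W z‖ₑ).indicator hΩ
  set G : E d → ℝ≥0∞ := Ω.indicator fun z => ‖W z‖ₑ ^ p with hG
  have hGm : Measurable G := by
    refine Measurable.indicator ?_ hΩ
    have := hW.continuous; fun_prop
  -- Each of the d + 2 full line integrals dominates |W(a)|. Raised to the power 1/(d+1) and
  -- multiplied, they dominate |W(a)| to the power p = (d+2)/(d+1).
  have hpt : ∀ x, G (dir e (coneMap d K x)) ≤
      ∏ i, (∫⁻ t, B * F (dir e (coneMap d K (Function.update x i t)))) ^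
        ((1 : ℝ) / ((Fintype.card (Fin (d + 2)) : ℝ) - 1)) := by
    intro x
    set a := dir e (coneMap d K x) with ha
    by_cases haΩ : a ∈ Ω
    swap
    · simp [hG, haΩ]
    by_cases haU : a ∈ Metric.ball y r
    swap
    · simp [hG, haΩ, hW0 a haU, ENNReal.zero_rpow_of_pos (by linarith : 0 < p)]
    have h1 : ∀ i, ‖W a‖ₑ ≤ ∫⁻ t, B * F (dir e (coneMap d K (Function.update x i t))) := by
      intro i
      set v := coneMap d K (Pi.single i 1) with hv
      have hvh := norm_horiz_coneMap_single_le (d := d) K i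
      have hvv := le_vert_coneMap_single (d := d) K i
      rw [← hv] at hvh hvv
      have hM0 : (0 : ℝ) ≤ M := M.coe_nonneg
      have hv0 : dir e v ≠ 0 := by
        rw [← norm_ne_zero_iff, norm_dir]
        have := abs_vert_le v
        have := le_abs_self (vert v)
        intro h0
        linarith
      refine (enorm_le_lintegral_ray hW hW0 a hv0).trans ?_
      rw [← lintegral_add_left_eq_self
        (fun t => B * F (dir e (coneMap d K (Function.update x i t)))) (x i),
        ← lintegral_indicator measurableSet_Ioi]
      refine lintegral_mono fun t => ?_
      by_cases ht : t ∈ Ioi (0 : ℝ)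
      · rw [indicator_of_mem ht, coneMap_update]
        have hadd : dir e (coneMap d K x + t • v) = a + t • dir e v := by
          rw [ha]; simp [dir]
        rw [hadd]
        gcongr
        · rw [← ofReal_norm, norm_dir, ofReal_norm, hB]
          exact Finset.single_le_sum (f := fun i => ‖coneMap d K (Pi.single i 1)‖ₑ)
            (fun _ _ => zero_le) (Finset.mem_univ i)
        · by_cases hz : a + t • dir e v ∈ tsupport W
          · have : a + t • dir e v ∈ Ω := by
              rw [h.mem_iff _ (hU (hs hz)), ← dir_smul]
              refine epigraph_add h.lipφ ((h.mem_iff a (hU haU)).1 haΩ) ?_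
              rw [horiz_smul, vert_smul, norm_smul, Real.norm_of_nonneg (le_of_lt ht)]
              have ht' : (0 : ℝ) < t := ht
              have : (M : ℝ) * ‖horiz v‖ ≤ vert v := by nlinarith
              nlinarith
            rw [hF, indicator_of_mem this]
          · exact (enorm_fderiv_eq_zero_of_notMem hz).le.trans zero_le
      · simp [indicator_of_notMem ht]
    simp only [hG, indicator_of_mem haΩ]
    have hcard : ((Fintype.card (Fin (d + 2)) : ℝ) - 1) = d + 1 := by
      simp; ring
    calc ‖W a‖ₑ ^ p = ∏ _i : Fin (d + 2), ‖W a‖ₑ ^ ((1 : ℝ) / (d + 1)) := by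
          rw [Finset.prod_const, ← ENNReal.rpow_natCast, ← ENNReal.rpow_mul]
          congr 1
          simp [hp]; field_simp
      _ ≤ _ := by
          rw [hcard]
          refine Finset.prod_le_prod' fun i _ => ?_
          exact ENNReal.rpow_le_rpow (h1 i) (by positivity)
  have hmeas : Measurable fun x => B * F (dir e (coneMap d K x)) := by
    refine (hFm.comp (hmp.measurable.comp ?_)).const_mul B
    exact (LinearMap.continuous_of_finiteDimensional (coneMap d K)).measurable
  have hmain := lintegral_prod_lintegral_pow_le (fun _ : Fin (d + 2) => (volume : Measure ℝ))
    hconj hmeas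
  rw [← volume_pi] at hmain
  have h2 : c * ∫⁻ z in Ω, ‖W z‖ₑ ^ p ≤ (B * c) ^ p * (∫⁻ z in Ω, ‖fderiv ℝ W z‖ₑ) ^ p := by
    calc c * ∫⁻ z in Ω, ‖W z‖ₑ ^ p = ∫⁻ x, G (dir e (coneMap d K x)) := by
          rw [hrot G hGm, hG, lintegral_indicator hΩ]
      _ ≤ _ := lintegral_mono hpt
      _ ≤ _ := hmain
      _ = _ := by
          rw [lintegral_const_mul' _ _ hBt, hrot F hFm, hF, lintegral_indicator hΩ, ← mul_assoc,
            ENNReal.mul_rpow_of_nonneg _ _ (by linarith : 0 ≤ p)]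
  calc ∫⁻ z in Ω, ‖W z‖ₑ ^ p = c⁻¹ * (c * ∫⁻ z in Ω, ‖W z‖ₑ ^ p) := by
        rw [← mul_assoc, ENNReal.inv_mul_cancel hc0 hct, one_mul]
    _ ≤ _ := by rw [mul_assoc]; gcongr

end Chart

/-! ### The scaling-invariant trace inequality. -/

theorem enorm_norm_rpow (a : ℝ) {γ : ℝ} (hγ : 0 ≤ γ) : ‖‖a‖ ^ γ‖ₑ = ‖a‖ₑ ^ γ := by
  rw [← ofReal_norm, Real.norm_of_nonneg (by positivity),
    ← ENNReal.ofReal_rpow_of_nonneg (norm_nonneg _) hγ, ofReal_norm]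

theorem enorm_fderiv_norm_rpow_le {V : Type*} [NormedAddCommGroup V] [NormedSpace ℝ V]
    {w : V → ℝ} (hw : Differentiable ℝ w) {γ : ℝ} (hγ : 1 < γ) (z : V) :
    ‖fderiv ℝ (fun z => ‖w z‖ ^ γ) z‖ₑ ≤
      ENNReal.ofReal γ * (‖w z‖ₑ ^ (γ - 1) * ‖fderiv ℝ w z‖ₑ) := by
  have h := norm_fderiv_norm_rpow_le hw (x := z) hγ
  rw [← ofReal_norm]
  refine (ENNReal.ofReal_le_ofReal h).trans (le_of_eq ?_)
  rw [ENNReal.ofReal_mul (by positivity), ENNReal.ofReal_mul (by positivity), ofReal_norm,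
    ← ENNReal.ofReal_rpow_of_nonneg (norm_nonneg _) (by linarith), ofReal_norm, mul_assoc]

theorem rpow_le_of_le_mul_rpow {X c : ℝ≥0∞} {θ : ℝ} (hX : X ≠ ∞)
    (h : X ≤ c * X ^ θ) (hθ1 : θ < 1) : X ^ (1 - θ) ≤ c := by
  rcases eq_or_ne X 0 with rfl | hX0
  · rw [ENNReal.zero_rpow_of_pos (by linarith)]; exact zero_le
  · rw [ENNReal.rpow_sub _ _ hX0 hX, ENNReal.rpow_one]
    exact ENNReal.div_le_of_le_mul h

/-- The trace inequality for compactly supported functions, with the scaling-invariant power of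
the radius. -/
theorem exists_trace_const (d : ℕ) (M : ℝ≥0) {γ : ℝ} (hγ : 1 < γ) (hγd : γ * d ≤ 2 * (d + 1)) :
    ∃ C : ℝ≥0∞, C ≠ ∞ ∧
    ∀ {Ω D : Set (E d)} {e : E d ≃ᵃⁱ[ℝ] E d} {φ : EuclideanSpace ℝ (Fin (d + 1)) → ℝ}
    {ψ : EuclideanSpace ℝ (Fin d) → ℝ} {U : Set (E d)}, GraphChart M Ω D e φ ψ U →
    MeasurableSet Ω → ∀ {w : E d → ℝ}, ContDiff ℝ 1 w → ∀ {y : E d} {r : ℝ}, 0 < r →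
    tsupport w ⊆ Metric.ball y r → Metric.ball y r ⊆ U →
    (∫⁻ z in frontier Ω, ‖w z‖ₑ ^ γ ∂(σ d)) ^ (2 / γ) ≤
      C * ENNReal.ofReal (r ^ ((d + 2 : ℝ) - 2 * (d + 1) * ((γ - 1) / γ))) *
        ∫⁻ z in Ω, ‖fderiv ℝ w z‖ₑ ^ 2 := by
  obtain ⟨C₂, hC₂, hsob⟩ := exists_sobolev_const d M
  set k : ℝ := ((d : ℝ) + 2) / (d + 1) with hk
  set C₁ : ℝ≥0∞ := ((1 + M : ℝ≥0) : ℝ≥0∞) ^ (d + 1) with hC₁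
  have hd0 : (0 : ℝ) ≤ d := d.cast_nonneg
  have hd1 : (0 : ℝ) < d + 1 := by positivity
  have hk0 : 0 < k := by rw [hk]; positivity
  have hγ0 : 0 < γ := by linarith
  -- The exponent with θγk = 2(γ - 1), by which the integral of |w|^(2(γ-1)) is interpolated between
  -- that of |w|^(γk) and the volume of the ball. The bound θ ≤ 1 is exactly γd ≤ 2(d+1), the
  -- critical trace exponent.
  set θ : ℝ := 2 * (γ - 1) / (γ * k) with hθ
  have hθ0 : 0 ≤ θ := div_nonneg (by linarith) (by positivity)
  have hθ1 : θ ≤ 1 := by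
    rw [hθ, div_le_one (by positivity), hk, mul_div_assoc', le_div_iff₀ hd1]
    nlinarith
  set g : ℝ≥0∞ := ENNReal.ofReal γ with hg
  set c₁ : ℝ≥0∞ := C₂ * g ^ k with hc₁
  set ω : ℝ≥0∞ := volume (Metric.ball (0 : E d) 1) with hω
  have hωt : ω ≠ ∞ := measure_ball_lt_top.ne
  refine ⟨(C₁ * g) ^ (2 / γ) * (c₁ ^ (2 * (γ - 1) / k)) ^ (1 / γ) * ω ^ (1 - θ), ?_, ?_⟩
  · have h1 : 0 ≤ 2 * (γ - 1) / k := div_nonneg (by linarith) hk0.le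
    refine ENNReal.mul_ne_top (ENNReal.mul_ne_top ?_ ?_) ?_
    · exact ENNReal.rpow_ne_top_of_nonneg (by positivity)
        (ENNReal.mul_ne_top (by simp [hC₁]) ENNReal.ofReal_ne_top)
    · exact ENNReal.rpow_ne_top_of_nonneg (by positivity) (ENNReal.rpow_ne_top_of_nonneg h1
        (ENNReal.mul_ne_top hC₂ (ENNReal.rpow_ne_top_of_nonneg hk0.le ENNReal.ofReal_ne_top)))
    · exact ENNReal.rpow_ne_top_of_nonneg (by linarith) hωt
  intro Ω D e φ ψ U h hΩ w hw y r hr hs hU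
  have hwc := hw.continuous
  have hdwc : Continuous (fderiv ℝ w) := hw.continuous_fderiv one_ne_zero
  set W : E d → ℝ := fun z => ‖w z‖ ^ γ with hWdef
  have hW : ContDiff ℝ 1 W := hw.norm_rpow hγ
  have hWs : tsupport W ⊆ Metric.ball y r := by
    refine Subset.trans (closure_mono fun z hz => ?_) hs
    simp only [hWdef, Function.mem_support] at hz ⊢
    intro h0
    apply hz
    rw [h0, norm_zero, Real.zero_rpow hγ0.ne']
  have hW0 : ∀ z ∉ Metric.ball y r, w z = 0 := fun p hp =>
    image_eq_zero_of_notMem_tsupport fun h => hp (hs h)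
  have hWe : ∀ z, ‖W z‖ₑ = ‖w z‖ₑ ^ γ := fun z => enorm_norm_rpow _ hγ0.le
  set Z := ∫⁻ z in frontier Ω, ‖w z‖ₑ ^ γ ∂(σ d) with hZ
  set A := ∫⁻ z in Ω, ‖fderiv ℝ w z‖ₑ ^ 2 with hA
  set J := ∫⁻ z in Ω, ‖w z‖ₑ ^ (γ - 1) * ‖fderiv ℝ w z‖ₑ with hJ
  set X := ∫⁻ z in Ω, ‖w z‖ₑ ^ (γ * k) with hX
  set Y := ∫⁻ z in Ω, (‖w z‖ₑ ^ (γ - 1)) ^ 2 with hY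
  set B := volume (Metric.ball y r) with hB
  have hDW : ∫⁻ z in Ω, ‖fderiv ℝ W z‖ₑ ≤ g * J := by
    rw [hJ, ← lintegral_const_mul' _ _ ENNReal.ofReal_ne_top]
    exact lintegral_mono fun z => enorm_fderiv_norm_rpow_le (hw.differentiable one_ne_zero) hγ z
  have hZJ : Z ≤ C₁ * g * J := by
    have := h.trace_le hΩ hW hWs hU
    simp only [hWe] at this
    refine this.trans ?_
    rw [mul_assoc]
    gcongr
  have hXJ : X ≤ c₁ * J ^ k := by
    have := hsob h hΩ hW hWs hU
    simp only [hWe, ← ENNReal.rpow_mul] at this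
    refine this.trans ?_
    rw [hc₁, mul_assoc, ← ENNReal.mul_rpow_of_nonneg _ _ hk0.le]
    gcongr
  have hJ2 : J ^ 2 ≤ Y * A :=
    sq_setLIntegral_le (by fun_prop) (by fun_prop)
  have hYX : Y ≤ X ^ θ * B ^ (1 - θ) := by
    have hball : MeasurableSet (Metric.ball y r) := Metric.isOpen_ball.measurableSet
    have h1 : Y = ∫⁻ z in Metric.ball y r ∩ Ω,
        (‖w z‖ₑ ^ (γ * k)) ^ θ * (1 : ℝ≥0∞) ^ (1 - θ) := by
      rw [hY, ← Measure.restrict_restrict hball, ← lintegral_indicator hball]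
      refine lintegral_congr fun z => ?_
      by_cases hz : z ∈ Metric.ball y r
      · rw [indicator_of_mem hz, ENNReal.one_rpow, mul_one, ← ENNReal.rpow_mul,
          ← ENNReal.rpow_natCast, ← ENNReal.rpow_mul]
        congr 1
        rw [hθ]; push_cast; field_simp
      · rw [indicator_of_notMem hz, hW0 z hz]
        simp [ENNReal.zero_rpow_of_pos (by linarith : 0 < γ - 1)]
    rw [h1]
    refine (ENNReal.lintegral_mul_norm_pow_le (by fun_prop) (by fun_prop) hθ0 (by linarith)
      (by ring)).trans ?_
    gcongr
    · exact lintegral_mono_set inter_subset_right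
    · simp only [lintegral_const, one_mul, Measure.restrict_apply_univ]
      exact measure_mono inter_subset_left
  -- Finiteness is needed because a power of `X` is about to be divided out.
  have hXt : X ≠ ∞ := by
    have hcs : HasCompactSupport w := HasCompactSupport.of_support_subset_isCompact
      (isCompact_closedBall y r) fun z hz => Metric.ball_subset_closedBall (hs (subset_tsupport _ hz))
    obtain ⟨b, hb⟩ := hcs.exists_bound_of_continuous hwc
    have : X ≤ ∫⁻ z in Metric.ball y r, ENNReal.ofReal b ^ (γ * k) := by
      rw [hX, ← lintegral_indicator hΩ, ← lintegral_indicator Metric.isOpen_ball.measurableSet]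
      refine lintegral_mono fun z => ?_
      by_cases hz : z ∈ Metric.ball y r
      · rw [indicator_of_mem hz]
        refine (indicator_le_self _ _ _).trans ?_
        refine ENNReal.rpow_le_rpow ?_ (by positivity)
        rw [← ofReal_norm]
        exact ENNReal.ofReal_le_ofReal (hb z)
      · refine (indicator_le_self _ _ _).trans ?_
        simp [hW0 z hz, ENNReal.zero_rpow_of_pos (by positivity : 0 < γ * k)]
    refine (this.trans_lt ?_).ne
    rw [setLIntegral_const]
    exact ENNReal.mul_lt_top (ENNReal.rpow_lt_top_of_nonneg (by positivity) ENNReal.ofReal_ne_top)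
      measure_ball_lt_top
  have hJ2' : J ^ 2 ≤ A * B ^ (1 - θ) * X ^ θ := by
    refine hJ2.trans ((mul_le_mul_left hYX A).trans (le_of_eq ?_))
    ring
  have hθk : θ * (k / 2) = (γ - 1) / γ := by rw [hθ]; field_simp
  -- Sobolev's inequality for |w|^γ bounds X by a power of J, and Cauchy–Schwarz with the
  -- interpolation bounds J by X again, with total exponent (γ-1)/γ < 1. Dividing out closes the
  -- loop.
  have hX1 : X ^ (1 / γ) ≤ c₁ * (A * B ^ (1 - θ)) ^ (k / 2) := by
    have h1 : X ≤ c₁ * (A * B ^ (1 - θ)) ^ (k / 2) * X ^ ((γ - 1) / γ) := by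
      refine hXJ.trans ?_
      rw [mul_assoc c₁]
      refine mul_le_mul_right ?_ c₁
      calc J ^ k = (J ^ 2) ^ (k / 2) := by
            rw [← ENNReal.rpow_natCast, ← ENNReal.rpow_mul]; congr 1; push_cast; ring
        _ ≤ (A * B ^ (1 - θ) * X ^ θ) ^ (k / 2) := ENNReal.rpow_le_rpow hJ2' (by positivity)
        _ = _ := by
          rw [ENNReal.mul_rpow_of_nonneg _ _ (by positivity), ← ENNReal.rpow_mul X, hθk]
    have hlt : (γ - 1) / γ < 1 := by rw [div_lt_one hγ0]; linarith
    have h2 := rpow_le_of_le_mul_rpow hXt h1 hlt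
    convert h2 using 2
    field_simp; ring
  have hJf : J ^ 2 ≤ c₁ ^ (2 * (γ - 1) / k) * (A * B ^ (1 - θ)) ^ γ := by
    have hexp : 0 ≤ 2 * (γ - 1) / k := div_nonneg (by linarith) hk0.le
    calc J ^ 2 ≤ A * B ^ (1 - θ) * X ^ θ := hJ2'
      _ = A * B ^ (1 - θ) * (X ^ (1 / γ)) ^ (2 * (γ - 1) / k) := by
        rw [← ENNReal.rpow_mul X]; congr 2; rw [hθ]; field_simp
      _ ≤ A * B ^ (1 - θ) * (c₁ * (A * B ^ (1 - θ)) ^ (k / 2)) ^ (2 * (γ - 1) / k) := by gcongr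
      _ = c₁ ^ (2 * (γ - 1) / k) *
          ((A * B ^ (1 - θ)) ^ (1 : ℝ) * (A * B ^ (1 - θ)) ^ (γ - 1)) := by
        rw [ENNReal.mul_rpow_of_nonneg _ _ hexp, ← ENNReal.rpow_mul _ (k / 2),
          show k / 2 * (2 * (γ - 1) / k) = γ - 1 by field_simp, ENNReal.rpow_one]
        ring
      _ = _ := by
        rw [← ENNReal.rpow_add_of_nonneg _ _ zero_le_one (by linarith)]
        congr 2; ring
  have hBr : B ^ (1 - θ) = ω ^ (1 - θ) *
      ENNReal.ofReal (r ^ ((d + 2 : ℝ) - 2 * (d + 1) * ((γ - 1) / γ))) := by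
    rw [hB, Measure.addHaar_ball_of_pos _ _ hr, ENNReal.mul_rpow_of_nonneg _ _ (by linarith),
      mul_comm, ENNReal.ofReal_rpow_of_pos (by positivity), ← Real.rpow_natCast,
      ← Real.rpow_mul hr.le]
    congr 4
    rw [hθ, hk]; simp; field_simp
  calc Z ^ (2 / γ) ≤ (C₁ * g * J) ^ (2 / γ) := ENNReal.rpow_le_rpow hZJ (by positivity)
    _ = (C₁ * g) ^ (2 / γ) * (J ^ 2) ^ (1 / γ) := by
      rw [ENNReal.mul_rpow_of_nonneg _ _ (by positivity), ← ENNReal.rpow_natCast J,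
        ← ENNReal.rpow_mul J]
      congr 2; push_cast; ring
    _ ≤ (C₁ * g) ^ (2 / γ) *
        (c₁ ^ (2 * (γ - 1) / k) * (A * B ^ (1 - θ)) ^ γ) ^ (1 / γ) := by
      gcongr
    _ = _ := by
      rw [ENNReal.mul_rpow_of_nonneg (c₁ ^ _) _ (by positivity), ← ENNReal.rpow_mul _ γ,
        mul_one_div_cancel hγ0.ne', ENNReal.rpow_one, hBr]
      ring

/-! ### The shape of the domain at small scales. -/

theorem IsMixedLipschitzDomain.exists_graphChart {M : ℝ≥0} {Ω D : Set (E d)} {r₀ : ℝ}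
    (h : IsMixedLipschitzDomain M Ω D r₀) {x : E d} (hx : x ∈ frontier Ω) :
    ∃ e φ ψ, GraphChart M Ω D e φ ψ (Metric.ball x (99 * r₀)) := by
  obtain ⟨k, e, c, ρ, -, hρ, hcyl, hcov, hmin⟩ := h.cover
  obtain ⟨i, hi⟩ := mem_iUnion.1 (hcov hx)
  have hle : r₀ ≤ ρ i := hmin.2 (mem_range_self i)
  obtain ⟨φ, ψ, hφ, hψ, hΩ, hf, hD, -⟩ := hcyl i
  -- A point of the i-th cylinder has room 99ρᵢ ≥ 99r₀ left inside the 100-fold dilate.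
  have hsub : Metric.ball x (99 * r₀) ⊆ cyl M (e i) (c i) (100 * ρ i) := by
    intro p hp
    have hd : dist (e i p) (e i x) < 99 * r₀ := by rw [(e i).dist_map]; exact hp
    have h1 := dist_horiz_le (e i p) (e i x)
    have h2 := abs_vert_sub_le (e i p) (e i x)
    obtain ⟨h3, h4⟩ := hi
    rw [← dist_eq_norm] at h3
    have hM := M.coe_nonneg
    refine ⟨?_, ?_⟩
    · rw [← dist_eq_norm]
      linarith [dist_triangle (horiz (e i p)) (horiz (e i x)) (horiz (e i (c i)))]
    · have h5 := abs_sub_le (vert (e i p)) (vert (e i x)) (vert (e i (c i)))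
      nlinarith [hρ i]
  refine ⟨e i, φ, ψ, hφ, hψ, fun p hp => ?_, fun p hp => ?_, fun p hp => ?_⟩
  · have := Set.ext_iff.1 hΩ p
    simpa [hsub hp] using this
  · have := Set.ext_iff.1 hf p
    simpa [hsub hp] using this
  · have := Set.ext_iff.1 hD p
    simpa [hsub hp] using this

/-- The shape of the domain in a ball: every point has a cone of admissible directions, and there
is a large set `S` that can be joined to all points by segments, above the Dirichlet part of the
boundary if the latter is close. -/
structure LocalGeometry (M : ℝ≥0) (Λ : ℝ) (Ω D : Set (E d)) (y : E d) (ρ : ℝ) : Prop where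
  cone : ∃ ν : E d, ‖ν‖ = 1 ∧ ∀ a ∈ Ω ∩ Metric.ball y (2 * ρ), ∀ τ, 0 < τ → τ ≤ ρ →
    ∀ q ∈ Metric.ball (((M + 2) * τ) • ν) τ, ∀ s ∈ Icc (0 : ℝ) 1, a + s • q ∈ Ω
  star : ∃ S ⊆ Ω ∩ Metric.ball y (Λ * ρ), MeasurableSet S ∧
    volume (Metric.ball y ρ) ≤ ENNReal.ofReal Λ * volume S ∧
    (∀ a ∈ Ω ∩ Metric.ball y ((M + 5) * ρ), ∀ b ∈ S, segment ℝ a b ⊆ Ω) ∧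
    (D ∩ Metric.ball y (2 * ρ) = ∅ ∨ ∀ u : E d → ℝ, ContDiff ℝ 1 u → (∀ z ∈ D, u z = 0) →
      ∫⁻ z in S, ‖u z‖ₑ ≤
        ENNReal.ofReal ρ * ∫⁻ z in Ω ∩ Metric.ball y (Λ * ρ), ‖fderiv ℝ u z‖ₑ)
  chart : frontier Ω ∩ Metric.ball y ((M + 5) * ρ) = ∅ ∨
    ∃ e φ ψ, GraphChart M Ω D e φ ψ (Metric.ball y (Λ * ρ))

/-- In a ball without boundary points the interior of Ω and the complement of its closure would
otherwise disconnect the ball. -/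
theorem ball_subset_of_frontier {Ω : Set (E d)} {y : E d} {r : ℝ} (hy : y ∈ Ω) (hr : 0 < r)
    (h : frontier Ω ∩ Metric.ball y r = ∅) : Metric.ball y r ⊆ Ω := by
  by_contra hsub
  obtain ⟨z, hz, hzΩ⟩ := not_subset.1 hsub
  have hc : IsPreconnected (Metric.ball y r) := (convex_ball y r).isPreconnected
  have hmem : ∀ p ∈ Metric.ball y r, p ∈ closure Ω → p ∈ interior Ω := by
    intro p hp hpc
    by_contra hpi
    exact (h ▸ (⟨⟨hpc, hpi⟩, hp⟩ : p ∈ frontier Ω ∩ Metric.ball y r) : p ∈ (∅ : Set (E d)))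
  obtain ⟨p, -, hp1, hp2⟩ := hc (interior Ω) (closure Ω)ᶜ isOpen_interior
    isClosed_closure.isOpen_compl
    (fun p hp => (em (p ∈ closure Ω)).imp (hmem p hp) id)
    ⟨y, Metric.mem_ball_self hr, hmem y (Metric.mem_ball_self hr) (subset_closure hy)⟩
    ⟨z, hz, fun hzc => hzΩ (interior_subset (hmem z hz hzc))⟩
  exact hp2 (subset_closure (interior_subset hp1))

/-- Far from the boundary a whole ball lies in Ω and convexity gives everything; the direction of
the cone is arbitrary. The radius (M+5)ρ is 2ρ for the base point plus (M+3)ρ for the shifts. -/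
theorem localGeometry_interior {M : ℝ≥0} {Λ : ℝ} (hΛ : 1 ≤ Λ) {Ω D : Set (E d)} {y : E d} {ρ : ℝ}
    (hDΩ : D ⊆ frontier Ω) (hy : y ∈ Ω) (hρ : 0 < ρ)
    (hf : frontier Ω ∩ Metric.ball y ((M + 5) * ρ) = ∅) : LocalGeometry M Λ Ω D y ρ := by
  have hM := M.coe_nonneg
  have hsub := ball_subset_of_frontier hy (by positivity) hf
  have h1 : Metric.ball y ρ ⊆ Metric.ball y ((M + 5) * ρ) :=
    Metric.ball_subset_ball (by nlinarith)
  refine ⟨⟨up d, norm_up, ?_⟩, ⟨Metric.ball y ρ, subset_inter (h1.trans hsub)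
    (Metric.ball_subset_ball (by nlinarith)), Metric.isOpen_ball.measurableSet, ?_, ?_,
    Or.inl ?_⟩, Or.inl hf⟩
  · rintro a ⟨-, ha⟩ τ hτ hτρ q hq s ⟨hs0, hs1⟩
    apply hsub
    rw [Metric.mem_ball, dist_eq_norm] at *
    have h2 : ‖q‖ < (M + 3) * τ := by
      have h3 : ‖((M + 2) * τ) • up d‖ = (M + 2) * τ := by
        rw [norm_smul, norm_up, mul_one, Real.norm_of_nonneg (by positivity)]
      have h4 : q = (q - ((M + 2) * τ) • up d) + ((M + 2) * τ) • up d := by abel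
      have h5 := norm_add_le (q - ((M + 2) * τ) • up d) (((M + 2) * τ) • up d)
      rw [← h4] at h5
      linarith
    have h3 : ‖s • q‖ ≤ ‖q‖ := by
      rw [norm_smul, Real.norm_of_nonneg hs0]
      nlinarith [norm_nonneg q]
    have h4 : ‖a + s • q - y‖ ≤ ‖a - y‖ + ‖s • q‖ := by
      rw [show a + s • q - y = (a - y) + s • q by abel]; exact norm_add_le _ _
    nlinarith
  · calc volume (Metric.ball y ρ) = 1 * volume (Metric.ball y ρ) := (one_mul _).symm
      _ ≤ _ := by gcongr; simpa using hΛ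
  · rintro a ⟨-, ha⟩ b hb
    exact ((convex_ball y _).segment_subset ha (h1 hb)).trans hsub
  · refine eq_empty_of_subset_empty (hf ▸ inter_subset_inter hDΩ (Metric.ball_subset_ball ?_))
    nlinarith

/-- The last coordinates of a point of `ℝⁿ⁻¹`. -/
noncomputable def tail (x : EuclideanSpace ℝ (Fin (d + 1))) : EuclideanSpace ℝ (Fin d) :=
  WithLp.toLp 2 fun i => x i.succ

theorem mid_eq_tail (y : E d) : mid y = tail (horiz y) := rfl
theorem fst_eq_horiz (y : E d) : fst y = horiz y 0 := rfl

theorem dist_tail_le (x y : EuclideanSpace ℝ (Fin (d + 1))) : dist (tail x) (tail y) ≤ dist x y := by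
  rw [EuclideanSpace.dist_eq, EuclideanSpace.dist_eq, Fin.sum_univ_succ]
  apply Real.sqrt_le_sqrt
  simp only [tail]
  linarith [sq_nonneg (dist (x 0) (y 0))]

theorem abs_coord_sub_le (x y : EuclideanSpace ℝ (Fin (d + 1))) (i : Fin (d + 1)) :
    |x i - y i| ≤ dist x y := by
  rw [dist_eq_norm]; exact PiLp.norm_apply_le (x - y) i

section Chart
variable {M : ℝ≥0} {Ω D : Set (E d)} {e : E d ≃ᵃⁱ[ℝ] E d}
    {φ : EuclideanSpace ℝ (Fin (d + 1)) → ℝ} {ψ : EuclideanSpace ℝ (Fin d) → ℝ}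
    {U : Set (E d)}

/-- The points at height between `s` and `t` above the part of the graph over a ball. -/
def slab (e : E d ≃ᵃⁱ[ℝ] E d) (φ : EuclideanSpace ℝ (Fin (d + 1)) → ℝ)
    (z : EuclideanSpace ℝ (Fin (d + 1))) (ρ s t : ℝ) : Set (E d) :=
  {p | horiz (e p) ∈ Metric.ball z ρ ∧ vert (e p) - φ (horiz (e p)) ∈ Ioo s t}

theorem continuous_horiz : Continuous (horiz : E d → _) := by
  unfold horiz; fun_prop

theorem continuous_vert : Continuous (vert : E d → ℝ) := by
  unfold vert; fun_prop

theorem measurableSet_slab (hφ : Continuous φ) (z : EuclideanSpace ℝ (Fin (d + 1))) (ρ s t : ℝ) :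
    MeasurableSet (slab e φ z ρ s t) := by
  have h1 := continuous_horiz (d := d)
  have h2 := continuous_vert (d := d)
  have h3 := e.continuous
  refine ((Metric.isOpen_ball.preimage (by fun_prop)).inter
    (isOpen_Ioo.preimage (f := fun p => vert (e p) - φ (horiz (e p))) (by fun_prop))).measurableSet

theorem indicator_slab (z : EuclideanSpace ℝ (Fin (d + 1))) (ρ s t : ℝ) (F : E d → ℝ≥0∞)
    (x : EuclideanSpace ℝ (Fin (d + 1))) (τ : ℝ) :
    (slab e φ z ρ s t).indicator F (graphMap e φ (x, τ)) =
      (Metric.ball z ρ).indicator (fun x => (Ioo s t).indicator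
        (fun τ => F (graphMap e φ (x, τ))) τ) x := by
  by_cases hx : x ∈ Metric.ball z ρ <;> by_cases hτ : τ ∈ Ioo s t
  · have : graphMap e φ (x, τ) ∈ slab e φ z ρ s t := by
      simpa [slab] using ⟨hx, hτ⟩
    rw [indicator_of_mem this, indicator_of_mem hx, indicator_of_mem hτ]
  all_goals
    have : graphMap e φ (x, τ) ∉ slab e φ z ρ s t := by
      simp only [slab, mem_ofPred_eq, horiz_graphMap, vert_graphMap, add_sub_cancel_left, hx, hτ]
      simp
    rw [indicator_of_notMem this]
    simp [hx, hτ]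

theorem lintegral_slab (hφ : LipschitzWith M φ) (z : EuclideanSpace ℝ (Fin (d + 1))) (ρ s t : ℝ)
    {F : E d → ℝ≥0∞} (hF : Measurable F) :
    ∫⁻ p in slab e φ z ρ s t, F p =
      ∫⁻ x in Metric.ball z ρ, ∫⁻ τ in Ioo s t, F (graphMap e φ (x, τ)) := by
  have hm := measurableSet_slab (e := e) hφ.continuous z ρ s t
  rw [← lintegral_indicator hm, ← lintegral_graphMap (e := e) hφ (hF.indicator hm),
    ← lintegral_indicator Metric.isOpen_ball.measurableSet]
  refine lintegral_congr fun x => ?_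
  simp_rw [indicator_slab]
  by_cases hx : x ∈ Metric.ball z ρ
  · simp only [indicator_of_mem hx]
    rw [lintegral_indicator measurableSet_Ioo]
  · simp [hx]

theorem volume_slab (hφ : LipschitzWith M φ) (z : EuclideanSpace ℝ (Fin (d + 1))) (ρ s t : ℝ) :
    volume (slab e φ z ρ s t) = volume (Metric.ball z ρ) * ENNReal.ofReal (t - s) := by
  have := lintegral_slab (e := e) hφ z ρ s t (F := fun _ => 1) measurable_const
  simp only [lintegral_one, Measure.restrict_apply_univ, Real.volume_Ioo, lintegral_const] at this
  rw [this, mul_comm]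

/-- A function that vanishes below the slab is controlled by its gradient. -/
theorem lintegral_slab_le (hφ : LipschitzWith M φ) {z : EuclideanSpace ℝ (Fin (d + 1))}
    {ρ s t : ℝ} (hs : 0 ≤ s) {H : Set (E d)} (hH : MeasurableSet H) {u : E d → ℝ}
    (hu : ContDiff ℝ 1 u) (hu0 : ∀ x ∈ Metric.ball z ρ, u (graphMap e φ (x, 0)) = 0)
    (hHs : ∀ x ∈ Metric.ball z ρ, ∀ τ ∈ Ioo 0 t, graphMap e φ (x, τ) ∈ H) :
    ∫⁻ p in slab e φ z ρ s t, ‖u p‖ₑ ≤ ENNReal.ofReal (t - s) * ∫⁻ p in H, ‖fderiv ℝ u p‖ₑ := by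
  have huc := hu.continuous
  have hdu : Continuous (fderiv ℝ u) := hu.continuous_fderiv one_ne_zero
  have hball : MeasurableSet (Metric.ball z ρ) := Metric.isOpen_ball.measurableSet
  have hFm : Measurable (H.indicator fun p => ‖fderiv ℝ u p‖ₑ) :=
    (by fun_prop : Measurable fun z => ‖fderiv ℝ u z‖ₑ).indicator hH
  rw [lintegral_slab hφ z ρ s t (by fun_prop : Measurable fun p => ‖u p‖ₑ),
    ← lintegral_indicator hH, ← lintegral_graphMap (e := e) hφ hFm]
  rw [← lintegral_const_mul' _ _ ENNReal.ofReal_ne_top]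
  refine le_trans (setLIntegral_mono' hball fun x hx => ?_) (setLIntegral_le_lintegral _ _)
  calc ∫⁻ τ in Ioo s t, ‖u (graphMap e φ (x, τ))‖ₑ
      ≤ ∫⁻ τ in Ioo s t, ∫⁻ σ, (H.indicator fun p => ‖fderiv ℝ u p‖ₑ) (graphMap e φ (x, σ)) := by
        refine setLIntegral_mono' measurableSet_Ioo fun τ hτ => ?_
        have hτ0 : 0 ≤ τ := hs.trans hτ.1.le
        have hline : ∀ σ : ℝ, graphMap e φ (x, σ) = graphMap e φ (x, 0) + σ • dir e (up d) :=
          fun σ => by rw [← graphMap_add, zero_add]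
        have h1 : ContDiff ℝ 1 fun σ : ℝ => u (graphMap e φ (x, 0) + σ • dir e (up d)) :=
          hu.comp (by fun_prop)
        have h2 := enorm_sub_le_lintegral_deriv_of_contDiffOn_Icc
          (f := fun σ : ℝ => u (graphMap e φ (x, 0) + σ • dir e (up d))) h1.contDiffOn hτ0
        simp only [zero_smul, add_zero, hu0 x hx, sub_zero, ← hline] at h2
        refine h2.trans ?_
        rw [setLIntegral_congr Ioo_ae_eq_Icc.symm, ← lintegral_indicator measurableSet_Ioo]
        refine lintegral_mono fun σ => ?_
        by_cases hσ : σ ∈ Ioo 0 τ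
        · rw [indicator_of_mem hσ, indicator_of_mem (hHs x hx σ ⟨hσ.1, hσ.2.trans hτ.2⟩)]
          have h3 : HasDerivAt (fun σ : ℝ => u (graphMap e φ (x, σ)))
              (fderiv ℝ u (graphMap e φ (x, σ)) (dir e (up d))) σ := by
            have h4 : HasDerivAt (fun σ : ℝ => graphMap e φ (x, σ)) (dir e (up d)) σ := by
              rw [funext hline]
              simpa using ((hasDerivAt_id σ).smul_const (dir e (up d))).const_add
                (graphMap e φ (x, 0))
            exact ((hu.differentiable one_ne_zero _).hasFDerivAt).comp_hasDerivAt σ h4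
          rw [h3.deriv]
          refine (ContinuousLinearMap.le_opENorm _ _).trans ?_
          rw [← ofReal_norm (dir e (up d)), norm_dir, norm_up, ENNReal.ofReal_one, mul_one]
        · rw [indicator_of_notMem hσ]; exact zero_le
    _ = _ := by rw [setLIntegral_const, Real.volume_Ioo, mul_comm]

/-- The slab lies at height hρ above the graph, with h = 4L² so large that a vector from any point
of Ω in the ball of radius Lρ to a point of the slab rises at least M times as much as it moves
sideways. Such a vector cannot cross the graph. The radius 8L²ρ accommodates all points involved. -/
theorem GraphChart.star_aux {y x₀ : E d} {ρ L h : ℝ} (hρ : 0 < ρ) (hL : L = M + 5)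
    (hh : h = 4 * L ^ 2) (hchart : GraphChart M Ω D e φ ψ (Metric.ball y (8 * L ^ 2 * ρ)))
    (hx₀ : x₀ ∈ frontier Ω) (hx₀y : dist x₀ y < L * ρ)
    {z : EuclideanSpace ℝ (Fin (d + 1))} (hz : dist z (horiz (e y)) ≤ (M + 3) * ρ) :
    (∀ x ∈ Metric.ball z ρ, ∀ τ, 0 ≤ τ → τ < (h + 1) * ρ →
      graphMap e φ (x, τ) ∈ Metric.ball y (8 * L ^ 2 * ρ)) ∧
    (∀ a ∈ Ω ∩ Metric.ball y (L * ρ), ∀ b ∈ slab e φ z ρ (h * ρ) ((h + 1) * ρ),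
      segment ℝ a b ⊆ Ω) ∧
    slab e φ z ρ (h * ρ) ((h + 1) * ρ) ⊆ Ω ∩ Metric.ball y (8 * L ^ 2 * ρ) := by
  have hM := M.coe_nonneg
  have hL5 : 5 ≤ L := by linarith
  have hLL : L * ρ ≤ 8 * L ^ 2 * ρ := by nlinarith [mul_pos (by linarith : 0 < L) hρ]
  have hx₀U : x₀ ∈ Metric.ball y (8 * L ^ 2 * ρ) := hx₀y.trans_le hLL
  have hVx₀ := (hchart.frontier_iff x₀ hx₀U).1 hx₀
  have hdx : dist (e x₀) (e y) < L * ρ := by rwa [e.dist_map]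
  have hHx := dist_horiz_le (e x₀) (e y)
  have hVx := abs_vert_sub_le (e x₀) (e y)
  have hφx : ∀ x ∈ Metric.ball z ρ, |φ x - vert (e x₀)| ≤ M * (2 * L * ρ) := by
    intro x hx
    rw [hVx₀]
    refine (lipschitz_sub_le hchart.lipφ _ _).trans (mul_le_mul_of_nonneg_left ?_ hM)
    have h1 : dist x z < ρ := hx
    have h2 := dist_triangle4 x z (horiz (e y)) (horiz (e x₀))
    rw [dist_comm (horiz (e y)) (horiz (e x₀))] at h2
    nlinarith
  have hball : ∀ x ∈ Metric.ball z ρ, ∀ τ, 0 ≤ τ → τ < (h + 1) * ρ →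
      graphMap e φ (x, τ) ∈ Metric.ball y (8 * L ^ 2 * ρ) := by
    intro x hx τ hτ0 hτ
    rw [Metric.mem_ball, ← e.dist_map]
    refine (dist_le_horiz_add_vert _ _).trans_lt ?_
    rw [horiz_graphMap, vert_graphMap]
    have h1 : dist x z < ρ := hx
    have h2 := dist_triangle x z (horiz (e y))
    have h3 := hφx x hx
    rw [abs_le] at h3 hVx
    have h4 : |φ x + τ - vert (e y)| < M * (2 * L * ρ) + L * ρ + (h + 1) * ρ := by
      rw [abs_lt]; constructor <;> linarith
    have h5 : (M : ℝ) = L - 5 := by linarith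
    have h6 : (M + 3) * ρ + ρ + M * (2 * L * ρ) + L * ρ + (h + 1) * ρ ≤ 8 * L ^ 2 * ρ := by
      have h7 : 0 ≤ (8 * L ^ 2 - ((M + 3) + 1 + M * (2 * L) + L + (h + 1))) := by
        rw [h5, hh]; nlinarith
      nlinarith
    linarith
  refine ⟨hball, ?_, ?_⟩
  · rintro a ⟨haΩ, ha⟩ b ⟨hb1, hb2⟩
    have hab : a ∈ Metric.ball y (8 * L ^ 2 * ρ) := lt_of_lt_of_le ha hLL
    have hbeq := graphMap_eq e φ b
    have hbb : b ∈ Metric.ball y (8 * L ^ 2 * ρ) := by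
      rw [← hbeq]
      exact hball _ hb1 _ (by have := hb2.1; nlinarith [sq_nonneg L]) hb2.2
    have hVa := (hchart.mem_iff a hab).1 haΩ
    have hda : dist (e a) (e y) < L * ρ := by rw [e.dist_map]; exact ha
    have hHa := dist_horiz_le (e a) (e y)
    have hVay := abs_vert_sub_le (e a) (e y)
    -- Sideways the vector moves by at most 2Lρ. The values of φ over the slab differ from the
    -- height of x₀ by at most 2MLρ, and a is at most 2Lρ higher than x₀, so the rise is at least (h
    -- - 2ML - 2L)ρ.
    have hslope : (M : ℝ) * ‖horiz (e b - e a)‖ ≤ vert (e b - e a) := by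
      rw [horiz_sub, vert_sub, ← dist_eq_norm]
      have h1 : dist (horiz (e b)) z < ρ := hb1
      have h2 := dist_triangle4 (horiz (e b)) z (horiz (e y)) (horiz (e a))
      rw [dist_comm (horiz (e y)) (horiz (e a))] at h2
      have h3 : dist (horiz (e b)) (horiz (e a)) ≤ 2 * L * ρ := by nlinarith
      have h4 := hφx _ hb1
      rw [abs_le] at h4 hVx hVay
      have h5 := hb2.1
      have h6 : (M : ℝ) * dist (horiz (e b)) (horiz (e a)) ≤ M * (2 * L * ρ) :=
        mul_le_mul_of_nonneg_left h3 hM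
      have h5' : (M : ℝ) = L - 5 := by linarith
      have h7 : M * (2 * L * ρ) ≤ h * ρ - M * (2 * L * ρ) - 2 * L * ρ := by
        have : 0 ≤ h - M * (2 * L) - 2 * L - M * (2 * L) := by rw [h5', hh]; nlinarith
        nlinarith
      linarith
    intro p hp
    have hpU := (convex_ball y _).segment_subset hab hbb hp
    rw [segment_eq_image'] at hp
    obtain ⟨s, ⟨hs0, hs1⟩, rfl⟩ := hp
    rw [hchart.mem_iff _ hpU]
    have hdir : s • (b - a) = dir e (s • (e b - e a)) := by
      have h1 : e b - e a = e.linearIsometryEquiv (b - a) := by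
        have := apply_add e a (b - a)
        rw [add_sub_cancel] at this
        rw [this]; exact add_sub_cancel_left _ _
      rw [h1, dir_smul]; simp [dir]
    simp only [hdir]
    refine epigraph_add hchart.lipφ hVa ?_
    rw [horiz_smul, vert_smul, norm_smul, Real.norm_of_nonneg hs0]
    nlinarith
  · rintro b ⟨hb1, hb2⟩
    have hbb : b ∈ Metric.ball y (8 * L ^ 2 * ρ) := by
      rw [← graphMap_eq e φ b]
      exact hball _ hb1 _ (by have := hb2.1; nlinarith [sq_nonneg L]) hb2.2
    refine ⟨(hchart.mem_iff b hbb).2 ?_, hbb⟩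
    have := hb2.1
    nlinarith [sq_nonneg L]

/-- From a point of D move by (1+M)ρ in the y₁-direction. Within distance ρ of the new base point y₁
loses at most ρ and ψ gains at most Mρ, so the strict inequality y₁ > ψ(y'') survives and the whole
patch of the graph belongs to D. -/
theorem GraphChart.graphMap_mem_D {p : E d} {ρ : ℝ}
    (hchart : GraphChart M Ω D e φ ψ U) (hpU : p ∈ U) (hp : p ∈ D)
    {x : EuclideanSpace ℝ (Fin (d + 1))}
    (hx : x ∈ Metric.ball (horiz (e p) + ((1 + M) * ρ) • EuclideanSpace.single 0 (1 : ℝ)) ρ)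
    (hxU : graphMap e φ (x, 0) ∈ U) : graphMap e φ (x, 0) ∈ D := by
  rw [hchart.mem_D_iff _ hxU]
  have h1 := ((hchart.mem_D_iff p hpU).1 hp).1
  simp only [mid_eq_tail, fst_eq_horiz, horiz_graphMap, vert_graphMap, add_zero, and_true] at h1 ⊢
  set z := horiz (e p) + ((1 + M) * ρ) • EuclideanSpace.single 0 (1 : ℝ) with hz
  have h2 : dist x z < ρ := hx
  have h3 := abs_coord_sub_le x z 0
  have h4 : z 0 = horiz (e p) 0 + (1 + M) * ρ := by simp [hz]
  have h5 : tail z = tail (horiz (e p)) := by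
    ext i; simp [tail, hz]
  have h6 := dist_tail_le x z
  have h7 := lipschitz_sub_le hchart.lipψ (tail x) (tail z)
  rw [h5] at h6 h7
  rw [abs_le] at h3 h7
  have hM := M.coe_nonneg
  have h8 : (M : ℝ) * dist (tail x) (tail (horiz (e p))) ≤ M * ρ :=
    mul_le_mul_of_nonneg_left (h6.trans h2.le) hM
  rw [h4] at h3
  linarith

theorem GraphChart.localGeometry {y x₀ : E d} {ρ L : ℝ} (hρ : 0 < ρ) (hL : L = M + 5)
    (hchart : GraphChart M Ω D e φ ψ (Metric.ball y (8 * L ^ 2 * ρ)))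
    (hx₀ : x₀ ∈ frontier Ω) (hx₀y : dist x₀ y < L * ρ) (hΩ : MeasurableSet Ω)
    {Λ : ℝ} (hΛ : 8 * L ^ 2 ≤ Λ) (hchart' : GraphChart M Ω D e φ ψ (Metric.ball y (Λ * ρ)))
    (hc : ∀ z : EuclideanSpace ℝ (Fin (d + 1)), volume (Metric.ball y ρ) ≤
      ENNReal.ofReal Λ * (volume (Metric.ball z ρ) * ENNReal.ofReal ρ)) :
    LocalGeometry M Λ Ω D y ρ := by
  have hM := M.coe_nonneg
  have hL5 : 5 ≤ L := by linarith
  have hball : Metric.ball y (8 * L ^ 2 * ρ) ⊆ Metric.ball y (Λ * ρ) :=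
    Metric.ball_subset_ball (by nlinarith)
  refine ⟨⟨dir e (up d), by rw [norm_dir, norm_up], ?_⟩, ?_, Or.inr ⟨e, φ, ψ, hchart'⟩⟩
  -- A vector within τ of (M+2)τ times the upward unit vector has horizontal part below τ and
  -- vertical part above (M+1)τ, hence belongs to the cone of the epigraph.
  · rintro a ⟨haΩ, ha⟩ τ hτ hτρ q hq s ⟨hs0, hs1⟩
    have hdist : dist q (((M + 2) * τ) • dir e (up d)) < τ := hq
    obtain ⟨v, rfl⟩ : ∃ v, q = dir e v := ⟨e.linearIsometryEquiv q, by simp [dir]⟩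
    have h2 : ‖v - ((M + 2) * τ) • up d‖ < τ := by
      have h1 : dir e (v - ((M + 2) * τ) • up d) = dir e v - dir e (((M + 2) * τ) • up d) :=
        e.linearIsometryEquiv.symm.map_sub _ _
      rwa [← norm_dir e, h1, dir_smul, ← dist_eq_norm]
    have h3 := (norm_horiz_le _).trans_lt h2
    have h4 := (abs_vert_le _).trans_lt h2
    rw [horiz_sub, horiz_smul, horiz_up, smul_zero, sub_zero] at h3
    rw [vert_sub, vert_smul, vert_up, mul_one, abs_lt] at h4
    have h5 : ‖s • dir e v‖ ≤ (M + 3) * τ := by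
      have h6 : ‖v‖ ≤ ‖v - ((M + 2) * τ) • up d‖ + ‖((M + 2) * τ) • up d‖ := by
        have := norm_add_le (v - ((M + 2) * τ) • up d) (((M + 2) * τ) • up d)
        rwa [sub_add_cancel] at this
      rw [norm_smul ((M + 2) * τ), norm_up, mul_one, Real.norm_of_nonneg (by positivity)] at h6
      rw [norm_smul, norm_dir, Real.norm_of_nonneg hs0]
      nlinarith [norm_nonneg v]
    have hmemball : ∀ q : E d, ‖q‖ ≤ (M + 3) * τ → a + q ∈ Metric.ball y (8 * L ^ 2 * ρ) := by
      intro q hq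
      rw [Metric.mem_ball] at ha ⊢
      have h7 : dist (a + q) y ≤ dist a y + ‖q‖ := by
        rw [dist_eq_norm, dist_eq_norm, show a + q - y = (a - y) + q by abel]
        exact norm_add_le _ _
      have h8 : (M + 3) * τ ≤ (M + 3) * ρ := by gcongr
      have h9 : L * ρ ≤ 8 * L ^ 2 * ρ := by nlinarith [mul_pos (by linarith : 0 < L) hρ]
      nlinarith
    have haU : a ∈ Metric.ball y (8 * L ^ 2 * ρ) := by
      have := hmemball 0 (by rw [norm_zero]; positivity)
      rwa [add_zero] at this
    rw [hchart.mem_iff _ (hmemball _ h5), ← dir_smul]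
    refine epigraph_add hchart.lipφ ((hchart.mem_iff a haU).1 haΩ) ?_
    rw [horiz_smul, vert_smul, norm_smul, Real.norm_of_nonneg hs0]
    have : (M : ℝ) * ‖horiz v‖ ≤ vert v := by nlinarith
    nlinarith
  -- The slab may be centred over any base point within (M+3)ρ of that of y. This freedom is used to
  -- place it above D if D meets the ball of radius 2ρ: that costs 2ρ to reach D and (1+M)ρ for the
  -- shift into D.
  · have key : ∀ z : EuclideanSpace ℝ (Fin (d + 1)), dist z (horiz (e y)) ≤ (M + 3) * ρ →
        (D ∩ Metric.ball y (2 * ρ) = ∅ ∨ ∀ x ∈ Metric.ball z ρ,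
          graphMap e φ (x, 0) ∈ Metric.ball y (8 * L ^ 2 * ρ) → graphMap e φ (x, 0) ∈ D) →
        ∃ S ⊆ Ω ∩ Metric.ball y (Λ * ρ), MeasurableSet S ∧
          volume (Metric.ball y ρ) ≤ ENNReal.ofReal Λ * volume S ∧
          (∀ a ∈ Ω ∩ Metric.ball y ((M + 5) * ρ), ∀ b ∈ S, segment ℝ a b ⊆ Ω) ∧
          (D ∩ Metric.ball y (2 * ρ) = ∅ ∨ ∀ u : E d → ℝ, ContDiff ℝ 1 u → (∀ z ∈ D, u z = 0) →
            ∫⁻ z in S, ‖u z‖ₑ ≤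
              ENNReal.ofReal ρ * ∫⁻ z in Ω ∩ Metric.ball y (Λ * ρ), ‖fderiv ℝ u z‖ₑ) := by
      intro z hz hzD
      obtain ⟨h1, h2, h3⟩ := hchart.star_aux hρ hL rfl hx₀ hx₀y hz
      refine ⟨_, h3.trans (inter_subset_inter_right _ hball),
        measurableSet_slab hchart.lipφ.continuous _ _ _ _, ?_, hL ▸ h2, hzD.imp_right ?_⟩
      · rw [volume_slab hchart.lipφ]
        convert hc z using 4
        ring
      · intro hD u hu hu0
        have := lintegral_slab_le (e := e) hchart.lipφ (z := z) (ρ := ρ) (s := 4 * L ^ 2 * ρ)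
          (t := (4 * L ^ 2 + 1) * ρ) (by positivity)
          (hΩ.inter Metric.isOpen_ball.measurableSet) hu
          (fun x hx => hu0 _ (hD x hx (h1 x hx 0 le_rfl (by positivity))))
          (fun x hx τ hτ => ⟨?_, hball (h1 x hx τ hτ.1.le hτ.2)⟩)
        · convert this using 3
          ring
        · rw [hchart.mem_iff _ (h1 x hx τ hτ.1.le hτ.2), horiz_graphMap, vert_graphMap]
          linarith [hτ.1]
    by_cases hDy : D ∩ Metric.ball y (2 * ρ) = ∅
    · exact key (horiz (e y)) (by rw [dist_self]; positivity) (Or.inl hDy)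
    · obtain ⟨p, hpD, hp⟩ := nonempty_iff_ne_empty.2 hDy
      have hpU : p ∈ Metric.ball y (8 * L ^ 2 * ρ) := by
        exact Metric.ball_subset_ball
          (mul_le_mul_of_nonneg_right (by nlinarith : 2 ≤ 8 * L ^ 2) hρ.le) hp
      refine key (horiz (e p) + ((1 + M) * ρ) • EuclideanSpace.single 0 (1 : ℝ)) ?_
        (Or.inr fun x hx hxU => hchart.graphMap_mem_D hpU hpD hx hxU)
      have h1 : dist (horiz (e p)) (horiz (e y)) ≤ 2 * ρ := by
        refine (dist_horiz_le _ _).trans ?_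
        rw [e.dist_map]; exact le_of_lt hp
      have h2 : dist (horiz (e p) + ((1 + M) * ρ) • EuclideanSpace.single 0 (1 : ℝ))
          (horiz (e p)) = (1 + M) * ρ := by
        rw [dist_eq_norm, add_sub_cancel_left, norm_smul, Real.norm_of_nonneg (by positivity)]
        simp
      have h3 := dist_triangle (horiz (e p) + ((1 + M) * ρ) • EuclideanSpace.single 0 (1 : ℝ))
          (horiz (e p)) (horiz (e y))
      nlinarith

end Chart

theorem exists_localGeometry (d : ℕ) (M : ℝ≥0) : ∃ Λ : ℝ, 8 * ((M : ℝ) + 5) ^ 2 ≤ Λ ∧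
    ∀ {Ω D : Set (E d)} {r₀ : ℝ}, IsMixedLipschitzDomain M Ω D r₀ → ∀ {y : E d}, y ∈ Ω →
    ∀ {ρ : ℝ}, 0 < ρ → Λ * ρ ≤ r₀ → LocalGeometry M Λ Ω D y ρ := by
  -- The ratio of the volumes of the unit balls in dimensions n and n - 1. It compares the ball of
  -- radius ρ with the slab, whose volume is ρ times that of an (n-1)-dimensional ball of radius ρ.
  set c : ℝ≥0∞ := volume (Metric.ball (0 : E d) 1) /
    volume (Metric.ball (0 : EuclideanSpace ℝ (Fin (d + 1))) 1) with hc
  have hω0 : volume (Metric.ball (0 : EuclideanSpace ℝ (Fin (d + 1))) 1) ≠ 0 :=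
    (Metric.measure_ball_pos _ _ one_pos).ne'
  have hωt : volume (Metric.ball (0 : EuclideanSpace ℝ (Fin (d + 1))) 1) ≠ ∞ :=
    measure_ball_lt_top.ne
  have hct : c ≠ ∞ := ENNReal.div_ne_top measure_ball_lt_top.ne hω0
  refine ⟨max (8 * ((M : ℝ) + 5) ^ 2) c.toReal, le_max_left _ _, ?_⟩
  intro Ω D r₀ h y hy ρ hρ hr₀
  set Λ := max (8 * ((M : ℝ) + 5) ^ 2) c.toReal with hΛ
  have hM := M.coe_nonneg
  have hΛ8 : 8 * ((M : ℝ) + 5) ^ 2 ≤ Λ := le_max_left _ _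
  by_cases hf : frontier Ω ∩ Metric.ball y ((M + 5) * ρ) = ∅
  · refine localGeometry_interior (by nlinarith) ?_ hy hρ hf
    obtain ⟨V, -, rfl⟩ := h.relOpen
    exact inter_subset_right
  · obtain ⟨x₀, hx₀, hx₀y⟩ := nonempty_iff_ne_empty.2 hf
    obtain ⟨e, φ, ψ, hchart⟩ := h.exists_graphChart hx₀
    have hsub : Metric.ball y (Λ * ρ) ⊆ Metric.ball x₀ (99 * r₀) := by
      refine Metric.ball_subset_ball' ?_
      rw [dist_comm]
      have h1 : dist x₀ y < (M + 5) * ρ := hx₀y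
      have h2 : (M + 5) * ρ ≤ Λ * ρ := mul_le_mul_of_nonneg_right (by nlinarith) hρ.le
      have h3 : 0 ≤ (M + 5) * ρ := by positivity
      linarith
    have hchart' := hchart.mono hsub
    refine GraphChart.localGeometry hρ rfl
      (hchart'.mono (Metric.ball_subset_ball (by nlinarith))) hx₀ hx₀y h.isOpen.measurableSet
      hΛ8 hchart' fun z => ?_
    rw [Measure.addHaar_ball_of_pos _ _ hρ, Measure.addHaar_ball_of_pos _ z hρ]
    have h1 : volume (Metric.ball (0 : E d) 1) =
        c * volume (Metric.ball (0 : EuclideanSpace ℝ (Fin (d + 1))) 1) :=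
      (ENNReal.div_mul_cancel hω0 hωt).symm
    have h2 : c ≤ ENNReal.ofReal Λ := by
      rw [← ENNReal.ofReal_toReal hct]
      exact ENNReal.ofReal_le_ofReal (le_max_right _ _)
    have h3 : ENNReal.ofReal (ρ ^ Module.finrank ℝ (E d)) =
        ENNReal.ofReal (ρ ^ Module.finrank ℝ (EuclideanSpace ℝ (Fin (d + 1)))) *
          ENNReal.ofReal ρ := by
      rw [← ENNReal.ofReal_mul (by positivity)]
      simp [pow_succ]
    rw [h1, h3]
    calc _ = c * (ENNReal.ofReal (ρ ^ Module.finrank ℝ (EuclideanSpace ℝ (Fin (d + 1)))) *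
          volume (Metric.ball (0 : EuclideanSpace ℝ (Fin (d + 1))) 1) * ENNReal.ofReal ρ) := by ring
      _ ≤ _ := by gcongr

/-! ### Poincaré inequalities on the domain. -/

theorem volume_ball_eq (y : E d) {r : ℝ} (hr : 0 < r) :
    volume (Metric.ball y r) = ENNReal.ofReal r ^ (d + 2) * volume (Metric.ball (0 : E d) 1) := by
  rw [Measure.addHaar_ball_of_pos _ _ hr, ENNReal.ofReal_pow hr.le]
  simp

theorem volume_closedBall_eq (y : E d) {r : ℝ} (hr : 0 < r) :
    volume (Metric.closedBall y r) =
      ENNReal.ofReal r ^ (d + 2) * volume (Metric.ball (0 : E d) 1) := by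
  rw [Measure.addHaar_closedBall_eq_addHaar_ball, volume_ball_eq y hr]

/-- The Poincaré inequality in `L¹`, for functions that vanish on `D` (with the constant zero if
`D` is close). -/
theorem LocalGeometry.poincare_one {M : ℝ≥0} {Λ : ℝ} {Ω D : Set (E d)} {y : E d} {ρ : ℝ}
    (h : LocalGeometry M Λ Ω D y ρ) (hρ : 0 < ρ) (hΛ : (M : ℝ) + 5 ≤ Λ) (hΩ : MeasurableSet Ω)
    {u : E d → ℝ} (hu : ContDiff ℝ 1 u) (hu0 : ∀ z ∈ D, u z = 0) :
    ∃ c : ℝ, (c = 0 ∨ D ∩ Metric.ball y (2 * ρ) = ∅) ∧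
      ∫⁻ a in Ω ∩ Metric.ball y ((M + 5) * ρ), ‖u a - c‖ₑ ≤
        ENNReal.ofReal (Λ * ((2 * Λ) ^ (d + 3) + Λ ^ (d + 2))) * (ENNReal.ofReal ρ *
          ∫⁻ z in Ω ∩ Metric.ball y (Λ * ρ), ‖fderiv ℝ u z‖ₑ) := by
  obtain ⟨S, hS, hSm, hSv, hseg, hD⟩ := h.star
  have hM := M.coe_nonneg
  have hΛ0 : 0 < Λ := by linarith
  set L : ℝ := M + 5 with hL
  set T := Ω ∩ Metric.ball y (L * ρ) with hT
  set H := Ω ∩ Metric.ball y (Λ * ρ) with hH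
  set I := ∫⁻ z in H, ‖fderiv ℝ u z‖ₑ with hI
  set ω := volume (Metric.ball (0 : E d) 1) with hω
  set a := ENNReal.ofReal ρ with ha
  have ha0 : a ≠ 0 := by simpa [ha] using hρ
  have hat : a ≠ ∞ := ENNReal.ofReal_ne_top
  have hω0 : ω ≠ 0 := (Metric.measure_ball_pos _ _ one_pos).ne'
  have hωt : ω ≠ ∞ := measure_ball_lt_top.ne
  have hball : ∀ r : ℝ, MeasurableSet (Metric.ball y r) := fun r => Metric.isOpen_ball.measurableSet
  have hTm : MeasurableSet T := hΩ.inter (hball _)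
  have hHm : MeasurableSet H := hΩ.inter (hball _)
  have hLΛ : L * ρ ≤ Λ * ρ := by gcongr
  have hTH : T ⊆ H := inter_subset_inter_right _ (Metric.ball_subset_ball hLΛ)
  have huc := hu.continuous
  have hS0 : volume S ≠ 0 := by
    intro h0
    rw [h0, mul_zero, volume_ball_eq y hρ] at hSv
    exact mul_ne_zero (pow_ne_zero _ ha0) hω0 (le_antisymm hSv zero_le)
  have hSt : volume S ≠ ∞ :=
    ((measure_mono (hS.trans inter_subset_right)).trans_lt measure_ball_lt_top).ne
  have hST : ∫⁻ z in S, (∫⁻ a in T, ‖u a - u z‖ₑ) ≤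
      a ^ (d + 2) * ω * (ENNReal.ofReal ((2 * Λ) ^ (d + 3)) * (a * I)) := by
    have h1 := lintegral_lintegral_enorm_sub_le (μ := volume) hu hTm hSm hHm (ℓ := 2 * Λ * ρ)
      (fun p hp z hz => ?_) (fun p hp z hz => subset_inter (hseg p hp z hz)
        ((convex_ball y _).segment_subset (hTH hp).2 (hS hz).2))
    · refine h1.trans (le_of_eq ?_)
      rw [volume_closedBall_eq 0 (by positivity), ENNReal.ofReal_mul (by positivity : 0 ≤ 2 * Λ),
        ENNReal.ofReal_pow (by positivity)]
      ring
    · have h2 : dist p y < Λ * ρ := (hTH hp).2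
      have h3 : dist z y < Λ * ρ := (hS hz).2
      have h4 := dist_triangle_right z p y
      linarith
  -- it suffices to bound the product with the measure of `S`
  suffices ∃ c : ℝ, (c = 0 ∨ D ∩ Metric.ball y (2 * ρ) = ∅) ∧
      volume S * ∫⁻ p in T, ‖u p - c‖ₑ ≤
        a ^ (d + 2) * ω * (ENNReal.ofReal ((2 * Λ) ^ (d + 3) + Λ ^ (d + 2)) * (a * I)) by
    obtain ⟨c, hc, hle⟩ := this
    refine ⟨c, hc, ?_⟩
    have h1 : a ^ (d + 2) * ω * ∫⁻ p in T, ‖u p - c‖ₑ ≤ a ^ (d + 2) * ω *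
        (ENNReal.ofReal (Λ * ((2 * Λ) ^ (d + 3) + Λ ^ (d + 2))) * (a * I)) := by
      calc a ^ (d + 2) * ω * ∫⁻ p in T, ‖u p - c‖ₑ
          ≤ ENNReal.ofReal Λ * volume S * ∫⁻ p in T, ‖u p - c‖ₑ := by
            rw [← volume_ball_eq y hρ]; gcongr
        _ = ENNReal.ofReal Λ * (volume S * ∫⁻ p in T, ‖u p - c‖ₑ) := by ring
        _ ≤ ENNReal.ofReal Λ * (a ^ (d + 2) * ω *
            (ENNReal.ofReal ((2 * Λ) ^ (d + 3) + Λ ^ (d + 2)) * (a * I))) := by gcongr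
        _ = _ := by rw [ENNReal.ofReal_mul hΛ0.le]; ring
    refine (ENNReal.mul_le_mul_iff_right (mul_ne_zero (pow_ne_zero _ ha0) hω0)
      (ENNReal.mul_ne_top (ENNReal.pow_ne_top hat) hωt)).1 h1
  -- If D is far, c is the value of u at a point of S where the integral of |u - u(z)| does not
  -- exceed its mean over S.
  rcases hD with hD | hD
  · obtain ⟨z, -, hz⟩ := exists_le_setLAverage hS0 hSt
      (f := fun z => ∫⁻ a in T, ‖u a - u z‖ₑ)
      (Measurable.aemeasurable (Measurable.lintegral_prod_right'
        (f := fun p : E d × E d => ‖u p.2 - u p.1‖ₑ) (by fun_prop)))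
    refine ⟨u z, Or.inr hD, ?_⟩
    rw [setLAverage_eq] at hz
    rw [mul_comm]
    refine ((ENNReal.le_div_iff_mul_le (Or.inl hS0) (Or.inl hSt)).1 hz).trans (hST.trans ?_)
    gcongr
    have : 0 ≤ Λ ^ (d + 2) := by positivity
    linarith
  -- If D is close, the values of u on S are themselves controlled by the gradient, so no constant
  -- has to be subtracted.
  · refine ⟨0, Or.inl rfl, ?_⟩
    have hDu := hD u hu hu0
    calc volume S * ∫⁻ p in T, ‖u p - 0‖ₑ = ∫⁻ z in S, (∫⁻ p in T, ‖u p‖ₑ) := by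
          simp [mul_comm]
      _ ≤ ∫⁻ z in S, ((∫⁻ p in T, ‖u p - u z‖ₑ) + volume T * ‖u z‖ₑ) := by
          refine lintegral_mono fun z => ?_
          calc ∫⁻ p in T, ‖u p‖ₑ ≤ ∫⁻ p in T, (‖u p - u z‖ₑ + ‖u z‖ₑ) :=
                lintegral_mono fun p => by
                  have := enorm_add_le (u p - u z) (u z)
                  rwa [sub_add_cancel] at this
            _ = _ := by
                rw [lintegral_add_right _ measurable_const, setLIntegral_const, mul_comm]
      _ = (∫⁻ z in S, (∫⁻ p in T, ‖u p - u z‖ₑ)) + volume T * ∫⁻ z in S, ‖u z‖ₑ := by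
          rw [lintegral_add_right _ (by fun_prop), lintegral_const_mul _ (by fun_prop)]
      _ ≤ a ^ (d + 2) * ω * (ENNReal.ofReal ((2 * Λ) ^ (d + 3)) * (a * I)) +
          (ENNReal.ofReal (Λ * ρ) ^ (d + 2) * ω) * (a * I) := by
          gcongr
          rw [← volume_ball_eq y (by positivity)]
          exact measure_mono (hTH.trans inter_subset_right)
      _ = _ := by
          rw [ENNReal.ofReal_add (by positivity) (by positivity), ENNReal.ofReal_mul hΛ0.le,
            ENNReal.ofReal_pow hΛ0.le (d + 2)]
          ring

/-- The `L²` norm of `u - c` is controlled by a small multiple of the `L²` norm of the gradient and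
the `L¹` norm of the gradient. -/
theorem exists_poincare_const (d : ℕ) (M : ℝ≥0) {Λ ε : ℝ} (hΛ : (M : ℝ) + 5 ≤ Λ) (hε : 0 < ε)
    (hε1 : ε ≤ 1) : ∃ K : ℝ≥0∞, K ≠ ∞ ∧ ∀ {Ω D : Set (E d)} {y : E d} {ρ : ℝ},
    LocalGeometry M Λ Ω D y ρ → 0 < ρ → MeasurableSet Ω →
    ∀ {u : E d → ℝ}, ContDiff ℝ 1 u → (∀ z ∈ D, u z = 0) →
    ∃ c : ℝ, (c = 0 ∨ D ∩ Metric.ball y (2 * ρ) = ∅) ∧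
      ENNReal.ofReal ρ ^ (d + 2) * ∫⁻ a in Ω ∩ Metric.ball y (2 * ρ), ‖u a - c‖ₑ ^ 2 ≤
        ENNReal.ofReal ρ ^ 2 * (ENNReal.ofReal (2 * (M + 3) ^ 2 * ε ^ 2) *
          (ENNReal.ofReal ρ ^ (d + 2) * ∫⁻ z in Ω ∩ Metric.ball y (Λ * ρ), ‖fderiv ℝ u z‖ₑ ^ 2) +
          K * (∫⁻ z in Ω ∩ Metric.ball y (Λ * ρ), ‖fderiv ℝ u z‖ₑ) ^ 2) := by
  set ω := volume (Metric.ball (0 : E d) 1) with hω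
  have hω0 : ω ≠ 0 := (Metric.measure_ball_pos _ _ one_pos).ne'
  have hωt : ω ≠ ∞ := measure_ball_lt_top.ne
  set K₁ := ENNReal.ofReal (Λ * ((2 * Λ) ^ (d + 3) + Λ ^ (d + 2))) with hK₁
  set b := ENNReal.ofReal ε with hb
  have hb0 : b ≠ 0 := by simpa [hb] using hε
  refine ⟨2 * (2 ^ (d + 2) * ω * ((b ^ (d + 2) * ω)⁻¹ * K₁) ^ 2), ?_, ?_⟩
  · have h1 : (b ^ (d + 2) * ω)⁻¹ ≠ ∞ :=
      ENNReal.inv_ne_top.2 (mul_ne_zero (pow_ne_zero _ hb0) hω0)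
    finiteness
  intro Ω D y ρ h hρ hΩ u hu hu0
  obtain ⟨c, hc, hle⟩ := h.poincare_one hρ hΛ hΩ hu hu0
  refine ⟨c, hc, ?_⟩
  obtain ⟨ν, hν, hcone⟩ := h.cone
  have hM := M.coe_nonneg
  set a := ENNReal.ofReal ρ with ha
  have ha0 : a ≠ 0 := by simpa [ha] using hρ
  have hat : a ≠ ∞ := ENNReal.ofReal_ne_top
  have hball : ∀ r : ℝ, MeasurableSet (Metric.ball y r) := fun r => Metric.isOpen_ball.measurableSet
  set I := ∫⁻ z in Ω ∩ Metric.ball y (Λ * ρ), ‖fderiv ℝ u z‖ₑ with hI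
  -- Translations run over a ball of radius ερ inside the cone, so they have length at most (M+3)ερ.
  -- This puts ε² in front of the energy; the L¹ term pays with a negative power of ε.
  set τ := ε * ρ with hτ
  have hτ0 : 0 < τ := by positivity
  have hτρ : τ ≤ ρ := by rw [hτ]; nlinarith
  set Q := Metric.ball (((M + 2) * τ) • ν) τ with hQ
  have hQv : volume Q = b ^ (d + 2) * a ^ (d + 2) * ω := by
    rw [hQ, volume_ball_eq _ hτ0, hτ, ENNReal.ofReal_mul hε.le]; ring
  have hqn : ∀ q ∈ Q, ‖q‖ ≤ (M + 3) * τ := by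
    intro q hq
    have h3 : ‖((M + 2) * τ) • ν‖ = (M + 2) * τ := by
      rw [norm_smul, hν, mul_one, Real.norm_of_nonneg (by positivity)]
    have h2 : ‖q - ((M + 2) * τ) • ν‖ < τ := by rw [← dist_eq_norm]; exact hq
    have h5 := norm_add_le (q - ((M + 2) * τ) • ν) (((M + 2) * τ) • ν)
    rw [sub_add_cancel] at h5
    linarith
  have hseg : ∀ p ∈ Ω ∩ Metric.ball y (2 * ρ), ∀ q ∈ Q, ∀ s ∈ Icc (0 : ℝ) 1,
      p + s • q ∈ Ω ∩ Metric.ball y ((M + 5) * ρ) := by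
    intro p hp q hq s hs
    refine ⟨hcone p hp τ hτ0 hτρ q hq s hs, ?_⟩
    have h1 : dist p y < 2 * ρ := hp.2
    have h2 := hqn q hq
    have h3 : ‖s • q‖ ≤ ‖q‖ := by
      rw [norm_smul, Real.norm_of_nonneg hs.1]
      nlinarith [norm_nonneg q, hs.2]
    rw [Metric.mem_ball, dist_eq_norm]
    have h4 : ‖p + s • q - y‖ ≤ dist p y + ‖s • q‖ := by
      rw [dist_eq_norm, show p + s • q - y = (p - y) + s • q by abel]; exact norm_add_le _ _
    nlinarith
  have hsub : Metric.ball y ((M + 5) * ρ) ⊆ Metric.ball y (Λ * ρ) :=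
    Metric.ball_subset_ball (by gcongr)
  have h1 := lintegral_enorm_sub_sq_le (μ := volume) hu (hΩ.inter (hball (2 * ρ)))
    (hΩ.inter (hball ((M + 5) * ρ))) (hΩ.inter (hball (Λ * ρ))) (Q := Q)
    Metric.isOpen_ball.measurableSet (by
      rw [hQv]; exact mul_ne_zero (mul_ne_zero (pow_ne_zero _ hb0) (pow_ne_zero _ ha0)) hω0)
    measure_ball_lt_top.ne hqn
    (fun p hp q hq => by simpa using hseg p hp q hq 1 ⟨zero_le_one, le_rfl⟩)
    (fun p hp q hq s hs => inter_subset_inter_right _ hsub (hseg p hp q hq s hs)) c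
  calc a ^ (d + 2) * ∫⁻ p in Ω ∩ Metric.ball y (2 * ρ), ‖u p - c‖ₑ ^ 2
      ≤ a ^ (d + 2) * (2 * (ENNReal.ofReal ((M + 3) * τ) ^ 2 *
          ∫⁻ z in Ω ∩ Metric.ball y (Λ * ρ), ‖fderiv ℝ u z‖ₑ ^ 2) +
          2 * (((2 * a) ^ (d + 2) * ω) *
            ((b ^ (d + 2) * a ^ (d + 2) * ω)⁻¹ * (K₁ * (a * I))) ^ 2)) := by
        refine mul_le_mul_right (h1.trans ?_) _
        rw [hQv]
        gcongr
        have : (2 * a) = ENNReal.ofReal (2 * ρ) := by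
          rw [ENNReal.ofReal_mul zero_le_two]; simp [ha]
        rw [this, ← volume_ball_eq y (by positivity)]
        exact measure_mono inter_subset_right
    _ = _ := by
        have h2 : (b ^ (d + 2) * a ^ (d + 2) * ω)⁻¹ =
            (a ^ (d + 2))⁻¹ * (b ^ (d + 2) * ω)⁻¹ := by
          rw [← ENNReal.mul_inv (Or.inl (pow_ne_zero _ ha0)) (Or.inl (ENNReal.pow_ne_top hat))]
          congr 1; ring
        have h3 : a ^ (d + 2) * (a ^ (d + 2))⁻¹ = 1 :=
          ENNReal.mul_inv_cancel (pow_ne_zero _ ha0) (ENNReal.pow_ne_top hat)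
        have h4 : ENNReal.ofReal ((M + 3) * τ) ^ 2 * 2 =
            a ^ 2 * ENNReal.ofReal (2 * (M + 3) ^ 2 * ε ^ 2) := by
          rw [← ENNReal.ofReal_pow (by positivity), ha, ← ENNReal.ofReal_pow hρ.le,
            ← ENNReal.ofReal_mul (by positivity), ← ENNReal.ofReal_ofNat 2,
            ← ENNReal.ofReal_mul (by positivity)]
          congr 1; rw [hτ]; ring
        rw [h2, mul_add, mul_add]
        congr 1
        · calc _ = ENNReal.ofReal ((M + 3) * τ) ^ 2 * 2 * (a ^ (d + 2) *
              ∫⁻ z in Ω ∩ Metric.ball y (Λ * ρ), ‖fderiv ℝ u z‖ₑ ^ 2) := by ring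
            _ = _ := by rw [h4]; ring
        · calc _ = (a ^ (d + 2) * (a ^ (d + 2))⁻¹) ^ 2 * (a ^ 2 * (2 * (2 ^ (d + 2) * ω *
              ((b ^ (d + 2) * ω)⁻¹ * K₁) ^ 2)) * I ^ 2) := by ring
            _ = _ := by rw [h3]; ring

/-- A cut-off function. -/
theorem exists_cutoff (d : ℕ) : ∃ K : ℝ, 0 < K ∧ ∀ (y : E d) {ρ : ℝ}, 0 < ρ →
    ∃ η : E d → ℝ, ContDiff ℝ ((⊤ : ℕ∞) : WithTop ℕ∞) η ∧ (∀ z, 0 ≤ η z ∧ η z ≤ 1) ∧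
      (∀ z ∈ Metric.ball y ρ, η z = 1) ∧ tsupport η ⊆ Metric.ball y (2 * ρ) ∧
      ∀ z, ‖fderiv ℝ η z‖ ≤ K / ρ := by
  let b : ContDiffBump (0 : E d) := ⟨1, 3 / 2, by norm_num, by norm_num⟩
  have hb : ContDiff ℝ ((⊤ : ℕ∞) : WithTop ℕ∞) b := b.contDiff
  obtain ⟨K, hK⟩ := ((b.hasCompactSupport.fderiv ℝ).exists_bound_of_continuous
    (hb.continuous_fderiv (by simp)))
  refine ⟨|K| + 1, by positivity, fun y ρ hρ => ?_⟩
  set T : E d → E d := fun z => ρ⁻¹ • (z - y) with hT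
  have hTd : ∀ z, HasFDerivAt T (ρ⁻¹ • ContinuousLinearMap.id ℝ (E d)) z := fun z =>
    ((hasFDerivAt_id z).sub_const y).const_smul ρ⁻¹
  have hTn : ∀ z, ‖T z‖ = dist z y / ρ := by
    intro z
    rw [hT, norm_smul, dist_eq_norm, norm_inv, Real.norm_of_nonneg hρ.le]; ring
  refine ⟨fun z => b (T z), hb.comp (by fun_prop), fun z => ⟨b.nonneg, b.le_one⟩, ?_, ?_, ?_⟩
  · intro z hz
    refine b.one_of_mem_closedBall ?_
    rw [mem_closedBall_zero_iff, hTn, div_le_one hρ]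
    exact le_of_lt hz
  · have hsub : tsupport (fun z => b (T z)) ⊆ Metric.closedBall y (3 / 2 * ρ) := by
      refine closure_minimal (fun z hz => ?_) Metric.isClosed_closedBall
      have h1 : T z ∈ Function.support b := hz
      rw [b.support_eq, mem_ball_zero_iff, hTn, div_lt_iff₀ hρ] at h1
      exact h1.le
    exact hsub.trans (Metric.closedBall_subset_ball (by linarith))
  · intro z
    have h1 : HasFDerivAt (fun z => b (T z))
        ((fderiv ℝ b (T z)).comp (ρ⁻¹ • ContinuousLinearMap.id ℝ (E d))) z :=
      ((hb.differentiable (by simp)) _).hasFDerivAt.comp z (hTd z)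
    rw [h1.fderiv]
    refine (ContinuousLinearMap.opNorm_comp_le _ _).trans ?_
    have h2 : ‖ρ⁻¹ • ContinuousLinearMap.id ℝ (E d)‖ ≤ ρ⁻¹ := by
      rw [norm_smul, norm_inv, Real.norm_of_nonneg hρ.le]
      exact mul_le_of_le_one_right (by positivity) ContinuousLinearMap.norm_id_le
    rw [div_eq_mul_inv]
    have h3 := hK (T z)
    gcongr
    linarith [le_abs_self K]

/-- The surface measure of the part of the boundary in a ball. -/
theorem GraphChart.surface_ball_le {M : ℝ≥0} {Ω D : Set (E d)} {e : E d ≃ᵃⁱ[ℝ] E d}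
    {φ : EuclideanSpace ℝ (Fin (d + 1)) → ℝ} {ψ : EuclideanSpace ℝ (Fin d) → ℝ} {y : E d} {r : ℝ}
    (hr : 0 < r) (h : GraphChart M Ω D e φ ψ (Metric.ball y r)) :
    σ d (frontier Ω ∩ Metric.ball y r) ≤ ((1 + M : ℝ≥0) : ℝ≥0∞) ^ (d + 1) *
      (ENNReal.ofReal r ^ (d + 1) *
        volume (Metric.ball (0 : EuclideanSpace ℝ (Fin (d + 1))) 1)) := by
  have h1 := h.lintegral_frontier_le Metric.isOpen_ball.measurableSet (F := fun _ => 1)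
    measurable_const
  rw [lintegral_one, Measure.restrict_apply_univ] at h1
  refine h1.trans (mul_le_mul_right ?_ _)
  have h2 : volume (Metric.ball (horiz (e y)) r) = ENNReal.ofReal r ^ (d + 1) *
        volume (Metric.ball (0 : EuclideanSpace ℝ (Fin (d + 1))) 1) := by
    rw [Measure.addHaar_ball_of_pos _ _ hr, ENNReal.ofReal_pow hr.le]; simp
  rw [← h2, ← setLIntegral_one, ← lintegral_indicator Metric.isOpen_ball.measurableSet]
  refine lintegral_mono fun x => ?_
  by_cases hx : graphMap e φ (x, 0) ∈ Metric.ball y r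
  · have h3 : x ∈ Metric.ball (horiz (e y)) r := by
      have h4 := dist_horiz_le (e (graphMap e φ (x, 0))) (e y)
      rw [e.dist_map, horiz_graphMap] at h4
      exact lt_of_le_of_lt h4 hx
    rw [indicator_of_mem hx, indicator_of_mem h3]
  · rw [indicator_of_notMem hx]; exact zero_le

/-! ### The quadratic form of the coefficient matrix -/

/-- The bilinear form `Aξ · ζ`. -/
noncomputable def form (A : Matrix (Fin (d + 2)) (Fin (d + 2)) ℝ) (ξ ζ : E d) : ℝ :=
  (A *ᵥ ξ.ofLp) ⬝ᵥ ζ.ofLp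

section Form
variable {A : Matrix (Fin (d + 2)) (Fin (d + 2)) ℝ}

theorem form_add_left (ξ ξ' ζ : E d) : form A (ξ + ξ') ζ = form A ξ ζ + form A ξ' ζ := by
  simp [form, Matrix.mulVec_add, add_dotProduct]

theorem form_add_right (ξ ζ ζ' : E d) : form A ξ (ζ + ζ') = form A ξ ζ + form A ξ ζ' := by
  simp [form, dotProduct_add]

theorem form_smul_left (c : ℝ) (ξ ζ : E d) : form A (c • ξ) ζ = c * form A ξ ζ := by
  simp [form, Matrix.mulVec_smul]

theorem form_smul_right (c : ℝ) (ξ ζ : E d) : form A ξ (c • ζ) = c * form A ξ ζ := by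
  simp [form]

theorem form_comm (hs : A.IsSymm) (ξ ζ : E d) : form A ξ ζ = form A ζ ξ := by
  unfold form
  rw [dotProduct_comm, Matrix.dotProduct_mulVec, ← Matrix.mulVec_transpose, hs.eq]

variable {lam : ℝ}

/-- Expand the form at ξ + ζ and ξ - ζ, where it is nonnegative, and use symmetry for the mixed
terms. -/
theorem abs_form_le (hlam : 0 < lam) (hs : A.IsSymm)
    (hb : ∀ ξ : E d, lam⁻¹ * ‖ξ‖ ^ 2 ≤ form A ξ ξ ∧ form A ξ ξ ≤ lam * ‖ξ‖ ^ 2) (ξ ζ : E d) :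
    |form A ξ ζ| ≤ (form A ξ ξ + form A ζ ζ) / 2 := by
  have h1 : 0 ≤ form A (ξ + ζ) (ξ + ζ) := le_trans (by positivity) (hb _).1
  have h2 : 0 ≤ form A (ξ + (-1 : ℝ) • ζ) (ξ + (-1 : ℝ) • ζ) := le_trans (by positivity) (hb _).1
  simp only [form_add_left, form_add_right, form_smul_left, form_smul_right, form_comm hs ζ ξ]
    at h1 h2
  rw [abs_le]; constructor <;> linarith

/-- The vector tested against is η(ηG + ζ) with ζ = η(g - G) + 2Uh, so the form at (G, ·) splits
into the form at (ηG, ηG) and a mixed term, half of which is absorbed. Here G, g and h stand for the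
gradients of the solution, of a smooth substitute U and of the cut-off; the substitute leaves the
error |g - G|². -/
theorem le_form_test (hlam : 0 < lam) (hs : A.IsSymm)
    (hb : ∀ ξ : E d, lam⁻¹ * ‖ξ‖ ^ 2 ≤ form A ξ ξ ∧ form A ξ ξ ≤ lam * ‖ξ‖ ^ 2)
    {η : ℝ} (hη0 : 0 ≤ η) (hη1 : η ≤ 1) (U : ℝ) (G g h : E d) :
    lam⁻¹ / 2 * ‖η • G‖ ^ 2 ≤
      form A G (η ^ 2 • g + (2 * η * U) • h) + lam * (‖g - G‖ ^ 2 + 4 * ‖U • h‖ ^ 2) := by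
  set ζ := η • (g - G) + (2 * U) • h with hζ
  have h1 : form A G (η ^ 2 • g + (2 * η * U) • h) = form A (η • G) (η • G) + form A (η • G) ζ := by
    have h2 : η ^ 2 • g + (2 * η * U) • h = η • (η • G + ζ) := by
      rw [hζ]; module
    rw [h2, form_smul_right, form_smul_left, form_smul_left, ← mul_add, ← form_add_right]
  have h3 := abs_form_le hlam hs hb (η • G) ζ
  have h4 : ‖ζ‖ ^ 2 ≤ 2 * ‖g - G‖ ^ 2 + 8 * ‖U • h‖ ^ 2 := by
    have h5 : ‖ζ‖ ≤ ‖g - G‖ + 2 * ‖U • h‖ := by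
      refine (norm_add_le _ _).trans (add_le_add ?_ (le_of_eq ?_))
      · rw [norm_smul, Real.norm_of_nonneg hη0]
        exact mul_le_of_le_one_left (norm_nonneg _) hη1
      · rw [mul_smul, norm_smul]; simp
    have h6 := norm_nonneg ζ
    nlinarith [sq_nonneg (‖g - G‖ - 2 * ‖U • h‖), norm_nonneg (g - G), norm_nonneg (U • h)]
  have h7 := (hb (η • G)).1
  have h8 := (hb ζ).2
  have h9 : lam * ‖ζ‖ ^ 2 ≤ lam * (2 * ‖g - G‖ ^ 2 + 8 * ‖U • h‖ ^ 2) := by gcongr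
  rw [abs_le] at h3
  rw [h1]
  nlinarith

theorem aestronglyMeasurable_form {X : Type*} [MeasurableSpace X] {μ : Measure X}
    {A : X → Matrix (Fin (d + 2)) (Fin (d + 2)) ℝ} (hA : ∀ i j, AEMeasurable (fun y => A y i j) μ)
    {G H : X → E d} (hG : AEStronglyMeasurable G μ) (hH : AEStronglyMeasurable H μ) :
    AEStronglyMeasurable (fun y => form (A y) (G y) (H y)) μ := by
  have h1 : ∀ {F : X → E d}, AEStronglyMeasurable F μ → ∀ i, AEMeasurable (fun y => F y i) μ :=
    fun {F} hF i => ((EuclideanSpace.proj (𝕜 := ℝ) i).continuous.comp_aestronglyMeasurable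
      hF).aemeasurable
  simp only [form, dotProduct, Matrix.mulVec]
  refine (Finset.aemeasurable_fun_sum _ fun i _ => AEMeasurable.mul ?_ (h1 hH i)).aestronglyMeasurable
  exact Finset.aemeasurable_fun_sum _ fun j _ => (hA i j).mul (h1 hG j)

end Form

/-! ### Smooth test functions -/

theorem gradient_apply (u : E d → ℝ) (y : E d) (i : Fin (d + 2)) :
    gradient u y i = fderiv ℝ u y (EuclideanSpace.single i 1) := by
  have h := InnerProductSpace.toDual_symm_apply (𝕜 := ℝ) (x := (EuclideanSpace.single i 1 : E d))
    (y := fderiv ℝ u y)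
  refine Eq.trans ?_ h
  have h2 := EuclideanSpace.inner_single_right i (1 : ℝ) (gradient u y)
  rw [one_mul] at h2
  exact h2.symm

theorem norm_gradient (u : E d → ℝ) (y : E d) : ‖gradient u y‖ = ‖fderiv ℝ u y‖ := by
  simp [gradient]

theorem enorm_gradient (u : E d → ℝ) (y : E d) : ‖gradient u y‖ₑ = ‖fderiv ℝ u y‖ₑ := by
  rw [← ofReal_norm, norm_gradient, ofReal_norm]

theorem continuous_gradient {u : E d → ℝ} (hu : ContDiff ℝ 1 u) : Continuous (gradient u) :=
  (InnerProductSpace.toDual ℝ (E d)).symm.continuous.comp (hu.continuous_fderiv one_ne_zero)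

theorem hasWeakGradient_smooth {Ω : Set (E d)} {v : E d → ℝ} (hv : ContDiff ℝ 1 v) :
    HasWeakGradient Ω v (gradient v) := by
  intro ζ hζ hζc hζΩ i
  have hζ1 : ContDiff ℝ 1 ζ := hζ.of_le (by exact_mod_cast le_top)
  have hdζ := hζ1.continuous_fderiv one_ne_zero
  have hdv := hv.continuous_fderiv one_ne_zero
  have hz : ∀ y ∉ Ω, ζ y = 0 := fun y hy => image_eq_zero_of_notMem_tsupport fun h => hy (hζΩ h)
  have hdz : ∀ y ∉ Ω, fderiv ℝ ζ y = 0 := fun y hy => by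
    have h1 := enorm_fderiv_eq_zero_of_notMem fun h => hy (hζΩ h)
    rwa [← ofReal_norm, ENNReal.ofReal_eq_zero, norm_le_zero_iff] at h1
  set b : E d := EuclideanSpace.single i 1 with hb
  have hc1 : Continuous fun y => fderiv ℝ ζ y b := by fun_prop
  have hc2 : Continuous fun y => fderiv ℝ v y b := by fun_prop
  have hs1 : HasCompactSupport fun y => fderiv ℝ ζ y b :=
    (hζc.fderiv ℝ).comp_left (g := fun L : E d →L[ℝ] ℝ => L b) rfl
  simp only [gradient_apply, ← hb]
  rw [setIntegral_eq_integral_of_forall_compl_eq_zero (fun y hy => by simp [hdz y hy]),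
    setIntegral_eq_integral_of_forall_compl_eq_zero (fun y hy => by simp [hz y hy])]
  refine integral_mul_fderiv_eq_neg_fderiv_mul_of_integrable ?_ ?_ ?_
    (fun y _ => hv.differentiable one_ne_zero y) (fun y _ => hζ1.differentiable one_ne_zero y)
  · exact (hc2.mul hζ1.continuous).integrable_of_hasCompactSupport hζc.mul_left
  · exact (hv.continuous.mul hc1).integrable_of_hasCompactSupport hs1.mul_left
  · exact (hv.continuous.mul hζ1.continuous).integrable_of_hasCompactSupport hζc.mul_left

theorem memW12D_smooth {Ω D : Set (E d)} {v : E d → ℝ}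
    (hv : ContDiff ℝ ((⊤ : ℕ∞) : WithTop ℕ∞) v) (hvc : HasCompactSupport v)
    (hvD : ∀ y ∈ D, v y = 0) : MemW12D Ω D v (gradient v) := by
  have hv1 : ContDiff ℝ 1 v := hv.of_le (by exact_mod_cast le_top)
  have hgc : HasCompactSupport (gradient v) :=
    (hvc.fderiv ℝ).comp_left (g := (InnerProductSpace.toDual ℝ (E d)).symm) (by simp)
  refine ⟨⟨?_, ?_, hasWeakGradient_smooth hv1⟩, fun _ => v, ⟨fun _ => hv, ?_, ?_⟩, fun _ => hvD⟩
  · exact (hv1.continuous.memLp_of_hasCompactSupport hvc).restrict _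
  · exact ((continuous_gradient hv1).memLp_of_hasCompactSupport hgc).restrict _
  · simp
  · simp

theorem isTrace_smooth {Ω : Set (E d)} {v : E d → ℝ}
    (hv : ContDiff ℝ ((⊤ : ℕ∞) : WithTop ℕ∞) v)
    (hvt : MemLp v 2 ((σ d).restrict (frontier Ω))) : IsTrace Ω v (gradient v) v :=
  ⟨hvt, fun _ => v, ⟨fun _ => hv, by simp, by simp⟩, by simp⟩

theorem gradient_test {η U : E d → ℝ} {y : E d} (hη : DifferentiableAt ℝ η y)
    (hU : DifferentiableAt ℝ U y) :
    gradient (fun z => η z ^ 2 * U z) y =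
      η y ^ 2 • gradient U y + (2 * η y * U y) • gradient η y := by
  have h1 : HasFDerivAt (fun z => η z ^ 2 * U z)
      (η y ^ 2 • fderiv ℝ U y + U y • ((2 * η y) • fderiv ℝ η y)) y := by
    refine ((hη.hasFDerivAt.pow 2).mul hU.hasFDerivAt).congr_fderiv ?_
    simp
  unfold gradient
  rw [h1.fderiv]
  simp only [map_add, map_smulₛₗ, smul_smul]
  congr 2
  simp; ring

theorem enorm_sq_eq_ofReal {V : Type*} [NormedAddCommGroup V] (x : V) :
    ‖x‖ₑ ^ 2 = ENNReal.ofReal (‖x‖ ^ 2) := by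
  rw [ENNReal.ofReal_pow (norm_nonneg _), ofReal_norm]

/-- The energy inequality. -/
theorem IsWeakSolution.energy_le {lam : ℝ} (hlam : 0 < lam) {Ω D : Set (E d)}
    {A : E d → Matrix (Fin (d + 2)) (Fin (d + 2)) ℝ} (hA : IsEllipticCoeff lam Ω A)
    {f u : E d → ℝ} {G : E d → E d} (hsol : IsWeakSolution Ω D A f u G)
    {η U : E d → ℝ} (hη : ContDiff ℝ ((⊤ : ℕ∞) : WithTop ℕ∞) η)
    (hU : ContDiff ℝ ((⊤ : ℕ∞) : WithTop ℕ∞) U) (hηc : HasCompactSupport η)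
    (hη01 : ∀ z, 0 ≤ η z ∧ η z ≤ 1) (hD : ∀ z ∈ D, η z * U z = 0)
    (ht : MemLp (fun z => η z ^ 2 * U z) 2 ((σ d).restrict (frontier Ω))) :
    ENNReal.ofReal (lam⁻¹ / 2) * ∫⁻ y in Ω, ‖η y • G y‖ₑ ^ 2 ≤
      (∫⁻ y in neumannPart Ω D, ‖f y‖ₑ * ‖η y ^ 2 * U y‖ₑ ∂(σ d)) + ENNReal.ofReal lam *
        ((∫⁻ y in Ω, ‖gradient U y - G y‖ₑ ^ 2) + 4 * ∫⁻ y in Ω, ‖U y • gradient η y‖ₑ ^ 2) := by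
  have hη1 : ContDiff ℝ 1 η := hη.of_le (by exact_mod_cast le_top)
  have hU1 : ContDiff ℝ 1 U := hU.of_le (by exact_mod_cast le_top)
  set v : E d → ℝ := fun z => η z ^ 2 * U z with hv
  have hvs : ContDiff ℝ ((⊤ : ℕ∞) : WithTop ℕ∞) v := (hη.pow 2).mul hU
  have hv1 : ContDiff ℝ 1 v := hvs.of_le (by exact_mod_cast le_top)
  have hvc : HasCompactSupport v := by
    refine hηc.mono fun z hz => ?_
    simp only [hv, Function.mem_support] at hz ⊢
    intro h0; apply hz; rw [h0]; ring
  have hvD : ∀ z ∈ D, v z = 0 := fun z hz => by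
    have : v z = η z * (η z * U z) := by simp only [hv]; ring
    rw [this, hD z hz, mul_zero]
  -- The test function η²U is smooth, compactly supported and zero on D, so it is admissible and is
  -- its own trace. A product of η² with the solution itself would first have to be shown
  -- admissible.
  have hid := hsol.2 v (gradient v) v (memW12D_smooth hvs hvc hvD) (isTrace_smooth hvs ht)
  have hGm : MemLp G 2 (volume.restrict Ω) := hsol.1.1.memLp_grad
  have hgvm : MemLp (gradient v) 2 (volume.restrict Ω) :=
    (memW12D_smooth hvs hvc hvD).1.memLp_grad
  have hGi : Integrable (fun y => ‖G y‖ ^ 2) (volume.restrict Ω) := by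
    simpa using hGm.integrable_norm_pow two_ne_zero
  have hgvi : Integrable (fun y => ‖gradient v y‖ ^ 2) (volume.restrict Ω) := by
    simpa using hgvm.integrable_norm_pow two_ne_zero
  set μ := volume.restrict Ω with hμ
  have hgU : Continuous (gradient U) := continuous_gradient hU1
  have hgη : Continuous (gradient η) := continuous_gradient hη1
  set R₁ := ∫⁻ y, ‖gradient U y - G y‖ₑ ^ 2 ∂μ with hR₁
  set R₂ := ∫⁻ y, ‖U y • gradient η y‖ₑ ^ 2 ∂μ with hR₂
  -- If the error terms are infinite there is nothing to prove; otherwise all integrands below are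
  -- integrable and the pointwise inequality may be integrated.
  by_cases hRt : ENNReal.ofReal lam * (R₁ + 4 * R₂) = ∞
  · rw [hRt]; simp
  set R : E d → ℝ := fun y => lam * (‖gradient U y - G y‖ ^ 2 + 4 * ‖U y • gradient η y‖ ^ 2) with hR
  have hRm : AEStronglyMeasurable R μ := by
    have h1 := hGm.1
    have h2 : AEStronglyMeasurable (fun y => gradient U y - G y) μ :=
      hgU.aestronglyMeasurable.sub h1
    have h3 : Continuous fun y => ‖U y • gradient η y‖ ^ 2 := by
      have := hU.continuous; fun_prop
    exact ((h2.norm.pow 2).add (h3.aestronglyMeasurable.const_mul 4)).const_mul lam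
  have hR0 : ∀ y, 0 ≤ R y := fun y => by positivity
  have hRl : ∫⁻ y, ENNReal.ofReal (R y) ∂μ = ENNReal.ofReal lam * (R₁ + 4 * R₂) := by
    have h3 : Measurable fun y => 4 * ‖U y • gradient η y‖ₑ ^ 2 := by
      have := hU.continuous
      exact (Continuous.measurable (by fun_prop)).enorm.pow_const 2 |>.const_mul 4
    rw [hR₁, hR₂, ← lintegral_const_mul' _ _ (by simp), ← lintegral_add_right _ h3,
      ← lintegral_const_mul' _ _ ENNReal.ofReal_ne_top]
    refine lintegral_congr fun y => ?_
    rw [enorm_sq_eq_ofReal, enorm_sq_eq_ofReal, hR, ENNReal.ofReal_mul hlam.le,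
      ENNReal.ofReal_add (by positivity) (by positivity), ENNReal.ofReal_mul zero_le_four]
    simp
  have hRi : Integrable R μ := by
    refine ⟨hRm, ?_⟩
    rw [hasFiniteIntegral_iff_ofReal (ae_of_all _ hR0), hRl]
    exact lt_top_iff_ne_top.2 hRt
  have hell : ∀ᵐ y ∂μ, (A y).IsSymm ∧ ∀ ξ : E d, lam⁻¹ * ‖ξ‖ ^ 2 ≤ form (A y) ξ ξ ∧
      form (A y) ξ ξ ≤ lam * ‖ξ‖ ^ 2 := hA.2
  have hFi : Integrable (fun y => form (A y) (G y) (gradient v y)) μ := by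
    refine ((hGi.add hgvi).const_mul (lam / 2)).mono'
      (aestronglyMeasurable_form hA.1 hGm.1 hgvm.1) ?_
    filter_upwards [hell] with y ⟨hs, hb⟩
    rw [Real.norm_eq_abs]
    refine (abs_form_le hlam hs hb _ _).trans ?_
    have h1 := (hb (G y)).2
    have h2 := (hb (gradient v y)).2
    simp only [Pi.add_apply]
    linarith
  have hLi : Integrable (fun y => lam⁻¹ / 2 * ‖η y • G y‖ ^ 2) μ := by
    refine (hGi.const_mul (lam⁻¹ / 2)).mono' ?_ (ae_of_all _ fun y => ?_)
    · have h1 : AEStronglyMeasurable (fun y => η y • G y) μ :=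
        hη.continuous.aestronglyMeasurable.smul hGm.1
      exact (h1.norm.pow 2).const_mul _
    · rw [Real.norm_of_nonneg (by positivity)]
      have : ‖η y • G y‖ ≤ ‖G y‖ := by
        rw [norm_smul, Real.norm_of_nonneg (hη01 y).1]
        exact mul_le_of_le_one_left (norm_nonneg _) (hη01 y).2
      gcongr
  have hle : ∫ y, lam⁻¹ / 2 * ‖η y • G y‖ ^ 2 ∂μ ≤
      (∫ y, form (A y) (G y) (gradient v y) ∂μ) + ∫ y, R y ∂μ := by
    rw [← integral_add hFi hRi]
    refine integral_mono_ae hLi (hFi.add hRi) ?_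
    filter_upwards [hell] with y ⟨hs, hb⟩
    have h1 := le_form_test hlam hs hb (hη01 y).1 (hη01 y).2 (U y) (G y) (gradient U y)
      (gradient η y)
    rw [← gradient_test (hη1.differentiable one_ne_zero y) (hU1.differentiable one_ne_zero y)] at h1
    exact h1
  have hle2 := ENNReal.ofReal_le_ofReal hle
  rw [ofReal_integral_eq_lintegral_ofReal hLi (ae_of_all _ fun y => by positivity)] at hle2
  have hL : ∫⁻ y, ENNReal.ofReal (lam⁻¹ / 2 * ‖η y • G y‖ ^ 2) ∂μ =
      ENNReal.ofReal (lam⁻¹ / 2) * ∫⁻ y, ‖η y • G y‖ₑ ^ 2 ∂μ := by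
    rw [← lintegral_const_mul' _ _ ENNReal.ofReal_ne_top]
    refine lintegral_congr fun y => ?_
    rw [ENNReal.ofReal_mul (by positivity), enorm_sq_eq_ofReal]
  rw [hL] at hle2
  refine hle2.trans (ENNReal.ofReal_add_le.trans (add_le_add ?_ ?_))
  · have hid' : ∫ y, form (A y) (G y) (gradient v y) ∂μ = ∫ y in neumannPart Ω D, f y * v y ∂(σ d) :=
      hid
    rw [hid']
    calc ENNReal.ofReal (∫ y in neumannPart Ω D, f y * v y ∂(σ d))
        ≤ ‖∫ y in neumannPart Ω D, f y * v y ∂(σ d)‖ₑ := Real.ofReal_le_enorm _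
      _ ≤ ∫⁻ y in neumannPart Ω D, ‖f y * v y‖ₑ ∂(σ d) := enorm_integral_le_lintegral_enorm _
      _ = _ := lintegral_congr fun y => enorm_mul _ _
  · rw [ofReal_integral_eq_lintegral_ofReal hRi (ae_of_all _ hR0), hRl]

/-! ### Caccioppoli's inequality -/

/-- With P = θ⁻¹p and Q = θq the hypothesis reads b² ≤ PQ ≤ (P + Q)². -/
theorem le_of_sq_le_mul {b p q : ℝ≥0∞} {θ : ℝ} (hθ : 0 < θ) (h : b ^ 2 ≤ p * q) :
    b ≤ ENNReal.ofReal θ⁻¹ * p + ENNReal.ofReal θ * q := by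
  by_contra! hlt
  have h0 : ENNReal.ofReal θ⁻¹ * ENNReal.ofReal θ = 1 := by
    rw [← ENNReal.ofReal_mul (by positivity), inv_mul_cancel₀ hθ.ne', ENNReal.ofReal_one]
  set P := ENNReal.ofReal θ⁻¹ * p
  set Q := ENNReal.ofReal θ * q
  have h1 : p * q = P * Q := by
    calc p * q = (ENNReal.ofReal θ⁻¹ * ENNReal.ofReal θ) * (p * q) := by rw [h0, one_mul]
      _ = P * Q := by ring
  have h2 : P * Q ≤ (P + Q) ^ 2 := by
    rw [sq]; gcongr <;> simp
  have h3 : (P + Q) ^ 2 < b ^ 2 := ENNReal.pow_lt_pow_left two_ne_zero hlt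
  exact absurd (h.trans (h1.le.trans h2)) (not_le.2 h3)

/-- The arithmetic of Caccioppoli's inequality: x is the energy, b the boundary integral, e the
approximation error, v the cut-off term and p the data. The energy reappears in the bound for b and
is absorbed, which requires x to be finite. -/
theorem exists_energy_absorb {c lam : ℝ} (hc : 0 < c) (hlam : 0 < lam) : ∃ C : ℝ, 0 < C ∧
    ∀ {x b e v p : ℝ≥0∞}, x ≠ ∞ → ENNReal.ofReal c * x ≤ b + ENNReal.ofReal lam * (e + 4 * v) →
      b ^ 2 ≤ p * (4 * x + 4 * e + 2 * v) → x ≤ ENNReal.ofReal C * (e + v + p) := by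
  refine ⟨2 / c * (8 / c + c / 2 + 4 * lam), by positivity, fun {x b e v p} hx h1 h2 => ?_⟩
  set C := 2 / c * (8 / c + c / 2 + 4 * lam) with hC
  have hC0 : 0 < C := by positivity
  by_cases ht : e + v + p = ∞
  · rw [ht, ENNReal.mul_top (by simpa using hC0)]; exact le_top
  have he : e ≠ ∞ := fun h => ht (by simp [h])
  have hv : v ≠ ∞ := fun h => ht (by simp [h])
  have hp : p ≠ ∞ := fun h => ht (by simp [h])
  -- The weight c/8 turns the 4x on the right into (c/2)x, half of the left side.
  have h3 := le_of_sq_le_mul (θ := c / 8) (by positivity) h2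
  have h4 := h1.trans (add_le_add_left h3 _)
  lift x to ℝ≥0 using hx
  lift e to ℝ≥0 using he
  lift v to ℝ≥0 using hv
  lift p to ℝ≥0 using hp
  have hcast : ∀ z : ℝ≥0, (z : ℝ≥0∞) = ENNReal.ofReal z := fun z => by simp
  have e4 : (4 : ℝ≥0∞) = ENNReal.ofReal 4 := by simp
  have e2 : (2 : ℝ≥0∞) = ENNReal.ofReal 2 := by simp
  rw [hcast x, hcast e, hcast v, hcast p] at *
  rw [e4, e2] at h4
  have hx0 := x.coe_nonneg
  have he0 := e.coe_nonneg
  have hv0 := v.coe_nonneg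
  have hp0 := p.coe_nonneg
  simp only [← ENNReal.ofReal_mul hc.le,
    ← ENNReal.ofReal_mul zero_le_four, ← ENNReal.ofReal_mul zero_le_two,
    ← ENNReal.ofReal_mul (inv_nonneg.2 (by positivity : 0 ≤ c / 8)),
    ← ENNReal.ofReal_add he0 hv0] at h4 ⊢
  rw [← ENNReal.ofReal_add he0 (by positivity), ← ENNReal.ofReal_mul hlam.le,
    ← ENNReal.ofReal_add (by positivity) (by positivity),
    ← ENNReal.ofReal_add (by positivity) (by positivity),
    ← ENNReal.ofReal_mul (by positivity), ← ENNReal.ofReal_add (by positivity) (by positivity),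
    ← ENNReal.ofReal_add (by positivity) (by positivity),
    ENNReal.ofReal_le_ofReal_iff (by positivity)] at h4
  rw [← ENNReal.ofReal_add (by positivity) (by positivity), ← ENNReal.ofReal_mul hC0.le]
  refine ENNReal.ofReal_le_ofReal ?_
  have h5 : c / 2 * x ≤ (8 / c + c / 2 + 4 * lam) * (e + v + p) := by
    have h6 : (c / 8)⁻¹ = 8 / c := by rw [inv_div]
    rw [h6] at h4
    have h7 : 0 ≤ 8 / c := by positivity
    nlinarith [mul_nonneg h7 he0, mul_nonneg h7 hv0, mul_nonneg hc.le he0, mul_nonneg hc.le hv0,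
      mul_nonneg hc.le hp0, mul_nonneg hlam.le he0, mul_nonneg hlam.le hv0, mul_nonneg hlam.le hp0]
  calc (x : ℝ) = 2 / c * (c / 2 * x) := by field_simp
    _ ≤ 2 / c * ((8 / c + c / 2 + 4 * lam) * (e + v + p)) := by gcongr
    _ = C * (e + v + p) := by rw [hC]; ring

theorem LocalGeometry.surface_ball_le {M : ℝ≥0} {Λ : ℝ} {Ω D : Set (E d)} {y : E d} {ρ r : ℝ}
    (h : LocalGeometry M Λ Ω D y ρ) (hr : 0 < r) (h1 : r ≤ (M + 5) * ρ) (h2 : r ≤ Λ * ρ) :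
    σ d (frontier Ω ∩ Metric.ball y r) ≤ ((1 + M : ℝ≥0) : ℝ≥0∞) ^ (d + 1) *
      (ENNReal.ofReal r ^ (d + 1) *
        volume (Metric.ball (0 : EuclideanSpace ℝ (Fin (d + 1))) 1)) := by
  rcases h.chart with h3 | ⟨e, φ, ψ, h3⟩
  · have : frontier Ω ∩ Metric.ball y r = ∅ := subset_empty_iff.1
      (h3 ▸ inter_subset_inter_right _ (Metric.ball_subset_ball h1))
    simp [this]
  · exact (h3.mono (Metric.ball_subset_ball h2)).surface_ball_le hr

/-- A bounded function supported in a ball is integrable to any power because the boundary has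
finite surface measure there. It makes cut-off test functions their own traces. -/
theorem LocalGeometry.memLp_frontier {M : ℝ≥0} {Λ : ℝ} {Ω D : Set (E d)} {y : E d} {ρ : ℝ}
    (h : LocalGeometry M Λ Ω D y ρ) (hρ : 0 < ρ) (hΛ : 2 ≤ Λ) {v : E d → ℝ} (hv : Continuous v)
    (hvs : tsupport v ⊆ Metric.ball y (2 * ρ)) (p : ℝ≥0∞) :
    MemLp v p ((σ d).restrict (frontier Ω)) := by
  have hM := M.coe_nonneg
  have hvc : HasCompactSupport v :=
    (isCompact_closedBall y (2 * ρ)).of_isClosed_subset (isClosed_tsupport v)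
      (hvs.trans Metric.ball_subset_closedBall)
  obtain ⟨C, hC⟩ := hvc.exists_bound_of_continuous hv
  have hind : (Metric.ball y (2 * ρ)).indicator v = v :=
    indicator_eq_self.2 ((subset_tsupport v).trans hvs)
  rw [← hind, memLp_indicator_iff_restrict Metric.isOpen_ball.measurableSet,
    Measure.restrict_restrict Metric.isOpen_ball.measurableSet, inter_comm]
  have hfin : σ d (frontier Ω ∩ Metric.ball y (2 * ρ)) < ∞ := by
    refine (h.surface_ball_le (by positivity) (by nlinarith) (by nlinarith)).trans_lt ?_
    exact ENNReal.mul_lt_top (by finiteness) (ENNReal.mul_lt_top (by finiteness)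
      measure_ball_lt_top)
  have : IsFiniteMeasure ((σ d).restrict (frontier Ω ∩ Metric.ball y (2 * ρ))) :=
    ⟨by rwa [Measure.restrict_apply_univ]⟩
  exact MemLp.of_bound hv.aestronglyMeasurable C (ae_of_all _ hC)

/-- The boundary term in the energy inequality. -/
theorem exists_boundary_const (d : ℕ) (M : ℝ≥0) {γ : ℝ} (hγ : 1 < γ)
    (hγd : γ * d ≤ 2 * (d + 1)) : ∃ C : ℝ≥0∞, C ≠ ∞ ∧
    ∀ {Λ : ℝ} {Ω D : Set (E d)} {y : E d} {ρ : ℝ}, LocalGeometry M Λ Ω D y ρ → 2 ≤ Λ → 0 < ρ →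
    MeasurableSet Ω → ∀ {f w : E d → ℝ}, AEMeasurable f ((σ d).restrict (neumannPart Ω D)) →
    ContDiff ℝ 1 w → tsupport w ⊆ Metric.ball y (2 * ρ) →
    (∫⁻ z in neumannPart Ω D, ‖f z‖ₑ * ‖w z‖ₑ ∂(σ d)) ^ 2 ≤
      C * (ENNReal.ofReal ρ ^ ((d + 2 : ℝ) - 2 * (d + 1) * ((γ - 1) / γ)) *
        (∫⁻ z in Metric.ball y (2 * ρ) ∩ neumannPart Ω D, ‖f z‖ₑ ^ (γ / (γ - 1)) ∂(σ d)) ^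
          (2 * ((γ - 1) / γ))) * ∫⁻ z in Ω, ‖fderiv ℝ w z‖ₑ ^ 2 := by
  obtain ⟨C, hC, htr⟩ := exists_trace_const d M hγ hγd
  have hγ0 : 0 < γ := by linarith
  have hγ1 : 0 < γ - 1 := by linarith
  set b : ℝ := (d + 2 : ℝ) - 2 * (d + 1) * ((γ - 1) / γ) with hb
  refine ⟨C * ENNReal.ofReal (2 ^ b), by finiteness, ?_⟩
  intro Λ Ω D y ρ hLG hΛ hρ hΩ f w hf hw hws
  have hM := M.coe_nonneg
  have hN : neumannPart Ω D ⊆ frontier Ω := sdiff_subset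
  set B := Metric.ball y (2 * ρ) with hB
  have hBm : MeasurableSet B := Metric.isOpen_ball.measurableSet
  set F := ∫⁻ z in B ∩ neumannPart Ω D, ‖f z‖ₑ ^ (γ / (γ - 1)) ∂(σ d) with hF
  have hw0 : ∀ z ∉ B, w z = 0 := fun z hz => image_eq_zero_of_notMem_tsupport fun h => hz (hws h)
  have h1 : ∫⁻ z in neumannPart Ω D, ‖f z‖ₑ * ‖w z‖ₑ ∂(σ d) =
      ∫⁻ z in B ∩ neumannPart Ω D, ‖f z‖ₑ * ‖w z‖ₑ ∂(σ d) := by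
    rw [← Measure.restrict_restrict hBm, ← lintegral_indicator hBm]
    refine lintegral_congr fun z => ?_
    by_cases hz : z ∈ B
    · rw [indicator_of_mem hz]
    · rw [indicator_of_notMem hz, hw0 z hz]; simp
  rw [h1]
  rcases hLG.chart with hch | ⟨e, φ, ψ, hch⟩
  · have he : B ∩ neumannPart Ω D = ∅ := by
      refine subset_empty_iff.1 fun z hz => ?_
      rw [← hch]
      exact ⟨hN hz.2, Metric.ball_subset_ball (by nlinarith) hz.1⟩
    rw [he]; simp
  have h2 := htr hch hΩ hw (y := y) (r := 2 * ρ) (by positivity) hws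
    (Metric.ball_subset_ball (by nlinarith))
  have hf' : AEMeasurable f ((σ d).restrict (B ∩ neumannPart Ω D)) :=
    hf.mono_measure (Measure.restrict_mono inter_subset_right le_rfl)
  have hpq : Real.HolderConjugate (γ / (γ - 1)) γ := by
    rw [Real.holderConjugate_comm]
    exact Real.HolderConjugate.conjExponent hγ
  have h3 := ENNReal.lintegral_mul_le_Lp_mul_Lq ((σ d).restrict (B ∩ neumannPart Ω D)) hpq
    hf'.enorm hw.continuous.measurable.aemeasurable.enorm
  simp only [Pi.mul_apply] at h3
  set T := ∫⁻ z in frontier Ω, ‖w z‖ₑ ^ γ ∂(σ d) with hT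
  have h4 : ∫⁻ z in B ∩ neumannPart Ω D, ‖w z‖ₑ ^ γ ∂(σ d) ≤ T :=
    lintegral_mono_set (inter_subset_right.trans hN)
  calc (∫⁻ z in B ∩ neumannPart Ω D, ‖f z‖ₑ * ‖w z‖ₑ ∂(σ d)) ^ 2
      ≤ (F ^ (1 / (γ / (γ - 1))) * T ^ (1 / γ)) ^ 2 := by
        gcongr
        exact h3.trans (by gcongr)
    _ = F ^ (2 * ((γ - 1) / γ)) * T ^ (2 / γ) := by
        rw [mul_pow, ← ENNReal.rpow_natCast, ← ENNReal.rpow_natCast, ← ENNReal.rpow_mul,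
          ← ENNReal.rpow_mul]
        congr 2
        · rw [one_div_div]; push_cast; ring
        · push_cast; ring
    _ ≤ F ^ (2 * ((γ - 1) / γ)) * (C * ENNReal.ofReal ((2 * ρ) ^ b) *
          ∫⁻ z in Ω, ‖fderiv ℝ w z‖ₑ ^ 2) := by gcongr
    _ = _ := by
        rw [Real.mul_rpow zero_le_two hρ.le, ENNReal.ofReal_mul (by positivity),
          ← ENNReal.ofReal_rpow_of_pos hρ]
        ring

theorem lintegral_enorm_sq_eq {X V : Type*} [MeasurableSpace X] {μ : Measure X}
    [NormedAddCommGroup V] (F : X → V) : ∫⁻ x, ‖F x‖ₑ ^ 2 ∂μ = eLpNorm F 2 μ ^ 2 := by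
  have h := eLpNorm_nnreal_pow_eq_lintegral (f := F) (μ := μ) (p := 2) two_ne_zero
  simpa using h.symm

/-- The inequality is stated for a smooth v in place of u, with the error in ∇v - G, so that the
Poincaré inequality for smooth functions can be inserted before passing to the limit. The order of
the quantifiers matters: C is fixed before the exponent γ, and only the factor C' of the data
depends on γ. The exponent p₀ finally inherits this independence. -/
theorem exists_caccioppoli_smooth (d : ℕ) (M : ℝ≥0) {lam : ℝ} (hlam : 0 < lam) :
    ∃ C : ℝ, 0 < C ∧ ∀ {γ : ℝ}, 1 < γ → γ * d ≤ 2 * (d + 1) → ∃ C' : ℝ≥0∞, C' ≠ ∞ ∧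
    ∀ {Λ : ℝ} {Ω D : Set (E d)} {y : E d} {ρ : ℝ}, LocalGeometry M Λ Ω D y ρ → 2 ≤ Λ → 0 < ρ →
    MeasurableSet Ω → ∀ {A : E d → Matrix (Fin (d + 2)) (Fin (d + 2)) ℝ},
    IsEllipticCoeff lam Ω A → ∀ {f u : E d → ℝ} {G : E d → E d},
    AEMeasurable f ((σ d).restrict (neumannPart Ω D)) → IsWeakSolution Ω D A f u G →
    ∀ {v : E d → ℝ} {c : ℝ}, ContDiff ℝ ((⊤ : ℕ∞) : WithTop ℕ∞) v → (∀ z ∈ D, v z = 0) →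
    (c = 0 ∨ D ∩ Metric.ball y (2 * ρ) = ∅) →
    ∫⁻ z in Ω ∩ Metric.ball y ρ, ‖G z‖ₑ ^ 2 ≤
      ENNReal.ofReal C * ((∫⁻ z in Ω, ‖gradient v z - G z‖ₑ ^ 2) +
        ENNReal.ofReal (1 / ρ ^ 2) * ∫⁻ z in Ω ∩ Metric.ball y (2 * ρ), ‖v z - c‖ₑ ^ 2) +
      C' * (ENNReal.ofReal ρ ^ ((d + 2 : ℝ) - 2 * (d + 1) * ((γ - 1) / γ)) *
        (∫⁻ z in Metric.ball y (2 * ρ) ∩ neumannPart Ω D, ‖f z‖ₑ ^ (γ / (γ - 1)) ∂(σ d)) ^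
          (2 * ((γ - 1) / γ))) := by
  obtain ⟨C, hC, habs⟩ := exists_energy_absorb (c := lam⁻¹ / 2) (by positivity) hlam
  obtain ⟨K, hK, hcut⟩ := exists_cutoff d
  refine ⟨C * (1 + K ^ 2), by positivity, fun {γ} hγ hγd => ?_⟩
  obtain ⟨C', hC', hbd⟩ := exists_boundary_const d M hγ hγd
  refine ⟨ENNReal.ofReal C * C', by finiteness, ?_⟩
  intro Λ Ω D y ρ hLG hΛ hρ hΩ A hA f u G hf hsol v c hv hvD hc
  obtain ⟨η, hη, hη01, hη1, hηs, hηK⟩ := hcut y hρ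
  set B := Metric.ball y (2 * ρ) with hB
  have hBm : MeasurableSet B := Metric.isOpen_ball.measurableSet
  set U : E d → ℝ := fun z => v z - c with hU
  have hUs : ContDiff ℝ ((⊤ : ℕ∞) : WithTop ℕ∞) U := hv.sub contDiff_const
  have hηd : ContDiff ℝ 1 η := hη.of_le (by exact_mod_cast le_top)
  have hUd : ContDiff ℝ 1 U := hUs.of_le (by exact_mod_cast le_top)
  have hgU : ∀ z, gradient U z = gradient v z := fun z => by
    simp only [gradient, hU]
    rw [fderiv_sub_const]
  have hη0 : ∀ z ∉ B, η z = 0 := fun z hz => image_eq_zero_of_notMem_tsupport fun h => hz (hηs h)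
  have hηc : HasCompactSupport η :=
    (isCompact_closedBall y (2 * ρ)).of_isClosed_subset (isClosed_tsupport η)
      (hηs.trans Metric.ball_subset_closedBall)
  -- Either c = 0 and v vanishes on D, or D misses the support of η; this is the dichotomy supplied
  -- by the Poincaré inequality.
  have hDz : ∀ z ∈ D, η z * U z = 0 := by
    intro z hz
    rcases hc with rfl | hc
    · simp [hU, hvD z hz]
    · rw [hη0 z fun h => (hc ▸ (⟨hz, h⟩ : z ∈ D ∩ B) : z ∈ (∅ : Set (E d))), zero_mul]
  set w : E d → ℝ := fun z => η z * U z with hw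
  have hwd : ContDiff ℝ 1 w := hηd.mul hUd
  have hws : tsupport w ⊆ B := (tsupport_mul_subset_left).trans hηs
  have hts : tsupport (fun z => η z ^ 2 * U z) ⊆ B := by
    have : (fun z => η z ^ 2 * U z) = fun z => η z * (η z * U z) := by ext z; ring
    rw [this]
    exact (tsupport_mul_subset_left).trans hηs
  have hmem : MemLp (fun z => η z ^ 2 * U z) 2 ((σ d).restrict (frontier Ω)) :=
    hLG.memLp_frontier hρ hΛ ((hη.continuous.pow 2).mul hUs.continuous) hts 2
  have hen := hsol.energy_le hlam hA hη hUs hηc hη01 hDz hmem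
  have hbdry := hbd hLG hΛ hρ hΩ hf hwd hws
  set x := ∫⁻ z in Ω, ‖η z • G z‖ₑ ^ 2 with hx
  set b := ∫⁻ z in neumannPart Ω D, ‖f z‖ₑ * ‖w z‖ₑ ∂(σ d) with hb
  set e := ∫⁻ z in Ω, ‖gradient U z - G z‖ₑ ^ 2 with he
  set V := ∫⁻ z in Ω, ‖U z • gradient η z‖ₑ ^ 2 with hV
  have hGm : MemLp G 2 (volume.restrict Ω) := hsol.1.1.memLp_grad
  have hηe : ∀ (z : E d) (ξ : E d), ‖η z • ξ‖ₑ ≤ ‖ξ‖ₑ := fun z ξ => by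
    rw [← ofReal_norm, ← ofReal_norm]
    refine ENNReal.ofReal_le_ofReal ?_
    rw [norm_smul, Real.norm_of_nonneg (hη01 z).1]
    exact mul_le_of_le_one_left (norm_nonneg _) (hη01 z).2
  have hGfin : ∫⁻ z in Ω, ‖G z‖ₑ ^ 2 ≠ ∞ := by
    rw [lintegral_enorm_sq_eq]
    exact ENNReal.pow_ne_top hGm.2.ne
  have hxfin : x ≠ ∞ := ne_top_of_le_ne_top hGfin (lintegral_mono fun z => by
    gcongr; exact hηe z _)
  have hb1 : ∫⁻ z in neumannPart Ω D, ‖f z‖ₑ * ‖η z ^ 2 * U z‖ₑ ∂(σ d) ≤ b := by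
    refine lintegral_mono fun z => ?_
    gcongr
    rw [hw, ← ofReal_norm, ← ofReal_norm]
    refine ENNReal.ofReal_le_ofReal ?_
    rw [sq, mul_assoc, norm_mul, Real.norm_of_nonneg (hη01 z).1]
    exact mul_le_of_le_one_left (norm_nonneg _) (hη01 z).2
  -- The trace inequality brings in ∇(ηU) = ηG + η(∇U - G) + U∇η, whose first part is the energy to
  -- be absorbed.
  have hwe : ∫⁻ z in Ω, ‖fderiv ℝ w z‖ₑ ^ 2 ≤ 4 * x + 4 * e + 2 * V := by
    have hm1 : AEMeasurable (fun z => 4 * ‖η z • G z‖ₑ ^ 2) (volume.restrict Ω) :=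
      ((hη.continuous.aestronglyMeasurable.smul hGm.1).enorm.pow_const 2).const_mul 4
    have hm2 : AEMeasurable (fun z => 4 * ‖gradient U z - G z‖ₑ ^ 2) (volume.restrict Ω) :=
      (((continuous_gradient hUd).aestronglyMeasurable.sub hGm.1).enorm.pow_const 2).const_mul 4
    rw [hx, he, hV, ← lintegral_const_mul' _ _ (by simp), ← lintegral_const_mul' _ _ (by simp),
      ← lintegral_const_mul' _ _ (by simp), ← lintegral_add_left' hm1,
      ← lintegral_add_left' (f := fun z => 4 * ‖η z • G z‖ₑ ^ 2 + 4 * ‖gradient U z - G z‖ₑ ^ 2)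
        (hm1.add hm2)]
    refine lintegral_mono fun z => ?_
    have h1 : gradient w z = η z • gradient U z + U z • gradient η z := by
      simp only [gradient, hw]
      rw [fderiv_fun_mul (hηd.differentiable one_ne_zero z) (hUd.differentiable one_ne_zero z)]
      simp
    have h2 : η z • gradient U z = η z • G z + η z • (gradient U z - G z) := by
      rw [← smul_add]; congr 1; abel
    rw [← enorm_gradient, h1]
    calc ‖η z • gradient U z + U z • gradient η z‖ₑ ^ 2
        ≤ (‖η z • gradient U z‖ₑ + ‖U z • gradient η z‖ₑ) ^ 2 := by
          gcongr; exact enorm_add_le _ _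
      _ ≤ 2 * ‖η z • gradient U z‖ₑ ^ 2 + 2 * ‖U z • gradient η z‖ₑ ^ 2 := add_sq_le_two_mul _ _
      _ ≤ 2 * (2 * ‖η z • G z‖ₑ ^ 2 + 2 * ‖gradient U z - G z‖ₑ ^ 2) +
            2 * ‖U z • gradient η z‖ₑ ^ 2 := by
          gcongr
          rw [h2]
          refine le_trans ?_ (add_sq_le_two_mul _ _)
          gcongr
          refine (enorm_add_le _ _).trans ?_
          gcongr
          exact hηe z _
      _ = _ := by ring
  have hmain := habs hxfin (hen.trans (by gcongr)) (hbdry.trans (mul_le_mul_right hwe _))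
  have hVle : V ≤ ENNReal.ofReal (K ^ 2) * (ENNReal.ofReal (1 / ρ ^ 2) *
      ∫⁻ z in Ω ∩ B, ‖v z - c‖ₑ ^ 2) := by
    rw [inter_comm, ← Measure.restrict_restrict hBm, ← lintegral_indicator hBm,
      ← lintegral_const_mul' _ _ (by finiteness), ← lintegral_const_mul' _ _ (by finiteness)]
    refine lintegral_mono fun z => ?_
    by_cases hz : z ∈ B
    · rw [indicator_of_mem hz, enorm_smul, mul_pow, ← mul_assoc, mul_comm (‖U z‖ₑ ^ 2),
        ← ENNReal.ofReal_mul (by positivity)]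
      refine mul_le_mul_left ?_ _
      rw [enorm_sq_eq_ofReal, norm_gradient]
      refine ENNReal.ofReal_le_ofReal ?_
      calc ‖fderiv ℝ η z‖ ^ 2 ≤ (K / ρ) ^ 2 := by gcongr; exact hηK z
        _ = K ^ 2 * (1 / ρ ^ 2) := by ring
    · rw [indicator_of_notMem hz, enorm_smul, enorm_gradient,
        enorm_fderiv_eq_zero_of_notMem fun h => hz (hηs h)]
      simp
  have hxge : ∫⁻ z in Ω ∩ Metric.ball y ρ, ‖G z‖ₑ ^ 2 ≤ x := by
    calc ∫⁻ z in Ω ∩ Metric.ball y ρ, ‖G z‖ₑ ^ 2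
        = ∫⁻ z in Ω ∩ Metric.ball y ρ, ‖η z • G z‖ₑ ^ 2 :=
          setLIntegral_congr_fun (hΩ.inter Metric.isOpen_ball.measurableSet) fun z hz => by
            simp [hη1 z hz.2]
      _ ≤ x := lintegral_mono_set inter_subset_left
  have hee : e = ∫⁻ z in Ω, ‖gradient v z - G z‖ₑ ^ 2 := by simp only [he, hgU]
  rw [← hee]
  refine hxge.trans (hmain.trans ?_)
  rw [mul_add, mul_assoc (ENNReal.ofReal C) C']
  refine add_le_add ?_ le_rfl
  rw [ENNReal.ofReal_mul hC.le, mul_assoc (ENNReal.ofReal C)]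
  refine mul_le_mul_right ?_ _
  rw [ENNReal.ofReal_add zero_le_one (by positivity), ENNReal.ofReal_one, mul_add]
  refine add_le_add (le_mul_of_one_le_left zero_le le_self_add) (hVle.trans ?_)
  rw [add_mul]
  exact le_add_self

theorem lintegral_enorm_sq_le {X V : Type*} [MeasurableSpace X] {μ : Measure X}
    [NormedAddCommGroup V] {F G : X → V} (hG : AEStronglyMeasurable G μ) :
    ∫⁻ x, ‖F x‖ₑ ^ 2 ∂μ ≤ 2 * ∫⁻ x, ‖G x‖ₑ ^ 2 ∂μ + 2 * ∫⁻ x, ‖F x - G x‖ₑ ^ 2 ∂μ := by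
  have h1 : AEMeasurable (fun x => 2 * ‖G x‖ₑ ^ 2) μ := (hG.enorm.pow_const 2).const_mul 2
  rw [← lintegral_const_mul' _ _ (by simp), ← lintegral_const_mul' _ _ (by simp),
    ← lintegral_add_left' h1]
  refine lintegral_mono fun x => ?_
  refine le_trans ?_ (add_sq_le_two_mul _ _)
  gcongr
  calc ‖F x‖ₑ = ‖G x + (F x - G x)‖ₑ := by rw [add_sub_cancel]
    _ ≤ _ := enorm_add_le _ _

theorem sq_lintegral_enorm_le {X V : Type*} [MeasurableSpace X] {μ : Measure X}
    [NormedAddCommGroup V] {F G : X → V} (hF : AEStronglyMeasurable F μ)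
    (hG : AEStronglyMeasurable G μ) :
    (∫⁻ x, ‖F x‖ₑ ∂μ) ^ 2 ≤
      2 * (∫⁻ x, ‖G x‖ₑ ∂μ) ^ 2 + 2 * (μ univ * ∫⁻ x, ‖F x - G x‖ₑ ^ 2 ∂μ) := by
  have h1 : ∫⁻ x, ‖F x‖ₑ ∂μ ≤ (∫⁻ x, ‖G x‖ₑ ∂μ) + ∫⁻ x, ‖F x - G x‖ₑ ∂μ := by
    rw [← lintegral_add_left' hG.enorm]
    refine lintegral_mono fun x => ?_
    calc ‖F x‖ₑ = ‖G x + (F x - G x)‖ₑ := by rw [add_sub_cancel]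
      _ ≤ _ := enorm_add_le _ _
  have h2 : (∫⁻ x, ‖F x - G x‖ₑ ∂μ) ^ 2 ≤ μ univ * ∫⁻ x, ‖F x - G x‖ₑ ^ 2 ∂μ := by
    have := sq_setLIntegral_le (μ := μ) (f := fun _ => 1) (g := fun x => ‖F x - G x‖ₑ)
      aemeasurable_const (hF.sub hG).enorm
    simpa using this
  calc (∫⁻ x, ‖F x‖ₑ ∂μ) ^ 2 ≤ ((∫⁻ x, ‖G x‖ₑ ∂μ) + ∫⁻ x, ‖F x - G x‖ₑ ∂μ) ^ 2 := by gcongr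
    _ ≤ _ := add_sq_le_two_mul _ _
    _ ≤ _ := by gcongr

/-- The reverse Hölder inequality with an absorbable term. -/
theorem exists_reverse_holder_absorb (d : ℕ) (M : ℝ≥0) {lam : ℝ} (hlam : 0 < lam) {Λ δ : ℝ}
    (hΛ : (M : ℝ) + 5 ≤ Λ) (hδ : 0 < δ) :
    ∃ C : ℝ≥0∞, C ≠ ∞ ∧ ∀ {γ : ℝ}, 1 < γ → γ * d ≤ 2 * (d + 1) → ∃ C' : ℝ≥0∞, C' ≠ ∞ ∧
    ∀ {Ω D : Set (E d)} {y : E d} {ρ : ℝ}, LocalGeometry M Λ Ω D y ρ → 0 < ρ →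
    MeasurableSet Ω → ∀ {A : E d → Matrix (Fin (d + 2)) (Fin (d + 2)) ℝ},
    IsEllipticCoeff lam Ω A → ∀ {f u : E d → ℝ} {G : E d → E d},
    AEMeasurable f ((σ d).restrict (neumannPart Ω D)) → IsWeakSolution Ω D A f u G →
    ENNReal.ofReal ρ ^ (d + 2) * ∫⁻ z in Ω ∩ Metric.ball y ρ, ‖G z‖ₑ ^ 2 ≤
      ENNReal.ofReal δ * (ENNReal.ofReal ρ ^ (d + 2) *
        ∫⁻ z in Ω ∩ Metric.ball y (Λ * ρ), ‖G z‖ₑ ^ 2) +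
      C * (∫⁻ z in Ω ∩ Metric.ball y (Λ * ρ), ‖G z‖ₑ) ^ 2 +
      C' * (ENNReal.ofReal ρ ^ (2 * (d + 2 : ℝ) - 2 * (d + 1) * ((γ - 1) / γ)) *
        (∫⁻ z in Metric.ball y (2 * ρ) ∩ neumannPart Ω D, ‖f z‖ₑ ^ (γ / (γ - 1)) ∂(σ d)) ^
          (2 * ((γ - 1) / γ))) := by
  have hM := M.coe_nonneg
  obtain ⟨C, hC, hcac⟩ := exists_caccioppoli_smooth d M hlam
  -- Caccioppoli contributes C, the Poincaré inequality 2(M+3)²ε², and the replacement of ∇v by G a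
  -- factor 2. The product is Qε² ≤ Qε ≤ δ by the choice of ε.
  set Q : ℝ := C * (4 * (M + 3) ^ 2) with hQ
  have hQ0 : 0 < Q := by positivity
  set ε : ℝ := min 1 (δ / Q) with hε
  have hε0 : 0 < ε := lt_min one_pos (by positivity)
  have hε1 : ε ≤ 1 := min_le_left _ _
  have hεδ : Q * ε ^ 2 ≤ δ := by
    have h1 : ε ≤ δ / Q := min_le_right _ _
    rw [le_div_iff₀ hQ0] at h1
    nlinarith
  obtain ⟨K, hK, hpoi⟩ := exists_poincare_const d M hΛ hε0 hε1
  refine ⟨ENNReal.ofReal C * (K * 2), by finiteness, fun {γ} hγ hγd => ?_⟩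
  obtain ⟨C', hC', hcac⟩ := hcac hγ hγd
  refine ⟨C', hC', ?_⟩
  intro Ω D y ρ hLG hρ hΩ A hA f u G hf hsol
  obtain ⟨v, ⟨hv, -, hvG⟩, hvD⟩ := hsol.1.2
  have hGm : AEStronglyMeasurable G (volume.restrict Ω) := hsol.1.1.memLp_grad.1
  set a := ENNReal.ofReal ρ with ha
  have ha0 : a ≠ 0 := by simpa [ha] using hρ
  have hat : a ≠ ∞ := ENNReal.ofReal_ne_top
  set H := Ω ∩ Metric.ball y (Λ * ρ) with hH
  set X := ∫⁻ z in H, ‖G z‖ₑ ^ 2 with hX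
  set Y := ∫⁻ z in H, ‖G z‖ₑ with hY
  set F := ∫⁻ z in Metric.ball y (2 * ρ) ∩ neumannPart Ω D, ‖f z‖ₑ ^ (γ / (γ - 1)) ∂(σ d) with hF
  set e : ℕ → ℝ≥0∞ := fun k => ∫⁻ z in Ω, ‖gradient (v k) z - G z‖ₑ ^ 2 with he
  have he0 : Tendsto e atTop (𝓝 0) := by
    have h1 := ENNReal.Tendsto.pow (n := 2) hvG
    rw [zero_pow two_ne_zero] at h1
    refine h1.congr fun k => ?_
    exact (lintegral_enorm_sq_eq (fun z => gradient (v k) z - G z)).symm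
  have hHv : volume H ≠ ∞ :=
    ne_top_of_le_ne_top measure_ball_lt_top.ne (measure_mono inter_subset_right)
  set q := ENNReal.ofReal (2 * (M + 3) ^ 2 * ε ^ 2) with hq
  set R := a ^ (d + 2) * (C' * (a ^ ((d + 2 : ℝ) - 2 * (d + 1) * ((γ - 1) / γ)) *
    F ^ (2 * ((γ - 1) / γ)))) with hR
  set W := ENNReal.ofReal C * (a ^ (d + 2) + (q * (a ^ (d + 2) * 2) + K * (2 * volume H))) with hW
  -- The k-th approximant of u gives the claim with the error W·e k. The factor W may depend on
  -- everything but k, and e k tends to zero.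
  have hstep : ∀ k, a ^ (d + 2) * ∫⁻ z in Ω ∩ Metric.ball y ρ, ‖G z‖ₑ ^ 2 ≤
      (ENNReal.ofReal C * (q * (a ^ (d + 2) * (2 * X)) + K * (2 * Y ^ 2)) + R) + W * e k := by
    intro k
    have hv1 : ContDiff ℝ 1 (v k) := (hv k).of_le (by exact_mod_cast le_top)
    obtain ⟨c, hc, hpc⟩ := hpoi hLG hρ hΩ hv1 (hvD k)
    have h1 := hcac hLG (by linarith) hρ hΩ hA hf hsol (hv k) (hvD k) hc
    have hgm : AEStronglyMeasurable (gradient (v k)) (volume.restrict H) :=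
      (continuous_gradient hv1).aestronglyMeasurable
    have hGm' : AEStronglyMeasurable G (volume.restrict H) :=
      hGm.mono_measure (Measure.restrict_mono inter_subset_left le_rfl)
    have hek : ∫⁻ z in H, ‖gradient (v k) z - G z‖ₑ ^ 2 ≤ e k := lintegral_mono_set inter_subset_left
    have h2 := (lintegral_enorm_sq_le hGm').trans (add_le_add_right (mul_le_mul_right hek 2) _)
    have h3 := (sq_lintegral_enorm_le hgm hGm').trans
      (add_le_add_right (mul_le_mul_right (mul_le_mul_right hek _) 2) _)
    rw [Measure.restrict_apply_univ] at h3
    simp only [← enorm_gradient] at hpc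
    set P := ∫⁻ z in Ω ∩ Metric.ball y (2 * ρ), ‖v k z - c‖ₑ ^ 2 with hP
    have hinv : ENNReal.ofReal (1 / ρ ^ 2) * a ^ 2 = 1 := by
      rw [ha, ← ENNReal.ofReal_pow hρ.le, ← ENNReal.ofReal_mul (by positivity),
        one_div_mul_cancel (by positivity), ENNReal.ofReal_one]
    calc a ^ (d + 2) * ∫⁻ z in Ω ∩ Metric.ball y ρ, ‖G z‖ₑ ^ 2
        ≤ a ^ (d + 2) * (ENNReal.ofReal C * (e k + ENNReal.ofReal (1 / ρ ^ 2) * P) +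
          C' * (a ^ ((d + 2 : ℝ) - 2 * (d + 1) * ((γ - 1) / γ)) * F ^ (2 * ((γ - 1) / γ)))) :=
          mul_le_mul_right h1 _
      _ = ENNReal.ofReal C * (a ^ (d + 2) * e k + ENNReal.ofReal (1 / ρ ^ 2) *
            (a ^ (d + 2) * P)) + R := by rw [hR]; ring
      _ ≤ ENNReal.ofReal C * (a ^ (d + 2) * e k + ENNReal.ofReal (1 / ρ ^ 2) *
            (a ^ 2 * (q * (a ^ (d + 2) * (2 * X + 2 * e k)) +
              K * (2 * Y ^ 2 + 2 * (volume H * e k))))) + R := by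
          refine add_le_add_left (mul_le_mul_right (add_le_add_right (mul_le_mul_right
            (hpc.trans (mul_le_mul_right ?_ _)) _) _) _) _
          exact add_le_add (mul_le_mul_right (mul_le_mul_right h2 _) _) (mul_le_mul_right h3 _)
      _ = ENNReal.ofReal C * (a ^ (d + 2) * e k + (ENNReal.ofReal (1 / ρ ^ 2) * a ^ 2) *
            (q * (a ^ (d + 2) * (2 * X + 2 * e k)) +
              K * (2 * Y ^ 2 + 2 * (volume H * e k)))) + R := by ring
      _ = _ := by rw [hinv, hW]; ring
  have hWt : W ≠ ∞ := by finiteness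
  have hlim : Tendsto (fun k => (ENNReal.ofReal C * (q * (a ^ (d + 2) * (2 * X)) +
      K * (2 * Y ^ 2)) + R) + W * e k) atTop (𝓝 (ENNReal.ofReal C * (q * (a ^ (d + 2) * (2 * X)) +
      K * (2 * Y ^ 2)) + R)) := by
    have h1 := (ENNReal.Tendsto.const_mul (a := W) he0 (Or.inr hWt)).const_add
      (ENNReal.ofReal C * (q * (a ^ (d + 2) * (2 * X)) + K * (2 * Y ^ 2)) + R)
    rwa [mul_zero, add_zero] at h1
  refine (ge_of_tendsto' hlim hstep).trans ?_
  rw [mul_add]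
  refine add_le_add (add_le_add ?_ (le_of_eq (by ring))) (le_of_eq ?_)
  · have h1 : ENNReal.ofReal C * (q * 2) ≤ ENNReal.ofReal δ := by
      rw [hq, show (2 : ℝ≥0∞) = ENNReal.ofReal 2 by simp, ← ENNReal.ofReal_mul (by positivity),
        ← ENNReal.ofReal_mul hC.le]
      refine ENNReal.ofReal_le_ofReal (le_trans (le_of_eq ?_) hεδ)
      rw [hQ]; ring
    calc ENNReal.ofReal C * (q * (a ^ (d + 2) * (2 * X)))
        = ENNReal.ofReal C * (q * 2) * (a ^ (d + 2) * X) := by ring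
      _ ≤ _ := mul_le_mul_left h1 _
  · have h1 : a ^ (2 * (d + 2 : ℝ) - 2 * (d + 1) * ((γ - 1) / γ)) =
        a ^ (d + 2) * a ^ ((d + 2 : ℝ) - 2 * (d + 1) * ((γ - 1) / γ)) := by
      rw [← ENNReal.rpow_natCast, ← ENNReal.rpow_add _ _ ha0 hat]
      congr 1; push_cast; ring
    rw [h1, hR]; ring

/-! ### Removing the absorbable term -/

/-- Scaling reduces to the unit ball, which is totally bounded. A net of mesh ε/2 is used so that
its points can be replaced by points of A at the cost of doubling the radius; the centres have to
lie in Ω, where the inequalities are available. -/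
theorem exists_cover_card (d : ℕ) {ε : ℝ} (hε : 0 < ε) : ∃ N : ℕ, ∀ (z : E d) {τ : ℝ}, 0 < τ →
    ∀ A ⊆ Metric.ball z τ, ∃ t : Finset (E d), (t : Set (E d)) ⊆ A ∧ t.card ≤ N ∧
      A ⊆ ⋃ p ∈ t, Metric.ball p (ε * τ) := by
  classical
  obtain ⟨T, hTf, hT⟩ := Metric.totallyBounded_iff.1
    ((isCompact_closedBall (0 : E d) 1).totallyBounded) (ε / 2) (by positivity)
  refine ⟨hTf.toFinset.card, fun z τ hτ A hA => ?_⟩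
  let P : E d → Prop := fun p => (A ∩ Metric.ball (z + τ • p) (ε / 2 * τ)).Nonempty
  let c : E d → E d := fun p => if h : P p then h.some else z
  have hc : ∀ p, P p → c p ∈ A ∩ Metric.ball (z + τ • p) (ε / 2 * τ) := fun p hp => by
    simp only [c, dif_pos hp]; exact hp.some_mem
  refine ⟨(hTf.toFinset.filter P).image c, ?_, ?_, ?_⟩
  · intro q hq
    simp only [Finset.coe_image, mem_image, Finset.mem_coe, Finset.mem_filter] at hq
    obtain ⟨p, ⟨-, hp⟩, rfl⟩ := hq
    exact (hc p hp).1
  · exact Finset.card_image_le.trans (Finset.card_filter_le _ _)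
  · intro q hq
    have h1 : τ⁻¹ • (q - z) ∈ Metric.closedBall (0 : E d) 1 := by
      have h2 := hA hq
      rw [Metric.mem_ball, dist_eq_norm] at h2
      rw [mem_closedBall_zero_iff, norm_smul, norm_inv, Real.norm_of_nonneg hτ.le,
        inv_mul_le_iff₀ hτ]
      linarith
    obtain ⟨p, hpT, hp⟩ := mem_iUnion₂.1 (hT h1)
    have hq2 : q ∈ Metric.ball (z + τ • p) (ε / 2 * τ) := by
      rw [Metric.mem_ball, dist_eq_norm] at hp ⊢
      have : q - (z + τ • p) = τ • (τ⁻¹ • (q - z) - p) := by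
        rw [smul_sub, smul_smul, mul_inv_cancel₀ hτ.ne', one_smul]; abel
      rw [this, norm_smul, Real.norm_of_nonneg hτ.le, mul_comm]
      gcongr
    have hPp : P p := ⟨q, hq, hq2⟩
    refine mem_iUnion₂.2 ⟨c p, Finset.mem_image_of_mem c
      (Finset.mem_filter.2 ⟨hTf.mem_toFinset.2 hpT, hPp⟩), ?_⟩
    have h3 := (hc p hPp).2
    rw [Metric.mem_ball] at *
    calc dist q (c p) ≤ dist q (z + τ • p) + dist (c p) (z + τ • p) := dist_triangle_right _ _ _
      _ < ε / 2 * τ + ε / 2 * τ := add_lt_add hq2 h3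
      _ = ε * τ := by ring

theorem setLIntegral_le_sum_of_cover {X : Type*} [MeasurableSpace X] {μ : Measure X} {s : Set X}
    (hs : MeasurableSet s) {ι : Type*} (t : Finset ι) {B : ι → Set X}
    (hB : ∀ i ∈ t, MeasurableSet (B i)) {g : X → ℝ≥0∞}
    (h : ∀ z ∈ s, g z ≠ 0 → z ∈ ⋃ i ∈ t, B i) :
    ∫⁻ z in s, g z ∂μ ≤ ∑ i ∈ t, ∫⁻ z in B i, g z ∂μ := by
  have hU : MeasurableSet (⋃ i ∈ t, B i) := Finset.measurableSet_biUnion _ hB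
  calc ∫⁻ z in s, g z ∂μ = ∫⁻ z in s, (⋃ i ∈ t, B i).indicator g z ∂μ := by
        refine setLIntegral_congr_fun hs fun z hz => ?_
        by_cases h0 : g z = 0
        · rw [h0]; by_cases hz' : z ∈ ⋃ i ∈ t, B i
          · rw [indicator_of_mem hz', h0]
          · rw [indicator_of_notMem hz']
        · rw [indicator_of_mem (h z hz h0)]
    _ ≤ ∫⁻ z, (⋃ i ∈ t, B i).indicator g z ∂μ := setLIntegral_le_lintegral _ _
    _ = ∫⁻ z in ⋃ i ∈ t, B i, g z ∂μ := lintegral_indicator hU _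
    _ ≤ ∫⁻ z, g z ∂(∑ i ∈ t, μ.restrict (B i)) := by
        refine lintegral_mono' (Measure.le_iff.2 fun A hA => ?_) le_rfl
        rw [Measure.restrict_apply hA, Measure.finsetSum_apply, inter_iUnion₂]
        refine (measure_biUnion_finset_le _ _).trans (Finset.sum_le_sum fun i _ => ?_)
        rw [Measure.restrict_apply hA]
    _ = _ := lintegral_finsetSum_measure _ _ _

/-- A reverse Hölder inequality holds without the absorbable term on the right. -/
theorem exists_reverse_holder_of_absorb (d : ℕ) {Λ : ℝ} (hΛ : 2 ≤ Λ) :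
    ∃ δ : ℝ, 0 < δ ∧ ∃ K : ℝ≥0∞, K ≠ ∞ ∧ ∀ {Ω : Set (E d)} {g : E d → ℝ≥0∞} {C C' : ℝ≥0∞}
    {Φ : Set (E d) → ℝ≥0∞} {β r₀ : ℝ}, (∀ z ∉ Ω, g z = 0) → ∫⁻ z, g z ^ 2 ≠ ∞ →
    Monotone Φ → 0 ≤ β → (∀ y ∈ Ω, ∀ ρ, 0 < ρ → Λ * ρ ≤ r₀ →
      ENNReal.ofReal ρ ^ (d + 2) * ∫⁻ z in Metric.ball y ρ, g z ^ 2 ≤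
      ENNReal.ofReal δ * (ENNReal.ofReal ρ ^ (d + 2) * ∫⁻ z in Metric.ball y (Λ * ρ), g z ^ 2) +
      C * (∫⁻ z in Metric.ball y (Λ * ρ), g z) ^ 2 +
      C' * (ENNReal.ofReal ρ ^ β * Φ (Metric.ball y (2 * ρ)))) →
    ∀ y ∈ Ω, ∀ ρ, 0 < ρ → ρ ≤ r₀ →
      ENNReal.ofReal ρ ^ (d + 2) * ∫⁻ z in Metric.ball y ρ, g z ^ 2 ≤
      K * C * (∫⁻ z in Metric.ball y (2 * ρ), g z) ^ 2 +
      K * C' * (ENNReal.ofReal ρ ^ β * Φ (Metric.ball y (2 * ρ))) := by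
  have hΛ0 : 0 < Λ := by linarith
  -- With this ε the Λ-fold dilate of a covering ball has radius τ/2, so it belongs to the family
  -- `J` again.
  set ε : ℝ := 1 / (2 * Λ) with hε
  have hε0 : 0 < ε := by positivity
  have hεΛ : Λ * ε = 1 / 2 := by rw [hε]; field_simp
  obtain ⟨N, hN⟩ := exists_cover_card d hε0
  -- The number of covering balls, increased by one, times the loss from comparing the powers of τ
  -- and ετ. With δ = 1/(2P) exactly half of the supremum comes back.
  set P : ℝ := (N + 1) * (1 / ε) ^ (d + 2) with hP
  have hP0 : 0 < P := by positivity
  refine ⟨1 / (2 * P), by positivity, 2 * ENNReal.ofReal P, by finiteness, ?_⟩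
  intro Ω g C C' Φ β r₀ hg0 hg2 hΦ hβ hrh y hy ρ hρ hρr
  set Y := C * (∫⁻ z in Metric.ball y (2 * ρ), g z) ^ 2 +
      C' * (ENNReal.ofReal ρ ^ β * Φ (Metric.ball y (2 * ρ))) with hY
  -- The supremum runs over balls that shrink towards the edge of the ball of radius 2ρ about y, so
  -- the dilates of the covering balls never leave it. The factor τ^(d+2) makes the small balls
  -- harmless, and the supremum is finite because g² is integrable.
  let J : Set (E d × ℝ) := {p | p.1 ∈ Ω ∧ 0 < p.2 ∧ 2 * p.2 ≤ 2 * ρ - dist p.1 y}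
  let q : E d × ℝ → ℝ≥0∞ := fun p =>
    ENNReal.ofReal p.2 ^ (d + 2) * ∫⁻ z in Metric.ball p.1 p.2, g z ^ 2
  set S := ⨆ p ∈ J, q p with hS
  have hJρ : ∀ p ∈ J, p.2 ≤ ρ := fun p hp => by
    have := dist_nonneg (x := p.1) (y := y); linarith [hp.2.2]
  have hSfin : S ≠ ∞ := by
    refine ne_top_of_le_ne_top (b := ENNReal.ofReal ρ ^ (d + 2) * ∫⁻ z, g z ^ 2) (by finiteness)
      (iSup₂_le fun p hp => ?_)
    have := hJρ p hp
    exact mul_le_mul' (by gcongr) (setLIntegral_le_lintegral _ _)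
  have hkey : S ≤ (1 / 2) * S + ENNReal.ofReal P * Y := by
    refine iSup₂_le fun p hp => ?_
    obtain ⟨z, τ⟩ := p
    obtain ⟨hz, hτ, hzτ⟩ := hp
    have hτρ : τ ≤ ρ := hJρ (z, τ) ⟨hz, hτ, hzτ⟩
    simp only at hz hτ hzτ
    obtain ⟨t, htA, htN, htc⟩ := hN z hτ (Ω ∩ Metric.ball z τ) inter_subset_right
    have h1 : ∫⁻ w in Metric.ball z τ, g w ^ 2 ≤
        ∑ p ∈ t, ∫⁻ w in Metric.ball p (ε * τ), g w ^ 2 := by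
      refine setLIntegral_le_sum_of_cover Metric.isOpen_ball.measurableSet t
        (fun p _ => Metric.isOpen_ball.measurableSet) fun w hw hgw => htc ⟨?_, hw⟩
      by_contra hwΩ
      exact hgw (by simp [hg0 w hwΩ])
    have hετ : 0 < ε * τ := by positivity
    have hΛετ : Λ * (ε * τ) = τ / 2 := by rw [← mul_assoc, hεΛ]; ring
    have h2 : ∀ p ∈ t, ENNReal.ofReal (ε * τ) ^ (d + 2) *
        ∫⁻ w in Metric.ball p (ε * τ), g w ^ 2 ≤ ENNReal.ofReal (1 / (2 * P)) * S + Y := by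
      intro p hp
      have hpA := htA hp
      have hpy : dist p y ≤ 2 * ρ - τ := by
        have h3 := dist_triangle p z y
        have h4 := Metric.mem_ball.1 hpA.2
        linarith
      have hsub : ∀ r, r ≤ τ → Metric.ball p r ⊆ Metric.ball y (2 * ρ) := fun r hr =>
        Metric.ball_subset_ball' (by linarith)
      have h3 := hrh p hpA.1 (ε * τ) hετ (by rw [hΛετ]; linarith)
      refine h3.trans ?_
      rw [hY, add_assoc]
      have h2ετ : 2 * (ε * τ) ≤ τ := by nlinarith
      have hετρ : ε * τ ≤ ρ := by linarith
      refine add_le_add (mul_le_mul_right ?_ _) (add_le_add (mul_le_mul_right ?_ _)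
        (mul_le_mul_right (mul_le_mul' ?_ ?_) _))
      · have h4 : (p, Λ * (ε * τ)) ∈ J := ⟨hpA.1, by positivity, by simp only; rw [hΛετ]; linarith⟩
        refine le_trans ?_ (le_iSup₂ (f := fun p (_ : p ∈ J) => q p) _ h4)
        simp only [q]
        exact mul_le_mul_left (pow_le_pow_left' (ENNReal.ofReal_le_ofReal (by nlinarith)) _) _
      · gcongr
        exact hsub _ (by rw [hΛετ]; linarith)
      · exact ENNReal.rpow_le_rpow (ENNReal.ofReal_le_ofReal hετρ) hβ
      · exact hΦ (hsub _ h2ετ)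
    have h3 : ENNReal.ofReal τ ^ (d + 2) =
        ENNReal.ofReal ((1 / ε) ^ (d + 2)) * ENNReal.ofReal (ε * τ) ^ (d + 2) := by
      rw [ENNReal.ofReal_pow (by positivity), ← mul_pow, ← ENNReal.ofReal_mul (by positivity)]
      congr 2; field_simp
    calc q (z, τ) ≤ ENNReal.ofReal τ ^ (d + 2) * ∑ p ∈ t, ∫⁻ w in Metric.ball p (ε * τ), g w ^ 2 :=
          mul_le_mul_right h1 _
      _ = ENNReal.ofReal ((1 / ε) ^ (d + 2)) * ∑ p ∈ t, ENNReal.ofReal (ε * τ) ^ (d + 2) *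
            ∫⁻ w in Metric.ball p (ε * τ), g w ^ 2 := by
          rw [h3, mul_assoc, Finset.mul_sum]
      _ ≤ ENNReal.ofReal ((1 / ε) ^ (d + 2)) *
            (t.card • (ENNReal.ofReal (1 / (2 * P)) * S + Y)) :=
          mul_le_mul_right (Finset.sum_le_card_nsmul _ _ _ h2) _
      _ ≤ ENNReal.ofReal ((1 / ε) ^ (d + 2)) *
            (ENNReal.ofReal (N + 1) * (ENNReal.ofReal (1 / (2 * P)) * S + Y)) := by
          rw [nsmul_eq_mul]
          gcongr
          rw [← ENNReal.ofReal_natCast]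
          refine ENNReal.ofReal_le_ofReal ?_
          have : (t.card : ℝ) ≤ N := by exact_mod_cast htN
          linarith
      _ = ENNReal.ofReal P * (ENNReal.ofReal (1 / (2 * P)) * S + Y) := by
          rw [← mul_assoc, ← ENNReal.ofReal_mul (by positivity), hP, mul_comm ((1 / ε) ^ (d + 2))]
      _ = (1 / 2) * S + ENNReal.ofReal P * Y := by
          rw [mul_add, ← mul_assoc, ← ENNReal.ofReal_mul hP0.le]
          congr 2
          rw [show P * (1 / (2 * P)) = 1 / 2 by field_simp,
            ENNReal.ofReal_div_of_pos two_pos]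
          simp
  have hS2 : S ≤ 2 * (ENNReal.ofReal P * Y) := by
    have h1 : (1 / 2) * S + (1 / 2) * S ≤ (1 / 2) * S + ENNReal.ofReal P * Y := by
      rw [← add_mul, ENNReal.add_halves, one_mul]; exact hkey
    have h2 : (1 / 2 : ℝ≥0∞) * S ≤ ENNReal.ofReal P * Y :=
      (ENNReal.add_le_add_iff_left (by finiteness)).1 h1
    calc S = 2 * ((1 / 2) * S) := by
          rw [← mul_assoc, one_div, ENNReal.mul_inv_cancel two_ne_zero (by simp), one_mul]
      _ ≤ _ := mul_le_mul_right h2 _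
  have hmem : (y, ρ) ∈ J := ⟨hy, hρ, by simp⟩
  refine (le_iSup₂ (f := fun p (_ : p ∈ J) => q p) _ hmem).trans (hS2.trans (le_of_eq ?_))
  rw [hY]; ring

/-! ### Gehring's lemma: the level sets -/

/-- The power of the (normalized) distance to the complement of the ball of radius `2R` about `x`
by which functions are weighted. -/
noncomputable def wt (x : E d) (R : ℝ) (y : E d) : ℝ≥0∞ :=
  ENNReal.ofReal (2 - dist y x / R) ^ (d + 2)

theorem continuous_wt (x : E d) (R : ℝ) : Continuous (wt x R) := by
  unfold wt
  exact (ENNReal.continuous_pow _).comp (ENNReal.continuous_ofReal.comp (by fun_prop))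

theorem wt_ne_top (x : E d) (R : ℝ) (y : E d) : wt x R y ≠ ∞ := by unfold wt; finiteness

theorem wt_eq_zero {x : E d} {R : ℝ} (hR : 0 < R) {y : E d} (hy : y ∉ Metric.ball x (2 * R)) :
    wt x R y = 0 := by
  rw [Metric.mem_ball, not_lt] at hy
  have h1 : 2 ≤ dist y x / R := by rwa [le_div_iff₀ hR]
  rw [wt, ENNReal.ofReal_of_nonpos (by linarith), zero_pow (by simp)]

theorem wt_le {x : E d} {R : ℝ} (hR : 0 < R) (y : E d) : wt x R y ≤ 2 ^ (d + 2) := by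
  unfold wt
  gcongr
  refine (ENNReal.ofReal_le_ofReal (q := 2) ?_).trans (by simp)
  have : 0 ≤ dist y x / R := by positivity
  linarith

theorem one_le_wt {x : E d} {R : ℝ} (hR : 0 < R) {y : E d} (hy : y ∈ Metric.ball x R) :
    1 ≤ wt x R y := by
  unfold wt
  refine one_le_pow₀ ?_
  rw [← ENNReal.ofReal_one]
  refine ENNReal.ofReal_le_ofReal ?_
  have : dist y x / R ≤ 1 := by rw [div_le_one hR]; exact (Metric.mem_ball.1 hy).le
  linarith

theorem ofReal_le_two_mul {a b : ℝ} (h : a ≤ 2 * b) :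
    ENNReal.ofReal a ≤ 2 * ENNReal.ofReal b := by
  refine (ENNReal.ofReal_le_ofReal h).trans ?_
  rw [ENNReal.ofReal_mul zero_le_two]; simp

/-- The hypothesis keeps z within half the distance from y to the edge of the ball of radius 2R, so
the two distances to the edge differ by at most a factor 2. -/
theorem wt_le_wt {x : E d} {R : ℝ} (hR : 0 < R) {y z : E d}
    (h : dist z y ≤ R * (2 - dist y x / R) / 2) :
    wt x R z ≤ 2 ^ (d + 2) * wt x R y ∧ wt x R y ≤ 2 ^ (d + 2) * wt x R z := by
  have h1 : |dist z x - dist y x| ≤ dist z y := abs_dist_sub_le _ _ _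
  have h2 : dist z y / R ≤ (2 - dist y x / R) / 2 := by
    rw [div_le_iff₀ hR]; linarith
  have h3 : |dist z x / R - dist y x / R| ≤ dist z y / R := by
    rw [← sub_div, abs_div, abs_of_pos hR]; gcongr
  rw [abs_le] at h3
  have h0 : 0 ≤ dist z y / R := by positivity
  unfold wt
  rw [← mul_pow, ← mul_pow]
  constructor <;> exact pow_le_pow_left' (ofReal_le_two_mul (by linarith)) _

/-- A stopping time along dyadic radii: at small radii the weighted mean of g² exceeds A² since y is
a Lebesgue point, while at the first few radii it cannot, A being above the global level in the last
hypothesis. At the first radius where it does, the mean is large, but not on the ball 32 times as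
large. -/
theorem exists_stopping_radius {g : E d → ℝ≥0∞} {x y : E d} {R κ : ℝ} (hR : 0 < R) (hκ : 0 < κ)
    (hκ1 : κ ≤ 1 / 2) (hy : y ∈ Metric.ball x (2 * R)) {A : ℝ≥0∞}
    (hlim : Tendsto (fun r => (∫⁻ z in Metric.closedBall y r, g z ^ 2) /
      volume (Metric.closedBall y r)) (𝓝[>] 0) (𝓝 (g y ^ 2)))
    (hA : A < wt x R y * g y)
    (h0 : 64 ^ (d + 2) * ∫⁻ z in Metric.ball x (2 * R), g z ^ 2 ≤
      volume (Metric.ball (0 : E d) 1) * A ^ 2 * ENNReal.ofReal (κ * R) ^ (d + 2)) :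
    ∃ ρ : ℝ, 0 < ρ ∧ 16 * ρ ≤ κ * R * (2 - dist y x / R) ∧
      volume (Metric.ball (0 : E d) 1) * A ^ 2 * ENNReal.ofReal ρ ^ (d + 2) ≤
        2 ^ (d + 2) * wt x R y ^ 2 * ∫⁻ z in Metric.ball y ρ, g z ^ 2 ∧
      wt x R y ^ 2 * ∫⁻ z in Metric.ball y (16 * ρ), g z ^ 2 ≤
        volume (Metric.ball (0 : E d) 1) * A ^ 2 * ENNReal.ofReal (16 * ρ) ^ (d + 2) := by
  classical
  set ω := volume (Metric.ball (0 : E d) 1) with hω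
  have hω0 : ω ≠ 0 := (Metric.measure_ball_pos _ _ one_pos).ne'
  have hωt : ω ≠ ∞ := measure_ball_lt_top.ne
  set D : ℝ := 2 - dist y x / R with hD
  have hD0 : 0 < D := by
    have : dist y x / R < 2 := by rw [div_lt_iff₀ hR]; exact Metric.mem_ball.1 hy
    linarith
  have hD2 : D ≤ 2 := by
    have : 0 ≤ dist y x / R := by positivity
    linarith
  set w := wt x R y with hw
  have hwt : w ≠ ∞ := wt_ne_top _ _ _
  set r : ℕ → ℝ := fun j => κ * R * D / 2 ^ j with hr
  have hr0 : ∀ j, 0 < r j := fun j => by positivity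
  let p : ℕ → Prop := fun j =>
    ω * A ^ 2 * ENNReal.ofReal (r j) ^ (d + 2) < w ^ 2 * ∫⁻ z in Metric.closedBall y (r j), g z ^ 2
  have hex : ∃ j, p j := by
    have hrt : Tendsto r atTop (𝓝[>] 0) := by
      refine tendsto_nhdsWithin_iff.2 ⟨?_, Eventually.of_forall hr0⟩
      have h1 := (tendsto_pow_atTop_nhds_zero_of_lt_one (r := (1 / 2 : ℝ)) (by norm_num)
        (by norm_num)).const_mul (κ * R * D)
      rw [mul_zero] at h1
      refine h1.congr fun j => ?_
      rw [hr, one_div, inv_pow]; rfl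
    have h1 := ENNReal.Tendsto.const_mul (a := w ^ 2) (hlim.comp hrt)
      (Or.inr (ENNReal.pow_ne_top hwt))
    rw [← mul_pow] at h1
    have h2 : A ^ 2 < (w * g y) ^ 2 := ENNReal.pow_lt_pow_left two_ne_zero hA
    obtain ⟨j, hj⟩ := (h1.eventually (lt_mem_nhds h2)).exists
    refine ⟨j, ?_⟩
    simp only [Function.comp_apply] at hj
    rw [volume_closedBall_eq y (hr0 j), ← mul_div_assoc, ENNReal.lt_div_iff_mul_lt
      (Or.inl (by have := hr0 j; positivity)) (Or.inl (by finiteness))] at hj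
    refine lt_of_eq_of_lt ?_ hj
    ring
  -- The constant 64 is 32·2: the radius has been halved at most five times, and one of the two
  -- factors w is bounded by 2^(d+2).
  have hinit : ∀ i ≤ 5, ¬ p i := by
    intro i hi
    simp only [p, not_lt]
    have hsub : Metric.closedBall y (r i) ⊆ Metric.ball x (2 * R) := by
      refine Metric.closedBall_subset_ball' ?_
      have h1 : r i ≤ κ * R * D := div_le_self (by positivity) (one_le_pow₀ one_le_two)
      have h2 : R * D = 2 * R - dist y x := by rw [hD]; field_simp
      have h3 : 0 < R * D := by positivity
      nlinarith
    have h1 : ∫⁻ z in Metric.closedBall y (r i), g z ^ 2 ≤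
        ∫⁻ z in Metric.ball x (2 * R), g z ^ 2 := lintegral_mono_set hsub
    set X := ∫⁻ z in Metric.ball x (2 * R), g z ^ 2 with hX
    have h2 : ENNReal.ofReal (κ * R) ^ (d + 2) * w ≤ 32 ^ (d + 2) * ENNReal.ofReal (r i) ^ (d + 2) := by
      rw [hw, wt, ← hD, ← mul_pow, ← mul_pow, ← ENNReal.ofReal_mul (by positivity),
        show (32 : ℝ≥0∞) = ENNReal.ofReal 32 by simp, ← ENNReal.ofReal_mul (by norm_num)]
      refine pow_le_pow_left' (ENNReal.ofReal_le_ofReal ?_) _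
      have h3 : (2 : ℝ) ^ i ≤ 2 ^ 5 := pow_le_pow_right₀ one_le_two hi
      rw [hr]
      simp only
      rw [← mul_div_assoc, le_div_iff₀ (by positivity)]
      have : 0 < κ * R * D := by positivity
      nlinarith
    have h32 : (32 : ℝ≥0∞) ^ (d + 2) ≠ 0 := by positivity
    refine (ENNReal.mul_le_mul_iff_right h32 (by finiteness)).1 ?_
    calc 32 ^ (d + 2) * (w ^ 2 * ∫⁻ z in Metric.closedBall y (r i), g z ^ 2)
        ≤ 32 ^ (d + 2) * (w * 2 ^ (d + 2) * X) := by
          rw [sq]; gcongr; exact wt_le hR y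
      _ = w * (64 ^ (d + 2) * X) := by
          rw [show (64 : ℝ≥0∞) = 32 * 2 by norm_num, mul_pow]; ring
      _ ≤ w * (ω * A ^ 2 * ENNReal.ofReal (κ * R) ^ (d + 2)) := mul_le_mul_right h0 _
      _ = ω * A ^ 2 * (ENNReal.ofReal (κ * R) ^ (d + 2) * w) := by ring
      _ ≤ ω * A ^ 2 * (32 ^ (d + 2) * ENNReal.ofReal (r i) ^ (d + 2)) := mul_le_mul_right h2 _
      _ = _ := by ring
  set j := Nat.find hex with hj
  have hj6 : 5 < j := by
    by_contra hlt
    exact hinit j (not_lt.1 hlt) (Nat.find_spec hex)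
  have hpj : p j := Nat.find_spec hex
  have hpj5 : ¬ p (j - 5) := Nat.find_min hex (by omega)
  -- Five steps back multiply the radius by 32. With ρ = 2 r j this is 16ρ; the factor 2 in ρ is
  -- used to pass from the closed ball of radius r j to an open ball.
  have hr5 : r (j - 5) = 16 * (2 * r j) := by
    obtain ⟨i, hi⟩ : ∃ i, j = i + 5 := ⟨j - 5, by omega⟩
    rw [hi, Nat.add_sub_cancel, hr]
    simp only [pow_add]
    field_simp
    norm_num
  refine ⟨2 * r j, by have := hr0 j; positivity, ?_, ?_, ?_⟩
  · rw [← hr5]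
    exact div_le_self (by positivity) (one_le_pow₀ one_le_two)
  · rw [ENNReal.ofReal_mul zero_le_two, mul_pow]
    calc ω * A ^ 2 * (ENNReal.ofReal 2 ^ (d + 2) * ENNReal.ofReal (r j) ^ (d + 2))
        = 2 ^ (d + 2) * (ω * A ^ 2 * ENNReal.ofReal (r j) ^ (d + 2)) := by
          simp only [ENNReal.ofReal_ofNat]; ring
      _ ≤ 2 ^ (d + 2) * (w ^ 2 * ∫⁻ z in Metric.closedBall y (r j), g z ^ 2) :=
          mul_le_mul_right hpj.le _
      _ ≤ 2 ^ (d + 2) * (w ^ 2 * ∫⁻ z in Metric.ball y (2 * r j), g z ^ 2) := by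
          gcongr
          exact Metric.closedBall_subset_ball (by linarith [hr0 j])
      _ = _ := by ring
  · rw [← hr5]
    refine le_trans ?_ (not_lt.1 hpj5)
    gcongr
    exact Metric.ball_subset_closedBall

theorem sq_mul_le_cases {c u v p q : ℝ≥0∞} (h : c ≤ u * (p + q)) (hv : v = 2 * u) :
    c ≤ v * p ∨ c ≤ v * q := by
  rw [hv, mul_comm 2, mul_assoc, mul_assoc, two_mul, two_mul]
  rcases le_total p q with hpq | hpq
  · exact Or.inr (h.trans (by gcongr))
  · exact Or.inl (h.trans (by gcongr))

theorem le_two_mul_of_le_add_half {a b c : ℝ≥0∞} (ha : a ≠ ∞) (hc : c ≤ 1 / 2)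
    (h : a ≤ b + c * a) : a ≤ 2 * b := by
  have h1 : (1 / 2) * a + (1 / 2) * a ≤ b + (1 / 2) * a := by
    rw [← add_mul, ENNReal.add_halves, one_mul]
    exact h.trans (by gcongr)
  have h2 : (1 / 2 : ℝ≥0∞) * a ≤ b := (ENNReal.add_le_add_iff_right (by finiteness)).1 h1
  calc a = 2 * ((1 / 2) * a) := by
        rw [← mul_assoc, one_div, ENNReal.mul_inv_cancel two_ne_zero (by simp), one_mul]
    _ ≤ _ := mul_le_mul_right h2 _

theorem exists_mul_le_half {Q : ℝ≥0∞} (hQ : Q ≠ ∞) :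
    ∃ ε : ℝ, 0 < ε ∧ ε ≤ 1 ∧ Q * ENNReal.ofReal ε ≤ 1 / 2 := by
  have hq := Q.toReal_nonneg
  have hpos : 0 < 2 * (Q.toReal + 1) := by positivity
  refine ⟨1 / (2 * (Q.toReal + 1)), by positivity, ?_, ?_⟩
  · rw [div_le_one hpos]; linarith
  · rw [← ENNReal.ofReal_toReal hQ, ← ENNReal.ofReal_mul ENNReal.toReal_nonneg,
      ENNReal.toReal_ofReal hq, show (1 / 2 : ℝ≥0∞) = ENNReal.ofReal (1 / 2) by
        rw [ENNReal.ofReal_div_of_pos two_pos]; simp]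
    refine ENNReal.ofReal_le_ofReal ?_
    rw [mul_one_div, div_le_div_iff₀ hpos two_pos]; linarith

theorem setLIntegral_le_add {X : Type*} [MeasurableSpace X] {μ : Measure X} {B : Set X}
    {F h : X → ℝ≥0∞} (hh : Measurable h) {c C : ℝ≥0∞}
    (hFC : ∀ z, h z ≤ c → F z ≤ C) :
    ∫⁻ z in B, F z ∂μ ≤ (∫⁻ z in B ∩ {z | c < h z}, F z ∂μ) + C * μ B := by
  have hm : MeasurableSet {z | c < h z} := measurableSet_lt measurable_const hh
  rw [inter_comm, ← Measure.restrict_restrict hm, ← lintegral_indicator hm,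
    ← setLIntegral_const, ← lintegral_add_right _ measurable_const]
  refine lintegral_mono fun z => ?_
  by_cases hz : z ∈ {z | c < h z}
  · rw [indicator_of_mem hz]; exact le_self_add
  · rw [indicator_of_notMem hz, zero_add]
    exact hFC z (not_lt.1 hz)

/-- At points where the weighted function is large there are balls where a reverse Hölder
inequality gains. -/
theorem exists_good_ball_const (d : ℕ) {C₁ : ℝ≥0∞} (hC₁ : C₁ ≠ ∞) :
    ∃ (K : ℝ≥0∞) (ε : ℝ), K ≠ ∞ ∧ 0 < ε ∧ ε ≤ 1 ∧ ∀ {C₂ C₃ : ℝ≥0∞} {s : ℝ}, C₂ ≠ ∞ → C₃ ≠ ∞ → 1 ≤ s →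
    ∃ (K' : ℝ≥0∞) (ε' : ℝ), K' ≠ ∞ ∧ 0 < ε' ∧ ∀ {g f : E d → ℝ≥0∞} {μ : Measure (E d)} {x y : E d}
    {R κ : ℝ} {A : ℝ≥0∞}, Measurable g → Measurable f → 0 < R → 0 < κ → κ ≤ 1 / 2 →
    (∀ ρ, 0 < ρ → ρ ≤ κ * R → ENNReal.ofReal ρ ^ (d + 2) * ∫⁻ z in Metric.ball y ρ, g z ^ 2 ≤
      C₁ * (∫⁻ z in Metric.ball y (2 * ρ), g z) ^ 2 +
      C₂ * (ENNReal.ofReal ρ ^ (2 * (d + 2 : ℝ) - 2 * (d + 1) * (1 / s)) *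
        (∫⁻ z in Metric.ball y (2 * ρ), f z ^ s ∂μ) ^ (2 * (1 / s)))) →
    (∀ ρ, 0 < ρ → ρ ≤ κ * R → μ (Metric.ball y (2 * ρ)) ≤ C₃ * ENNReal.ofReal ρ ^ (d + 1)) →
    y ∈ Metric.ball x (2 * R) →
    Tendsto (fun r => (∫⁻ z in Metric.closedBall y r, g z ^ 2) /
      volume (Metric.closedBall y r)) (𝓝[>] 0) (𝓝 (g y ^ 2)) →
    A ≠ 0 → A < wt x R y * g y →
    64 ^ (d + 2) * ∫⁻ z in Metric.ball x (2 * R), g z ^ 2 ≤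
      volume (Metric.ball (0 : E d) 1) * A ^ 2 * ENNReal.ofReal (κ * R) ^ (d + 2) →
    ∃ ρ : ℝ, 0 < ρ ∧ ρ ≤ κ * R ∧
      ∫⁻ z in Metric.ball y (16 * ρ), (wt x R z * g z) ^ 2 ≤
        K * A ^ 2 * ENNReal.ofReal ρ ^ (d + 2) ∧
      (A * ENNReal.ofReal ρ ^ (d + 2) ≤
          K * ∫⁻ z in Metric.ball y (2 * ρ) ∩ {z | ENNReal.ofReal ε * A < wt x R z * g z},
            wt x R z * g z ∨
        A ^ s * ENNReal.ofReal ρ ^ (d + 1) ≤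
          K' * ∫⁻ z in Metric.ball y (2 * ρ) ∩ {z | ENNReal.ofReal ε' * A < wt x R z * f z},
            (wt x R z * f z) ^ s ∂μ) := by
  set ω := volume (Metric.ball (0 : E d) 1) with hω
  have hω0 : ω ≠ 0 := (Metric.measure_ball_pos _ _ one_pos).ne'
  have hωt : ω ≠ ∞ := measure_ball_lt_top.ne
  -- The summand 1 ensures Q ≤ Q², so that square roots can be taken without fractional powers.
  set Q : ℝ≥0∞ := 2 ^ (d + 3) * C₁ / ω + 1 with hQ
  have hQt : Q ≠ ∞ := by
    have : 2 ^ (d + 3) * C₁ / ω ≠ ∞ := ENNReal.div_ne_top (by finiteness) hω0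
    finiteness
  -- The part of the integral where wg ≤ εA is at most εA times the volume of the ball; this ε makes
  -- it at most half of the left side.
  obtain ⟨ε, hε0, hε1, hε⟩ := exists_mul_le_half (Q := Q * 2 ^ (d + 2) * (2 ^ (d + 2) * ω))
    (by finiteness)
  refine ⟨4 ^ (d + 2) * ω * 16 ^ (d + 2) + 2 * (Q * 2 ^ (d + 2)), ε, by finiteness, hε0, hε1, ?_⟩
  set K := 4 ^ (d + 2) * ω * 16 ^ (d + 2) + 2 * (Q * 2 ^ (d + 2)) with hK
  intro C₂ C₃ s hC₂ hC₃ hs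
  have hs0 : 0 < s := by linarith
  set Q' : ℝ≥0∞ := (2 ^ (d + 3) * C₂ / ω) ^ (s / 2) with hQ'
  have hQt' : Q' ≠ ∞ := by
    have : 2 ^ (d + 3) * C₂ / ω ≠ ∞ := ENNReal.div_ne_top (by finiteness) hω0
    exact ENNReal.rpow_ne_top_of_nonneg (by positivity) this
  set P : ℝ≥0∞ := (2 ^ (d + 2)) ^ s with hP
  have hPt : P ≠ ∞ := ENNReal.rpow_ne_top_of_nonneg (by positivity) (by finiteness)
  obtain ⟨ε', hε0', hε1', hε'⟩ := exists_mul_le_half (Q := Q' * P * C₃) (by finiteness)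
  refine ⟨2 * (Q' * P), ε', by finiteness, hε0', ?_⟩
  intro g f μ x y R κ A hg hf hR hκ hκ1 hrh hμ hy hlim hA0 hA h0
  obtain ⟨ρ, hρ, hρD, hst1, hst2⟩ := exists_stopping_radius hR hκ hκ1 hy hlim hA h0
  have hAt : A ≠ ∞ := hA.ne_top
  have hD2 : 2 - dist y x / R ≤ 2 := by
    have : 0 ≤ dist y x / R := by positivity
    linarith
  have hρκ : ρ ≤ κ * R := by
    have h1 : κ * R * (2 - dist y x / R) ≤ κ * R * 2 := by gcongr
    nlinarith
  set a := ENNReal.ofReal ρ with ha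
  have ha0 : a ≠ 0 := by simpa [ha] using hρ
  have hat : a ≠ ∞ := ENNReal.ofReal_ne_top
  set w := wt x R y with hw
  have hwt : w ≠ ∞ := wt_ne_top _ _ _
  have hcmp : ∀ z ∈ Metric.ball y (16 * ρ), wt x R z ≤ 2 ^ (d + 2) * w ∧
      w ≤ 2 ^ (d + 2) * wt x R z := fun z hz => by
    refine wt_le_wt hR ?_
    have h1 := Metric.mem_ball.1 hz
    have h2 : 0 < κ * R * (2 - dist y x / R) := by linarith
    have h3 : 0 < R * (2 - dist y x / R) := by
      rw [mul_assoc] at h2; exact pos_of_mul_pos_right h2 hκ.le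
    nlinarith
  have hsub : Metric.ball y (2 * ρ) ⊆ Metric.ball y (16 * ρ) := Metric.ball_subset_ball (by linarith)
  refine ⟨ρ, hρ, hρκ, ?_, ?_⟩
  · calc ∫⁻ z in Metric.ball y (16 * ρ), (wt x R z * g z) ^ 2
        ≤ ∫⁻ z in Metric.ball y (16 * ρ), (2 ^ (d + 2) * w) ^ 2 * g z ^ 2 := by
          refine setLIntegral_mono' Metric.isOpen_ball.measurableSet fun z hz => ?_
          rw [mul_pow]
          gcongr
          exact (hcmp z hz).1
      _ = (2 ^ (d + 2)) ^ 2 * (w ^ 2 * ∫⁻ z in Metric.ball y (16 * ρ), g z ^ 2) := by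
          rw [lintegral_const_mul' _ _ (by finiteness)]; ring
      _ ≤ (2 ^ (d + 2)) ^ 2 * (ω * A ^ 2 * ENNReal.ofReal (16 * ρ) ^ (d + 2)) :=
          mul_le_mul_right hst2 _
      _ = 4 ^ (d + 2) * ω * 16 ^ (d + 2) * A ^ 2 * a ^ (d + 2) := by
          rw [ENNReal.ofReal_mul (by norm_num), show (4 : ℝ≥0∞) = 2 ^ 2 by norm_num, ← pow_mul,
            ← pow_mul, mul_comm 2 (d + 2), mul_pow, ENNReal.ofReal_ofNat]
          ring
      _ ≤ _ := by gcongr; rw [hK]; exact le_self_add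
  set Y := ∫⁻ z in Metric.ball y (2 * ρ), g z with hY
  set F := ∫⁻ z in Metric.ball y (2 * ρ), f z ^ s ∂μ with hF
  set β : ℝ := 2 * (d + 2 : ℝ) - 2 * (d + 1) * (1 / s) with hβ
  have hmain : ω * (A * a ^ (d + 2)) ^ 2 ≤
      (2 ^ (d + 2) * w ^ 2) * (C₁ * Y ^ 2 + C₂ * (a ^ β * F ^ (2 * (1 / s)))) := by
    calc ω * (A * a ^ (d + 2)) ^ 2 = (ω * A ^ 2 * a ^ (d + 2)) * a ^ (d + 2) := by ring
      _ ≤ (2 ^ (d + 2) * w ^ 2 * ∫⁻ z in Metric.ball y ρ, g z ^ 2) * a ^ (d + 2) :=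
          mul_le_mul_left hst1 _
      _ = (2 ^ (d + 2) * w ^ 2) * (a ^ (d + 2) * ∫⁻ z in Metric.ball y ρ, g z ^ 2) := by ring
      _ ≤ _ := mul_le_mul_right (hrh ρ hρ hρκ) _
  -- One of the two terms of the reverse Hölder inequality dominates. According to which one it is,
  -- the ball is charged to a level set of g or to a level set of f.
  rcases sq_mul_le_cases hmain rfl with h1 | h1
  · left
    have h2 : (A * a ^ (d + 2)) ^ 2 ≤ (Q * (w * Y)) ^ 2 := by
      calc (A * a ^ (d + 2)) ^ 2 ≤ (2 * (2 ^ (d + 2) * w ^ 2) * (C₁ * Y ^ 2)) / ω := by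
            rw [ENNReal.le_div_iff_mul_le (Or.inl hω0) (Or.inl hωt), mul_comm]; exact h1
        _ = (2 ^ (d + 3) * C₁ / ω) * (w * Y) ^ 2 := by
            simp only [div_eq_mul_inv]; ring
        _ ≤ Q * (w * Y) ^ 2 := by gcongr; exact le_self_add
        _ ≤ (Q * (w * Y)) ^ 2 := by
            rw [mul_pow Q]; gcongr
            exact le_self_pow₀ (by rw [hQ]; exact le_add_self) two_ne_zero
    have h3 : A * a ^ (d + 2) ≤ Q * (w * Y) := (ENNReal.pow_le_pow_left_iff two_ne_zero).1 h2
    set J := ∫⁻ z in Metric.ball y (2 * ρ) ∩ {z | ENNReal.ofReal ε * A < wt x R z * g z},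
            wt x R z * g z with hJ
    have hwm : Measurable fun z => wt x R z * g z := (continuous_wt x R).measurable.mul hg
    have h4 : w * Y ≤ 2 ^ (d + 2) * (J + ENNReal.ofReal ε * A * (2 ^ (d + 2) * a ^ (d + 2) * ω)) := by
      calc w * Y = ∫⁻ z in Metric.ball y (2 * ρ), w * g z := by
            rw [lintegral_const_mul' _ _ hwt]
        _ ≤ ∫⁻ z in Metric.ball y (2 * ρ), 2 ^ (d + 2) * (wt x R z * g z) := by
            refine setLIntegral_mono' Metric.isOpen_ball.measurableSet fun z hz => ?_
            rw [← mul_assoc]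
            gcongr
            exact (hcmp z (hsub hz)).2
        _ = 2 ^ (d + 2) * ∫⁻ z in Metric.ball y (2 * ρ), wt x R z * g z :=
            lintegral_const_mul' _ _ (by finiteness)
        _ ≤ 2 ^ (d + 2) * (J + ENNReal.ofReal ε * A * volume (Metric.ball y (2 * ρ))) :=
            mul_le_mul_right (setLIntegral_le_add hwm fun z hz => hz) _
        _ = _ := by
            rw [volume_ball_eq y (by positivity), ENNReal.ofReal_mul zero_le_two, mul_pow,
              ENNReal.ofReal_ofNat]
    have h5 : A * a ^ (d + 2) ≤ 2 * (Q * 2 ^ (d + 2) * J) := by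
      refine le_two_mul_of_le_add_half (by finiteness) hε ?_
      refine h3.trans ((mul_le_mul_right h4 Q).trans (le_of_eq ?_))
      ring
    refine h5.trans ?_
    rw [← mul_assoc]
    gcongr
    rw [hK]; exact le_add_self
  · right
    have h2 : (A * a ^ (d + 2)) ^ 2 ≤
        (2 ^ (d + 3) * C₂ / ω) * w ^ 2 * a ^ β * F ^ (2 * (1 / s)) := by
      calc (A * a ^ (d + 2)) ^ 2
          ≤ (2 * (2 ^ (d + 2) * w ^ 2) * (C₂ * (a ^ β * F ^ (2 * (1 / s))))) / ω := by
            rw [ENNReal.le_div_iff_mul_le (Or.inl hω0) (Or.inl hωt), mul_comm]; exact h1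
        _ = _ := by simp only [div_eq_mul_inv]; ring
    have hs2 : 0 ≤ s / 2 := by positivity
    have h3 := ENNReal.rpow_le_rpow h2 hs2
    have hp2 : ∀ b : ℝ≥0∞, (b ^ 2) ^ (s / 2) = b ^ s := fun b => by
      rw [← ENNReal.rpow_natCast, ← ENNReal.rpow_mul]; congr 1; push_cast; ring
    -- The exponent β of the data term satisfies ns = (n-1) + βs/2. Dividing by the second factor
    -- leaves ρⁿ⁻¹, the scale of surface measure, so the low part of f is absorbed through the bound
    -- for μ.
    have ha3 : (a ^ (d + 2)) ^ s = a ^ (d + 1) * (a ^ β) ^ (s / 2) := by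
      rw [← ENNReal.rpow_natCast, ← ENNReal.rpow_mul, ← ENNReal.rpow_natCast a (d + 1),
        ← ENNReal.rpow_mul, ← ENNReal.rpow_add _ _ ha0 hat]
      congr 1
      rw [hβ]; push_cast; field_simp; ring
    have haβ0 : (a ^ β) ^ (s / 2) ≠ 0 := by
      rw [← ENNReal.rpow_mul]; exact (ENNReal.rpow_pos (pos_iff_ne_zero.2 ha0) hat).ne'
    have haβt : (a ^ β) ^ (s / 2) ≠ ∞ := by
      rw [← ENNReal.rpow_mul]; exact ENNReal.rpow_ne_top_of_ne_zero ha0 hat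
    rw [hp2, ENNReal.mul_rpow_of_nonneg _ _ hs0.le, ENNReal.mul_rpow_of_nonneg _ _ hs2,
      ENNReal.mul_rpow_of_nonneg _ _ hs2, ENNReal.mul_rpow_of_nonneg _ _ hs2, hp2, ha3,
      ← ENNReal.rpow_mul F, show 2 * (1 / s) * (s / 2) = 1 by field_simp, ENNReal.rpow_one] at h3
    have h4 : A ^ s * a ^ (d + 1) ≤ Q' * (w ^ s * F) := by
      refine (ENNReal.mul_le_mul_iff_right haβ0 haβt).1 ?_
      refine (le_of_eq ?_).trans (h3.trans (le_of_eq ?_)) <;> ring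
    set J := ∫⁻ z in Metric.ball y (2 * ρ) ∩ {z | ENNReal.ofReal ε' * A < wt x R z * f z},
            (wt x R z * f z) ^ s ∂μ with hJ
    have hwm : Measurable fun z => wt x R z * f z := (continuous_wt x R).measurable.mul hf
    have h5 : w ^ s * F ≤ P * (J + ENNReal.ofReal ε' * A ^ s * (C₃ * a ^ (d + 1))) := by
      have hwst : w ^ s ≠ ∞ := ENNReal.rpow_ne_top_of_nonneg hs0.le hwt
      calc w ^ s * F = ∫⁻ z in Metric.ball y (2 * ρ), w ^ s * f z ^ s ∂μ := by
            rw [lintegral_const_mul' _ _ hwst]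
        _ ≤ ∫⁻ z in Metric.ball y (2 * ρ), P * (wt x R z * f z) ^ s ∂μ := by
            refine setLIntegral_mono' Metric.isOpen_ball.measurableSet fun z hz => ?_
            rw [hP, ← ENNReal.mul_rpow_of_nonneg _ _ hs0.le, ← ENNReal.mul_rpow_of_nonneg _ _ hs0.le,
              ← mul_assoc]
            gcongr
            exact (hcmp z (hsub hz)).2
        _ = P * ∫⁻ z in Metric.ball y (2 * ρ), (wt x R z * f z) ^ s ∂μ :=
            lintegral_const_mul' _ _ hPt
        _ ≤ P * (J + (ENNReal.ofReal ε' * A) ^ s * μ (Metric.ball y (2 * ρ))) :=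
            mul_le_mul_right (setLIntegral_le_add hwm
              fun z hz => ENNReal.rpow_le_rpow hz hs0.le) _
        _ ≤ _ := by
            rw [ENNReal.mul_rpow_of_nonneg _ _ hs0.le]
            gcongr
            · exact ENNReal.rpow_le_self_of_le_one (by simpa using hε1') hs
            · exact hμ ρ hρ hρκ
    have hAs : A ^ s ≠ ∞ := ENNReal.rpow_ne_top_of_nonneg hs0.le hAt
    have h6 : A ^ s * a ^ (d + 1) ≤ 2 * (Q' * P * J) := by
      refine le_two_mul_of_le_add_half (by finiteness) hε' ?_
      refine h4.trans ((mul_le_mul_right h5 Q').trans (le_of_eq ?_))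
      ring
    rwa [← mul_assoc] at h6

/-- Each summand is vᵢ times vᵢ^(k-1), and the second factor is at most the power of the whole sum.
-/
theorem tsum_rpow_le {ι : Type*} (v : ι → ℝ≥0∞) {k : ℝ} (hk : 1 ≤ k) :
    ∑' i, v i ^ k ≤ (∑' i, v i) ^ k := by
  have hsplit : ∀ b : ℝ≥0∞, b ^ k = b * b ^ (k - 1) := fun b => by
    conv_lhs => rw [show k = 1 + (k - 1) by ring]
    rw [ENNReal.rpow_add_of_nonneg _ _ zero_le_one (by linarith), ENNReal.rpow_one]
  rw [hsplit (∑' i, v i), ← ENNReal.tsum_mul_right]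
  refine ENNReal.tsum_le_tsum fun i => ?_
  rw [hsplit]
  gcongr
  exact ENNReal.le_tsum i

/-- The level set inequality. -/
theorem exists_level_set_const (d : ℕ) {C₁ : ℝ≥0∞} (hC₁ : C₁ ≠ ∞) :
    ∃ (K : ℝ≥0∞) (ε : ℝ), K ≠ ∞ ∧ 0 < ε ∧ ε ≤ 1 ∧ ∀ {C₂ C₃ : ℝ≥0∞} {s : ℝ}, C₂ ≠ ∞ → C₃ ≠ ∞ → 1 ≤ s →
    ∃ (K' : ℝ≥0∞) (ε' : ℝ), K' ≠ ∞ ∧ 0 < ε' ∧ ∀ {Ω : Set (E d)} {g f : E d → ℝ≥0∞}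
    {μ : Measure (E d)} {x : E d} {R κ : ℝ} {A : ℝ≥0∞}, Measurable g → Measurable f →
    (∀ y ∉ Ω, g y = 0) → ∫⁻ z, g z ^ 2 ≠ ∞ → 0 < R → 0 < κ → κ ≤ 1 / 2 →
    (∀ y ∈ Ω ∩ Metric.ball x (2 * R), ∀ ρ, 0 < ρ → ρ ≤ κ * R →
      ENNReal.ofReal ρ ^ (d + 2) * ∫⁻ z in Metric.ball y ρ, g z ^ 2 ≤
      C₁ * (∫⁻ z in Metric.ball y (2 * ρ), g z) ^ 2 +
      C₂ * (ENNReal.ofReal ρ ^ (2 * (d + 2 : ℝ) - 2 * (d + 1) * (1 / s)) *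
        (∫⁻ z in Metric.ball y (2 * ρ), f z ^ s ∂μ) ^ (2 * (1 / s)))) →
    (∀ y ∈ Ω ∩ Metric.ball x (2 * R), ∀ ρ, 0 < ρ → ρ ≤ κ * R →
      μ (Metric.ball y (2 * ρ)) ≤ C₃ * ENNReal.ofReal ρ ^ (d + 1)) →
    A ≠ 0 → A ≠ ∞ →
    64 ^ (d + 2) * ∫⁻ z in Metric.ball x (2 * R), g z ^ 2 ≤
      volume (Metric.ball (0 : E d) 1) * A ^ 2 * ENNReal.ofReal (κ * R) ^ (d + 2) →
    ∫⁻ z in {z | A < wt x R z * g z}, (wt x R z * g z) ^ 2 ≤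
      K * (A * ∫⁻ z in {z | ENNReal.ofReal ε * A < wt x R z * g z}, wt x R z * g z) +
      K' * (A ^ 2 * ((A ^ s)⁻¹ * ∫⁻ z in {z | ENNReal.ofReal ε' * A < wt x R z * f z},
        (wt x R z * f z) ^ s ∂μ) ^ ((d + 2 : ℝ) / (d + 1))) := by
  obtain ⟨K, ε, hK, hε0, hε1, hgood⟩ := exists_good_ball_const d hC₁
  refine ⟨K * K, ε, by finiteness, hε0, hε1, ?_⟩
  intro C₂ C₃ s hC₂ hC₃ hs
  have hs0 : 0 < s := by linarith
  obtain ⟨K', ε', hK', hε0', hgood⟩ := hgood hC₂ hC₃ hs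
  set k : ℝ := (d + 2 : ℝ) / (d + 1) with hk
  have hk1 : 1 ≤ k := by rw [hk, le_div_iff₀ (by positivity)]; linarith
  have hk0 : 0 ≤ k := by linarith
  refine ⟨K * K' ^ k, ε', ENNReal.mul_ne_top hK (ENNReal.rpow_ne_top_of_nonneg hk0 hK'), hε0', ?_⟩
  intro Ω g f μ x R κ A hg hf hgΩ hg2 hR hκ hκ1 hrh hμ hA0 hAt h0
  set h : E d → ℝ≥0∞ := fun z => wt x R z * g z with hh
  set F : E d → ℝ≥0∞ := fun z => wt x R z * f z with hF
  have hhm : Measurable h := (continuous_wt x R).measurable.mul hg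
  have hFm : Measurable F := (continuous_wt x R).measurable.mul hf
  -- Only Lebesgue points of g² are covered; the other points of the level set form a null set.
  set L : Set (E d) := {y | A < h y ∧ Tendsto (fun r => (∫⁻ z in Metric.closedBall y r, g z ^ 2) /
      volume (Metric.closedBall y r)) (𝓝[>] 0) (𝓝 (g y ^ 2))} with hL
  have hleb : ∀ᵐ y, Tendsto (fun r => (∫⁻ z in Metric.closedBall y r, g z ^ 2) /
      volume (Metric.closedBall y r)) (𝓝[>] 0) (𝓝 (g y ^ 2)) := by
    filter_upwards [VitaliFamily.ae_tendsto_lintegral_div (Besicovitch.vitaliFamily volume)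
      (hg.pow_const 2).aemeasurable hg2] with y hy
    exact hy.comp (Besicovitch.tendsto_filterAt volume y)
  have hball : ∀ y ∈ L, ∃ ρ : ℝ, 0 < ρ ∧ ρ ≤ κ * R ∧
      ∫⁻ z in Metric.ball y (16 * ρ), h z ^ 2 ≤ K * A ^ 2 * ENNReal.ofReal ρ ^ (d + 2) ∧
      (A * ENNReal.ofReal ρ ^ (d + 2) ≤
          K * ∫⁻ z in Metric.ball y (2 * ρ) ∩ {z | ENNReal.ofReal ε * A < h z}, h z ∨
        A ^ s * ENNReal.ofReal ρ ^ (d + 1) ≤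
          K' * ∫⁻ z in Metric.ball y (2 * ρ) ∩ {z | ENNReal.ofReal ε' * A < F z}, F z ^ s ∂μ) := by
    intro y hy
    have hy0 : h y ≠ 0 := (zero_le.trans_lt hy.1).ne'
    have hyΩ : y ∈ Ω := by
      by_contra hyΩ
      exact hy0 (by simp [hh, hgΩ y hyΩ])
    have hyx : y ∈ Metric.ball x (2 * R) := by
      by_contra hyx
      exact hy0 (by simp [hh, wt_eq_zero hR hyx])
    exact hgood hg hf hR hκ hκ1 (hrh y ⟨hyΩ, hyx⟩) (hμ y ⟨hyΩ, hyx⟩) hyx hy.2 hA0 hy.1 h0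
  choose! r hr0 hrκ hr16 hrc using hball
  -- Disjoint balls of radius 2r are selected whose five-fold dilates cover, and 10r < 16r. On the
  -- balls of radius 16r the stopping time bounds the energy; on the disjoint ones the charges add
  -- up.
  obtain ⟨u, huL, hud, huc⟩ := Vitali.exists_disjoint_subfamily_covering_enlargement_closedBall
    L id (fun y => 2 * r y) (2 * (κ * R)) (fun y hy => by have := hrκ y hy; linarith) 5 (by norm_num)
  have hucount : u.Countable := hud.countable_of_nonempty_interior fun y hy => by
    refine (Metric.nonempty_ball.2 ?_).mono Metric.ball_subset_interior_closedBall
    have := hr0 y (huL hy); positivity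
  have : Countable u := hucount
  have hcover : L ⊆ ⋃ i : u, Metric.ball (i : E d) (16 * r i) := by
    intro y hy
    obtain ⟨i, hi, hsub⟩ := huc y hy
    refine mem_iUnion.2 ⟨⟨i, hi⟩, ?_⟩
    have h1 : y ∈ Metric.closedBall i (5 * (2 * r i)) :=
      hsub (Metric.mem_closedBall_self (by have := hr0 y hy; positivity))
    rw [Metric.mem_closedBall] at h1
    rw [Metric.mem_ball]
    have := hr0 i (huL hi)
    linarith
  have hdisj : Pairwise (Function.onFun Disjoint fun i : u => Metric.ball (i : E d) (2 * r i)) := by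
    intro i j hij
    exact (hud i.2 j.2 fun hh => hij (Subtype.ext hh)).mono Metric.ball_subset_closedBall
      Metric.ball_subset_closedBall
  have hsumle : ∀ {ν : Measure (E d)} (H : E d → ℝ≥0∞) {S : Set (E d)}, MeasurableSet S →
      ∑' i : u, ∫⁻ z in Metric.ball (i : E d) (2 * r i) ∩ S, H z ∂ν ≤ ∫⁻ z in S, H z ∂ν := by
    intro ν H S hS
    rw [← lintegral_iUnion (fun i => Metric.isOpen_ball.measurableSet.inter hS)
      fun i j hij => (hdisj hij).mono inter_subset_left inter_subset_left]
    exact lintegral_mono_set (iUnion_subset fun i => inter_subset_right)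
  set J : u → ℝ≥0∞ := fun i =>
    ∫⁻ z in Metric.ball (i : E d) (2 * r i) ∩ {z | ENNReal.ofReal ε * A < h z}, h z with hJ
  set J' : u → ℝ≥0∞ := fun i =>
    ∫⁻ z in Metric.ball (i : E d) (2 * r i) ∩ {z | ENNReal.ofReal ε' * A < F z}, F z ^ s ∂μ with hJ'
  have hAs0 : A ^ s ≠ 0 := (ENNReal.rpow_pos (pos_iff_ne_zero.2 hA0) hAt).ne'
  have hAst : A ^ s ≠ ∞ := ENNReal.rpow_ne_top_of_nonneg hs0.le hAt
  -- A ball charged to f has rⁿ⁻¹ bounded by the data, hence rⁿ by their power k = n/(n-1). Since k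
  -- ≥ 1, the sum of these powers is at most the power of the sum.
  have hone : ∀ i : u, A ^ 2 * ENNReal.ofReal (r i) ^ (d + 2) ≤
      A * (K * J i) + A ^ 2 * (K' * ((A ^ s)⁻¹ * J' i)) ^ k := by
    intro i
    rcases hrc i (huL i.2) with h1 | h1
    · refine le_trans ?_ le_self_add
      rw [sq, mul_assoc]
      exact mul_le_mul_right h1 _
    · refine le_trans ?_ le_add_self
      refine mul_le_mul_right ?_ _
      have h2 : ENNReal.ofReal (r i) ^ (d + 1) ≤ K' * ((A ^ s)⁻¹ * J' i) := by
        refine (ENNReal.mul_le_mul_iff_right hAs0 hAst).1 (h1.trans (le_of_eq ?_))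
        rw [mul_left_comm (A ^ s), ← mul_assoc (A ^ s), ENNReal.mul_inv_cancel hAs0 hAst, one_mul]
      have h3 : ENNReal.ofReal (r i) ^ (d + 2) = (ENNReal.ofReal (r i) ^ (d + 1)) ^ k := by
        rw [← ENNReal.rpow_natCast, ← ENNReal.rpow_natCast, ← ENNReal.rpow_mul]
        congr 1
        rw [hk]; push_cast; field_simp
      rw [h3]
      exact ENNReal.rpow_le_rpow h2 hk0
  have hLae : ∫⁻ z in {z | A < h z}, h z ^ 2 = ∫⁻ z in L, h z ^ 2 := by
    refine setLIntegral_congr ?_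
    filter_upwards [hleb] with y hy
    exact propext ⟨fun h1 => ⟨h1, hy⟩, fun h1 => h1.1⟩
  calc ∫⁻ z in {z | A < h z}, h z ^ 2 = ∫⁻ z in L, h z ^ 2 := hLae
    _ ≤ ∫⁻ z in ⋃ i : u, Metric.ball (i : E d) (16 * r i), h z ^ 2 := lintegral_mono_set hcover
    _ ≤ ∑' i : u, ∫⁻ z in Metric.ball (i : E d) (16 * r i), h z ^ 2 := lintegral_iUnion_le _ _
    _ ≤ ∑' i : u, K * (A ^ 2 * ENNReal.ofReal (r i) ^ (d + 2)) :=
        ENNReal.tsum_le_tsum fun i => (hr16 i (huL i.2)).trans (le_of_eq (mul_assoc _ _ _))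
    _ = K * ∑' i : u, A ^ 2 * ENNReal.ofReal (r i) ^ (d + 2) := ENNReal.tsum_mul_left
    _ ≤ K * ∑' i : u, (A * (K * J i) + A ^ 2 * (K' * ((A ^ s)⁻¹ * J' i)) ^ k) :=
        mul_le_mul_right (ENNReal.tsum_le_tsum hone) _
    _ = K * (A * (K * ∑' i, J i) + A ^ 2 * ∑' i, (K' * ((A ^ s)⁻¹ * J' i)) ^ k) := by
        rw [ENNReal.tsum_add, ENNReal.tsum_mul_left, ENNReal.tsum_mul_left, ENNReal.tsum_mul_left]
    _ ≤ K * (A * (K * ∑' i, J i) + A ^ 2 * (K' * ((A ^ s)⁻¹ * ∑' i, J' i)) ^ k) := by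
        refine mul_le_mul_right (add_le_add_right (mul_le_mul_right ?_ _) _) _
        refine (tsum_rpow_le _ hk1).trans (le_of_eq ?_)
        rw [ENNReal.tsum_mul_left, ENNReal.tsum_mul_left]
    _ ≤ K * (A * (K * ∫⁻ z in {z | ENNReal.ofReal ε * A < h z}, h z) +
          A ^ 2 * (K' * ((A ^ s)⁻¹ * ∫⁻ z in {z | ENNReal.ofReal ε' * A < F z}, F z ^ s ∂μ)) ^ k) := by
        gcongr
        · exact hsumle _ (measurableSet_lt measurable_const hhm)
        · exact hsumle _ (measurableSet_lt measurable_const hFm)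
    _ = _ := by
        rw [ENNReal.mul_rpow_of_nonneg _ _ hk0]
        ring

/-! ### Gehring's lemma: integration over the levels -/

theorem lintegral_Ioc_rpow {p a c : ℝ} (hp : 0 < p) (ha : 0 ≤ a) (hac : a ≤ c) :
    ∫⁻ α in Ioc a c, ENNReal.ofReal (p * α ^ (p - 1)) = ENNReal.ofReal (c ^ p - a ^ p) := by
  have hint : IntervalIntegrable (fun α : ℝ => p * α ^ (p - 1)) volume a c :=
    (intervalIntegral.intervalIntegrable_rpow' (by linarith)).const_mul p
  rw [← ofReal_integral_eq_lintegral_ofReal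
    ((intervalIntegrable_iff_integrableOn_Ioc_of_le hac).1 hint), ← intervalIntegral.integral_of_le hac,
    intervalIntegral.integral_const_mul, integral_rpow (Or.inl (by linarith))]
  · congr 1
    rw [sub_add_cancel]; field_simp
  · filter_upwards [ae_restrict_mem measurableSet_Ioc] with α hα
    have : 0 < α := ha.trans_lt hα.1
    positivity

/-- The layer-cake formula above level a. The truncation at L keeps finite the quantity that is
absorbed later. -/
theorem rpow_min_le {m a L : ℝ} (hm : 0 < m) (ha : 0 < a) (b : ℝ≥0∞) :
    min b (ENNReal.ofReal L) ^ m ≤ ENNReal.ofReal a ^ m +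
      ∫⁻ α in Ioo a L, {α : ℝ | ENNReal.ofReal α < b}.indicator
        (fun α => ENNReal.ofReal (m * α ^ (m - 1))) α := by
  set c := min b (ENNReal.ofReal L) with hc
  have hct : c ≠ ∞ := ne_top_of_le_ne_top ENNReal.ofReal_ne_top (min_le_right _ _)
  rcases le_total c (ENNReal.ofReal a) with h1 | h1
  · exact (ENNReal.rpow_le_rpow h1 hm.le).trans le_self_add
  have hac : a ≤ c.toReal := (ENNReal.ofReal_le_iff_le_toReal hct).1 h1
  have h2 : c ^ m = ENNReal.ofReal a ^ m +
      ∫⁻ α in Ioc a c.toReal, ENNReal.ofReal (m * α ^ (m - 1)) := by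
    rw [lintegral_Ioc_rpow hm ha.le hac, ENNReal.ofReal_rpow_of_pos ha,
      ← ENNReal.ofReal_add (by positivity)
        (sub_nonneg.2 (Real.rpow_le_rpow ha.le hac hm.le)), add_sub_cancel,
      ← ENNReal.ofReal_rpow_of_nonneg ENNReal.toReal_nonneg hm.le, ENNReal.ofReal_toReal hct]
  rw [h2, ← restrict_Ioo_eq_restrict_Ioc]
  refine add_le_add_right ?_ _
  have hLc : ENNReal.ofReal c.toReal ≤ ENNReal.ofReal L := by
    rw [ENNReal.ofReal_toReal hct]; exact min_le_right _ _
  rw [← lintegral_indicator measurableSet_Ioo, ← lintegral_indicator measurableSet_Ioo]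
  refine lintegral_mono fun α => ?_
  by_cases hα : α ∈ Ioo a c.toReal
  · have h3 : ENNReal.ofReal α < c := (ENNReal.ofReal_lt_iff_lt_toReal (ha.trans hα.1).le hct).2 hα.2
    have h4 : α < L := (ENNReal.ofReal_lt_ofReal_iff_of_nonneg (ha.trans hα.1).le).1
      (h3.trans_le (min_le_right _ _))
    rw [indicator_of_mem hα, indicator_of_mem (show α ∈ Ioo a L from ⟨hα.1, h4⟩),
      indicator_of_mem (show α ∈ {α : ℝ | ENNReal.ofReal α < b} from h3.trans_le (min_le_left _ _))]
  · rw [indicator_of_notMem hα]; exact zero_le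

/-- On the set of integration α ≤ min(b/ε, L), so the integral is at most m times the (m+1)-st power
of this bound; m ≤ 1 allows ε^(-m) to be replaced by ε⁻¹. The small factor m, gained since the
integrand is mα^m, is what makes Gehring's absorption possible. -/
theorem mul_lintegral_indicator_le {m a L ε : ℝ} (hm : 0 < m) (hm1 : m ≤ 1) (ha : 0 < a)
    (hε : 0 < ε) (hε1 : ε ≤ 1) (b : ℝ≥0∞) :
    b * ∫⁻ α in Ioo a L, {α : ℝ | ENNReal.ofReal (ε * α) < b}.indicator
        (fun α => ENNReal.ofReal (m * α ^ m)) α ≤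
      ENNReal.ofReal (m / ε ^ 2) * (b ^ 2 * min b (ENNReal.ofReal L) ^ m) := by
  set e := ENNReal.ofReal (1 / ε) with he
  have he1 : 1 ≤ e := by
    rw [he, ← ENNReal.ofReal_one]
    exact ENNReal.ofReal_le_ofReal (by rwa [le_div_iff₀ hε, one_mul])
  set c := min (e * b) (ENNReal.ofReal L) with hc
  have hct : c ≠ ∞ := ne_top_of_le_ne_top ENNReal.ofReal_ne_top (min_le_right _ _)
  have hcm : c ≤ e * min b (ENNReal.ofReal L) := by
    rw [mul_min]
    exact min_le_min_left _ (le_mul_of_one_le_left zero_le he1)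
  have hS : MeasurableSet {α : ℝ | ENNReal.ofReal (ε * α) < b} :=
    measurableSet_lt (by fun_prop) measurable_const
  have hmem : ∀ α ∈ Ioo a L, ENNReal.ofReal (ε * α) < b → ENNReal.ofReal α ≤ c := by
    intro α hα hb
    refine le_min ?_ (ENNReal.ofReal_le_ofReal hα.2.le)
    calc ENNReal.ofReal α = e * ENNReal.ofReal (ε * α) := by
          rw [he, ← ENNReal.ofReal_mul (by positivity)]; congr 1; field_simp
      _ ≤ e * b := by gcongr
  have h1 : ∫⁻ α in Ioo a L, {α : ℝ | ENNReal.ofReal (ε * α) < b}.indicator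
      (fun α => ENNReal.ofReal (m * α ^ m)) α ≤ ENNReal.ofReal m * c ^ m * c := by
    calc ∫⁻ α in Ioo a L, {α : ℝ | ENNReal.ofReal (ε * α) < b}.indicator
          (fun α => ENNReal.ofReal (m * α ^ m)) α
        ≤ ∫⁻ α in Ioo a L, {α : ℝ | ENNReal.ofReal (ε * α) < b}.indicator
          (fun _ => ENNReal.ofReal m * c ^ m) α := by
          refine setLIntegral_mono' measurableSet_Ioo fun α hα => ?_
          by_cases hb : ENNReal.ofReal (ε * α) < b
          · simp only [indicator, mem_ofPred_eq, hb, if_true]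
            rw [ENNReal.ofReal_mul hm.le, ← ENNReal.ofReal_rpow_of_pos (ha.trans hα.1)]
            gcongr
            exact hmem α hα hb
          · simp [indicator, hb]
      _ = ENNReal.ofReal m * c ^ m *
            volume ({α : ℝ | ENNReal.ofReal (ε * α) < b} ∩ Ioo a L) := by
          rw [lintegral_indicator hS, setLIntegral_const, Measure.restrict_apply hS]
      _ ≤ ENNReal.ofReal m * c ^ m * volume (Icc 0 c.toReal) := by
          gcongr
          rintro α ⟨hb, hα⟩
          have h2 := hmem α hα hb
          exact ⟨(ha.trans hα.1).le, (ENNReal.ofReal_le_iff_le_toReal hct).1 h2⟩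
      _ = _ := by rw [Real.volume_Icc, sub_zero, ENNReal.ofReal_toReal hct]
  have h2 : c ^ m ≤ e * min b (ENNReal.ofReal L) ^ m := by
    refine (ENNReal.rpow_le_rpow hcm hm.le).trans ?_
    rw [ENNReal.mul_rpow_of_nonneg _ _ hm.le]
    gcongr
    exact (ENNReal.rpow_le_rpow_of_exponent_le he1 hm1).trans (ENNReal.rpow_one e).le
  calc b * ∫⁻ α in Ioo a L, {α : ℝ | ENNReal.ofReal (ε * α) < b}.indicator
        (fun α => ENNReal.ofReal (m * α ^ m)) α
      ≤ b * (ENNReal.ofReal m * (e * min b (ENNReal.ofReal L) ^ m) * (e * b)) :=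
        mul_le_mul_right (h1.trans (by gcongr; exact min_le_left _ _)) _
    _ = ENNReal.ofReal m * (e * e) * (b ^ 2 * min b (ENNReal.ofReal L) ^ m) := by ring
    _ = _ := by
        rw [he, ← ENNReal.ofReal_mul (by positivity), ← ENNReal.ofReal_mul hm.le]
        congr 2; field_simp

theorem lintegral_indicator_rpow_le {p a L ε : ℝ} (hp : 0 < p) (ha : 0 < a) (hε : 0 < ε)
    (b : ℝ≥0∞) :
    ∫⁻ α in Ioo a L, {α : ℝ | ENNReal.ofReal (ε * α) < b}.indicator
        (fun α => ENNReal.ofReal (α ^ (p - 1))) α ≤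
      ENNReal.ofReal (1 / p) * ENNReal.ofReal ε ^ (-p) * b ^ p := by
  rcases eq_or_ne b ∞ with rfl | hb
  · rw [ENNReal.top_rpow_of_pos hp, ENNReal.mul_top]
    · exact le_top
    · refine mul_ne_zero (by simpa using hp) ?_
      exact (ENNReal.rpow_pos (by simpa using hε) ENNReal.ofReal_ne_top).ne'
  set c := b.toReal / ε with hc
  have hc0 : 0 ≤ c := by positivity
  calc ∫⁻ α in Ioo a L, {α : ℝ | ENNReal.ofReal (ε * α) < b}.indicator
        (fun α => ENNReal.ofReal (α ^ (p - 1))) α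
      ≤ ∫⁻ α in Ioc 0 c, ENNReal.ofReal (α ^ (p - 1)) := by
        rw [← lintegral_indicator measurableSet_Ioo, ← lintegral_indicator measurableSet_Ioc]
        refine lintegral_mono fun α => ?_
        by_cases hα : α ∈ Ioo a L
        · rw [indicator_of_mem hα]
          by_cases hαb : ENNReal.ofReal (ε * α) < b
          · have hα0 : 0 < α := ha.trans hα.1
            have h1 : α ∈ Ioc 0 c := ⟨hα0, by
              rw [hc, le_div_iff₀ hε, mul_comm]
              exact ((ENNReal.ofReal_lt_iff_lt_toReal (by positivity) hb).1 hαb).le⟩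
            rw [indicator_of_mem h1]
            exact indicator_le_self _ _ _
          · simp [indicator, hαb]
        · rw [indicator_of_notMem hα]; exact zero_le
    _ = ENNReal.ofReal (1 / p) * ∫⁻ α in Ioc 0 c, ENNReal.ofReal (p * α ^ (p - 1)) := by
        rw [← lintegral_const_mul' _ _ ENNReal.ofReal_ne_top]
        refine lintegral_congr fun α => ?_
        rw [← ENNReal.ofReal_mul (by positivity)]
        congr 1; field_simp
    _ = ENNReal.ofReal (1 / p) * ENNReal.ofReal (c ^ p) := by
        rw [lintegral_Ioc_rpow hp le_rfl hc0, Real.zero_rpow hp.ne', sub_zero]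
    _ = _ := by
        rw [mul_assoc]
        congr 1
        rw [hc, div_eq_inv_mul, Real.mul_rpow (by positivity) ENNReal.toReal_nonneg,
          ENNReal.ofReal_mul (by positivity), ← ENNReal.ofReal_rpow_of_nonneg ENNReal.toReal_nonneg
          hp.le, ENNReal.ofReal_toReal hb, ← ENNReal.ofReal_rpow_of_pos (by positivity),
          ENNReal.ofReal_inv_of_pos hε, ENNReal.inv_rpow, ENNReal.rpow_neg]

section Tonelli
variable {X : Type*} [MeasurableSpace X] {ν : Measure X} [SFinite ν]

theorem lintegral_levels {H h : X → ℝ≥0∞} (hH : Measurable H) (hh : Measurable h) {φ : ℝ → ℝ≥0∞}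
    (hφ : Measurable φ) (ε : ℝ) (I : Set ℝ) :
    ∫⁻ α in I, φ α * ∫⁻ z in {z | ENNReal.ofReal (ε * α) < h z}, H z ∂ν =
      ∫⁻ z, H z * (∫⁻ α in I, {α : ℝ | ENNReal.ofReal (ε * α) < h z}.indicator φ α) ∂ν := by
  have hS : MeasurableSet {p : ℝ × X | ENNReal.ofReal (ε * p.1) < h p.2} :=
    measurableSet_lt (by fun_prop) (by fun_prop)
  have h1 : ∀ α, MeasurableSet {z | ENNReal.ofReal (ε * α) < h z} := fun α =>
    measurableSet_lt measurable_const hh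
  have h2 : ∀ z, MeasurableSet {α : ℝ | ENNReal.ofReal (ε * α) < h z} := fun z =>
    measurableSet_lt (by fun_prop) measurable_const
  let Ψ : ℝ → X → ℝ≥0∞ := fun α z =>
    {p : ℝ × X | ENNReal.ofReal (ε * p.1) < h p.2}.indicator (fun p => φ p.1 * H p.2) (α, z)
  have hΨ : Measurable (Function.uncurry Ψ) := by
    change Measurable ({p : ℝ × X | ENNReal.ofReal (ε * p.1) < h p.2}.indicator
      fun p => φ p.1 * H p.2)
    exact Measurable.indicator (by fun_prop) hS
  calc ∫⁻ α in I, φ α * ∫⁻ z in {z | ENNReal.ofReal (ε * α) < h z}, H z ∂ν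
      = ∫⁻ α in I, ∫⁻ z, Ψ α z ∂ν := by
        refine lintegral_congr fun α => ?_
        rw [← lintegral_indicator (h1 α), ← lintegral_const_mul _ (hH.indicator (h1 α))]
        refine lintegral_congr fun z => ?_
        by_cases hz : ENNReal.ofReal (ε * α) < h z <;> simp [Ψ, indicator, hz]
    _ = ∫⁻ z, (∫⁻ α in I, Ψ α z) ∂ν := lintegral_lintegral_swap hΨ.aemeasurable
    _ = _ := by
        refine lintegral_congr fun z => ?_
        rw [← lintegral_const_mul _ (hφ.indicator (h2 z))]
        refine lintegral_congr fun α => ?_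
        by_cases hz : ENNReal.ofReal (ε * α) < h z <;> simp [Ψ, indicator, hz, mul_comm]

/-- Integration of the level set inequality. -/
theorem lintegral_rpow_le_of_level_sets {Z : Type*} [MeasurableSpace Z] {μ : Measure Z} [SFinite μ]
    {h : X → ℝ≥0∞} {F : Z → ℝ≥0∞} (hh : Measurable h) (hF : Measurable F) (hht : ∀ z, h z ≠ ∞)
    (h2 : ∫⁻ z, h z ^ 2 ∂ν ≠ ∞) {ε ε' : ℝ} (hε : 0 < ε) (hε1 : ε ≤ 1) (hε' : 0 < ε')
    {K K' : ℝ≥0∞} {s q k m : ℝ} (hsq : s < q) (hs : 0 ≤ s) (hk : 1 ≤ k) (hqk : q * k = 2 + m)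
    (hm : 0 < m) (hm1 : m ≤ 1) (hKm : K * ENNReal.ofReal (m / ε ^ 2) ≤ 1 / 2) {a : ℝ} (ha : 0 < a)
    (hlev : ∀ α, a < α → ∫⁻ z in {z | ENNReal.ofReal α < h z}, h z ^ 2 ∂ν ≤
      K * (ENNReal.ofReal α * ∫⁻ z in {z | ENNReal.ofReal (ε * α) < h z}, h z ∂ν) +
      K' * (ENNReal.ofReal α ^ 2 * ((ENNReal.ofReal α ^ s)⁻¹ *
        ∫⁻ z in {z | ENNReal.ofReal (ε' * α) < F z}, F z ^ s ∂μ) ^ k)) :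
    ∫⁻ z, h z ^ (2 + m) ∂ν ≤ 2 * (ENNReal.ofReal a ^ m * (∫⁻ z, h z ^ 2 ∂ν) +
      K' * ENNReal.ofReal (m / (q - s)) * ENNReal.ofReal ε' ^ (-((q - s) * k)) *
        (∫⁻ z, F z ^ q ∂μ) ^ k) := by
  set p := q - s with hp
  have hp0 : 0 < p := by linarith
  set I := ∫⁻ z, F z ^ q ∂μ with hI
  set e := ENNReal.ofReal ε' with he
  have he0 : e ≠ 0 := by simpa [he] using hε'
  have het : e ≠ ∞ := ENNReal.ofReal_ne_top
  set W := K' * ENNReal.ofReal (m / p) * e ^ (-(p * k)) * I ^ k with hW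
  -- Chebyshev's inequality. It controls the surplus power k - 1 of the tail integral of F, so that
  -- only its first power is left to integrate over the levels.
  have htail : ∀ α, 0 < α → ∫⁻ z in {z | ENNReal.ofReal (ε' * α) < F z}, F z ^ s ∂μ ≤
      ENNReal.ofReal α ^ (-p) * (e ^ (-p) * I) := by
    intro α hα
    set b := ENNReal.ofReal (ε' * α) with hb
    have hb0 : b ≠ 0 := by simpa [hb] using mul_pos hε' hα
    have hbt : b ≠ ∞ := ENNReal.ofReal_ne_top
    have h1 : ENNReal.ofReal α ^ (-p) * (e ^ (-p) * I) = b ^ (-p) * I := by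
      rw [hb, ENNReal.ofReal_mul hε'.le, ENNReal.mul_rpow_of_ne_top het ENNReal.ofReal_ne_top]
      ring
    have hbp : b ^ (-p) ≠ ∞ := ENNReal.rpow_ne_top_of_ne_zero hb0 hbt
    rw [h1, hI, ← lintegral_const_mul' _ _ hbp]
    refine (setLIntegral_mono' (measurableSet_lt measurable_const hF) fun z hz => ?_).trans
      (setLIntegral_le_lintegral _ _)
    have h3 : F z ^ q = F z ^ p * F z ^ s := by
      rw [← ENNReal.rpow_add_of_nonneg _ _ hp0.le hs, hp, sub_add_cancel]
    rw [h3, ← mul_assoc]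
    refine le_mul_of_one_le_left zero_le ?_
    calc (1 : ℝ≥0∞) = b ^ (-p) * b ^ p := by
          rw [← ENNReal.rpow_add _ _ hb0 hbt, neg_add_cancel, ENNReal.rpow_zero]
      _ ≤ b ^ (-p) * F z ^ p := by
          gcongr
          exact (show b < F z from hz).le
  -- The estimate is proved for the truncated integral T, finite because h is square integrable, so
  -- that half of T can be absorbed.
  have hkey : ∀ L : ℝ, a < L → ∫⁻ z, h z ^ 2 * min (h z) (ENNReal.ofReal L) ^ m ∂ν ≤
      2 * (ENNReal.ofReal a ^ m * (∫⁻ z, h z ^ 2 ∂ν) + W) := by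
    intro L haL
    set T := ∫⁻ z, h z ^ 2 * min (h z) (ENNReal.ofReal L) ^ m ∂ν with hT
    have hTt : T ≠ ∞ := by
      have hLm : ENNReal.ofReal L ^ m ≠ ∞ :=
        ENNReal.rpow_ne_top_of_nonneg hm.le ENNReal.ofReal_ne_top
      refine ne_top_of_le_ne_top (ENNReal.mul_ne_top h2 hLm) ?_
      rw [← lintegral_mul_const' _ _ hLm]
      refine lintegral_mono fun z => ?_
      gcongr
      exact min_le_right _ _
    set ψ : ℝ → ℝ≥0∞ := fun α => ∫⁻ z in {z | ENNReal.ofReal (ε * α) < h z}, h z ∂ν with hψ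
    set A : ℝ → ℝ≥0∞ := fun α => ∫⁻ z in {z | ENNReal.ofReal (ε' * α) < F z}, F z ^ s ∂μ with hA
    have hψm : Measurable ψ := Antitone.measurable fun α α' hαα => lintegral_mono_set fun z hz =>
      lt_of_le_of_lt (ENNReal.ofReal_le_ofReal (by gcongr)) hz
    have hφ1 : Measurable fun α : ℝ => ENNReal.ofReal (m * α ^ (m - 1)) := by fun_prop
    have hφ2 : Measurable fun α : ℝ => ENNReal.ofReal (m * α ^ m) := by fun_prop
    have hφ3 : Measurable fun α : ℝ => ENNReal.ofReal (α ^ (p - 1)) := by fun_prop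
    have hs1 : T ≤ ENNReal.ofReal a ^ m * (∫⁻ z, h z ^ 2 ∂ν) +
        ∫⁻ α in Ioo a L, ENNReal.ofReal (m * α ^ (m - 1)) *
          ∫⁻ z in {z | ENNReal.ofReal α < h z}, h z ^ 2 ∂ν := by
      have h4 := lintegral_levels (ν := ν) (hh.pow_const 2) hh hφ1 1 (Ioo a L)
      simp only [one_mul] at h4
      rw [h4, mul_comm, ← lintegral_mul_const _ (hh.pow_const 2),
        ← lintegral_add_left ((hh.pow_const 2).mul_const _)]
      refine lintegral_mono fun z => ?_
      rw [← mul_add]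
      exact mul_le_mul_right (rpow_min_le hm ha _) _
    have hs2 : ∫⁻ α in Ioo a L, ENNReal.ofReal (m * α ^ (m - 1)) *
          ∫⁻ z in {z | ENNReal.ofReal α < h z}, h z ^ 2 ∂ν ≤
        K * (∫⁻ α in Ioo a L, ENNReal.ofReal (m * α ^ m) * ψ α) +
        K' * ENNReal.ofReal m * (e ^ (-p) * I) ^ (k - 1) *
          ∫⁻ α in Ioo a L, ENNReal.ofReal (α ^ (p - 1)) * A α := by
      have hAm : Measurable A := Antitone.measurable fun α α' hαα => lintegral_mono_set fun z hz =>
        lt_of_le_of_lt (ENNReal.ofReal_le_ofReal (by gcongr)) hz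
      have hφψ : Measurable fun α => ENNReal.ofReal (m * α ^ m) * ψ α := hφ2.mul hψm
      have hφA : Measurable fun α => ENNReal.ofReal (α ^ (p - 1)) * A α := hφ3.mul hAm
      rw [← lintegral_const_mul _ hφψ, ← lintegral_const_mul _ hφA,
        ← lintegral_add_left (hφψ.const_mul _)]
      refine setLIntegral_mono' measurableSet_Ioo fun α hα => ?_
      have hα0 : 0 < α := ha.trans hα.1
      set b := ENNReal.ofReal α with hb
      have hb0 : b ≠ 0 := by simpa [hb] using hα0
      have hbt : b ≠ ∞ := ENNReal.ofReal_ne_top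
      have e1 : ENNReal.ofReal (m * α ^ (m - 1)) = ENNReal.ofReal m * b ^ (m - 1) := by
        rw [ENNReal.ofReal_mul hm.le, ← ENNReal.ofReal_rpow_of_pos hα0]
      have e2 : ENNReal.ofReal (m * α ^ m) = ENNReal.ofReal m * (b ^ (m - 1) * b) := by
        rw [ENNReal.ofReal_mul hm.le, ← ENNReal.ofReal_rpow_of_pos hα0]
        conv_rhs => rw [← ENNReal.rpow_one b, ← ENNReal.rpow_mul, one_mul,
          ← ENNReal.rpow_add _ _ hb0 hbt, sub_add_cancel]
      -- The powers of α from the data term combine to α^(p-1) precisely because qk = 2 + m.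
      have e3 : ENNReal.ofReal (α ^ (p - 1)) = b ^ (m - 1) * (b ^ 2 * ((b ^ s)⁻¹ ^ k *
          (b ^ (-p)) ^ (k - 1))) := by
        rw [← ENNReal.ofReal_rpow_of_pos hα0, ← ENNReal.rpow_natCast, ← ENNReal.rpow_neg,
          ← ENNReal.rpow_mul, ← ENNReal.rpow_mul, ← ENNReal.rpow_add _ _ hb0 hbt,
          ← ENNReal.rpow_add _ _ hb0 hbt, ← ENNReal.rpow_add _ _ hb0 hbt]
        congr 1
        have : q = s + p := by rw [hp]; ring
        rw [this] at hqk
        push_cast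
        linarith
      have e4 : A α ^ k ≤ A α * ((b ^ (-p)) ^ (k - 1) * (e ^ (-p) * I) ^ (k - 1)) := by
        have h6 : A α ^ k = A α * A α ^ (k - 1) := by
          conv_lhs => rw [show k = 1 + (k - 1) by ring]
          rw [ENNReal.rpow_add_of_nonneg _ _ zero_le_one (by linarith), ENNReal.rpow_one]
        rw [h6, ← ENNReal.mul_rpow_of_nonneg _ _ (by linarith)]
        exact mul_le_mul_right (ENNReal.rpow_le_rpow (htail α hα0) (by linarith)) _
      calc ENNReal.ofReal (m * α ^ (m - 1)) * ∫⁻ z in {z | b < h z}, h z ^ 2 ∂ν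
          ≤ ENNReal.ofReal m * b ^ (m - 1) *
            (K * (b * ψ α) + K' * (b ^ 2 * ((b ^ s)⁻¹ ^ k * A α ^ k))) := by
            rw [e1, ← ENNReal.mul_rpow_of_nonneg _ _ (by linarith)]
            exact mul_le_mul_right (hlev α hα.1) _
        _ ≤ ENNReal.ofReal m * b ^ (m - 1) * (K * (b * ψ α) + K' * (b ^ 2 * ((b ^ s)⁻¹ ^ k *
              (A α * ((b ^ (-p)) ^ (k - 1) * (e ^ (-p) * I) ^ (k - 1)))))) := by gcongr
        _ = _ := by rw [e2, e3]; ring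
    have hs3 : ∫⁻ α in Ioo a L, ENNReal.ofReal (m * α ^ m) * ψ α ≤
        ENNReal.ofReal (m / ε ^ 2) * T := by
      rw [hψ, lintegral_levels hh hh hφ2, hT, ← lintegral_const_mul' _ _ ENNReal.ofReal_ne_top]
      exact lintegral_mono fun z => mul_lintegral_indicator_le hm hm1 ha hε hε1 _
    have hs4 : ∫⁻ α in Ioo a L, ENNReal.ofReal (α ^ (p - 1)) * A α ≤
        ENNReal.ofReal (1 / p) * e ^ (-p) * I := by
      have hcp : ENNReal.ofReal (1 / p) * e ^ (-p) ≠ ∞ :=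
        ENNReal.mul_ne_top ENNReal.ofReal_ne_top (ENNReal.rpow_ne_top_of_ne_zero he0 het)
      rw [hA, lintegral_levels (hF.pow_const s) hF hφ3, hI, ← lintegral_const_mul' _ _ hcp]
      refine lintegral_mono fun z => ?_
      have h3 : F z ^ q = F z ^ s * F z ^ p := by
        rw [← ENNReal.rpow_add_of_nonneg _ _ hs hp0.le, hp, add_sub_cancel]
      refine (mul_le_mul_right (lintegral_indicator_rpow_le hp0 ha hε' _) _).trans (le_of_eq ?_)
      rw [h3]; ring
    have hs5 : K' * ENNReal.ofReal m * (e ^ (-p) * I) ^ (k - 1) *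
        (ENNReal.ofReal (1 / p) * e ^ (-p) * I) = W := by
      have h5 : (e ^ (-p) * I) ^ (k - 1) * (e ^ (-p) * I) = e ^ (-(p * k)) * I ^ k := by
        conv_lhs => rw [← ENNReal.rpow_one (e ^ (-p) * I), ← ENNReal.rpow_mul, one_mul]
        rw [← ENNReal.rpow_add_of_nonneg _ _ (by linarith) zero_le_one, sub_add_cancel,
          ENNReal.mul_rpow_of_nonneg _ _ (by linarith), ← ENNReal.rpow_mul, neg_mul]
      calc K' * ENNReal.ofReal m * (e ^ (-p) * I) ^ (k - 1) *
            (ENNReal.ofReal (1 / p) * e ^ (-p) * I)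
          = K' * (ENNReal.ofReal m * ENNReal.ofReal (1 / p)) *
            ((e ^ (-p) * I) ^ (k - 1) * (e ^ (-p) * I)) := by ring
        _ = W := by
          rw [h5, ← ENNReal.ofReal_mul hm.le, mul_one_div, hW]; ring
    refine le_two_mul_of_le_add_half hTt hKm ?_
    calc T ≤ _ := hs1
      _ ≤ ENNReal.ofReal a ^ m * (∫⁻ z, h z ^ 2 ∂ν) + (K * (ENNReal.ofReal (m / ε ^ 2) * T) + W) := by
          refine add_le_add_right (hs2.trans ?_) _
          rw [← hs5]
          gcongr
      _ = _ := by ring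
  -- The truncation is removed by Fatou's lemma: at each point it is inactive from some n on, as h
  -- is finite there.
  have hfat : ∀ z, h z ^ (2 + m) ≤ liminf (fun n : ℕ =>
      h z ^ 2 * min (h z) (ENNReal.ofReal (a + 1 + n)) ^ m) atTop := by
    intro z
    have hev : ∀ᶠ n : ℕ in atTop, h z ^ (2 + m) =
        h z ^ 2 * min (h z) (ENNReal.ofReal (a + 1 + n)) ^ m := by
      obtain ⟨n₀, hn₀⟩ := exists_nat_ge (h z).toReal
      filter_upwards [eventually_ge_atTop n₀] with n hn
      have : h z ≤ ENNReal.ofReal (a + 1 + n) := by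
        rw [← ENNReal.ofReal_toReal (hht z)]
        refine ENNReal.ofReal_le_ofReal ?_
        have : (n₀ : ℝ) ≤ n := by exact_mod_cast hn
        linarith
      rw [min_eq_left this, ENNReal.rpow_add_of_nonneg _ _ zero_le_two hm.le]
      norm_num
    rw [liminf_congr (hev.mono fun n hn => hn.symm), liminf_const]
  calc ∫⁻ z, h z ^ (2 + m) ∂ν ≤ ∫⁻ z, liminf (fun n : ℕ =>
        h z ^ 2 * min (h z) (ENNReal.ofReal (a + 1 + n)) ^ m) atTop ∂ν := lintegral_mono hfat
    _ ≤ liminf (fun n : ℕ => ∫⁻ z, h z ^ 2 * min (h z) (ENNReal.ofReal (a + 1 + n)) ^ m ∂ν) atTop :=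
        lintegral_liminf_le fun n => by fun_prop
    _ ≤ liminf (fun _ : ℕ => 2 * (ENNReal.ofReal a ^ m * (∫⁻ z, h z ^ 2 ∂ν) + W)) atTop :=
        liminf_le_liminf (Eventually.of_forall fun n => hkey _ (by
          have : (0 : ℝ) ≤ n := n.cast_nonneg
          linarith))
    _ = _ := liminf_const _

end Tonelli

theorem rpow_le_of_one_le {c : ℝ≥0∞} (x : ℝ≥0∞) (hc : x ≤ c) (hc1 : 1 ≤ c) {p q : ℝ} (hp : 0 ≤ p)
    (hpq : p ≤ q) : x ^ p ≤ c ^ q :=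
  (ENNReal.rpow_le_rpow hc hp).trans (ENNReal.rpow_le_rpow_of_exponent_le hc1 hpq)

/-- Gehring's lemma with a boundary term. -/
theorem exists_gehring_const (d : ℕ) {C₁ : ℝ≥0∞} (hC₁ : C₁ ≠ ∞) : ∃ m₀ : ℝ, 0 < m₀ ∧ m₀ ≤ 1 ∧
    ∀ {κ s : ℝ} {C₂ C₃ : ℝ≥0∞}, 0 < κ → κ ≤ 1 / 2 → C₂ ≠ ∞ → C₃ ≠ ∞ → 1 ≤ s →
    ∃ C : ℝ≥0∞, C ≠ ∞ ∧ ∀ {m q : ℝ}, 0 < m → m ≤ m₀ → q * ((d + 2 : ℝ) / (d + 1)) = 2 + m →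
    s < q → m ≤ 4 * (q - s) → ∀ {Ω : Set (E d)} {g f : E d → ℝ≥0∞}
    {μ : Measure (E d)} [SFinite μ] {x : E d} {R : ℝ}, Measurable g → Measurable f →
    (∀ y, g y ≠ ∞) → (∀ y ∉ Ω, g y = 0) → ∫⁻ z, g z ^ 2 ≠ ∞ → 0 < R →
    (∀ y ∈ Ω ∩ Metric.ball x (2 * R), ∀ ρ, 0 < ρ → ρ ≤ κ * R →
      ENNReal.ofReal ρ ^ (d + 2) * ∫⁻ z in Metric.ball y ρ, g z ^ 2 ≤
      C₁ * (∫⁻ z in Metric.ball y (2 * ρ), g z) ^ 2 +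
      C₂ * (ENNReal.ofReal ρ ^ (2 * (d + 2 : ℝ) - 2 * (d + 1) * (1 / s)) *
        (∫⁻ z in Metric.ball y (2 * ρ), f z ^ s ∂μ) ^ (2 * (1 / s)))) →
    (∀ y ∈ Ω ∩ Metric.ball x (2 * R), ∀ ρ, 0 < ρ → ρ ≤ κ * R →
      μ (Metric.ball y (2 * ρ)) ≤ C₃ * ENNReal.ofReal ρ ^ (d + 1)) →
    ∫⁻ z in Metric.ball x R, g z ^ (2 + m) ≤ C * (ENNReal.ofReal R ^ (d + 2) *
      ((∫⁻ z in Metric.ball x (2 * R), g z ^ 2) / ENNReal.ofReal R ^ (d + 2)) ^ ((2 + m) / 2) +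
      (∫⁻ z in Metric.ball x (2 * R), f z ^ q ∂μ) ^ ((d + 2 : ℝ) / (d + 1))) := by
  set ω := volume (Metric.ball (0 : E d) 1) with hω
  have hω0 : ω ≠ 0 := (Metric.measure_ball_pos _ _ one_pos).ne'
  have hωt : ω ≠ ∞ := measure_ball_lt_top.ne
  set k : ℝ := (d + 2 : ℝ) / (d + 1) with hk
  have hk1 : 1 ≤ k := by rw [hk, le_div_iff₀ (by positivity)]; linarith
  obtain ⟨K, ε, hK, hε0, hε1, hlevel⟩ := exists_level_set_const d hC₁
  -- The gain m₀ is fixed by K and ε, that is by d and C₁, before the exponent s and the constants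
  -- of the data term are introduced.
  obtain ⟨m₀, hm0, hm01, hKm⟩ := exists_mul_le_half (Q := K * ENNReal.ofReal (1 / ε ^ 2))
    (by finiteness)
  refine ⟨m₀, hm0, hm01, ?_⟩
  intro κ s C₂ C₃ hκ hκ1 hC₂ hC₃ hs
  obtain ⟨K', ε', hK', hε0', hlevel⟩ := hlevel hC₂ hC₃ hs
  -- Chosen so that the level α₀ with α₀² = c₀X/Rⁿ satisfies the starting condition of the stopping
  -- time with equality.
  set c₀ : ℝ≥0∞ := 64 ^ (d + 2) / (ω * ENNReal.ofReal κ ^ (d + 2)) with hc₀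
  have hκe : ENNReal.ofReal κ ^ (d + 2) ≠ 0 := pow_ne_zero _ (by simpa using hκ)
  have hc₀t : c₀ ≠ ∞ := ENNReal.div_ne_top (by finiteness) (mul_ne_zero hω0 hκe)
  set e := ENNReal.ofReal ε' with he
  have he0 : e ≠ 0 := by simpa [he] using hε0'
  have heit : e⁻¹ ≠ ∞ := ENNReal.inv_ne_top.2 he0
  refine ⟨2 * ((c₀ + 1) * 4 ^ (d + 2) + K' * 4 * (e⁻¹ + 1) ^ 3 * (2 ^ (d + 2)) ^ 3),
    by finiteness, ?_⟩
  intro m q hm hmm₀ hqk hsq hmq Ω g f μ _ x R hg hf hgt hgΩ hg2 hR hrh hμ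
  have hm1 : m ≤ 1 := hmm₀.trans hm01
  set a := ENNReal.ofReal R with ha
  have ha0 : a ^ (d + 2) ≠ 0 := pow_ne_zero _ (by simpa [ha] using hR)
  have hat : a ^ (d + 2) ≠ ∞ := by finiteness
  set X := ∫⁻ z in Metric.ball x (2 * R), g z ^ 2 with hX
  have hXt : X ≠ ∞ := ne_top_of_le_ne_top hg2 (setLIntegral_le_lintegral _ _)
  set Ψ := ∫⁻ z in Metric.ball x (2 * R), f z ^ q ∂μ with hΨ
  set α₀ : ℝ≥0∞ := (c₀ * (X / a ^ (d + 2))) ^ (1 / 2 : ℝ) with hα₀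
  have hα₀t : α₀ ≠ ∞ := ENNReal.rpow_ne_top_of_nonneg (by norm_num)
    (ENNReal.mul_ne_top hc₀t (ENNReal.div_ne_top hXt ha0))
  have hα₀2 : α₀ ^ 2 = c₀ * (X / a ^ (d + 2)) := by
    rw [hα₀, ← ENNReal.rpow_natCast, ← ENNReal.rpow_mul]; norm_num
  have hc₀0 : c₀ ≠ 0 := by
    rw [hc₀]
    exact (ENNReal.div_pos (by positivity) (by finiteness)).ne'
  -- The starting level has to be positive. If X = 0, then α₀ vanishes and any positive level
  -- serves, since it is multiplied by X.
  obtain ⟨b, hb0, hbα, hbX⟩ : ∃ b : ℝ, 0 < b ∧ α₀ ≤ ENNReal.ofReal b ∧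
      ENNReal.ofReal b ^ m * X ≤ α₀ ^ m * X := by
    rcases eq_or_ne X 0 with h0 | h0
    · exact ⟨1, one_pos, by simp [hα₀, h0], by simp [h0]⟩
    · have h1 : 0 < α₀ := ENNReal.rpow_pos (pos_iff_ne_zero.2
        (mul_ne_zero hc₀0 (ENNReal.div_pos h0 hat).ne'))
        (ENNReal.mul_ne_top hc₀t (ENNReal.div_ne_top hXt ha0))
      refine ⟨α₀.toReal, ENNReal.toReal_pos h1.ne' hα₀t, ?_, ?_⟩ <;>
      rw [ENNReal.ofReal_toReal hα₀t]
  set h : E d → ℝ≥0∞ := fun z => wt x R z * g z with hh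
  set F : E d → ℝ≥0∞ := fun z => wt x R z * f z with hF
  have hhm : Measurable h := (continuous_wt x R).measurable.mul hg
  have hFm : Measurable F := (continuous_wt x R).measurable.mul hf
  have hBm : MeasurableSet (Metric.ball x (2 * R)) := Metric.isOpen_ball.measurableSet
  have hh2 : ∫⁻ z, h z ^ 2 ≤ 4 ^ (d + 2) * X := by
    rw [hX, ← lintegral_indicator hBm, ← lintegral_const_mul' _ _ (by finiteness)]
    refine lintegral_mono fun z => ?_
    by_cases hz : z ∈ Metric.ball x (2 * R)
    · rw [indicator_of_mem hz, hh, mul_pow, show (4 : ℝ≥0∞) = 2 ^ 2 by norm_num, ← pow_mul,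
        mul_comm 2 (d + 2), pow_mul]
      gcongr
      exact wt_le hR z
    · simp [hh, wt_eq_zero hR hz]
  have hF2 : ∫⁻ z, F z ^ q ∂μ ≤ (2 ^ (d + 2)) ^ q * Ψ := by
    have hq0 : 0 < q := by linarith
    rw [hΨ, ← lintegral_indicator hBm, ← lintegral_const_mul' _ _
      (ENNReal.rpow_ne_top_of_nonneg hq0.le (by finiteness))]
    refine lintegral_mono fun z => ?_
    by_cases hz : z ∈ Metric.ball x (2 * R)
    · rw [indicator_of_mem hz, hF, ← ENNReal.mul_rpow_of_nonneg _ _ hq0.le]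
      exact ENNReal.rpow_le_rpow (mul_le_mul_left (wt_le hR z) _) hq0.le
    · simp [hF, wt_eq_zero hR hz, hq0]
  have hmain := lintegral_rpow_le_of_level_sets (ν := volume) (μ := μ) hhm hFm
    (fun z => ENNReal.mul_ne_top (wt_ne_top x R z) (hgt z))
    (ne_top_of_le_ne_top (by finiteness) hh2) hε0 hε1 hε0' hsq (by linarith) hk1 hqk hm hm1
    (K := K) (K' := K') (a := b) ?_ hb0 ?_
  rotate_left
  · refine le_trans (le_of_eq ?_) ((mul_le_mul_right (ENNReal.ofReal_le_ofReal hmm₀) _).trans hKm)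
    rw [mul_assoc, ← ENNReal.ofReal_mul (by positivity)]
    congr 2; ring
  · intro α hα
    have hα0 : 0 < α := hb0.trans hα
    simp only [ENNReal.ofReal_mul hε0.le, ENNReal.ofReal_mul hε0'.le]
    refine hlevel hg hf hgΩ hg2 hR hκ hκ1 hrh hμ (by simpa using hα0) ENNReal.ofReal_ne_top ?_
    calc 64 ^ (d + 2) * X = ω * α₀ ^ 2 * ENNReal.ofReal (κ * R) ^ (d + 2) := by
          rw [hα₀2, hc₀, ENNReal.ofReal_mul hκ.le, mul_pow, ← ha]
          calc 64 ^ (d + 2) * X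
              = 64 ^ (d + 2) * X * ((ω * ENNReal.ofReal κ ^ (d + 2)) *
                (ω * ENNReal.ofReal κ ^ (d + 2))⁻¹) * (a ^ (d + 2) * (a ^ (d + 2))⁻¹) := by
                rw [ENNReal.mul_inv_cancel (mul_ne_zero hω0 hκe) (by finiteness),
                  ENNReal.mul_inv_cancel ha0 hat, mul_one, mul_one]
            _ = _ := by simp only [div_eq_mul_inv]; ring
      _ ≤ _ := by
          gcongr
          exact hbα.trans (ENNReal.ofReal_le_ofReal hα.le)
  have ht1 : ENNReal.ofReal b ^ m * ∫⁻ z, h z ^ 2 ≤ (c₀ + 1) * 4 ^ (d + 2) *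
      (a ^ (d + 2) * (X / a ^ (d + 2)) ^ ((2 + m) / 2)) := by
    have h1 : α₀ ^ m ≤ (c₀ + 1) * (X / a ^ (d + 2)) ^ (m / 2) := by
      rw [hα₀, ← ENNReal.rpow_mul, show 1 / 2 * m = m / 2 by ring,
        ENNReal.mul_rpow_of_nonneg _ _ (by positivity)]
      gcongr
      refine (rpow_le_of_one_le c₀ le_self_add le_add_self (q := 1) (by positivity)
        (by linarith)).trans (ENNReal.rpow_one _).le
    have h2 : X = a ^ (d + 2) * (X / a ^ (d + 2)) := (ENNReal.mul_div_cancel ha0 hat).symm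
    have h3 : (X / a ^ (d + 2)) ^ ((2 + m) / 2) =
        (X / a ^ (d + 2)) ^ (m / 2) * (X / a ^ (d + 2)) := by
      rw [show (2 + m) / 2 = m / 2 + 1 by ring,
        ENNReal.rpow_add_of_nonneg _ _ (by positivity) zero_le_one, ENNReal.rpow_one]
    calc ENNReal.ofReal b ^ m * ∫⁻ z, h z ^ 2 ≤ ENNReal.ofReal b ^ m * (4 ^ (d + 2) * X) := by
          gcongr
      _ = 4 ^ (d + 2) * (ENNReal.ofReal b ^ m * X) := by ring
      _ ≤ 4 ^ (d + 2) * ((c₀ + 1) * (X / a ^ (d + 2)) ^ (m / 2) *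
            (a ^ (d + 2) * (X / a ^ (d + 2)))) := by
          rw [← h2]
          exact mul_le_mul_right (hbX.trans (mul_le_mul_left h1 _)) _
      _ = _ := by rw [h3]; ring
  have hk0 : 0 ≤ k := by linarith
  have ht2 : K' * ENNReal.ofReal (m / (q - s)) * e ^ (-((q - s) * k)) * (∫⁻ z, F z ^ q ∂μ) ^ k ≤
      K' * 4 * (e⁻¹ + 1) ^ 3 * (2 ^ (d + 2)) ^ 3 * Ψ ^ k := by
    -- Here m ≤ 4(q - s) keeps the constant bounded as m tends to zero and q to s.
    have h1 : ENNReal.ofReal (m / (q - s)) ≤ 4 :=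
      (ENNReal.ofReal_le_ofReal (q := 4) (by
        rw [div_le_iff₀ (by linarith)]; linarith)).trans (by simp)
    have hexp : (q - s) * k ≤ (3 : ℕ) := by
      push_cast
      nlinarith
    have h2 : e ^ (-((q - s) * k)) ≤ (e⁻¹ + 1) ^ 3 := by
      rw [ENNReal.rpow_neg, ← ENNReal.inv_rpow, ← ENNReal.rpow_natCast]
      exact rpow_le_of_one_le _ le_self_add le_add_self (mul_nonneg (by linarith) hk0) hexp
    have h3 : (∫⁻ z, F z ^ q ∂μ) ^ k ≤ (2 ^ (d + 2)) ^ 3 * Ψ ^ k := by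
      refine (ENNReal.rpow_le_rpow hF2 hk0).trans ?_
      rw [ENNReal.mul_rpow_of_nonneg _ _ hk0, ← ENNReal.rpow_mul, hqk,
        ← ENNReal.rpow_natCast (2 ^ (d + 2)) 3]
      gcongr
      · exact one_le_pow₀ one_le_two
      · push_cast; linarith
    calc _ ≤ K' * 4 * (e⁻¹ + 1) ^ 3 * ((2 ^ (d + 2)) ^ 3 * Ψ ^ k) := by gcongr
      _ = _ := by ring
  calc ∫⁻ z in Metric.ball x R, g z ^ (2 + m) ≤ ∫⁻ z in Metric.ball x R, h z ^ (2 + m) := by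
        refine setLIntegral_mono' Metric.isOpen_ball.measurableSet fun z hz => ?_
        gcongr
        exact le_mul_of_one_le_left zero_le (one_le_wt hR hz)
    _ ≤ ∫⁻ z, h z ^ (2 + m) := setLIntegral_le_lintegral _ _
    _ ≤ _ := hmain
    _ ≤ 2 * ((c₀ + 1) * 4 ^ (d + 2) * (a ^ (d + 2) * (X / a ^ (d + 2)) ^ ((2 + m) / 2)) +
          K' * 4 * (e⁻¹ + 1) ^ 3 * (2 ^ (d + 2)) ^ 3 * Ψ ^ k) := by gcongr
    _ ≤ 2 * (((c₀ + 1) * 4 ^ (d + 2) + K' * 4 * (e⁻¹ + 1) ^ 3 * (2 ^ (d + 2)) ^ 3) *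
          (a ^ (d + 2) * (X / a ^ (d + 2)) ^ ((2 + m) / 2)) +
          ((c₀ + 1) * 4 ^ (d + 2) + K' * 4 * (e⁻¹ + 1) ^ 3 * (2 ^ (d + 2)) ^ 3) * Ψ ^ k) := by
        gcongr
        · exact le_self_add
        · exact le_add_self
    _ = _ := by ring

/-! ### Measures of balls -/

/-- Lower bound for the volume of the part of a ball in the domain. -/
theorem exists_volume_const (d : ℕ) (M : ℝ≥0) : ∃ C : ℝ≥0∞, C ≠ ∞ ∧
    ∀ {Ω D : Set (E d)} {r₀ : ℝ}, IsMixedLipschitzDomain M Ω D r₀ → ∀ {x : E d}, x ∈ closure Ω →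
    ∀ {r : ℝ}, 0 < r → r ≤ r₀ →
    ENNReal.ofReal r ^ (d + 2) ≤ C * volume (Metric.ball x r ∩ Ω) := by
  obtain ⟨Λ, hΛ, hloc⟩ := exists_localGeometry d M
  set ω := volume (Metric.ball (0 : E d) 1) with hω
  have hω0 : ω ≠ 0 := (Metric.measure_ball_pos _ _ one_pos).ne'
  have hωt : ω ≠ ∞ := measure_ball_lt_top.ne
  have hM := M.coe_nonneg
  have hΛ0 : 0 < Λ := by nlinarith
  have hωi : ω⁻¹ ≠ ∞ := ENNReal.inv_ne_top.2 hω0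
  refine ⟨ENNReal.ofReal (2 * Λ) ^ (d + 2) * ω⁻¹ * ENNReal.ofReal Λ, by finiteness, ?_⟩
  intro Ω D r₀ hdom x hx r hr hrr
  -- The point x may lie on the boundary, so the local geometry is taken at a nearby point of Ω, and
  -- its set S supplies the volume.
  obtain ⟨z, hz, hzx⟩ := Metric.mem_closure_iff.1 hx (r / 2) (by positivity)
  set ρ := r / (2 * Λ) with hρ
  have hρ0 : 0 < ρ := by positivity
  have hΛρ : Λ * ρ = r / 2 := by rw [hρ]; field_simp
  obtain ⟨S, hS, -, hSv, -⟩ := (hloc hdom hz hρ0 (by rw [hΛρ]; linarith)).star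
  have hsub : S ⊆ Metric.ball x r ∩ Ω := fun p hp => by
    refine ⟨?_, (hS hp).1⟩
    have h1 := (hS hp).2
    rw [hΛρ, Metric.mem_ball] at h1
    rw [Metric.mem_ball]
    have h2 := dist_triangle p z x
    rw [dist_comm] at hzx
    linarith
  calc ENNReal.ofReal r ^ (d + 2) = ENNReal.ofReal (2 * Λ) ^ (d + 2) * ENNReal.ofReal ρ ^ (d + 2) := by
        rw [← mul_pow, ← ENNReal.ofReal_mul (by positivity)]
        congr 2; rw [hρ]; field_simp
    _ = ENNReal.ofReal (2 * Λ) ^ (d + 2) * ω⁻¹ * (ENNReal.ofReal ρ ^ (d + 2) * ω) := by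
        rw [mul_assoc _ ω⁻¹, mul_left_comm ω⁻¹, ENNReal.inv_mul_cancel hω0 hωt, mul_one]
    _ ≤ ENNReal.ofReal (2 * Λ) ^ (d + 2) * ω⁻¹ * (ENNReal.ofReal Λ * volume S) := by
        rw [← volume_ball_eq z hρ0]; gcongr
    _ ≤ _ := by rw [← mul_assoc]; gcongr

/-- The surface measure of a small ball about a point of the domain. -/
theorem exists_surface_const (d : ℕ) (M : ℝ≥0) : ∃ (Λ : ℝ) (C : ℝ≥0∞), 1 ≤ Λ ∧ C ≠ ∞ ∧
    ∀ {Ω D : Set (E d)} {r₀ : ℝ}, IsMixedLipschitzDomain M Ω D r₀ → ∀ {y : E d}, y ∈ Ω →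
    ∀ {ρ : ℝ}, 0 < ρ → Λ * ρ ≤ r₀ →
    σ d (frontier Ω ∩ Metric.ball y ρ) ≤ C * ENNReal.ofReal ρ ^ (d + 1) := by
  obtain ⟨Λ, hΛ, hloc⟩ := exists_localGeometry d M
  have hM := M.coe_nonneg
  have hΛ1 : 1 ≤ Λ := by nlinarith
  have hωt : volume (Metric.ball (0 : EuclideanSpace ℝ (Fin (d + 1))) 1) ≠ ∞ := measure_ball_lt_top.ne
  refine ⟨Λ, ((1 + M : ℝ≥0) : ℝ≥0∞) ^ (d + 1) *
    volume (Metric.ball (0 : EuclideanSpace ℝ (Fin (d + 1))) 1), hΛ1, by finiteness, ?_⟩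
  intro Ω D r₀ hdom y hy ρ hρ hρr
  refine ((hloc hdom hy hρ hρr).surface_ball_le hρ (by nlinarith) (by nlinarith)).trans
    (le_of_eq ?_)
  ring

/-- Each boundary point in the open ball is a limit of points of Ω in that ball, so doubling the
radii of a cover of Ω covers the boundary as well. -/
theorem frontier_inter_ball_subset {Ω : Set (E d)} {x : E d} {τ δ : ℝ} (hδ : 0 < δ)
    {t : Finset (E d)} (h : Ω ∩ Metric.ball x τ ⊆ ⋃ p ∈ t, Metric.ball p δ) :
    frontier Ω ∩ Metric.ball x τ ⊆ ⋃ p ∈ t, Metric.ball p (2 * δ) := by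
  rintro z ⟨hz, hzx⟩
  obtain ⟨w, hw, hzw⟩ := Metric.mem_closure_iff.1 (frontier_subset_closure hz)
    (min δ (τ - dist z x)) (lt_min hδ (sub_pos.2 (Metric.mem_ball.1 hzx)))
  have h1 := hzw.trans_le (min_le_left _ _)
  have h2 := hzw.trans_le (min_le_right _ _)
  have h3 : w ∈ Metric.ball x τ := by
    rw [Metric.mem_ball]
    have := dist_triangle w z x
    rw [dist_comm w z] at this
    linarith
  obtain ⟨p, hp, hwp⟩ := mem_iUnion₂.1 (h ⟨hw, h3⟩)
  refine mem_iUnion₂.2 ⟨p, hp, ?_⟩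
  rw [Metric.mem_ball] at *
  have := dist_triangle z w p
  linarith

/-- The surface measure of a ball. -/
theorem exists_surface_const' (d : ℕ) (M : ℝ≥0) :
    ∃ Λ : ℝ, 1 ≤ Λ ∧ ∀ {θ : ℝ}, 0 < θ → ∃ C : ℝ≥0∞, C ≠ ∞ ∧
    ∀ {Ω D : Set (E d)} {r₀ : ℝ}, IsMixedLipschitzDomain M Ω D r₀ → ∀ {x : E d} {τ : ℝ}, 0 < τ →
    ∀ {ρ : ℝ}, 0 < ρ → τ ≤ θ * ρ → Λ * ρ ≤ r₀ →
    σ d (frontier Ω ∩ Metric.ball x τ) ≤ C * ENNReal.ofReal ρ ^ (d + 1) := by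
  obtain ⟨Λ, C, hΛ, hC, hsurf⟩ := exists_surface_const d M
  refine ⟨Λ, hΛ, fun {θ} hθ => ?_⟩
  -- The covering balls have radius τ/(2θ) ≤ ρ/2, so after doubling they are small enough for the
  -- estimate at points of Ω.
  obtain ⟨N, hN⟩ := exists_cover_card d (ε := 1 / (2 * θ)) (by positivity)
  refine ⟨N * C, by finiteness, ?_⟩
  intro Ω D r₀ hdom x τ hτ ρ hρ hτρ hρr
  obtain ⟨t, htA, htN, htc⟩ := hN x hτ (Ω ∩ Metric.ball x τ) inter_subset_right
  set δ := 1 / (2 * θ) * τ with hδ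
  have hδ0 : 0 < δ := by positivity
  have hδρ : 2 * δ ≤ ρ := by
    rw [hδ]; field_simp; linarith
  have hsub := frontier_inter_ball_subset hδ0 htc
  calc σ d (frontier Ω ∩ Metric.ball x τ)
      ≤ σ d (⋃ p ∈ t, frontier Ω ∩ Metric.ball p (2 * δ)) := by
        refine measure_mono fun z hz => ?_
        obtain ⟨p, hp, hzp⟩ := mem_iUnion₂.1 (hsub hz)
        exact mem_iUnion₂.2 ⟨p, hp, hz.1, hzp⟩
    _ ≤ ∑ p ∈ t, σ d (frontier Ω ∩ Metric.ball p (2 * δ)) := measure_biUnion_finset_le _ _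
    _ ≤ t.card • (C * ENNReal.ofReal ρ ^ (d + 1)) := by
        refine Finset.sum_le_card_nsmul _ _ _ fun p hp => ?_
        refine (hsurf hdom (htA hp).1 (by positivity) ?_).trans ?_
        · exact (mul_le_mul_of_nonneg_left hδρ (by linarith)).trans hρr
        · gcongr
    _ ≤ _ := by
        rw [nsmul_eq_mul, ← mul_assoc]
        gcongr

theorem IsMixedLipschitzDomain.pos {M : ℝ≥0} {Ω D : Set (E d)} {r₀ : ℝ}
    (h : IsMixedLipschitzDomain M Ω D r₀) : 0 < r₀ := by
  obtain ⟨k, e, c, ρ, -, hρ, -, -, ⟨i, hi⟩, -⟩ := h.cover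
  exact hi ▸ hρ i

/-- One ball contains the boundary. The bound depends on the size of Ω, which is harmless because
only finiteness is used. -/
theorem IsMixedLipschitzDomain.surface_lt_top {M : ℝ≥0} {Ω D : Set (E d)} {r₀ : ℝ}
    (h : IsMixedLipschitzDomain M Ω D r₀) : σ d (frontier Ω) < ∞ := by
  obtain ⟨Λ, hΛ, hsurf⟩ := exists_surface_const' d M
  have hr₀ := h.pos
  obtain ⟨τ, hτ, hball⟩ := h.isBounded.closure.subset_ball_lt 0 0
  have hρ0 : 0 < r₀ / Λ := by positivity
  obtain ⟨C, hC, hsurf⟩ := hsurf (θ := τ / (r₀ / Λ)) (by positivity)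
  have h1 := hsurf h (x := 0) hτ hρ0 (by rw [div_mul_cancel₀ _ hρ0.ne'])
    (by rw [mul_div_cancel₀ _ (by positivity)])
  rw [inter_eq_left.2 (frontier_subset_closure.trans hball)] at h1
  exact h1.trans_lt (by finiteness)

/-! ### The reverse Hölder inequality -/

theorem setLIntegral_eq_of_ae_eq {Ω B : Set (E d)} (hΩ : MeasurableSet Ω) {g h : E d → ℝ≥0∞}
    (hg0 : ∀ z ∉ Ω, g z = 0) (hgh : ∀ᵐ z ∂(volume.restrict Ω), g z = h z) {F : ℝ≥0∞ → ℝ≥0∞}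
    (hF : F 0 = 0) : ∫⁻ z in B, F (g z) = ∫⁻ z in Ω ∩ B, F (h z) := by
  have h1 : ∫⁻ z in B, F (g z) = ∫⁻ z in Ω ∩ B, F (g z) := by
    rw [← Measure.restrict_restrict hΩ, ← lintegral_indicator hΩ]
    refine lintegral_congr fun z => ?_
    by_cases hz : z ∈ Ω
    · rw [indicator_of_mem hz]
    · rw [indicator_of_notMem hz, hg0 z hz, hF]
  rw [h1]
  refine lintegral_congr_ae ?_
  filter_upwards [ae_mono (Measure.restrict_mono inter_subset_left le_rfl) hgh] with z hz
  rw [hz]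

/-- The reverse Hölder inequality. -/
theorem exists_reverse_holder (d : ℕ) (M : ℝ≥0) {lam : ℝ} (hlam : 0 < lam) :
    ∃ C : ℝ≥0∞, C ≠ ∞ ∧ ∀ {s : ℝ}, 1 < s → s * d ≤ 2 * (d + 1) * (s - 1) → ∃ C' : ℝ≥0∞, C' ≠ ∞ ∧
    ∀ {Ω D : Set (E d)} {r₀ : ℝ}, IsMixedLipschitzDomain M Ω D r₀ →
    ∀ {A : E d → Matrix (Fin (d + 2)) (Fin (d + 2)) ℝ},
    IsEllipticCoeff lam Ω A → ∀ {f u : E d → ℝ} {G : E d → E d},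
    AEMeasurable f ((σ d).restrict (neumannPart Ω D)) → IsWeakSolution Ω D A f u G →
    ∀ {g f₀ : E d → ℝ≥0∞}, (∀ z ∉ Ω, g z = 0) → (∀ᵐ z ∂(volume.restrict Ω), g z = ‖G z‖ₑ) →
    (∀ᵐ z ∂((σ d).restrict (neumannPart Ω D)), f₀ z = ‖f z‖ₑ) →
    ∀ y ∈ Ω, ∀ ρ, 0 < ρ → ρ ≤ r₀ →
    ENNReal.ofReal ρ ^ (d + 2) * ∫⁻ z in Metric.ball y ρ, g z ^ 2 ≤
      C * (∫⁻ z in Metric.ball y (2 * ρ), g z) ^ 2 +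
      C' * (ENNReal.ofReal ρ ^ (2 * (d + 2 : ℝ) - 2 * (d + 1) * (1 / s)) *
        (∫⁻ z in Metric.ball y (2 * ρ), f₀ z ^ s ∂((σ d).restrict (neumannPart Ω D))) ^
          (2 * (1 / s))) := by
  obtain ⟨Λ, hΛ, hloc⟩ := exists_localGeometry d M
  have hM := M.coe_nonneg
  obtain ⟨δ, hδ, K, hK, habs⟩ := exists_reverse_holder_of_absorb d (Λ := Λ) (by nlinarith)
  obtain ⟨C, hC, hrh⟩ := exists_reverse_holder_absorb d M hlam (Λ := Λ) (by nlinarith) hδ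
  refine ⟨K * C, by finiteness, fun {s} hs hsd => ?_⟩
  have hs1 : 0 < s - 1 := by linarith
  -- The trace exponent γ is dual to s; the condition on s says that γ does not exceed the critical
  -- trace exponent.
  obtain ⟨C', hC', hrh⟩ := hrh (γ := s / (s - 1)) (by rw [lt_div_iff₀ hs1]; linarith)
    (by rw [div_mul_eq_mul_div, div_le_iff₀ hs1]; exact hsd)
  have e1 : s / (s - 1) / (s / (s - 1) - 1) = s := by
    field_simp; ring
  have e2 : (s / (s - 1) - 1) / (s / (s - 1)) = 1 / s := by
    field_simp; ring
  rw [e1, e2] at hrh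
  refine ⟨K * C', by finiteness, ?_⟩
  intro Ω D r₀ hdom A hA f u G hf hsol g f₀ hg0 hgG hf₀
  have hΩ := hdom.isOpen.measurableSet
  set μ := (σ d).restrict (neumannPart Ω D) with hμ
  have hsq : ∀ B : Set (E d), ∫⁻ z in B, g z ^ 2 = ∫⁻ z in Ω ∩ B, ‖G z‖ₑ ^ 2 := fun B =>
    setLIntegral_eq_of_ae_eq hΩ hg0 hgG (F := fun b => b ^ 2) (by simp)
  have hone : ∀ B : Set (E d), ∫⁻ z in B, g z = ∫⁻ z in Ω ∩ B, ‖G z‖ₑ := fun B =>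
    setLIntegral_eq_of_ae_eq hΩ hg0 hgG (F := fun b => b) rfl
  refine habs (Φ := fun B => (∫⁻ z in B, f₀ z ^ s ∂μ) ^ (2 * (1 / s))) hg0 ?_ ?_ ?_ ?_
  · have h1 := hsq univ
    rw [Measure.restrict_univ, inter_univ, lintegral_enorm_sq_eq] at h1
    rw [h1]
    exact ENNReal.pow_ne_top hsol.1.1.memLp_grad.2.ne
  · intro B B' hBB
    exact ENNReal.rpow_le_rpow (lintegral_mono_set hBB) (by positivity)
  · have : 1 / s ≤ 1 := by rw [div_le_one (by linarith)]; exact hs.le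
    have hd : (0 : ℝ) ≤ d := d.cast_nonneg
    nlinarith
  · intro y hy ρ hρ hρr
    simp only [hsq, hone]
    refine (hrh (hloc hdom hy hρ hρr) hρ hΩ hA hf hsol).trans (le_of_eq ?_)
    congr 4
    rw [hμ, Measure.restrict_restrict Metric.isOpen_ball.measurableSet]
    refine lintegral_congr_ae ?_
    filter_upwards [ae_mono (Measure.restrict_mono inter_subset_right le_rfl) hf₀] with z hz
    rw [hz]

/-! ### A bound for the gradient in terms of the boundary data

Since the data are supported near a point, the mean of the gradient is bounded by the mean of the
data. The proof tests the equation with bounded functions of the solution. -/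

/-- Here θ is the derivative of the bounded test function and g the gradient of a smooth substitute
for the solution. The mixed term with g - G is split by `abs_form_le`, and half of the form at G
survives. -/
theorem le_form_trunc {A : Matrix (Fin (d + 2)) (Fin (d + 2)) ℝ} {lam : ℝ} (hlam : 0 < lam)
    (hs : A.IsSymm)
    (hb : ∀ ξ : E d, lam⁻¹ * ‖ξ‖ ^ 2 ≤ form A ξ ξ ∧ form A ξ ξ ≤ lam * ‖ξ‖ ^ 2)
    {θ : ℝ} (hθ0 : 0 ≤ θ) (hθ1 : θ ≤ 1) (G g : E d) :
    lam⁻¹ / 2 * (θ * ‖G‖ ^ 2) ≤ form A G (θ • g) + lam / 2 * ‖g - G‖ ^ 2 := by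
  have h1 : form A G (θ • g) = θ * (form A G G + form A G (g - G)) := by
    rw [form_smul_right, ← form_add_right, add_sub_cancel]
  have h2 := abs_le.1 (abs_form_le hlam hs hb G (g - G))
  have h3 := (hb G).1
  have h4 := (hb (g - G)).2
  have h5 : θ * (lam * ‖g - G‖ ^ 2) ≤ lam * ‖g - G‖ ^ 2 := mul_le_of_le_one_left (by positivity) hθ1
  have h6 : θ * ((lam⁻¹ * ‖G‖ ^ 2) / 2 - (lam * ‖g - G‖ ^ 2) / 2) ≤
      θ * (form A G G + form A G (g - G)) := mul_le_mul_of_nonneg_left (by linarith) hθ0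
  rw [h1]
  nlinarith

/-- The bounded function of the solution with which the equation is tested. -/
noncomputable def trunc (c κ s : ℝ) : ℝ :=
  κ * Real.arctan ((s - c) / κ) - κ * Real.arctan ((0 - c) / κ)

theorem contDiff_trunc (c κ : ℝ) : ContDiff ℝ ((⊤ : ℕ∞) : WithTop ℕ∞) (trunc c κ) := by
  unfold trunc
  exact (contDiff_const.mul (Real.contDiff_arctan.comp
    ((contDiff_id.sub contDiff_const).div_const _))).sub contDiff_const

/-- The normalization at 0 makes truncations of functions vanishing on D vanish there for every c,
so they are admissible for any choice of c. -/
theorem trunc_zero (c κ : ℝ) : trunc c κ 0 = 0 := by simp [trunc]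

theorem abs_trunc_le (c : ℝ) {κ : ℝ} (hκ : 0 < κ) (s : ℝ) : |trunc c κ s| ≤ Real.pi * κ := by
  unfold trunc
  have h1 := Real.arctan_lt_pi_div_two ((s - c) / κ)
  have h2 := Real.neg_pi_div_two_lt_arctan ((s - c) / κ)
  have h3 := Real.arctan_lt_pi_div_two ((0 - c) / κ)
  have h4 := Real.neg_pi_div_two_lt_arctan ((0 - c) / κ)
  rw [abs_le]
  constructor <;> nlinarith

theorem hasDerivAt_trunc (c : ℝ) {κ : ℝ} (hκ : 0 < κ) (s : ℝ) :
    HasDerivAt (trunc c κ) (1 / (1 + ((s - c) / κ) ^ 2)) s := by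
  unfold trunc
  have h1 : HasDerivAt (fun s => (s - c) / κ) (1 / κ) s :=
    ((hasDerivAt_id s).sub_const c).div_const κ
  have h2 := ((h1.arctan).const_mul κ).sub_const (κ * Real.arctan ((0 - c) / κ))
  exact h2.congr_deriv (by field_simp)

/-- The test function is bounded by πκ, so the data enter only through their L¹ norm. The price is
that the energy on the left carries the weight 1/(1 + ((v - c)/κ)²), small where v is far from c. -/
theorem IsWeakSolution.trunc_energy_le {lam : ℝ} (hlam : 0 < lam) {Ω D : Set (E d)}
    (hΩo : IsOpen Ω) (hΩb : Bornology.IsBounded Ω) (hσ : σ d (frontier Ω) < ∞)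
    {A : E d → Matrix (Fin (d + 2)) (Fin (d + 2)) ℝ} (hA : IsEllipticCoeff lam Ω A)
    {f u : E d → ℝ} {G : E d → E d} (hsol : IsWeakSolution Ω D A f u G)
    {v : E d → ℝ} (hv : ContDiff ℝ ((⊤ : ℕ∞) : WithTop ℕ∞) v) (hvD : ∀ z ∈ D, v z = 0)
    (c : ℝ) {κ : ℝ} (hκ : 0 < κ) :
    ENNReal.ofReal (lam⁻¹ / 2) *
      ∫⁻ y in Ω, ENNReal.ofReal (1 / (1 + ((v y - c) / κ) ^ 2)) * ‖G y‖ₑ ^ 2 ≤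
      ENNReal.ofReal (Real.pi * κ) * (∫⁻ y in neumannPart Ω D, ‖f y‖ₑ ∂(σ d)) +
      ENNReal.ofReal (lam / 2) * ∫⁻ y in Ω, ‖gradient v y - G y‖ₑ ^ 2 := by
  obtain ⟨τ, hτ, hball⟩ := hΩb.subset_ball_lt 0 0
  obtain ⟨_, _, hcut⟩ := exists_cutoff d
  -- A cut-off equal to 1 on Ω makes the test function compactly supported without changing it in Ω.
  obtain ⟨χ, hχ, hχ01, hχ1, hχs, -⟩ := hcut 0 hτ
  have hχc : HasCompactSupport χ :=
    (isCompact_closedBall (0 : E d) (2 * τ)).of_isClosed_subset (isClosed_tsupport χ)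
      (hχs.trans Metric.ball_subset_closedBall)
  have hv1 : ContDiff ℝ 1 v := hv.of_le (by exact_mod_cast le_top)
  set w : E d → ℝ := fun z => χ z * trunc c κ (v z) with hw
  have hws : ContDiff ℝ ((⊤ : ℕ∞) : WithTop ℕ∞) w := hχ.mul ((contDiff_trunc c κ).comp hv)
  have hwc : HasCompactSupport w := hχc.mul_right
  have hwD : ∀ z ∈ D, w z = 0 := fun z hz => by simp [hw, hvD z hz, trunc_zero]
  have hwb : ∀ z, ‖w z‖ ≤ Real.pi * κ := fun z => by
    rw [hw, norm_mul, Real.norm_of_nonneg (hχ01 z).1]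
    exact (mul_le_of_le_one_left (norm_nonneg _) (hχ01 z).2).trans (abs_trunc_le c hκ _)
  have hfin : IsFiniteMeasure ((σ d).restrict (frontier Ω)) :=
    ⟨by rwa [Measure.restrict_apply_univ]⟩
  have hwt : MemLp w 2 ((σ d).restrict (frontier Ω)) :=
    MemLp.of_bound hws.continuous.aestronglyMeasurable _ (ae_of_all _ hwb)
  have hmem := memW12D_smooth (Ω := Ω) hws hwc hwD
  have hid := hsol.2 w (gradient w) w hmem (isTrace_smooth hws hwt)
  set θ : E d → ℝ := fun y => 1 / (1 + ((v y - c) / κ) ^ 2) with hθ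
  have hθ0 : ∀ y, 0 ≤ θ y := fun y => by positivity
  have hθ1 : ∀ y, θ y ≤ 1 := fun y => by
    rw [hθ]; simp only
    rw [div_le_one (by positivity)]
    have := sq_nonneg ((v y - c) / κ)
    linarith
  have hθc : Continuous θ := by
    have := hv.continuous
    refine continuous_const.div (by fun_prop) fun y => by positivity
  have hgw : ∀ y ∈ Ω, gradient w y = θ y • gradient v y := by
    intro y hy
    have h1 : w =ᶠ[𝓝 y] fun z => trunc c κ (v z) := by
      filter_upwards [hΩo.mem_nhds hy] with z hz
      simp only [hw]; rw [hχ1 z (hball hz), one_mul]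
    have h2 : HasFDerivAt (fun z => trunc c κ (v z)) (θ y • fderiv ℝ v y) y :=
      (hasDerivAt_trunc c hκ (v y)).comp_hasFDerivAt y
        (hv1.differentiable one_ne_zero y).hasFDerivAt
    unfold gradient
    rw [h1.fderiv_eq, h2.fderiv]
    simp
  set μ := volume.restrict Ω with hμ
  have hGm : MemLp G 2 μ := hsol.1.1.memLp_grad
  have hgwm : MemLp (gradient w) 2 μ := hmem.1.memLp_grad
  have hGi : Integrable (fun y => ‖G y‖ ^ 2) μ := by
    simpa using hGm.integrable_norm_pow two_ne_zero
  have hgwi : Integrable (fun y => ‖gradient w y‖ ^ 2) μ := by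
    simpa using hgwm.integrable_norm_pow two_ne_zero
  set e := ∫⁻ y, ‖gradient v y - G y‖ₑ ^ 2 ∂μ with he
  by_cases hRt : ENNReal.ofReal (lam / 2) * e = ∞
  · rw [hRt]; simp
  set R : E d → ℝ := fun y => lam / 2 * ‖gradient v y - G y‖ ^ 2 with hR
  have hRm : AEStronglyMeasurable R μ :=
    (((continuous_gradient hv1).aestronglyMeasurable.sub hGm.1).norm.pow 2).const_mul _
  have hR0 : ∀ y, 0 ≤ R y := fun y => by positivity
  have hRl : ∫⁻ y, ENNReal.ofReal (R y) ∂μ = ENNReal.ofReal (lam / 2) * e := by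
    rw [he, ← lintegral_const_mul' _ _ ENNReal.ofReal_ne_top]
    refine lintegral_congr fun y => ?_
    rw [enorm_sq_eq_ofReal, hR, ENNReal.ofReal_mul (by positivity)]
  have hRi : Integrable R μ := by
    refine ⟨hRm, ?_⟩
    rw [hasFiniteIntegral_iff_ofReal (ae_of_all _ hR0), hRl]
    exact lt_top_iff_ne_top.2 hRt
  have hell : ∀ᵐ y ∂μ, (A y).IsSymm ∧ ∀ ξ : E d, lam⁻¹ * ‖ξ‖ ^ 2 ≤ form (A y) ξ ξ ∧
      form (A y) ξ ξ ≤ lam * ‖ξ‖ ^ 2 := hA.2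
  have hFi : Integrable (fun y => form (A y) (G y) (gradient w y)) μ := by
    refine ((hGi.add hgwi).const_mul (lam / 2)).mono'
      (aestronglyMeasurable_form hA.1 hGm.1 hgwm.1) ?_
    filter_upwards [hell] with y ⟨hs, hb⟩
    rw [Real.norm_eq_abs]
    refine (abs_form_le hlam hs hb _ _).trans ?_
    have h1 := (hb (G y)).2
    have h2 := (hb (gradient w y)).2
    simp only [Pi.add_apply]
    linarith
  have hLi : Integrable (fun y => lam⁻¹ / 2 * (θ y * ‖G y‖ ^ 2)) μ := by
    refine (hGi.const_mul (lam⁻¹ / 2)).mono' ?_ (ae_of_all _ fun y => ?_)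
    · exact (hθc.aestronglyMeasurable.mul (hGm.1.norm.pow 2)).const_mul _
    · have h0 := hθ0 y
      rw [Real.norm_of_nonneg (by positivity)]
      have : θ y * ‖G y‖ ^ 2 ≤ ‖G y‖ ^ 2 := mul_le_of_le_one_left (by positivity) (hθ1 y)
      gcongr
  have hle : ∫ y, lam⁻¹ / 2 * (θ y * ‖G y‖ ^ 2) ∂μ ≤
      (∫ y, form (A y) (G y) (gradient w y) ∂μ) + ∫ y, R y ∂μ := by
    rw [← integral_add hFi hRi]
    refine integral_mono_ae hLi (hFi.add hRi) ?_
    filter_upwards [hell, ae_restrict_mem hΩo.measurableSet] with y ⟨hs, hb⟩ hy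
    have h1 := le_form_trunc hlam hs hb (hθ0 y) (hθ1 y) (G y) (gradient v y)
    rw [← hgw y hy] at h1
    exact h1
  have hle2 := ENNReal.ofReal_le_ofReal hle
  rw [ofReal_integral_eq_lintegral_ofReal hLi (ae_of_all _ fun y => by
    have := hθ0 y; positivity)] at hle2
  have hL : ∫⁻ y, ENNReal.ofReal (lam⁻¹ / 2 * (θ y * ‖G y‖ ^ 2)) ∂μ =
      ENNReal.ofReal (lam⁻¹ / 2) * ∫⁻ y, ENNReal.ofReal (θ y) * ‖G y‖ₑ ^ 2 ∂μ := by
    rw [← lintegral_const_mul' _ _ ENNReal.ofReal_ne_top]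
    refine lintegral_congr fun y => ?_
    rw [ENNReal.ofReal_mul (by positivity), ENNReal.ofReal_mul (hθ0 y), enorm_sq_eq_ofReal]
  rw [hL] at hle2
  refine hle2.trans (ENNReal.ofReal_add_le.trans (add_le_add ?_ ?_))
  · have hid' : ∫ y, form (A y) (G y) (gradient w y) ∂μ = ∫ y in neumannPart Ω D, f y * w y ∂(σ d) :=
      hid
    rw [hid', ← lintegral_const_mul' _ _ ENNReal.ofReal_ne_top]
    calc ENNReal.ofReal (∫ y in neumannPart Ω D, f y * w y ∂(σ d))
        ≤ ‖∫ y in neumannPart Ω D, f y * w y ∂(σ d)‖ₑ := Real.ofReal_le_enorm _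
      _ ≤ ∫⁻ y in neumannPart Ω D, ‖f y * w y‖ₑ ∂(σ d) := enorm_integral_le_lintegral_enorm _
      _ ≤ _ := lintegral_mono fun y => by
          rw [enorm_mul, mul_comm]
          gcongr
          rw [← ofReal_norm]
          exact ENNReal.ofReal_le_ofReal (hwb y)
  · rw [ofReal_integral_eq_lintegral_ofReal hRi (ae_of_all _ hR0), hRl]

/-- Cauchy–Schwarz with the weight of the truncated energy and its reciprocal 1 + ((v - c)/κ)²,
whose integral is accessible to the Poincaré inequality. -/
theorem IsWeakSolution.sq_lintegral_le {lam : ℝ} (hlam : 0 < lam) {Ω D : Set (E d)}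
    (hΩo : IsOpen Ω) (hΩb : Bornology.IsBounded Ω) (hσ : σ d (frontier Ω) < ∞)
    {A : E d → Matrix (Fin (d + 2)) (Fin (d + 2)) ℝ} (hA : IsEllipticCoeff lam Ω A)
    {f u : E d → ℝ} {G : E d → E d} (hsol : IsWeakSolution Ω D A f u G)
    {v : E d → ℝ} (hv : ContDiff ℝ ((⊤ : ℕ∞) : WithTop ℕ∞) v) (hvD : ∀ z ∈ D, v z = 0)
    (c : ℝ) {κ : ℝ} (hκ : 0 < κ) (B : Set (E d)) :
    (∫⁻ y in Ω ∩ B, ‖G y‖ₑ) ^ 2 ≤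
      (ENNReal.ofReal (2 * lam) * (ENNReal.ofReal (Real.pi * κ) *
        (∫⁻ y in neumannPart Ω D, ‖f y‖ₑ ∂(σ d)) +
        ENNReal.ofReal (lam / 2) * ∫⁻ y in Ω, ‖gradient v y - G y‖ₑ ^ 2)) *
      (volume (Ω ∩ B) + ENNReal.ofReal (1 / κ ^ 2) * ∫⁻ y in Ω ∩ B, ‖v y - c‖ₑ ^ 2) := by
  have hen := hsol.trunc_energy_le hlam hΩo hΩb hσ hA hv hvD c hκ
  set ϑ : E d → ℝ := fun y => 1 + ((v y - c) / κ) ^ 2 with hϑ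
  have hϑ0 : ∀ y, 0 < ϑ y := fun y => by positivity
  have hϑc : Continuous ϑ := by
    have := hv.continuous
    fun_prop
  set μ := volume.restrict (Ω ∩ B) with hμ
  have hGm : AEStronglyMeasurable G μ :=
    hsol.1.1.memLp_grad.1.mono_measure (Measure.restrict_mono inter_subset_left le_rfl)
  set g₁ : E d → ℝ≥0∞ := fun y => ENNReal.ofReal √(1 / ϑ y) * ‖G y‖ₑ with hg₁
  set g₂ : E d → ℝ≥0∞ := fun y => ENNReal.ofReal √(ϑ y) with hg₂
  have hg₂m : AEMeasurable g₂ μ :=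
    (hϑc.sqrt.measurable.ennreal_ofReal).aemeasurable
  have hg₁m : AEMeasurable g₁ μ := by
    have h1 : Continuous fun y => √(1 / ϑ y) :=
      (continuous_const.div hϑc fun y => (hϑ0 y).ne').sqrt
    exact (h1.measurable.ennreal_ofReal).aemeasurable.mul hGm.enorm
  have hmul : ∀ y, g₁ y * g₂ y = ‖G y‖ₑ := fun y => by
    simp only [hg₁, hg₂]
    rw [mul_right_comm, ← ENNReal.ofReal_mul (by positivity), ← Real.sqrt_mul (by
      have := hϑ0 y; positivity), one_div_mul_cancel (hϑ0 y).ne', Real.sqrt_one, ENNReal.ofReal_one,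
      one_mul]
  have hsq₁ : ∀ y, g₁ y ^ 2 = ENNReal.ofReal (1 / ϑ y) * ‖G y‖ₑ ^ 2 := fun y => by
    simp only [hg₁]
    rw [mul_pow, ← ENNReal.ofReal_pow (by positivity), Real.sq_sqrt (by
      have := hϑ0 y; positivity)]
  have hsq₂ : ∀ y, g₂ y ^ 2 = 1 + ENNReal.ofReal (1 / κ ^ 2) * ‖v y - c‖ₑ ^ 2 := fun y => by
    simp only [hg₂]
    rw [← ENNReal.ofReal_pow (by positivity), Real.sq_sqrt (hϑ0 y).le, hϑ,
      ENNReal.ofReal_add zero_le_one (by positivity), ENNReal.ofReal_one, enorm_sq_eq_ofReal,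
      ← ENNReal.ofReal_mul (by positivity), Real.norm_eq_abs, sq_abs]
    congr 2
    ring
  have h1 := sq_setLIntegral_le hg₁m hg₂m
  simp only [hmul, hsq₁, hsq₂] at h1
  refine h1.trans (mul_le_mul' ?_ (le_of_eq ?_))
  · have h2 : ∫⁻ y in Ω ∩ B, ENNReal.ofReal (1 / ϑ y) * ‖G y‖ₑ ^ 2 ≤
        ∫⁻ y in Ω, ENNReal.ofReal (1 / ϑ y) * ‖G y‖ₑ ^ 2 := lintegral_mono_set inter_subset_left
    refine h2.trans ?_
    have h3 : ENNReal.ofReal (2 * lam) * ENNReal.ofReal (lam⁻¹ / 2) = 1 := by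
      rw [← ENNReal.ofReal_mul (by positivity), ← ENNReal.ofReal_one]
      congr 1; field_simp
    calc ∫⁻ y in Ω, ENNReal.ofReal (1 / ϑ y) * ‖G y‖ₑ ^ 2
        = ENNReal.ofReal (2 * lam) * (ENNReal.ofReal (lam⁻¹ / 2) *
            ∫⁻ y in Ω, ENNReal.ofReal (1 / ϑ y) * ‖G y‖ₑ ^ 2) := by rw [← mul_assoc, h3, one_mul]
      _ ≤ _ := mul_le_mul_right hen _
  · rw [lintegral_add_left measurable_const, lintegral_const, one_mul,
      Measure.restrict_apply_univ, lintegral_const_mul' _ _ ENNReal.ofReal_ne_top]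

/-- The gradient near a point in terms of the boundary data and of the gradient in a larger ball,
with a small factor. -/
theorem exists_gradient_absorb (d : ℕ) (M : ℝ≥0) {lam : ℝ} (hlam : 0 < lam) :
    ∃ Λ : ℝ, 2 ≤ Λ ∧ ∀ {s : ℝ}, 1 < s → s * d ≤ 2 * (d + 1) * (s - 1) → ∃ C : ℝ≥0∞, C ≠ ∞ ∧
    ∀ {Ω D : Set (E d)} {r₀ : ℝ}, IsMixedLipschitzDomain M Ω D r₀ →
    ∀ {A : E d → Matrix (Fin (d + 2)) (Fin (d + 2)) ℝ},
    IsEllipticCoeff lam Ω A → ∀ {f u : E d → ℝ} {G : E d → E d},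
    AEMeasurable f ((σ d).restrict (neumannPart Ω D)) → IsWeakSolution Ω D A f u G →
    ∀ {Q δ : ℝ}, 0 < Q → 0 < δ → ∫⁻ z in neumannPart Ω D, ‖f z‖ₑ ∂(σ d) ≤ ENNReal.ofReal Q →
    ∀ y ∈ Ω, ∀ ρ, 0 < ρ → Λ * ρ ≤ r₀ →
    ∫⁻ z in Ω ∩ Metric.ball y ρ, ‖G z‖ₑ ≤
      C * (ENNReal.ofReal δ⁻¹ * (ENNReal.ofReal ρ * ENNReal.ofReal Q) +
        ENNReal.ofReal δ * ((∫⁻ z in Ω ∩ Metric.ball y (Λ * ρ), ‖G z‖ₑ) +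
          ENNReal.ofReal ρ ^ ((d + 2 : ℝ) - (d + 1) * (1 / s)) *
            (∫⁻ z in neumannPart Ω D, ‖f z‖ₑ ^ s ∂(σ d)) ^ (1 / s))) := by
  obtain ⟨Λ, hΛ, hloc⟩ := exists_localGeometry d M
  have hM := M.coe_nonneg
  have hΛ1 : 1 ≤ Λ := by nlinarith
  have hΛ0 : 0 < Λ := by linarith
  obtain ⟨C₁, hC₁, hrh⟩ := exists_reverse_holder d M hlam
  obtain ⟨K, hK, hpoi⟩ := exists_poincare_const d M (Λ := Λ) (by nlinarith) one_pos le_rfl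
  refine ⟨2 * Λ, by nlinarith, fun {s} hs hsd => ?_⟩
  obtain ⟨C₂, hC₂, hrh⟩ := hrh hs hsd
  set b : ℝ := (d + 2 : ℝ) - (d + 1) * (1 / s) with hb
  set ω := volume (Metric.ball (0 : E d) 1) with hω
  have hωt : ω ≠ ∞ := measure_ball_lt_top.ne
  set q := ENNReal.ofReal (2 * (M + 3) ^ 2 * 1 ^ 2) with hq
  set L := ENNReal.ofReal Λ ^ b with hL
  have hLt : L ≠ ∞ := ENNReal.rpow_ne_top_of_ne_zero (by simpa using hΛ0) ENNReal.ofReal_ne_top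
  set C₃ : ℝ≥0∞ := 2 * q * (C₁ + C₂ * L ^ 2) + 2 * K with hC₃
  have hC₃t : C₃ ≠ ∞ := by finiteness
  set C₄ : ℝ≥0∞ := ENNReal.ofReal (2 * lam * Real.pi) * (ω + C₃) with hC₄
  refine ⟨C₄ + 1, by finiteness, ?_⟩
  intro Ω D r₀ hdom A hA f u G hf hsol Q δ hQ hδ hfQ y hy ρ hρ hρr
  have hΩ := hdom.isOpen.measurableSet
  set a := ENNReal.ofReal ρ with ha
  have ha0 : a ≠ 0 := by simpa [ha] using hρ
  have hat : a ≠ ∞ := ENNReal.ofReal_ne_top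
  set Fs := (∫⁻ z in neumannPart Ω D, ‖f z‖ₑ ^ s ∂(σ d)) ^ (1 / s) with hFs
  set Y := ∫⁻ z in Ω ∩ Metric.ball y ρ, ‖G z‖ₑ with hY
  set Y' := ∫⁻ z in Ω ∩ Metric.ball y (2 * Λ * ρ), ‖G z‖ₑ with hY'
  set H := Ω ∩ Metric.ball y (Λ * ρ) with hH
  set X := ∫⁻ z in H, ‖G z‖ₑ ^ 2 with hX
  set Y₁ := ∫⁻ z in H, ‖G z‖ₑ with hY₁
  have hsub : H ⊆ Ω ∩ Metric.ball y (2 * Λ * ρ) :=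
    inter_subset_inter_right _ (Metric.ball_subset_ball (by nlinarith))
  have hY₁Y : Y₁ ≤ Y' := lintegral_mono_set hsub
  have hLG : LocalGeometry M Λ Ω D y ρ := hloc hdom hy hρ (by nlinarith)
  -- the energy in the ball of radius Λρ
  have hXle : a ^ (d + 2) * X ≤ C₁ * Y' ^ 2 + C₂ * L ^ 2 * (a ^ b * Fs) ^ 2 := by
    have h1 := hrh hdom hA hf hsol (g := Ω.indicator fun z => ‖G z‖ₑ) (f₀ := fun z => ‖f z‖ₑ)
      (fun z hz => indicator_of_notMem hz _)
      (by filter_upwards [ae_restrict_mem hΩ] with z hz; rw [indicator_of_mem hz])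
      (ae_of_all _ fun z => rfl) y hy (Λ * ρ) (by positivity) (by nlinarith)
    have hg0 : ∀ z ∉ Ω, Ω.indicator (fun z => ‖G z‖ₑ) z = 0 :=
      fun z hz => indicator_of_notMem hz _
    have hgG : ∀ᵐ z ∂(volume.restrict Ω), Ω.indicator (fun z => ‖G z‖ₑ) z = ‖G z‖ₑ := by
      filter_upwards [ae_restrict_mem hΩ] with z hz; rw [indicator_of_mem hz]
    rw [setLIntegral_eq_of_ae_eq hΩ hg0 hgG (F := fun b => b ^ 2) (by simp),
      setLIntegral_eq_of_ae_eq hΩ hg0 hgG (F := fun b => b) rfl, ← mul_assoc 2 Λ ρ] at h1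
    have h2 : a ^ (d + 2) * X ≤ ENNReal.ofReal (Λ * ρ) ^ (d + 2) * X := by
      gcongr
      exact ENNReal.ofReal_le_ofReal (le_mul_of_one_le_left hρ.le hΛ1)
    refine h2.trans (h1.trans (add_le_add_right ?_ _))
    rw [mul_assoc C₂]
    refine mul_le_mul_right ?_ _
    have e1 : ENNReal.ofReal (Λ * ρ) ^ (2 * (d + 2 : ℝ) - 2 * (d + 1) * (1 / s)) =
        L ^ 2 * (a ^ b) ^ 2 := by
      rw [show 2 * (d + 2 : ℝ) - 2 * (d + 1) * (1 / s) = b * (2 : ℕ) by rw [hb]; push_cast; ring,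
        ENNReal.rpow_mul, ENNReal.rpow_natCast, ENNReal.ofReal_mul hΛ0.le,
        ENNReal.mul_rpow_of_ne_top ENNReal.ofReal_ne_top hat, mul_pow]
    have e2 : ∀ F : ℝ≥0∞, F ^ (2 * (1 / s)) = (F ^ (1 / s)) ^ 2 := fun F => by
      rw [mul_comm 2 (1 / s), ENNReal.rpow_mul]; simp
    rw [e1, e2, mul_pow, mul_assoc]
    refine mul_le_mul_right (mul_le_mul_right ?_ _) _
    refine pow_le_pow_left₀ zero_le (ENNReal.rpow_le_rpow (lintegral_mono' Measure.restrict_le_self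
      le_rfl) ?_) _
    positivity
  -- This truncation height balances the two products: after division by ρⁿ, the volume term carries
  -- (δ⁻¹ρQ)² and the oscillation term carries δ². That is the small factor in front of the
  -- gradient.
  set κ : ℝ := Q / (δ ^ 2 * ρ ^ d) with hκ
  have hκ0 : 0 < κ := by positivity
  obtain ⟨v, ⟨hv, -, hvG⟩, hvD⟩ := hsol.1.2
  have hGm : AEStronglyMeasurable G (volume.restrict Ω) := hsol.1.1.memLp_grad.1
  set e : ℕ → ℝ≥0∞ := fun k => ∫⁻ z in Ω, ‖gradient (v k) z - G z‖ₑ ^ 2 with he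
  have he0 : Tendsto e atTop (𝓝 0) := by
    have h1 := ENNReal.Tendsto.pow (n := 2) hvG
    rw [zero_pow two_ne_zero] at h1
    refine h1.congr fun k => ?_
    exact (lintegral_enorm_sq_eq (fun z => gradient (v k) z - G z)).symm
  have hHv : volume H ≠ ∞ :=
    ne_top_of_le_ne_top measure_ball_lt_top.ne (measure_mono inter_subset_right)
  have hGfin : ∫⁻ z in Ω, ‖G z‖ₑ ^ 2 ≠ ∞ := by
    rw [lintegral_enorm_sq_eq]
    exact ENNReal.pow_ne_top hsol.1.1.memLp_grad.2.ne
  have hXt : X ≠ ∞ := ne_top_of_le_ne_top hGfin (lintegral_mono_set inter_subset_left)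
  have hGm' : AEStronglyMeasurable G (volume.restrict H) :=
    hGm.mono_measure (Measure.restrict_mono inter_subset_left le_rfl)
  have hY₁t : Y₁ ^ 2 ≠ ∞ := by
    have h1 := sq_setLIntegral_le (μ := volume.restrict H) (f := fun _ => 1)
      (g := fun z => ‖G z‖ₑ) aemeasurable_const hGm'.enorm
    simp only [one_mul, one_pow, lintegral_const, Measure.restrict_apply_univ] at h1
    exact ne_top_of_le_ne_top (by finiteness) h1
  set W₀ := q * (a ^ (d + 2) * (2 * X)) + K * (2 * Y₁ ^ 2) with hW₀
  have hW₀t : W₀ ≠ ∞ := by finiteness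
  set W := q * (a ^ (d + 2) * 2) + K * (2 * volume H) with hW
  have hWt : W ≠ ∞ := by finiteness
  set S₀ := a ^ (d + 2) * (a ^ (d + 2) * ω) + ENNReal.ofReal (1 / κ ^ 2) * (a ^ 2 * W₀) with hS₀
  set S := ENNReal.ofReal (1 / κ ^ 2) * (a ^ 2 * W) with hS
  have hS₀t : S₀ ≠ ∞ := by finiteness
  have hSt : S ≠ ∞ := by finiteness
  set T₀ := ENNReal.ofReal (2 * lam) * (ENNReal.ofReal (Real.pi * κ) * ENNReal.ofReal Q) with hT₀
  set T := ENNReal.ofReal (2 * lam) * ENNReal.ofReal (lam / 2) with hT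
  have hstep : ∀ k, a ^ (d + 2) * Y ^ 2 ≤ (T₀ + T * e k) * (S₀ + S * e k) := by
    intro k
    have hv1 : ContDiff ℝ 1 (v k) := (hv k).of_le (by exact_mod_cast le_top)
    obtain ⟨c, hc, hpc⟩ := hpoi hLG hρ hΩ hv1 (hvD k)
    have h1 := hsol.sq_lintegral_le hlam hdom.isOpen hdom.isBounded hdom.surface_lt_top hA (hv k)
      (hvD k) c hκ0 (Metric.ball y ρ)
    have hgm : AEStronglyMeasurable (gradient (v k)) (volume.restrict H) :=
      (continuous_gradient hv1).aestronglyMeasurable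
    have hek : ∫⁻ z in H, ‖gradient (v k) z - G z‖ₑ ^ 2 ≤ e k := lintegral_mono_set inter_subset_left
    have h2 := (lintegral_enorm_sq_le hGm').trans (add_le_add_right (mul_le_mul_right hek 2) _)
    have h3 := (sq_lintegral_enorm_le hgm hGm').trans
      (add_le_add_right (mul_le_mul_right (mul_le_mul_right hek _) 2) _)
    rw [Measure.restrict_apply_univ] at h3
    simp only [← enorm_gradient] at hpc
    have hP : ∫⁻ z in Ω ∩ Metric.ball y ρ, ‖v k z - c‖ₑ ^ 2 ≤
        ∫⁻ z in Ω ∩ Metric.ball y (2 * ρ), ‖v k z - c‖ₑ ^ 2 :=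
      lintegral_mono_set (inter_subset_inter_right _ (Metric.ball_subset_ball (by linarith)))
    have hP' : a ^ (d + 2) * ∫⁻ z in Ω ∩ Metric.ball y ρ, ‖v k z - c‖ₑ ^ 2 ≤
        a ^ 2 * (W₀ + W * e k) := by
      refine (mul_le_mul_right hP _).trans (hpc.trans (mul_le_mul_right ?_ _))
      refine (add_le_add (mul_le_mul_right (mul_le_mul_right h2 _) _)
        (mul_le_mul_right h3 _)).trans (le_of_eq ?_)
      rw [hW₀, hW]; ring
    have hvol : volume (Ω ∩ Metric.ball y ρ) ≤ a ^ (d + 2) * ω := by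
      rw [ha, ← volume_ball_eq y hρ]
      exact measure_mono inter_subset_right
    calc a ^ (d + 2) * Y ^ 2 ≤ a ^ (d + 2) * ((ENNReal.ofReal (2 * lam) *
          (ENNReal.ofReal (Real.pi * κ) * ENNReal.ofReal Q + ENNReal.ofReal (lam / 2) * e k)) *
          (a ^ (d + 2) * ω + ENNReal.ofReal (1 / κ ^ 2) *
            ∫⁻ z in Ω ∩ Metric.ball y ρ, ‖v k z - c‖ₑ ^ 2)) := by
          refine mul_le_mul_right (h1.trans (mul_le_mul' (mul_le_mul_right (add_le_add_left
            (mul_le_mul_right hfQ _) _) _) (add_le_add_left hvol _))) _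
      _ = (T₀ + T * e k) * (a ^ (d + 2) * (a ^ (d + 2) * ω) + ENNReal.ofReal (1 / κ ^ 2) *
            (a ^ (d + 2) * ∫⁻ z in Ω ∩ Metric.ball y ρ, ‖v k z - c‖ₑ ^ 2)) := by
          rw [hT₀, hT]; ring
      _ ≤ (T₀ + T * e k) * (a ^ (d + 2) * (a ^ (d + 2) * ω) + ENNReal.ofReal (1 / κ ^ 2) *
            (a ^ 2 * (W₀ + W * e k))) :=
          mul_le_mul_right (add_le_add_right (mul_le_mul_right hP' _) _) _
      _ = _ := by rw [hS₀, hS]; ring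
  have hlin : ∀ {U V : ℝ≥0∞}, V ≠ ∞ → Tendsto (fun k => U + V * e k) atTop (𝓝 U) := by
    intro U V hV
    have h1 := (ENNReal.Tendsto.const_mul (a := V) he0 (Or.inr hV)).const_add U
    rwa [mul_zero, add_zero] at h1
  have hlim : Tendsto (fun k => (T₀ + T * e k) * (S₀ + S * e k)) atTop (𝓝 (T₀ * S₀)) :=
    ENNReal.Tendsto.mul (hlin (by finiteness)) (Or.inr hS₀t) (hlin hSt) (Or.inr (by finiteness))
  have hmain := ge_of_tendsto' hlim hstep
  set Z := Y' + a ^ b * Fs with hZ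
  -- The energy that comes from the Poincaré inequality is turned back into the square of an L¹ norm
  -- on a ball twice as large by the reverse Hölder inequality; the data in L^s enter here.
  have hW₀le : W₀ ≤ C₃ * Z ^ 2 := by
    have h1 : Y' ^ 2 ≤ Z ^ 2 := by gcongr; exact le_self_add
    have h2 : (a ^ b * Fs) ^ 2 ≤ Z ^ 2 := by gcongr; exact le_add_self
    calc W₀ = 2 * q * (a ^ (d + 2) * X) + 2 * K * Y₁ ^ 2 := by rw [hW₀]; ring
      _ ≤ 2 * q * (C₁ * Z ^ 2 + C₂ * L ^ 2 * Z ^ 2) + 2 * K * Z ^ 2 := by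
          refine add_le_add (mul_le_mul_right (hXle.trans (add_le_add (mul_le_mul_right h1 _)
            (mul_le_mul_right h2 _))) _) (mul_le_mul_right (le_trans ?_ h1) _)
          gcongr
      _ = _ := by rw [hC₃]; ring
  set p := ENNReal.ofReal δ⁻¹ * (a * ENNReal.ofReal Q) with hp
  have k1 : ENNReal.ofReal (Real.pi * κ) * ENNReal.ofReal Q * (a ^ (d + 2) * (a ^ (d + 2) * ω)) =
      ENNReal.ofReal Real.pi * (a ^ (d + 2) * (ω * p ^ 2)) := by
    have h1 : ENNReal.ofReal (Real.pi * κ) * ENNReal.ofReal Q * a ^ (d + 2) =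
        ENNReal.ofReal Real.pi * p ^ 2 := by
      rw [hp, ha, ← ENNReal.ofReal_mul (by positivity), ← ENNReal.ofReal_pow hρ.le,
        ← ENNReal.ofReal_mul (by positivity), ← ENNReal.ofReal_mul (by positivity),
        ← ENNReal.ofReal_mul (by positivity), ← ENNReal.ofReal_pow (by positivity),
        ← ENNReal.ofReal_mul (by positivity)]
      congr 1
      rw [hκ]; field_simp; ring
    calc _ = ENNReal.ofReal (Real.pi * κ) * ENNReal.ofReal Q * a ^ (d + 2) *
          (a ^ (d + 2) * ω) := by ring
      _ = _ := by rw [h1]; ring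
  have k2 : ENNReal.ofReal (Real.pi * κ) * ENNReal.ofReal Q * (ENNReal.ofReal (1 / κ ^ 2) * a ^ 2) =
      ENNReal.ofReal Real.pi * (a ^ (d + 2) * ENNReal.ofReal δ ^ 2) := by
    rw [ha, ← ENNReal.ofReal_mul (by positivity), ← ENNReal.ofReal_pow hρ.le,
      ← ENNReal.ofReal_pow hρ.le, ← ENNReal.ofReal_pow hδ.le,
      ← ENNReal.ofReal_mul (by positivity), ← ENNReal.ofReal_mul (by positivity),
      ← ENNReal.ofReal_mul (by positivity), ← ENNReal.ofReal_mul (by positivity)]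
    congr 1
    rw [hκ]; field_simp; ring
  have hsq : Y ^ 2 ≤ C₄ * (p + ENNReal.ofReal δ * Z) ^ 2 := by
    have han0 : a ^ (d + 2) ≠ 0 := pow_ne_zero _ ha0
    have hant : a ^ (d + 2) ≠ ∞ := ENNReal.pow_ne_top hat
    rw [← ENNReal.mul_le_mul_iff_right han0 hant]
    have h1 : p ^ 2 ≤ (p + ENNReal.ofReal δ * Z) ^ 2 := by gcongr; exact le_self_add
    have h2 : (ENNReal.ofReal δ * Z) ^ 2 ≤ (p + ENNReal.ofReal δ * Z) ^ 2 := by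
      gcongr; exact le_add_self
    calc a ^ (d + 2) * Y ^ 2 ≤ T₀ * S₀ := hmain
      _ = ENNReal.ofReal (2 * lam) * (ENNReal.ofReal (Real.pi * κ) * ENNReal.ofReal Q *
            (a ^ (d + 2) * (a ^ (d + 2) * ω)) + ENNReal.ofReal (Real.pi * κ) * ENNReal.ofReal Q *
            (ENNReal.ofReal (1 / κ ^ 2) * a ^ 2) * W₀) := by rw [hT₀, hS₀]; ring
      _ = ENNReal.ofReal (2 * lam * Real.pi) * (a ^ (d + 2) * (ω * p ^ 2 +
            ENNReal.ofReal δ ^ 2 * W₀)) := by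
          rw [k1, k2, ENNReal.ofReal_mul (by positivity : 0 ≤ 2 * lam)]; ring
      _ ≤ ENNReal.ofReal (2 * lam * Real.pi) * (a ^ (d + 2) * (ω * p ^ 2 +
            ENNReal.ofReal δ ^ 2 * (C₃ * Z ^ 2))) :=
          mul_le_mul_right (mul_le_mul_right (add_le_add_right (mul_le_mul_right hW₀le _) _) _) _
      _ = ENNReal.ofReal (2 * lam * Real.pi) * (a ^ (d + 2) * (ω * p ^ 2 +
            C₃ * (ENNReal.ofReal δ * Z) ^ 2)) := by ring
      _ ≤ ENNReal.ofReal (2 * lam * Real.pi) * (a ^ (d + 2) *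
            (ω * (p + ENNReal.ofReal δ * Z) ^ 2 + C₃ * (p + ENNReal.ofReal δ * Z) ^ 2)) :=
          mul_le_mul_right (mul_le_mul_right (add_le_add (mul_le_mul_right h1 _)
            (mul_le_mul_right h2 _)) _) _
      _ = _ := by rw [hC₄]; ring
  rw [← ENNReal.pow_le_pow_left_iff two_ne_zero, mul_pow]
  refine hsq.trans (mul_le_mul_left ?_ _)
  calc C₄ ≤ C₄ + 1 := le_self_add
    _ = (C₄ + 1) ^ 1 := (pow_one _).symm
    _ ≤ (C₄ + 1) ^ 2 := pow_le_pow_right₀ le_add_self one_le_two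

theorem lintegral_enorm_ne_top_of_memLp_two {Ω : Set (E d)} (hΩb : Bornology.IsBounded Ω)
    {G : E d → E d} (hG : MemLp G 2 (volume.restrict Ω)) : ∫⁻ z in Ω, ‖G z‖ₑ ≠ ∞ := by
  have : IsFiniteMeasure (volume.restrict Ω) :=
    ⟨by rw [Measure.restrict_apply_univ]; exact hΩb.measure_lt_top⟩
  exact (hG.integrable one_le_two).2.ne

/-- The gradient near a point in terms of the boundary data. -/
theorem exists_gradient_const (d : ℕ) (M : ℝ≥0) {lam : ℝ} (hlam : 0 < lam) {s : ℝ} (hs : 1 < s)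
    (hsd : s * d ≤ 2 * (d + 1) * (s - 1)) : ∃ C : ℝ≥0∞, C ≠ ∞ ∧
    ∀ {Ω D : Set (E d)} {r₀ : ℝ}, IsMixedLipschitzDomain M Ω D r₀ →
    ∀ {A : E d → Matrix (Fin (d + 2)) (Fin (d + 2)) ℝ},
    IsEllipticCoeff lam Ω A → ∀ {f u : E d → ℝ} {G : E d → E d},
    AEMeasurable f ((σ d).restrict (neumannPart Ω D)) → IsWeakSolution Ω D A f u G →
    ∀ (x : E d) {r : ℝ}, 0 < r → r ≤ r₀ →
    ∫⁻ z in Ω ∩ Metric.ball x (3 * r), ‖G z‖ₑ ≤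
      C * (ENNReal.ofReal r * (∫⁻ z in neumannPart Ω D, ‖f z‖ₑ ∂(σ d)) +
        ENNReal.ofReal r ^ ((d + 2 : ℝ) - (d + 1) * (1 / s)) *
          (∫⁻ z in neumannPart Ω D, ‖f z‖ₑ ^ s ∂(σ d)) ^ (1 / s)) := by
  obtain ⟨Λ, hΛ, hgr⟩ := exists_gradient_absorb d M hlam
  obtain ⟨C, hC, hgr⟩ := hgr hs hsd
  obtain ⟨δ₀, hδ₀, K, hK, habs⟩ := exists_reverse_holder_of_absorb d hΛ
  obtain ⟨N, hN⟩ := exists_cover_card d (ε := 1 / 3) (by positivity)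
  -- The coefficient Cδ of the gradient must not exceed the threshold δ₀ below which the covering
  -- argument removes it.
  set δ : ℝ := δ₀ / (C.toReal + 1) with hδ
  have hδ0 : 0 < δ := by positivity
  have hCδ : C * ENNReal.ofReal δ ≤ ENNReal.ofReal δ₀ := by
    rw [← ENNReal.ofReal_toReal hC, ← ENNReal.ofReal_mul ENNReal.toReal_nonneg]
    refine ENNReal.ofReal_le_ofReal ?_
    rw [hδ, mul_div_assoc', div_le_iff₀ (by positivity)]
    nlinarith [C.toReal_nonneg]
  set b : ℝ := (d + 2 : ℝ) - (d + 1) * (1 / s) with hb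
  have hb0 : 0 ≤ b := by
    have h1 : 1 / s ≤ 1 := by rw [div_le_one (by linarith)]; exact hs.le
    have hd : (0 : ℝ) ≤ d := d.cast_nonneg
    nlinarith
  set C' : ℝ≥0∞ := C * (ENNReal.ofReal δ⁻¹ + ENNReal.ofReal δ) with hC'
  set C₁ : ℝ≥0∞ := N * (K * C') + 1 with hC₁
  have hC₁t : C₁ ≠ ∞ := by finiteness
  refine ⟨C₁, hC₁t, ?_⟩
  intro Ω D r₀ hdom A hA f u G hf hsol x r hr hrr
  have hΩ := hdom.isOpen.measurableSet
  set I := ∫⁻ z in neumannPart Ω D, ‖f z‖ₑ ∂(σ d) with hI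
  set Fs := (∫⁻ z in neumannPart Ω D, ‖f z‖ₑ ^ s ∂(σ d)) ^ (1 / s) with hFs
  set a := ENNReal.ofReal r with ha
  have ha0 : a ≠ 0 := by simpa [ha] using hr
  have hat : a ≠ ∞ := ENNReal.ofReal_ne_top
  by_cases hIt : I = ∞
  · have hC₁0 : C₁ ≠ 0 := by rw [hC₁]; simp
    rw [hIt, ENNReal.mul_top ha0, top_add, ENNReal.mul_top hC₁0]
    exact le_top
  set g₁ : E d → ℝ≥0∞ := Ω.indicator fun z => ‖G z‖ₑ with hg₁
  -- The covering argument is stated for the integral of g². With g = |∇u|^(1/2) it applies to the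
  -- L¹ norm of the gradient; the term with coefficient C is absent, and the data term Φ does not
  -- depend on the ball.
  set g : E d → ℝ≥0∞ := fun z => g₁ z ^ (1 / 2 : ℝ) with hg
  have hgsq : ∀ z, g z ^ 2 = g₁ z := fun z => by
    simp only [hg]
    rw [← ENNReal.rpow_natCast, ← ENNReal.rpow_mul]; norm_num
  have hg0 : ∀ z ∉ Ω, g₁ z = 0 := fun z hz => indicator_of_notMem hz _
  have hgG : ∀ᵐ z ∂(volume.restrict Ω), g₁ z = ‖G z‖ₑ := by
    filter_upwards [ae_restrict_mem hΩ] with z hz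
    rw [hg₁, indicator_of_mem hz]
  have hone : ∀ B : Set (E d), ∫⁻ z in B, g₁ z = ∫⁻ z in Ω ∩ B, ‖G z‖ₑ := fun B =>
    setLIntegral_eq_of_ae_eq hΩ hg0 hgG (F := fun b => b) rfl
  have hstep : ∀ Q : ℝ, 0 < Q → I ≤ ENNReal.ofReal Q →
      ∫⁻ z in Ω ∩ Metric.ball x (3 * r), ‖G z‖ₑ ≤
        N * (K * C') * (a * ENNReal.ofReal Q + a ^ b * Fs) := by
    intro Q hQ hIQ
    set Φ := a * ENNReal.ofReal Q + a ^ b * Fs with hΦ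
    have hball : ∀ y ∈ Ω, ∫⁻ z in Metric.ball y r, g₁ z ≤ K * C' * Φ := by
      intro y hy
      have h1 := habs (Ω := Ω) (g := g) (C := 0) (C' := C') (Φ := fun _ => Φ) (β := (d + 2 : ℕ))
        (r₀ := r) (fun z hz => by simp only [hg]; rw [hg0 z hz]; simp) ?_ monotone_const
        (by positivity) ?_ y hy r hr le_rfl
      · simp only [hgsq, mul_zero, zero_mul, zero_add] at h1
        rw [ENNReal.rpow_natCast, mul_left_comm] at h1
        exact (ENNReal.mul_le_mul_iff_right (pow_ne_zero _ ha0) (ENNReal.pow_ne_top hat)).1 h1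
      · simp only [hgsq]
        have h2 := hone univ
        rw [Measure.restrict_univ, inter_univ] at h2
        rw [h2]
        exact lintegral_enorm_ne_top_of_memLp_two hdom.isBounded hsol.1.1.memLp_grad
      · intro z hz ρ hρ hρr
        have hρr' : ρ ≤ r := by nlinarith
        have h2 := hgr hdom hA hf hsol hQ hδ0 hIQ z hz ρ hρ (hρr.trans hrr)
        simp only [hgsq, hone, zero_mul, add_zero]
        rw [ENNReal.rpow_natCast, mul_left_comm _ (ENNReal.ofReal ρ ^ (d + 2)), mul_left_comm C',
          ← mul_add]
        refine mul_le_mul_right (h2.trans ?_) _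
        set Y' := ∫⁻ z_1 in Ω ∩ Metric.ball z (Λ * ρ), ‖G z_1‖ₑ
        have h3 : ENNReal.ofReal ρ ≤ a := ENNReal.ofReal_le_ofReal hρr'
        have h4 : ENNReal.ofReal ρ ^ b ≤ a ^ b := ENNReal.rpow_le_rpow h3 hb0
        have h5 : ENNReal.ofReal ρ * ENNReal.ofReal Q ≤ Φ := (mul_le_mul_left h3 _).trans le_self_add
        have h6 : ENNReal.ofReal ρ ^ b * Fs ≤ Φ := (mul_le_mul_left h4 _).trans le_add_self
        calc _ ≤ C * (ENNReal.ofReal δ⁻¹ * Φ + ENNReal.ofReal δ * (Y' + Φ)) :=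
              mul_le_mul_right (add_le_add (mul_le_mul_right h5 _)
                (mul_le_mul_right (add_le_add_right h6 _) _)) _
          _ = C * ENNReal.ofReal δ * Y' + C' * Φ := by rw [hC']; ring
          _ ≤ _ := add_le_add_left (mul_le_mul_left hCδ _) _
    obtain ⟨t, htA, htN, htc⟩ := hN x (τ := 3 * r) (by positivity) (Ω ∩ Metric.ball x (3 * r))
      inter_subset_right
    rw [show 1 / 3 * (3 * r) = r by ring] at htc
    rw [← hone]
    calc ∫⁻ z in Metric.ball x (3 * r), g₁ z ≤ ∑ p ∈ t, ∫⁻ z in Metric.ball p r, g₁ z := by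
          refine setLIntegral_le_sum_of_cover Metric.isOpen_ball.measurableSet t
            (fun p _ => Metric.isOpen_ball.measurableSet) fun z hz h0 => htc ⟨?_, hz⟩
          by_contra h; exact h0 (hg0 z h)
      _ ≤ t.card • (K * C' * Φ) := Finset.sum_le_card_nsmul _ _ _ fun p hp => hball p (htA hp).1
      _ ≤ _ := by
          rw [nsmul_eq_mul, ← mul_assoc]
          gcongr
  have hle : N * (K * C') ≤ C₁ := le_self_add
  refine le_trans ?_ (mul_le_mul_left hle _)
  -- The absorption needs Q > 0, while the L¹ norm I of the data may vanish. Hence Q = I + 1/(k+1),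
  -- with k tending to infinity.
  have hlim : Tendsto (fun k : ℕ => N * (K * C') * (a * (I + ((k : ℝ≥0∞) + 1)⁻¹) + a ^ b * Fs)) atTop
      (𝓝 (N * (K * C') * (a * (I + 0) + a ^ b * Fs))) := by
    have h0 : Tendsto (fun k : ℕ => ((k : ℝ≥0∞) + 1)⁻¹) atTop (𝓝 0) := by
      have h1 := (tendsto_add_atTop_iff_nat 1).2 ENNReal.tendsto_inv_nat_nhds_zero
      simpa using h1
    refine ENNReal.Tendsto.const_mul (Tendsto.add ?_ tendsto_const_nhds) (Or.inr (by finiteness))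
    exact ENNReal.Tendsto.const_mul (h0.const_add I) (Or.inr hat)
  rw [add_zero] at hlim
  refine ge_of_tendsto' hlim fun k => ?_
  have hk : ((k : ℝ≥0∞) + 1)⁻¹ ≠ ∞ := ENNReal.inv_ne_top.2 (by simp)
  have hk0 : ((k : ℝ≥0∞) + 1)⁻¹ ≠ 0 := ENNReal.inv_ne_zero.2 (by finiteness)
  have hQt : I + ((k : ℝ≥0∞) + 1)⁻¹ ≠ ∞ := ENNReal.add_ne_top.2 ⟨hIt, hk⟩
  have h1 := hstep (I + ((k : ℝ≥0∞) + 1)⁻¹).toReal (ENNReal.toReal_pos (by simp [hk0]) hQt)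
    (by rw [ENNReal.ofReal_toReal hQt]; exact le_self_add)
  rwa [ENNReal.ofReal_toReal hQt] at h1

/-! ### Higher integrability of the gradient -/

/-- Hölder's inequality for normalized integrals. -/
theorem rpow_lintegral_div_le {X : Type*} [MeasurableSpace X] {ν : Measure X} {C b : ℝ≥0∞}
    (hν : ν univ ≤ C * b) {f : X → ℝ≥0∞} (hf : AEMeasurable f ν)
    {s q : ℝ} (hs : 1 ≤ s) (hsq : s ≤ q) :
    ((∫⁻ z, f z ^ s ∂ν) / b) ^ (1 / s) ≤ (C + 1) * ((∫⁻ z, f z ^ q ∂ν) / b) ^ (1 / q) := by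
  have h1 := eLpNorm'_le_eLpNorm'_mul_rpow_measure_univ (μ := b⁻¹ • ν) (p := s) (q := q)
    (by linarith) hsq (f := f) (hf.smul_measure _).aestronglyMeasurable
  simp only [eLpNorm', enorm_eq_self, lintegral_smul_measure, Measure.smul_apply, smul_eq_mul] at h1
  have e : ∀ A : ℝ≥0∞, b⁻¹ * A = A / b := fun A => by rw [mul_comm, div_eq_mul_inv]
  rw [e, e, e] at h1
  refine h1.trans ?_
  rw [mul_comm]
  refine mul_le_mul_left ?_ _
  have h2 : ν univ / b ≤ C + 1 :=
    (ENNReal.div_le_of_le_mul hν).trans le_self_add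
  have hs0 : 0 < s := by linarith
  have h3 : 1 / q ≤ 1 / s := one_div_le_one_div_of_le hs0 hsq
  have h4 : 1 / s ≤ 1 := by rw [div_le_one hs0]; exact hs
  have h5 : 0 ≤ 1 / q := by have : 0 < q := by linarith
                            positivity
  have h6 := rpow_le_of_one_le (ν univ / b) h2 le_add_self (sub_nonneg.2 h3)
    (by linarith : 1 / s - 1 / q ≤ 1)
  rwa [ENNReal.rpow_one] at h6

/-- The gradient is controlled by the boundary data. -/
theorem exists_gradient_rpow_const (d : ℕ) (M : ℝ≥0) {lam : ℝ} (hlam : 0 < lam) :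
    ∃ m₀ : ℝ, 0 < m₀ ∧ ∀ {s : ℝ}, 1 < s → s * d ≤ 2 * (d + 1) * (s - 1) → ∃ C : ℝ≥0∞, C ≠ ∞ ∧
    ∀ {t q : ℝ}, 2 ≤ t → t ≤ 2 + m₀ → q * ((d + 2 : ℝ) / (d + 1)) = t → s ≤ q →
    t - 2 ≤ 4 * (q - s) →
    ∀ {Ω D : Set (E d)} {r₀ : ℝ}, IsMixedLipschitzDomain M Ω D r₀ →
    ∀ {A : E d → Matrix (Fin (d + 2)) (Fin (d + 2)) ℝ},
    IsEllipticCoeff lam Ω A → ∀ {f u : E d → ℝ} {G : E d → E d},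
    AEStronglyMeasurable f ((σ d).restrict (neumannPart Ω D)) → IsWeakSolution Ω D A f u G →
    ∀ {x : E d} {r : ℝ}, 0 < r → r ≤ r₀ →
    (∀ᵐ y ∂((σ d).restrict (neumannPart Ω D)), y ∉ Metric.ball x r → f y = 0) →
    ∫⁻ y in Metric.ball x r ∩ Ω, ‖G y‖ₑ ^ t ≤ C * (ENNReal.ofReal r ^ (d + 2) *
      (((∫⁻ y in Metric.ball x r ∩ neumannPart Ω D, ‖f y‖ₑ ^ q ∂(σ d)) /
        ENNReal.ofReal r ^ (d + 1)) ^ (1 / q)) ^ t) := by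
  obtain ⟨C₁, hC₁, hrh⟩ := exists_reverse_holder d M hlam
  obtain ⟨m₀, hm0, hm01, hgeh⟩ := exists_gehring_const d hC₁
  obtain ⟨Λ, C₃, hΛ, hC₃, hsurf⟩ := exists_surface_const d M
  obtain ⟨Λ', hΛ', hsurf'⟩ := exists_surface_const' d M
  obtain ⟨C₄, hC₄, hsurf'⟩ := hsurf' (θ := Λ') (by linarith)
  obtain ⟨N, hN⟩ := exists_cover_card d (ε := 1 / 4) (by positivity)
  refine ⟨m₀, hm0, fun {s} hs hsd => ?_⟩
  obtain ⟨C₂, hC₂, hrh⟩ := hrh hs hsd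
  obtain ⟨C₅, hC₅, hgr⟩ := exists_gradient_const d M hlam hs hsd
  -- For ρ ≤ κr this gives 2Λρ ≤ r ≤ r₀, as the surface estimate for balls of radius 2ρ requires.
  set κ : ℝ := 1 / (2 * Λ) with hκ
  have hκ0 : 0 < κ := by positivity
  have hκ1 : κ ≤ 1 / 2 := by
    rw [hκ]
    exact one_div_le_one_div_of_le two_pos (by linarith)
  obtain ⟨C₆, hC₆, hgeh⟩ := hgeh (κ := κ) (s := s) (C₂ := C₂) (C₃ := C₃ * 2 ^ (d + 1)) hκ0 hκ1 hC₂
    (by finiteness) hs.le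
  set C₇ : ℝ≥0∞ := C₄ + 1 with hC₇
  set C₈ : ℝ≥0∞ := C₅ * (C₇ + C₇) with hC₈
  set C₉ : ℝ≥0∞ := N * (2 ^ (d + 2) * (C₁ * C₈ ^ 2 + C₂ * C₇ ^ 2)) + 1 with hC₉
  have hC₉t : C₉ ≠ ∞ := by finiteness
  refine ⟨C₉ + C₆ * (C₉ ^ (2 : ℝ) + 1), by finiteness, ?_⟩
  intro t q ht2 htm hqt hsq htq Ω D r₀ hdom A hA f u G hf hsol x r hr hrr hsupp
  have hΩ := hdom.isOpen.measurableSet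
  set μ := (σ d).restrict (neumannPart Ω D) with hμ
  have hfin : IsFiniteMeasure μ := ⟨by
    rw [hμ, Measure.restrict_apply_univ]
    exact (measure_mono sdiff_subset).trans_lt hdom.surface_lt_top⟩
  set a := ENNReal.ofReal r with ha
  have ha0 : a ≠ 0 := by simpa [ha] using hr
  have hat : a ≠ ∞ := ENNReal.ofReal_ne_top
  have hs0 : 0 < s := by linarith
  have hq0 : 0 < q := by linarith
  set bt : ℝ := (d + 2 : ℝ) - (d + 1) * (1 / s) with hbt
  have hbt0 : 0 ≤ bt := by
    have h1 : 1 / s ≤ 1 := by rw [div_le_one hs0]; exact hs.le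
    have hd : (0 : ℝ) ≤ d := d.cast_nonneg
    nlinarith
  -- measurable representatives of the absolute values of the gradient and the data
  have hGm : AEStronglyMeasurable G (volume.restrict Ω) := hsol.1.1.memLp_grad.1
  set g : E d → ℝ≥0∞ := Ω.indicator fun z => ‖hGm.mk G z‖ₑ with hg
  have hgm : Measurable g := (hGm.stronglyMeasurable_mk.enorm).indicator hΩ
  have hg0 : ∀ z ∉ Ω, g z = 0 := fun z hz => indicator_of_notMem hz _
  have hgt : ∀ z, g z ≠ ∞ := fun z => by
    by_cases hz : z ∈ Ω
    · rw [hg, indicator_of_mem hz]; exact enorm_ne_top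
    · rw [hg0 z hz]; exact ENNReal.zero_ne_top
  have hgG : ∀ᵐ z ∂(volume.restrict Ω), g z = ‖G z‖ₑ := by
    filter_upwards [ae_restrict_mem hΩ, hGm.ae_eq_mk] with z hz hz2
    rw [hg, indicator_of_mem hz, hz2]
  set B := Metric.ball x r with hB
  have hBm : MeasurableSet B := Metric.isOpen_ball.measurableSet
  set f₁ : E d → ℝ≥0∞ := B.indicator fun z => ‖hf.mk f z‖ₑ with hf₁
  have hf₁m : Measurable f₁ := (hf.stronglyMeasurable_mk.enorm).indicator hBm
  have hf₁f : ∀ᵐ z ∂μ, f₁ z = ‖f z‖ₑ := by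
    filter_upwards [hf.ae_eq_mk, hsupp] with z hz hz2
    by_cases hzB : z ∈ B
    · rw [hf₁, indicator_of_mem hzB, hz]
    · rw [hf₁, indicator_of_notMem hzB, hz2 hzB]; simp
  have hint : ∀ p : ℝ, 0 < p → ∫⁻ z, f₁ z ^ p ∂μ =
      ∫⁻ z in B ∩ neumannPart Ω D, ‖f z‖ₑ ^ p ∂(σ d) := fun p hp => by
    rw [← Measure.restrict_restrict hBm, ← hμ, ← lintegral_indicator hBm]
    refine lintegral_congr_ae ?_
    filter_upwards [hf₁f] with z hz
    by_cases hzB : z ∈ B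
    · rw [indicator_of_mem hzB, hz]
    · rw [indicator_of_notMem hzB, hf₁, indicator_of_notMem hzB, ENNReal.zero_rpow_of_pos hp]
  have hint2 : ∀ p : ℝ, ∫⁻ z, f₁ z ^ p ∂μ = ∫⁻ z, ‖f z‖ₑ ^ p ∂μ := fun p =>
    lintegral_congr_ae (by filter_upwards [hf₁f] with z hz; rw [hz])
  have hrh' := hrh hdom hA hf.aemeasurable hsol hg0 hgG hf₁f
  -- Hölder's inequality on the boundary
  set Z := ((∫⁻ z in B ∩ neumannPart Ω D, ‖f z‖ₑ ^ q ∂(σ d)) / a ^ (d + 1)) ^ (1 / q) with hZ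
  have hb0 : a ^ (d + 1) ≠ 0 := pow_ne_zero _ ha0
  have hbt' : a ^ (d + 1) ≠ ∞ := ENNReal.pow_ne_top hat
  have hn0 : a ^ (d + 2) ≠ 0 := pow_ne_zero _ ha0
  have hnt : a ^ (d + 2) ≠ ∞ := ENNReal.pow_ne_top hat
  have hν : ((σ d).restrict (B ∩ neumannPart Ω D)) univ ≤ C₄ * a ^ (d + 1) := by
    rw [Measure.restrict_apply_univ]
    have h1 := hsurf' hdom (x := x) hr (ρ := r / Λ') (by positivity)
      (by rw [mul_div_cancel₀ _ (by positivity)])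
      (by rw [mul_div_cancel₀ _ (by positivity)]; exact hrr)
    refine (measure_mono ?_).trans (h1.trans ?_)
    · rw [inter_comm]; exact inter_subset_inter_left _ sdiff_subset
    · refine mul_le_mul_right (pow_le_pow_left₀ zero_le ?_ _) _
      exact ENNReal.ofReal_le_ofReal (div_le_self hr.le hΛ')
  have hfm : AEMeasurable (fun z => ‖f z‖ₑ) ((σ d).restrict (B ∩ neumannPart Ω D)) :=
    hf.enorm.mono_measure (Measure.restrict_mono inter_subset_right le_rfl)
  have hhol : ∀ p : ℝ, 1 ≤ p → p ≤ q →
      (∫⁻ z, ‖f z‖ₑ ^ p ∂μ) ^ (1 / p) ≤ a ^ ((d + 1) * (1 / p)) * (C₇ * Z) := by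
    intro p hp1 hpq
    have h1 := rpow_lintegral_div_le hν hfm hp1 hpq
    have hp0 : 0 < p := by linarith
    rw [← hint2 p, hint p hp0]
    rw [ENNReal.div_rpow_of_nonneg _ _ (by positivity), ENNReal.div_le_iff_le_mul
      (Or.inl (by simp [ENNReal.rpow_eq_zero_iff, ha0, hat])) (Or.inl (by
        exact ENNReal.rpow_ne_top_of_ne_zero hb0 hbt'))] at h1
    have e : (a ^ (d + 1)) ^ (1 / p) = a ^ (((d : ℝ) + 1) * (1 / p)) := by
      rw [← ENNReal.rpow_natCast, ← ENNReal.rpow_mul]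
      push_cast
      rfl
    rwa [mul_comm, e] at h1
  set Fs := (∫⁻ z, ‖f z‖ₑ ^ s ∂μ) ^ (1 / s) with hFs
  have hFsle : a ^ bt * Fs ≤ C₇ * (a ^ (d + 2) * Z) := by
    calc a ^ bt * Fs ≤ a ^ bt * (a ^ ((d + 1) * (1 / s)) * (C₇ * Z)) :=
          mul_le_mul_right (hhol s hs.le hsq) _
      _ = (a ^ bt * a ^ ((d + 1) * (1 / s))) * (C₇ * Z) := by ring
      _ = a ^ (d + 2) * (C₇ * Z) := by
          rw [← ENNReal.rpow_add _ _ ha0 hat, hbt, ← ENNReal.rpow_natCast]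
          congr 2; push_cast; ring
      _ = _ := by ring
  have hIle : a * ∫⁻ z, ‖f z‖ₑ ∂μ ≤ C₇ * (a ^ (d + 2) * Z) := by
    have h1 := hhol 1 le_rfl (hs.le.trans hsq)
    simp only [ENNReal.rpow_one, div_one, mul_one] at h1
    calc a * ∫⁻ z, ‖f z‖ₑ ∂μ ≤ a * (a ^ ((d : ℝ) + 1) * (C₇ * Z)) := mul_le_mul_right h1 _
      _ = _ := by
          rw [show ((d : ℝ) + 1) = ((d + 1 : ℕ) : ℝ) by push_cast; ring, ENNReal.rpow_natCast]
          ring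
  set Y := ∫⁻ z in Ω ∩ Metric.ball x (3 * r), ‖G z‖ₑ with hY
  have hYle : Y ≤ C₈ * (a ^ (d + 2) * Z) := by
    refine (hgr hdom hA hf.aemeasurable hsol x hr hrr).trans ?_
    rw [hC₈, mul_assoc, add_mul]
    exact mul_le_mul_right (add_le_add hIle hFsle) _
  -- the energy in the ball of radius 2r
  have hX : ∫⁻ z in Metric.ball x (2 * r), g z ^ 2 ≤ C₉ * (a ^ (d + 2) * Z ^ 2) := by
    obtain ⟨T, hTA, hTN, hTc⟩ := hN x (τ := 2 * r) (by positivity) (Ω ∩ Metric.ball x (2 * r))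
      inter_subset_right
    rw [show 1 / 4 * (2 * r) = r / 2 by ring] at hTc
    -- The reverse Hölder inequality at radius r/2 involves the ball of radius r about p, contained
    -- in the ball of radius 3r about x, where the data control the gradient.
    have hone : ∀ p ∈ T, ∫⁻ z in Metric.ball p (r / 2), g z ^ 2 ≤
        2 ^ (d + 2) * (C₁ * C₈ ^ 2 + C₂ * C₇ ^ 2) * (a ^ (d + 2) * Z ^ 2) := by
      intro p hp
      have h1 := hrh' p (hTA hp).1 (r / 2) (by positivity) (by linarith)
      rw [show 2 * (r / 2) = r by ring] at h1
      have h2 : ∫⁻ z in Metric.ball p r, g z ≤ Y := by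
        rw [setLIntegral_eq_of_ae_eq hΩ hg0 hgG (F := fun b => b) rfl]
        refine lintegral_mono_set (inter_subset_inter_right _ (Metric.ball_subset_ball' ?_))
        have := Metric.mem_ball.1 (hTA hp).2
        linarith
      have h3 : ENNReal.ofReal (r / 2) ^ (2 * (d + 2 : ℝ) - 2 * (d + 1) * (1 / s)) *
          (∫⁻ z in Metric.ball p r, f₁ z ^ s ∂μ) ^ (2 * (1 / s)) ≤ (a ^ bt * Fs) ^ 2 := by
        have e2 : ∀ F : ℝ≥0∞, F ^ (2 * (1 / s)) = (F ^ (1 / s)) ^ 2 := fun F => by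
          rw [mul_comm 2 (1 / s), ENNReal.rpow_mul]; simp
        rw [show 2 * (d + 2 : ℝ) - 2 * (d + 1) * (1 / s) = bt * (2 : ℕ) by rw [hbt]; push_cast; ring,
          ENNReal.rpow_mul, ENNReal.rpow_natCast, e2, ← mul_pow]
        refine pow_le_pow_left₀ zero_le (mul_le_mul' ?_ ?_) _
        · exact ENNReal.rpow_le_rpow (ENNReal.ofReal_le_ofReal (by linarith)) hbt0
        · refine ENNReal.rpow_le_rpow ?_ (by positivity)
          rw [← hint2]
          exact lintegral_mono' Measure.restrict_le_self le_rfl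
      have h4 : a ^ (d + 2) = 2 ^ (d + 2) * ENNReal.ofReal (r / 2) ^ (d + 2) := by
        rw [← mul_pow, ← ENNReal.ofReal_ofNat, ← ENNReal.ofReal_mul zero_le_two, ha]
        congr 2; ring
      rw [← ENNReal.mul_le_mul_iff_right hn0 hnt]
      calc a ^ (d + 2) * ∫⁻ z in Metric.ball p (r / 2), g z ^ 2
          = 2 ^ (d + 2) * (ENNReal.ofReal (r / 2) ^ (d + 2) *
              ∫⁻ z in Metric.ball p (r / 2), g z ^ 2) := by rw [h4]; ring
        _ ≤ 2 ^ (d + 2) * (C₁ * (C₈ * (a ^ (d + 2) * Z)) ^ 2 +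
              C₂ * (C₇ * (a ^ (d + 2) * Z)) ^ 2) := by
            refine mul_le_mul_right (h1.trans (add_le_add (mul_le_mul_right ?_ _)
              (mul_le_mul_right ?_ _))) _
            · exact pow_le_pow_left₀ zero_le (h2.trans hYle) _
            · exact h3.trans (pow_le_pow_left₀ zero_le hFsle _)
        _ = _ := by ring
    calc ∫⁻ z in Metric.ball x (2 * r), g z ^ 2
        ≤ ∑ p ∈ T, ∫⁻ z in Metric.ball p (r / 2), g z ^ 2 := by
          refine setLIntegral_le_sum_of_cover Metric.isOpen_ball.measurableSet T
            (fun p _ => Metric.isOpen_ball.measurableSet) fun z hz h0 => hTc ⟨?_, hz⟩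
          by_contra h; exact h0 (by rw [hg0 z h]; simp)
      _ ≤ T.card • _ := Finset.sum_le_card_nsmul _ _ _ hone
      _ ≤ N * (2 ^ (d + 2) * (C₁ * C₈ ^ 2 + C₂ * C₇ ^ 2) * (a ^ (d + 2) * Z ^ 2)) := by
          rw [nsmul_eq_mul]; gcongr
      _ = N * (2 ^ (d + 2) * (C₁ * C₈ ^ 2 + C₂ * C₇ ^ 2)) * (a ^ (d + 2) * Z ^ 2) := by ring
      _ ≤ _ := mul_le_mul_left le_self_add _
  have hgoal : ∫⁻ z in B ∩ Ω, ‖G z‖ₑ ^ t = ∫⁻ z in B, g z ^ t := by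
    rw [inter_comm, setLIntegral_eq_of_ae_eq hΩ hg0 hgG (F := fun b => b ^ t)
      (ENNReal.zero_rpow_of_pos (by linarith))]
  rw [hgoal]
  -- For t = 2 the energy bound is already the claim; Gehring's lemma requires m = t - 2 > 0.
  rcases ht2.eq_or_lt with rfl | ht2
  · have h1 : ∫⁻ z in B, g z ^ 2 ≤ ∫⁻ z in Metric.ball x (2 * r), g z ^ 2 :=
      lintegral_mono_set (Metric.ball_subset_ball (by linarith))
    simp only [ENNReal.rpow_ofNat]
    exact h1.trans (hX.trans (mul_le_mul_left le_self_add _))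
  · have h1 := hgeh (m := t - 2) (q := q) (by linarith) (by linarith) (by linarith) (by linarith)
      htq (Ω := Ω) (g := g) (f := f₁) (μ := μ) (x := x) (R := r) hgm hf₁m hgt hg0 ?_ hr ?_ ?_
    · rw [show 2 + (t - 2) = t by ring] at h1
      refine h1.trans ?_
      have h2 : ((∫⁻ z in Metric.ball x (2 * r), g z ^ 2) / a ^ (d + 2)) ^ (t / 2) ≤
          C₉ ^ (2 : ℝ) * Z ^ t := by
        have h3 : (∫⁻ z in Metric.ball x (2 * r), g z ^ 2) / a ^ (d + 2) ≤ C₉ * Z ^ 2 :=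
          ENNReal.div_le_of_le_mul (hX.trans (le_of_eq (by ring)))
        refine (ENNReal.rpow_le_rpow h3 (by positivity)).trans ?_
        rw [ENNReal.mul_rpow_of_nonneg _ _ (by positivity), ← ENNReal.rpow_natCast,
          ← ENNReal.rpow_mul]
        push_cast
        rw [mul_div_cancel₀ _ two_ne_zero]
        refine mul_le_mul_left ?_ _
        exact rpow_le_of_one_le C₉ le_rfl le_add_self (by positivity) (by linarith)
      have h4 : (∫⁻ z in Metric.ball x (2 * r), f₁ z ^ q ∂μ) ^ ((d + 2 : ℝ) / (d + 1)) ≤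
          a ^ (d + 2) * Z ^ t := by
        have h5 : ∫⁻ z in Metric.ball x (2 * r), f₁ z ^ q ∂μ ≤ a ^ (d + 1) * Z ^ q := by
          refine (lintegral_mono' Measure.restrict_le_self le_rfl).trans ?_
          rw [hint q hq0, hZ, ← ENNReal.rpow_mul, one_div_mul_cancel hq0.ne', ENNReal.rpow_one,
            ENNReal.mul_div_cancel hb0 hbt']
        refine (ENNReal.rpow_le_rpow h5 (by positivity)).trans (le_of_eq ?_)
        rw [ENNReal.mul_rpow_of_nonneg _ _ (by positivity), ← ENNReal.rpow_mul, hqt,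
          ← ENNReal.rpow_natCast, ← ENNReal.rpow_mul, ← ENNReal.rpow_natCast]
        congr 2
        push_cast
        field_simp
      calc C₆ * _ ≤ C₆ * (a ^ (d + 2) * (C₉ ^ (2 : ℝ) * Z ^ t) + a ^ (d + 2) * Z ^ t) :=
            mul_le_mul_right (add_le_add (mul_le_mul_right h2 _) h4) _
        _ = C₆ * (C₉ ^ (2 : ℝ) + 1) * (a ^ (d + 2) * Z ^ t) := by ring
        _ ≤ _ := mul_le_mul_left le_add_self _
    · have h2 := setLIntegral_eq_of_ae_eq (B := univ) hΩ hg0 hgG (F := fun b => b ^ 2) (by simp)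
      rw [Measure.restrict_univ, inter_univ, lintegral_enorm_sq_eq] at h2
      rw [h2]
      exact ENNReal.pow_ne_top hsol.1.1.memLp_grad.2.ne
    · intro y hy ρ hρ hρr
      exact hrh' y hy.1 ρ hρ (by nlinarith)
    · intro y hy ρ hρ hρr
      have h2 : Λ * (2 * ρ) ≤ r₀ := by
        have h3 : Λ * (2 * ρ) ≤ Λ * (2 * (κ * r)) := by
          have : 0 ≤ Λ := by linarith
          gcongr
        refine h3.trans (le_trans (le_of_eq ?_) hrr)
        rw [hκ]; field_simp
      have h4 := hsurf hdom hy.1 (ρ := 2 * ρ) (by positivity) h2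
      rw [hμ, Measure.restrict_apply Metric.isOpen_ball.measurableSet]
      refine (measure_mono ?_).trans (h4.trans (le_of_eq ?_))
      · rw [inter_comm]; exact inter_subset_inter_left _ sdiff_subset
      · rw [ENNReal.ofReal_mul zero_le_two, ENNReal.ofReal_ofNat, mul_pow, mul_assoc]

/-- The estimate of the theorem, with a constant that depends on an auxiliary exponent `s`. -/
theorem exists_estimate_const (d : ℕ) (M : ℝ≥0) {lam : ℝ} (hlam : 0 < lam) :
    ∃ m₀ : ℝ, 0 < m₀ ∧ ∀ {s : ℝ}, 1 < s → s * d ≤ 2 * (d + 1) * (s - 1) → ∃ C : ℝ, 0 < C ∧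
    ∀ {t : ℝ}, 2 ≤ t → t < 2 + m₀ → s ≤ t * (d + 1) / (d + 2) →
    t - 2 ≤ 4 * (t * (d + 1) / (d + 2) - s) →
    ∀ {Ω D : Set (E d)} {r₀ : ℝ}, IsMixedLipschitzDomain M Ω D r₀ →
    ∀ {A : E d → Matrix (Fin (d + 2)) (Fin (d + 2)) ℝ},
    IsEllipticCoeff lam Ω A → ∀ {f u : E d → ℝ} {G : E d → E d},
    AEStronglyMeasurable f ((σ d).restrict (neumannPart Ω D)) → IsWeakSolution Ω D A f u G →
    ∀ {x : E d}, x ∈ closure Ω → ∀ {r : ℝ}, 0 < r → r ≤ r₀ →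
    (∀ᵐ y ∂((σ d).restrict (neumannPart Ω D)), y ∉ Metric.ball x r → f y = 0) →
    (MemLp f (ENNReal.ofReal (t * (d + 1) / (d + 2))) ((σ d).restrict (neumannPart Ω D)) →
      MemLp G (ENNReal.ofReal t) (volume.restrict (Metric.ball x r ∩ Ω))) ∧
    (⨍⁻ y in Metric.ball x r ∩ Ω, ‖G y‖ₑ ^ t ∂volume) ^ (1 / t) ≤
      ENNReal.ofReal C *
        ((⨍⁻ y in Metric.ball x (C * r) ∩ Ω, ‖G y‖ₑ ∂volume) +
          (ENNReal.ofReal (1 / r ^ (d + 1)) *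
            ∫⁻ y in Metric.ball x (C * r) ∩ neumannPart Ω D,
              ‖f y‖ₑ ^ (t * (d + 1) / (d + 2)) ∂(σ d)) ^ ((d + 2) / (t * (d + 1)))) := by
  obtain ⟨m₀, hm₀, hcore⟩ := exists_gradient_rpow_const d M hlam
  obtain ⟨Cv, hCv, hvol⟩ := exists_volume_const d M
  refine ⟨m₀, hm₀, fun {s} hs hsd => ?_⟩
  obtain ⟨K, hK, hcore⟩ := hcore hs hsd
  have hL : K * Cv + 1 ≠ ∞ := by finiteness
  -- At least 1, so that the ball of radius Cr contains the ball of radius r and the 1/t-th power of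
  -- K·Cv is at most C for all t at once.
  set C : ℝ := (K * Cv + 1).toReal with hC
  have hC1 : 1 ≤ C := by
    have := ENNReal.toReal_mono hL (le_add_self : (1 : ℝ≥0∞) ≤ K * Cv + 1)
    simpa using this
  refine ⟨C, by linarith, ?_⟩
  intro t ht htm hst hts Ω D r₀ hdom A hA f u G hf hsol x hx r hr hrr hsupp
  set q : ℝ := t * (d + 1) / (d + 2) with hq
  have ht0 : 0 < t := by linarith
  have hq0 : 0 < q := by positivity
  have hq1 : (d + 2) / (t * (d + 1)) = 1 / q := by rw [hq, one_div_div]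
  rw [hq1]
  have hmain := hcore ht htm.le (q := q) (by rw [hq]; field_simp) hst hts hdom hA hf hsol hr hrr hsupp
  have hv := hvol hdom hx hr hrr
  set a := ENNReal.ofReal r with ha
  have ha0 : a ≠ 0 := by simpa [ha] using hr
  have hat : a ≠ ∞ := ENNReal.ofReal_ne_top
  set F := ∫⁻ y in Metric.ball x r ∩ neumannPart Ω D, ‖f y‖ₑ ^ q ∂(σ d) with hF
  have ha1 : ENNReal.ofReal (1 / r ^ (d + 1)) * F = F / a ^ (d + 1) := by
    rw [one_div, ENNReal.ofReal_inv_of_pos (by positivity), ENNReal.ofReal_pow hr.le, mul_comm,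
      ← div_eq_mul_inv]
  refine ⟨fun hfq => ?_, ?_⟩
  · have hFt : F ≠ ∞ := by
      have h1 := (eLpNorm_lt_top_iff_lintegral_rpow_enorm_lt_top (by simpa using hq0)
        ENNReal.ofReal_ne_top).1 hfq.2
      rw [ENNReal.toReal_ofReal hq0.le] at h1
      exact ne_top_of_le_ne_top h1.ne (lintegral_mono_set inter_subset_right)
    refine ⟨hsol.1.1.memLp_grad.1.mono_measure (Measure.restrict_mono inter_subset_right le_rfl), ?_⟩
    rw [eLpNorm_lt_top_iff_lintegral_rpow_enorm_lt_top (by simpa using ht0) ENNReal.ofReal_ne_top,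
      ENNReal.toReal_ofReal ht0.le]
    refine hmain.trans_lt (ENNReal.mul_lt_top hK.lt_top (ENNReal.mul_lt_top (by finiteness) ?_))
    refine ENNReal.rpow_lt_top_of_nonneg ht0.le (ENNReal.rpow_ne_top_of_nonneg (by positivity) ?_)
    exact ENNReal.div_ne_top hFt (pow_ne_zero _ ha0)
  · set Z := (F / a ^ (d + 1)) ^ (1 / q) with hZ
    have h1 : ⨍⁻ y in Metric.ball x r ∩ Ω, ‖G y‖ₑ ^ t ∂volume ≤ K * Cv * Z ^ t := by
      rw [setLAverage_eq]
      refine ENNReal.div_le_of_le_mul (hmain.trans ?_)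
      calc K * (a ^ (d + 2) * Z ^ t) ≤ K * (Cv * volume (Metric.ball x r ∩ Ω) * Z ^ t) := by gcongr
        _ = _ := by ring
    have h2 : (⨍⁻ y in Metric.ball x r ∩ Ω, ‖G y‖ₑ ^ t ∂volume) ^ (1 / t) ≤ ENNReal.ofReal C * Z := by
      refine (ENNReal.rpow_le_rpow h1 (by positivity)).trans ?_
      rw [ENNReal.mul_rpow_of_nonneg _ _ (by positivity), ← ENNReal.rpow_mul,
        mul_one_div_cancel ht0.ne', ENNReal.rpow_one, hC, ENNReal.ofReal_toReal hL]
      refine mul_le_mul_left ?_ _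
      exact (rpow_le_of_one_le (K * Cv) le_self_add le_add_self (q := 1) (by positivity) (by
        rw [div_le_one ht0]; linarith)).trans (ENNReal.rpow_one _).le
    -- The data alone bound the left side, so the mean of the gradient is discarded.
    refine h2.trans (mul_le_mul_right (le_trans ?_ le_add_self) _)
    rw [hZ, ← ha1]
    refine ENNReal.rpow_le_rpow (mul_le_mul_right (lintegral_mono_set ?_) _) (by positivity)
    exact inter_subset_inter_left _ (Metric.ball_subset_ball (le_mul_of_one_le_left hr.le hC1))

end MixedProblem

/-! ### Choice of the auxiliary exponent s. -/

open MixedProblem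
theorem mainTheorem6 (d : ℕ) (M : ℝ≥0) (lam : ℝ) (hlam : 0 < lam) :
    ∃ p₀ : ℝ, 2 < p₀ ∧ ∃ C : ℝ → ℝ, (1 ≤ d → ∀ t, C t = C 2) ∧
      ∀ t : ℝ, 2 ≤ t → t < p₀ → (d = 0 → 2 < t) → 0 < C t ∧
        ∀ (Ω D : Set (E d)) (r₀ : ℝ), IsMixedLipschitzDomain M Ω D r₀ →
        ∀ A : E d → Matrix (Fin (d + 2)) (Fin (d + 2)) ℝ, IsEllipticCoeff lam Ω A →
        ∀ (f : E d → ℝ) (p : ℝ≥0∞), 1 < p → ENNReal.ofReal (2 * (d + 1) / (d + 2)) ≤ p →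
          MemLp f p ((σ d).restrict (neumannPart Ω D)) →
        ∀ (u : E d → ℝ) (G : E d → E d), IsWeakSolution Ω D A f u G →
        ∀ x ∈ closure Ω, ∀ r : ℝ, 0 < r → r < r₀ →
          (∀ᵐ y ∂((σ d).restrict (neumannPart Ω D)), y ∉ Metric.ball x r → f y = 0) →
          (MemLp f (ENNReal.ofReal (t * (d + 1) / (d + 2))) ((σ d).restrict (neumannPart Ω D)) →
            MemLp G (ENNReal.ofReal t) (volume.restrict (Metric.ball x r ∩ Ω))) ∧
          (⨍⁻ y in Metric.ball x r ∩ Ω, ‖G y‖ₑ ^ t ∂volume) ^ (1 / t) ≤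
            ENNReal.ofReal (C t) *
              ((⨍⁻ y in Metric.ball x (C t * r) ∩ Ω, ‖G y‖ₑ ∂volume) +
                (ENNReal.ofReal (1 / r ^ (d + 1)) *
                  ∫⁻ y in Metric.ball x (C t * r) ∩ neumannPart Ω D,
                    ‖f y‖ₑ ^ (t * (d + 1) / (d + 2)) ∂(σ d)) ^ ((d + 2) / (t * (d + 1)))) := by
  obtain ⟨m₀, hm₀, hest⟩ := exists_estimate_const d M hlam
  refine ⟨2 + m₀, by linarith, ?_⟩
  rcases Nat.eq_zero_or_pos d with rfl | hd
  · have h : ∀ t : ℝ, ∃ C : ℝ, 2 < t → 0 < C ∧ _ := fun t => by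
      by_cases ht : 2 < t
      -- For n = 2 the exponent is q = t/2, and s is the midpoint of 1 and q. Then 4(q - s) = t - 2,
      -- and s tends to 1 as t tends to 2.
      · obtain ⟨C, hC, h⟩ := hest (s := (1 + t / 2) / 2) (by linarith) (by push_cast; linarith)
        refine ⟨C, fun _ => ⟨hC, fun h1 => @h t ht.le h1 (by push_cast; linarith)
          (by push_cast; linarith)⟩⟩
      -- A dummy value: for n = 2 nothing is claimed about C t unless t > 2.
      · exact ⟨0, fun h => absurd h ht⟩
    choose C hC using h
    refine ⟨C, fun h => absurd h (by norm_num), fun t _ htm h2 => ⟨(hC t (h2 rfl)).1, ?_⟩⟩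
    intro Ω D r₀ hdom A hA f p _ _ hf u G hsol x hx r hr hrr hsupp
    exact (hC t (h2 rfl)).2 htm hdom hA hf.1 hsol hx hr hrr.le hsupp
  · have hd1 : (1 : ℝ) ≤ d := by exact_mod_cast hd
    -- For n ≥ 3 the value s = 2(n-1)/n is admissible with equality, does not depend on t and never
    -- exceeds t(n-1)/n.
    obtain ⟨C, hC, h⟩ := hest (s := 2 * (d + 1) / (d + 2)) (by
      rw [lt_div_iff₀ (by positivity)]; linarith) (le_of_eq (by field_simp; ring))
    refine ⟨fun _ => C, fun _ _ => rfl, fun t ht htm _ => ⟨hC, ?_⟩⟩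
    intro Ω D r₀ hdom A hA f p _ _ hf u G hsol x hx r hr hrr hsupp
    refine h ht htm ?_ ?_ hdom hA hf.1 hsol hx hr hrr.le hsupp
    · gcongr
    · have h1 : t * (d + 1) / (d + 2) - 2 * (d + 1) / (d + 2) =
          (t - 2) * ((d + 1) / (d + 2 : ℝ)) := by ring
      have h2 : (1 / 4 : ℝ) ≤ (d + 1) / (d + 2) := by
        rw [div_le_div_iff₀ (by positivity) (by positivity)]; linarith
      rw [h1]
      nlinarith
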